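/- **Setting.** Let $n\ge 2$ be a power of $2$, $d\ge 1$, $N=n^d$, $\omega=e^{2\pi i/n}$; index signals $x\in\mathbb C^{[n]^d}$ by $[n]^d=(\mathbb Z/n)^d$. Let $\hat x_j=N^{-1/2}\sum_i\omega^{-i^Tj}x_i$ be the orthonormal DFT $\mathcal F$, let $\mathrm{Err}_k(x)=\min\|x-y\|_2$ over $k$-sparse $y$, and let $\mu_k(x)=\mathrm{Err}_k(x)/\sqrt k$. For $b$ a power of $2$ and $F\ge1$ put $H_j=\bigl(\frac1{b-1}\sum_{|m|<b/2}\omega^{mj}\bigr)^F$, $G_i=\prod_{s=1}^d H_{i_s}$, $\hat G=\mathcal F G$. For a $d\times d$ matrix $\Sigma$ over $\mathbb Z/n$ with odd determinant and $a,q\in[n]^d$ put $\pi_{\Sigma,q}(i)=\Sigma(i-q)$, $(P_{\Sigma,a,q}y)_i=y_{\Sigma^T(i-a)}\,\omega^{i^T\Sigma q}$ and $\mathrm{hash}_{\Sigma,a,q}(y)=\sqrt N\,\mathcal F^{-1}\bigl((P_{\Sigma,a,q}y)\cdot\hat G\bigr)$. **Algorithm SparseFFT** $(\hat x,k,\epsilon,R^*,\mu)$,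 with constants $\alpha\in(0,1)$, $c_F\ge2$, $C$: let $F=c_Fd$, let $b$ be the least power of $2$ with $b^d\ge k/(\epsilon\alpha^d)$, $T=\lceil\log_2R^*\rceil$ (and $T=0$ if $R^*\le1$), $r_{\max}=C\log_2N$. Draw $(\Sigma_r,a_r,q_r)$, $r=1,\dots,r_{\max}$, independently and uniformly ($\Sigma_r$ among the matrices with odd determinant), and set $u^r=\mathrm{hash}_r(\hat x)$, $\chi^{(0)}=0$. For $t=0,\dots,T-1$ let $\nu=4\sqrt\epsilon\,\mu\,2^{T-(t+1)}$ and $v^r=u^r-\mathrm{hash}_r(\widehat{\chi^{(t)}})$; for each $f\in[n]^d$ let $\eta_f$ be the median over $r$ (separately in real and imaginary parts) of $v^r_{\pi_r(f)}\,\omega^{-a_r^T\Sigma_rf}$; put $\chi^{(t+1)}_f=\chi^{(t)}_f+\eta_f$ if $|\eta_f|>\nu/2$ and $\chi^{(t+1)}_f=\chi^{(t)}_f$ otherwise. Return $\chi=\chi^{(T)}$. An execution *with numerical errors* $e$ replaces each $v^r$ in round $t$ by $v^r+e^{t,r}$. **Theorem.** There are absolute constants $\alpha\in(0,1)$, $c_F\ge2$,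 $c>0$, $C_0$, $K$ such that for every integer $C\ge C_0$ there is one program $p$ for the machine described below with the following property. For all $\Lambda\ge1$ and $A\in\mathbb N$ there are $K'$, $w$, $P$ (depending only on $C,\Lambda,A$) such that for all $n,d$ as above, all $k\ge1$, $0<\epsilon\le1$ and $x$, and all $\mu>0$ and $R^*$ with $$\mu_k(x)\le\mu\le\Lambda\,\mu_k(x),\qquad \|x\|_\infty\le R^*\sqrt\epsilon\,\mu,\qquad R^*\le N^A:$$ 1. With probability at least $1-N^{-cC}$ over the triples $(\Sigma_r,a_r,q_r)$, every execution of SparseFFT with numerical errors $|e^{t,r}_j|\le N^{-P}\|x\|_2$ (in particular the exact one) returns $\chi$ with $$\|x-\chi\|_2\le(1+K\Lambda^2\epsilon)\,\mathrm{Err}_k(x).$$ 2. For every value of the random triples, $p$ computes the output of SparseFFT in exact arithmetic, reading at most $C\cdot K\,d^{Kd}\cdot\frac1\epsilon\,k\log N$ entries of $\hat x$ and making at most $K'N\log^3N$ steps. The machine is a random access machine with an integer memory, whose stored integers and written addresses are at most $N^w$ in absolute value, and a memory of complex numbers. Each integer operation $+,-,\times,\mathrm{div},\mathrm{mod}$,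 each complex operation $+,-,\times,/,\mathrm{Re},\mathrm{Im}$, each conversion of an integer to a complex number, each evaluation of $e^{2\pi ip/q}$ for integers $p,q$, each comparison, memory access, reading of one entry of the random triples, and query of one entry of $\hat x$ costs one step, up to a constant factor. Its input is $n,d,k,\epsilon,R^*,\mu$. -/

import Mathlib

open scoped BigOperators

noncomputable section

namespace SparseFourier

/-! ### Signals on the grid `[n]^d`, `n = 2 ^ l` -/

/-- The index set `[n]^d` with `n = 2 ^ l`; coordinates are residues modulo `n`. -/
abbrev Grid (l d : ℕ) : Type := Fin d → ZMod (2 ^ l)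

/-- Complex signals of length `N = n ^ d`. -/
abbrev Signal (l d : ℕ) : Type := Grid l d → ℂ

/-- The signal length `N = n ^ d`, as a real number. -/
def sigLen (l d : ℕ) : ℝ := ((2 : ℝ) ^ l) ^ d

/-- The Euclidean norm of a signal. (The supremum norm is Mathlib's norm `‖x‖` on functions.) -/
def l2norm {l d : ℕ} (x : Signal l d) : ℝ := ‖WithLp.toLp 2 x‖

/-- The best `k`-sparse approximation error, `min ‖x - y‖₂` over `k`-sparse `y`. -/
def errK {l d : ℕ} (k : ℕ) (x : Signal l d) : ℝ :=
  ⨅ y : {y : Signal l d // (Function.support y).ncard ≤ k}, l2norm (x - y.1)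

/-- The noise level: `μ² = Err_k(x)² / k`. -/
def noiseLevel {l d : ℕ} (k : ℕ) (x : Signal l d) : ℝ := errK k x / Real.sqrt k

/-- `ω ^ z` for a residue `z` modulo `n`, where `ω = exp (2 π i / n)`. -/
def om {l : ℕ} (z : ZMod (2 ^ l)) : ℂ := ZMod.stdAddChar z

/-- The orthonormal `d`-dimensional discrete Fourier transform. -/
def dft {l d : ℕ} (x : Signal l d) : Signal l d := fun j =>
  (1 / (Real.sqrt (sigLen l d) : ℂ)) * ∑ i : Grid l d, om (-(i ⬝ᵥ j)) * x i

/-- The inverse of `dft`. -/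
def idft {l d : ℕ} (y : Signal l d) : Signal l d := fun j =>
  (1 / (Real.sqrt (sigLen l d) : ℂ)) * ∑ i : Grid l d, om (i ⬝ᵥ j) * y i

/-! ### The filter, the pseudorandom permutations and hashing -/

/-- `H^F_j = ((1 / (b - 1)) ∑_{|m| < b / 2} ω ^ (m j)) ^ F`. -/
def filterH {l : ℕ} (b F : ℕ) (j : ZMod (2 ^ l)) : ℂ :=
  ((1 / ((b : ℂ) - 1)) *
    ∑ m ∈ Finset.Ioo (-((b / 2 : ℕ) : ℤ)) ((b / 2 : ℕ) : ℤ), om ((m : ZMod (2 ^ l)) * j)) ^ F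

/-- The `d`-dimensional filter `G_i = ∏ₛ H^F_{iₛ}`. -/
def filterG {l d : ℕ} (b F : ℕ) : Signal l d := fun i => ∏ s : Fin d, filterH b F (i s)

/-- The `d × d` matrices over `ℤ/n` with odd determinant. -/
abbrev OddMatrix (l d : ℕ) : Type :=
  {M : Matrix (Fin d) (Fin d) (ZMod (2 ^ l)) // Odd M.det.val}

/-- One hash function: a triple `(Σ, a, q)`. -/
abbrev Draw (l d : ℕ) : Type := OddMatrix l d × Grid l d × Grid l d

/-- The matrix `Σ` of a draw. -/
def Draw.mat {l d : ℕ} (h : Draw l d) : Matrix (Fin d) (Fin d) (ZMod (2 ^ l)) := h.1.1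

/-- The vector `a` of a draw. -/
def Draw.a {l d : ℕ} (h : Draw l d) : Grid l d := h.2.1

/-- The vector `q` of a draw. -/
def Draw.q {l d : ℕ} (h : Draw l d) : Grid l d := h.2.2

/-- `π_{Σ,q}(i) = Σ (i - q)`. -/
def Draw.perm {l d : ℕ} (h : Draw l d) (i : Grid l d) : Grid l d := h.mat.mulVec (i - h.q)

/-- `(P_{Σ,a,q} y)_i = y_{Σᵀ (i - a)} ω ^ (iᵀ Σ q)`. -/
def Draw.permute {l d : ℕ} (h : Draw l d) (y : Signal l d) : Signal l d := fun i =>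
  y (h.mat.transpose.mulVec (i - h.a)) * om (i ⬝ᵥ h.mat.mulVec h.q)

/-- `√N F⁻¹((P_{Σ,a,q} y) · Ĝ)`. -/
def Draw.hash {l d : ℕ} (h : Draw l d) (b F : ℕ) (y : Signal l d) : Signal l d := fun j =>
  (Real.sqrt (sigLen l d) : ℂ) *
    idft (fun i => h.permute y i * dft (filterG b F) i) j

/-! ### The algorithm -/

/-- The median of `r` real numbers, with multiplicity: the entry at position `⌊r / 2⌋`
(counting from `0`) of the increasing rearrangement. -/
def median {r : ℕ} (s : Fin r → ℝ) : ℝ :=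
  ((Finset.univ.val.map s).sort (· ≤ ·)).getD (r / 2) 0

/-- The median of complex numbers, taken coordinatewise. -/
def medianC {r : ℕ} (s : Fin r → ℂ) : ℂ :=
  ⟨median fun i => (s i).re, median fun i => (s i).im⟩

/-- LocateAndEstimate with hash values `u`, current approximation `χ` and threshold `ν`.
The term `e` is the numerical error made in computing the updated hash values `v`. -/
def locateAndEstimate {l d r : ℕ} (b F : ℕ) (ρ : Fin r → Draw l d) (u : Fin r → Signal l d)
    (e : Fin r → Signal l d) (χ : Signal l d) (ν : ℝ) : Signal l d := fun f =>
  let v : Fin r → Signal l d := fun i j => u i j - (ρ i).hash b F (dft χ) j + e i j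
  let η : ℂ := medianC fun i =>
    v i ((ρ i).perm f) * om (-((ρ i).a ⬝ᵥ (ρ i).mat.mulVec f))
  if ‖η‖ ≤ ν / 2 then 0 else η

/-- The side `b` of a bucket: the least power of two with `b ^ d ≥ k / (ε α ^ d)`. -/
def bucketSide (α : ℝ) (d k : ℕ) (ε : ℝ) : ℕ :=
  2 ^ sInf {β : ℕ | (k : ℝ) / (ε * α ^ d) ≤ ((2 : ℝ) ^ β) ^ d}

/-- The number of rounds, `T = ⌈log₂ R⌉`. -/
def numRounds (R : ℝ) : ℕ := ⌈Real.logb 2 R⌉₊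

/-- The approximation `χ^(t)` after `t` of the rounds of SparseFFT. -/
def sparseFFTRound {l d r : ℕ} (α : ℝ) (F k : ℕ) (ε R μ : ℝ) (xhat : Signal l d)
    (ρ : Fin r → Draw l d) (e : ℕ → Fin r → Signal l d) : ℕ → Signal l d
  | 0 => 0
  | t + 1 =>
    let χ := sparseFFTRound α F k ε R μ xhat ρ e t
    let b := bucketSide α d k ε
    χ + locateAndEstimate b F ρ (fun i => (ρ i).hash b F xhat) (e t) χ
      (4 * Real.sqrt ε * μ * 2 ^ (numRounds R - (t + 1)))

/-- The output of SparseFFT on `(x̂, k, ε, R, μ)`, when the random choices are the `r` triples `ρ`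
and the numerical errors are `e` (`e = 0` is exact arithmetic). -/
def sparseFFT {l d r : ℕ} (α : ℝ) (F k : ℕ) (ε R μ : ℝ) (xhat : Signal l d)
    (ρ : Fin r → Draw l d) (e : ℕ → Fin r → Signal l d) : Signal l d :=
  sparseFFTRound α F k ε R μ xhat ρ e (numRounds R)

/-- The number of hash functions, `r_max = C log₂ N`. -/
def numHashes (C l d : ℕ) : ℕ := C * (l * d)

/-- Probability of an event under the uniform distribution on a finite type. -/
def uniformProb {Ω : Type} (E : Set Ω) : ℝ := (E.ncard : ℝ) / (Nat.card Ω : ℝ)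

/-! ### A random access machine with integer words and complex registers

The machine has an integer memory and a complex memory, both addressed by integers, a read-only
random tape, and query access to the samples. Each operation of an expression, each memory access
and each statement or test costs one step; complex arithmetic is exact. -/

/-- Integer expressions. -/
inductive IExp : Type
  | const (c : ℤ)
  | mem (addr : IExp)
  | tape (pos : IExp)
  | add (e f : IExp)
  | sub (e f : IExp)
  | mul (e f : IExp)
  | div (e f : IExp)
  | mod (e f : IExp)

/-- Complex expressions; `root p q` is `exp (2 π i p / q)`. -/
inductive CExp : Type
  | mem (addr : IExp)
  | ofInt (e : IExp)
  | root (p q : IExp)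
  | re (z : CExp)
  | im (z : CExp)
  | add (z w : CExp)
  | sub (z w : CExp)
  | mul (z w : CExp)
  | div (z w : CExp)

/-- Tests; complex numbers are compared through their real parts. -/
inductive BExp : Type
  | ilt (e f : IExp)
  | clt (z w : CExp)

/-- Programs. -/
inductive Prog : Type
  | skip
  | setI (addr val : IExp)
  | setC (addr : IExp) (val : CExp)
  | query (addr pos : IExp)
  | seq (p q : Prog)
  | ite (t : BExp) (p q : Prog)
  | while (t : BExp) (p : Prog)

/-- The contents of the two memories. -/
structure Store : Type where
  int : ℤ → ℤ
  cpx : ℤ → ℂ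

/-- Value of an integer expression (`div` and `mod` round down for positive divisors). -/
def IExp.eval (tp : ℤ → ℤ) (s : Store) : IExp → ℤ
  | .const c => c
  | .mem a => s.int (a.eval tp s)
  | .tape p => tp (p.eval tp s)
  | .add e f => e.eval tp s + f.eval tp s
  | .sub e f => e.eval tp s - f.eval tp s
  | .mul e f => e.eval tp s * f.eval tp s
  | .div e f => e.eval tp s / f.eval tp s
  | .mod e f => e.eval tp s % f.eval tp s

/-- Cost of an integer expression. -/
def IExp.cost : IExp → ℕ
  | .const _ => 1
  | .mem a => a.cost + 1
  | .tape p => p.cost + 1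
  | .add e f => e.cost + f.cost + 1
  | .sub e f => e.cost + f.cost + 1
  | .mul e f => e.cost + f.cost + 1
  | .div e f => e.cost + f.cost + 1
  | .mod e f => e.cost + f.cost + 1

/-- Value of a complex expression. -/
def CExp.eval (tp : ℤ → ℤ) (s : Store) : CExp → ℂ
  | .mem a => s.cpx (a.eval tp s)
  | .ofInt e => ((e.eval tp s : ℤ) : ℂ)
  | .root p q =>
    Complex.exp (2 * Real.pi * Complex.I * ((p.eval tp s : ℤ) : ℂ) / ((q.eval tp s : ℤ) : ℂ))
  | .re z => ((z.eval tp s).re : ℂ)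
  | .im z => ((z.eval tp s).im : ℂ)
  | .add z w => z.eval tp s + w.eval tp s
  | .sub z w => z.eval tp s - w.eval tp s
  | .mul z w => z.eval tp s * w.eval tp s
  | .div z w => z.eval tp s / w.eval tp s

/-- Cost of a complex expression. -/
def CExp.cost : CExp → ℕ
  | .mem a => a.cost + 1
  | .ofInt e => e.cost + 1
  | .root p q => p.cost + q.cost + 1
  | .re z => z.cost + 1
  | .im z => z.cost + 1
  | .add z w => z.cost + w.cost + 1
  | .sub z w => z.cost + w.cost + 1
  | .mul z w => z.cost + w.cost + 1
  | .div z w => z.cost + w.cost + 1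

/-- Truth of a test. -/
def BExp.holds (tp : ℤ → ℤ) (s : Store) : BExp → Prop
  | .ilt e f => e.eval tp s < f.eval tp s
  | .clt z w => (z.eval tp s).re < (w.eval tp s).re

/-- Cost of a test. -/
def BExp.cost : BExp → ℕ
  | .ilt e f => e.cost + f.cost + 1
  | .clt z w => z.cost + w.cost + 1

/-- `Exec W smp tp p s s' time queries`: started in `s`, the program `p` halts in `s'` after `time`
steps and `queries` queries to the samples `smp`. Integers that are stored, and addresses that
are written, have to fit into a word (absolute value at most `W`), otherwise there is no run. -/
inductive Exec (W : ℝ) (smp : ℤ → ℂ) (tp : ℤ → ℤ) : Prog → Store → Store → ℕ → ℕ → Prop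
  | skip (s : Store) : Exec W smp tp .skip s s 1 0
  | setI (a e : IExp) (s : Store) (ha : |((a.eval tp s : ℤ) : ℝ)| ≤ W)
      (he : |((e.eval tp s : ℤ) : ℝ)| ≤ W) :
      Exec W smp tp (.setI a e) s
        { s with int := Function.update s.int (a.eval tp s) (e.eval tp s) }
        (a.cost + e.cost + 1) 0
  | setC (a : IExp) (z : CExp) (s : Store) (ha : |((a.eval tp s : ℤ) : ℝ)| ≤ W) :
      Exec W smp tp (.setC a z) s
        { s with cpx := Function.update s.cpx (a.eval tp s) (z.eval tp s) }
        (a.cost + z.cost + 1) 0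
  | query (a e : IExp) (s : Store) (ha : |((a.eval tp s : ℤ) : ℝ)| ≤ W) :
      Exec W smp tp (.query a e) s
        { s with cpx := Function.update s.cpx (a.eval tp s) (smp (e.eval tp s)) }
        (a.cost + e.cost + 1) 1
  | seq {p q : Prog} {s s' s'' : Store} {t t' m m' : ℕ} (hp : Exec W smp tp p s s' t m)
      (hq : Exec W smp tp q s' s'' t' m') :
      Exec W smp tp (.seq p q) s s'' (t + t') (m + m')
  | iteTrue {c : BExp} {p q : Prog} {s s' : Store} {t m : ℕ} (hc : c.holds tp s)
      (hp : Exec W smp tp p s s' t m) :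
      Exec W smp tp (.ite c p q) s s' (c.cost + t + 1) m
  | iteFalse {c : BExp} {p q : Prog} {s s' : Store} {t m : ℕ} (hc : ¬ c.holds tp s)
      (hq : Exec W smp tp q s s' t m) :
      Exec W smp tp (.ite c p q) s s' (c.cost + t + 1) m
  | whileFalse {c : BExp} {p : Prog} {s : Store} (hc : ¬ c.holds tp s) :
      Exec W smp tp (.while c p) s s (c.cost + 1) 0
  | whileTrue {c : BExp} {p : Prog} {s s' s'' : Store} {t t' m m' : ℕ} (hc : c.holds tp s)
      (hp : Exec W smp tp p s s' t m) (hw : Exec W smp tp (.while c p) s' s'' t' m') :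
      Exec W smp tp (.while c p) s s'' (c.cost + t + t' + 1) (m + m')

/-- The position of a grid point in an array of length `N`: the number with digits `i s` in
base `n`. -/
def flatIndex {l d : ℕ} (i : Grid l d) : ℤ := ∑ s : Fin d, ((i s).val : ℤ) * (2 ^ l : ℤ) ^ (s : ℕ)

/-- Initial memory: `n, d, k` in the integer cells `0, 1, 2` and `ε, R, μ` in the complex
cells `0, 1, 2`; all other cells hold `0`. -/
def initStore (l d k : ℕ) (ε R μ : ℝ) : Store where
  int := fun z => if z = 0 then 2 ^ l else if z = 1 then (d : ℤ) else if z = 2 then (k : ℤ) else 0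
  cpx := fun z => if z = 0 then (ε : ℂ) else if z = 1 then (R : ℂ) else if z = 2 then (μ : ℂ) else 0

/-- The samples the machine can query are the entries of `xhat`. -/
def IsSampleAccess {l d : ℕ} (smp : ℤ → ℂ) (xhat : Signal l d) : Prop :=
  ∀ j : Grid l d, smp (flatIndex j) = xhat j

/-- The random tape holds the random choices: for each of the triples `(Σ, a, q)` in turn a block
of length `d ^ 2 + 2 d` with the rows of `Σ`, then `a`, then `q`, as numbers in `{0, …, n - 1}`. -/
def IsRandomTape {l d r : ℕ} (tp : ℤ → ℤ) (ρ : Fin r → Draw l d) : Prop :=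
  ∀ (i : Fin r) (s : Fin d),
    (∀ t : Fin d, tp (((i : ℕ) * (d * d + 2 * d) + (s : ℕ) * d + (t : ℕ) : ℕ) : ℤ)
      = (((ρ i).mat s t).val : ℤ)) ∧
    tp (((i : ℕ) * (d * d + 2 * d) + d * d + (s : ℕ) : ℕ) : ℤ) = (((ρ i).a s).val : ℤ) ∧
    tp (((i : ℕ) * (d * d + 2 * d) + d * d + d + (s : ℕ) : ℕ) : ℤ) = (((ρ i).q s).val : ℤ)

/-- `p` computes the signal `χ` (left in the complex cells `0, …, N - 1`) from the given inputs,
with word bound `W`, within `time` steps and with at most `queries` queries. -/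
def Computes {l d : ℕ} (p : Prog) (W : ℝ) (smp : ℤ → ℂ) (tp : ℤ → ℤ) (s : Store)
    (χ : Signal l d) (time queries : ℝ) : Prop :=
  ∃ (s' : Store) (t m : ℕ), Exec W smp tp p s s' t m ∧ (t : ℝ) ≤ time ∧ (m : ℝ) ≤ queries ∧
    ∀ f : Grid l d, s'.cpx (flatIndex f) = χ f

end SparseFourier

end

open SparseFourier

/-!
# Recovery, running time and sample count of SparseFFT

**One hash.** Let `π f = Σ (f - q)`. Undoing the phase in bucket `π f`, one hash estimates `y f` by
`∑ m, y m * ω ^ (aᵀ Σ (m - f)) * G (Σ (f - m))` (`Draw.estimate_eq`); the shift `q` drops out. The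
term `m = f` is `y f`, as `G 0 = 1`, and the others are noise. Its size is controlled by the mean of
`‖G (Σ z)‖` over the random matrix for `z ≠ 0`, which is at most `2 (9 / b) ^ d`
(`sum_oddMatrix_filterG_le`). For this, write `z = 2 ^ v z'` with an odd coordinate in `z'`.
Multiplying `Σ` by matrices that carry `z'` to other points shows that `Σ z'` is, up to a factor `2`,
dominated by the uniform distribution on the points with an odd coordinate. The sum of the filter
over these points is bounded in `sum_norm_filterG_le`. There the exponent `F = 2 d` matters: the
coordinate farthest from `0` alone contributes `D ^ (2 d)` with a small value `D` of the box kernel,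
and giving `D ^ 2` to each coordinate yields a product majorant, whose factor is `min 1 (w ^ 2)` and
not `1` in the coordinates that vanish, with `w = 2 ^ (l - v) / b`
(`norm_filterG_two_pow_smul_le`). So each coordinate sums to `O(w)` even if `w` is small.

**All hashes, all rounds.** Let the head `S` be the set of `f` with `‖x f‖ ≥ √ε μ`. It has at most
`2 k / ε` elements and the tail has energy at most `2 k μ²` (`head_bounds`). A draw is called bad for
`f` if the filter weight of the head around `f` exceeds `1 / 32` (Markov) or the contribution of the
tail of `x` exceeds `√ε μ / 32` (second moment, by orthogonality in `a`); for small `α` this has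
probability at most `1 / 64` (`card_bad_le_div`). This notion depends on `x` only, and not on the
current approximation `χ`: as long as `χ` is supported on the head, the tail of `x - χ` is that of
`x`, and its head enters only through its largest entry. Therefore the same draws serve all rounds
without any conditioning. By a Chernoff bound (`card_half_bad_le`) and a union bound over `f`, less
than half of the draws are bad for each `f`, except with probability `N ^ (-C)`. Then the medians
are accurate, and by induction `χ` remains supported on the head, no entry of the residual exceeds
that of `x`, and the bound for the residual on the head halves in every round
(`sparseFFTRound_invariant`). After the last round it is at most `3 √ε μ` everywhere. On the support
of a best `k`-sparse approximation this contributes at most `9 ε k μ² ≤ 9 ε Λ² Err²`, and outside of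
it the residual is dominated by `x`. Errors of size `N ^ (-A - 6) ‖x‖₂` are below `√ε μ / 32` and
change none of this.

**The program.** It tabulates, for all hashes and positions, the position read, the bucket and the
two phases, and queries a sample only where the transformed filter is not zero. The filter is a
trigonometric polynomial of degree less than `d b` in each coordinate, so its transform has at most
`(2 d b) ^ d` nonzero entries (`card_support_dft_filterG_le`), and `b ^ d` is `O(1) ^ d * k / ε` by the
choice of `b`. In a round the transform of `χ` is computed once and subtracted from the samples, each
hash costs one fast Fourier transform (`fftProg_good`), and each median is found by counting ranks
in `O(log² N)` steps (`medianProg_good`). There are at most `A log₂ N` rounds (`numRounds_le`), which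
gives `O(N log³ N)` steps. The words are polynomial in `N`, because the hypotheses force
`1 / ε ≤ Λ² N ^ (2 A + 2)` (`one_le_mul_sqrt`). Programs are treated in a logic whose judgement
`Good` bounds steps and queries along with the result, and whose frame conditions are read off
syntactically (`WritesIn`).
-/

noncomputable section

namespace SparseFourier

/-! ### Characters of the grid -/

section characters

variable {l d : ℕ}

theorem om_add (z w : ZMod (2 ^ l)) : om (z + w) = om z * om w := AddChar.map_add_eq_mul _ _ _

theorem om_zero : om (0 : ZMod (2 ^ l)) = 1 := AddChar.map_zero_eq_one _

theorem om_neg_mul (z : ZMod (2 ^ l)) : om (-z) * om z = 1 := by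
  rw [← om_add, neg_add_cancel, om_zero]

theorem norm_om (z : ZMod (2 ^ l)) : ‖om z‖ = 1 := by
  rw [om, ZMod.stdAddChar_apply]; exact Circle.norm_coe _

theorem om_intCast (z : ℤ) :
    om (z : ZMod (2 ^ l)) = Complex.exp (2 * Real.pi * Complex.I * z / ((2 ^ l : ℤ) : ℂ)) := by
  rw [om, ZMod.stdAddChar_coe]; push_cast; rfl

theorem om_sum {ι : Type*} (s : Finset ι) (f : ι → ZMod (2 ^ l)) :
    om (∑ i ∈ s, f i) = ∏ i ∈ s, om (f i) := by
  classical
  induction s using Finset.induction_on with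
  | empty => simp [om_zero]
  | insert i s hi ih => rw [Finset.sum_insert hi, Finset.prod_insert hi, om_add, ih]

theorem star_om (z : ZMod (2 ^ l)) : (starRingEnd ℂ) (om z) = om (-z) := by
  have h := om_neg_mul z
  have h2 : om z * (starRingEnd ℂ) (om z) = 1 := by
    rw [Complex.mul_conj, Complex.normSq_eq_norm_sq, norm_om]; simp
  have h3 : om z ≠ 0 := by intro h0; rw [h0] at h; simp at h
  apply mul_left_cancel₀ h3
  rw [h2, mul_comm, h]

theorem sum_om_mul (z : ZMod (2 ^ l)) :
    ∑ a : ZMod (2 ^ l), om (a * z) = if z = 0 then ((2 : ℂ) ^ l) else 0 := by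
  have h := AddChar.sum_mulShift z (ZMod.isPrimitive_stdAddChar (2 ^ l))
  simp only [om]
  rw [h]; simp

theorem sum_om_dotProduct (z : Grid l d) :
    ∑ a : Grid l d, om (a ⬝ᵥ z) = if z = 0 then ((sigLen l d : ℝ) : ℂ) else 0 := by
  have h : ∀ a : Grid l d, om (a ⬝ᵥ z) = ∏ s, om (a s * z s) := fun a => by
    rw [dotProduct, om_sum]
  simp only [h]
  rw [← Fintype.piFinset_univ, ← Finset.prod_univ_sum (fun _ => Finset.univ)
    (fun s a => om (a * z s))]
  simp only [sum_om_mul]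
  split_ifs with hz
  · subst hz; simp [sigLen]
  · obtain ⟨s, hs⟩ := Function.ne_iff.mp hz
    exact Finset.prod_eq_zero (Finset.mem_univ s) (by simpa using hs)

theorem sigLen_pos : 0 < sigLen l d := by unfold sigLen; positivity

theorem sqrt_sigLen_mul_self :
    ((Real.sqrt (sigLen l d) : ℝ) : ℂ) * (Real.sqrt (sigLen l d) : ℝ) = (sigLen l d : ℝ) := by
  rw [← Complex.ofReal_mul, Real.mul_self_sqrt sigLen_pos.le]

theorem sqrt_sigLen_ne_zero : ((Real.sqrt (sigLen l d) : ℝ) : ℂ) ≠ 0 := by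
  have := Real.sqrt_pos.mpr (sigLen_pos (l := l) (d := d))
  exact_mod_cast this.ne'

theorem sigLen_ne_zero : ((sigLen l d : ℝ) : ℂ) ≠ 0 := by
  exact_mod_cast (sigLen_pos (l := l) (d := d)).ne'

/-- The form in which the machine evaluates a hash: no normalization is left at the outer
transform. -/
theorem Draw.hash_eq_sum (h : Draw l d) (b F : ℕ) (y : Signal l d) (j : Grid l d) :
    h.hash b F y j = ∑ i : Grid l d, om (i ⬝ᵥ j) * (h.permute y i * dft (filterG b F) i) := by
  unfold Draw.hash idft
  rw [← mul_assoc, mul_one_div_cancel sqrt_sigLen_ne_zero, one_mul]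

/-- The hash is a convolution with the filter in the signal domain. -/
theorem Draw.hash_dft (h : Draw l d) (b F : ℕ) (y : Signal l d) (j : Grid l d) :
    h.hash b F (dft y) j =
      ∑ m : Grid l d, y m * om (h.a ⬝ᵥ h.mat.mulVec m) * filterG b F (j - h.perm m) := by
  rw [Draw.hash_eq_sum]
  unfold Draw.permute dft
  have key : ∀ (i m m' : Grid l d),
      om (i ⬝ᵥ j) * (om (-(m ⬝ᵥ h.mat.transpose.mulVec (i - h.a))) * om (i ⬝ᵥ h.mat.mulVec h.q) *
        om (-(m' ⬝ᵥ i))) = om (h.a ⬝ᵥ h.mat.mulVec m) * om (i ⬝ᵥ (j - h.perm m - m')) := by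
    intro i m m'
    rw [← om_add, ← om_add, ← om_add, ← om_add]
    congr 1
    have e1 : m ⬝ᵥ h.mat.transpose.mulVec (i - h.a) = (i - h.a) ⬝ᵥ h.mat.mulVec m := by
      rw [Matrix.mulVec_transpose, dotProduct_comm, Matrix.dotProduct_mulVec]
    rw [e1, Draw.perm, Matrix.mulVec_sub, dotProduct_comm m' i]
    simp only [sub_dotProduct, dotProduct_sub]
    ring
  calc _ = ∑ i : Grid l d, ∑ m : Grid l d, ∑ m' : Grid l d,
        (1 / (sigLen l d : ℂ)) * (y m * filterG b F m' *
          (om (h.a ⬝ᵥ h.mat.mulVec m) * om (i ⬝ᵥ (j - h.perm m - m')))) := by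
        refine Finset.sum_congr rfl fun i _ => ?_
        have e2 : (1 / (sigLen l d : ℂ)) = (1 / (Real.sqrt (sigLen l d) : ℂ)) *
            (1 / (Real.sqrt (sigLen l d) : ℂ)) := by
          rw [one_div_mul_one_div, sqrt_sigLen_mul_self]
        calc _ = (1 / (sigLen l d : ℂ)) * (om (i ⬝ᵥ j) * om (i ⬝ᵥ h.mat.mulVec h.q)) *
              ((∑ m : Grid l d, om (-(m ⬝ᵥ h.mat.transpose.mulVec (i - h.a))) * y m) *
              (∑ m' : Grid l d, om (-(m' ⬝ᵥ i)) * filterG b F m')) := by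
                rw [e2]; ring
          _ = _ := by
                rw [Finset.sum_mul_sum, Finset.mul_sum]
                refine Finset.sum_congr rfl fun m _ => ?_
                rw [Finset.mul_sum]
                refine Finset.sum_congr rfl fun m' _ => ?_
                rw [← key i m m']; ring
    _ = ∑ m : Grid l d, ∑ m' : Grid l d, ∑ i : Grid l d,
        (1 / (sigLen l d : ℂ)) * (y m * filterG b F m' *
          (om (h.a ⬝ᵥ h.mat.mulVec m) * om (i ⬝ᵥ (j - h.perm m - m')))) := by
        rw [Finset.sum_comm]
        exact Finset.sum_congr rfl fun m _ => Finset.sum_comm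
    _ = _ := by
        refine Finset.sum_congr rfl fun m _ => ?_
        have e3 : ∀ m' : Grid l d, ∑ i : Grid l d,
            (1 / (sigLen l d : ℂ)) * (y m * filterG b F m' *
              (om (h.a ⬝ᵥ h.mat.mulVec m) * om (i ⬝ᵥ (j - h.perm m - m')))) =
            if m' = j - h.perm m then
              y m * om (h.a ⬝ᵥ h.mat.mulVec m) * filterG b F m' else 0 := by
          intro m'
          rw [← Finset.mul_sum, ← Finset.mul_sum, ← Finset.mul_sum, sum_om_dotProduct]
          by_cases hm : m' = j - h.perm m
          · rw [if_pos hm, if_pos (by rw [hm, sub_self])]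
            rw [one_div, mul_comm (om _), ← mul_assoc (y m * _), mul_comm (_ * _) (om _)]
            have := inv_mul_cancel₀ (sigLen_ne_zero (l := l) (d := d))
            linear_combination (om (h.a ⬝ᵥ h.mat.mulVec m) * y m * filterG b F m') * this
          · rw [if_neg hm, if_neg (fun h0 => hm (sub_eq_zero.mp h0).symm)]; simp
        simp only [e3]
        rw [Finset.sum_ite_eq' Finset.univ, if_pos (Finset.mem_univ _)]

/-- The estimate of `y f` from one hash; the shift `q` has dropped out. -/
theorem Draw.estimate_eq (h : Draw l d) (b F : ℕ) (y : Signal l d) (f : Grid l d) :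
    h.hash b F (dft y) (h.perm f) * om (-(h.a ⬝ᵥ h.mat.mulVec f)) =
      ∑ m : Grid l d, y m * om (h.a ⬝ᵥ h.mat.mulVec (m - f)) *
        filterG b F (h.mat.mulVec (f - m)) := by
  rw [Draw.hash_dft, Finset.sum_mul]
  refine Finset.sum_congr rfl fun m _ => ?_
  have e : h.perm f - h.perm m = h.mat.mulVec (f - m) := by
    rw [Draw.perm, Draw.perm, ← Matrix.mulVec_sub]; congr 1; abel
  rw [e, Matrix.mulVec_sub h.mat m f, dotProduct_sub,
    sub_eq_add_neg (h.a ⬝ᵥ h.mat.mulVec m), om_add]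
  ring

theorem dft_sub (x y : Signal l d) : dft (x - y) = dft x - dft y := by
  funext j
  simp only [dft, Pi.sub_apply, mul_sub, Finset.sum_sub_distrib]

theorem Draw.hash_sub (h : Draw l d) (b F : ℕ) (y z : Signal l d) (j : Grid l d) :
    h.hash b F (y - z) j = h.hash b F y j - h.hash b F z j := by
  rw [Draw.hash_eq_sum, Draw.hash_eq_sum, Draw.hash_eq_sum, ← Finset.sum_sub_distrib]
  refine Finset.sum_congr rfl fun i _ => ?_
  simp only [Draw.permute, Pi.sub_apply]; ring

end characters

/-! ### Decay of the filter -/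

section filter

variable {l d : ℕ}

/-- The normalized box kernel, so that `filterH b F j = boxKernel b j ^ F`. -/
def boxKernel (b : ℕ) (j : ZMod (2 ^ l)) : ℂ :=
  (1 / ((b : ℂ) - 1)) *
    ∑ m ∈ Finset.Ioo (-((b / 2 : ℕ) : ℤ)) ((b / 2 : ℕ) : ℤ), om ((m : ZMod (2 ^ l)) * j)

theorem filterH_eq (b F : ℕ) (j : ZMod (2 ^ l)) : filterH b F j = boxKernel b j ^ F := rfl

/-- The geometric sum, with the denominator cleared. -/
theorem sum_om_mul_sub_one (h : ℕ) (hh : 1 ≤ h) (j : ZMod (2 ^ l)) :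
    (∑ m ∈ Finset.Ioo (-(h : ℤ)) (h : ℤ), om ((m : ZMod (2 ^ l)) * j)) * (om j - 1) =
      om ((h : ZMod (2 ^ l)) * j) - om ((1 - (h : ZMod (2 ^ l))) * j) := by
  have e : Finset.Ioo (-(h : ℤ)) (h : ℤ) =
      (Finset.range (2 * h - 1)).image (fun i : ℕ => (i : ℤ) + (1 - (h : ℤ))) := by
    ext m
    simp only [Finset.mem_Ioo, Finset.mem_image, Finset.mem_range]
    constructor
    · rintro ⟨h1, h2⟩
      exact ⟨(m - (1 - (h : ℤ))).toNat, by omega, by omega⟩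
    · rintro ⟨a, ha, rfl⟩; omega
  rw [e, Finset.sum_image fun a _ b _ hab => by simpa using hab]
  have e2 : ∀ N : ℕ, (∑ x ∈ Finset.range N, om ((((x : ℤ) + (1 - (h : ℤ)) : ℤ) : ZMod (2 ^ l)) * j))
      * (om j - 1) = om (((N : ZMod (2 ^ l)) + (1 - (h : ZMod (2 ^ l)))) * j) - om ((1 - (h : ZMod (2 ^ l))) * j) := by
    intro N
    induction N with
    | zero => simp
    | succ N ih =>
      rw [Finset.sum_range_succ, add_mul, ih, mul_sub, ← om_add]
      push_cast
      rw [show ((N : ZMod (2 ^ l)) + (1 - (h : ZMod (2 ^ l)))) * j + j =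
        ((N : ZMod (2 ^ l)) + 1 + (1 - (h : ZMod (2 ^ l)))) * j by ring]
      ring
  rw [e2]
  congr 2
  have : ((2 * h - 1 : ℕ) : ZMod (2 ^ l)) = 2 * h - 1 := by
    rw [Nat.cast_sub (by omega)]; push_cast; ring
  rw [this]; ring

theorem boxKernel_zero {b : ℕ} (hb : Even b) (hb0 : 2 ≤ b) : boxKernel b (0 : ZMod (2 ^ l)) = 1 := by
  obtain ⟨h, rfl⟩ := hb
  simp only [boxKernel, mul_zero, om_zero, Finset.sum_const, Int.card_Ioo, nsmul_eq_mul, mul_one]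
  have e : (((((h + h) / 2 : ℕ) : ℤ) - -(((h + h) / 2 : ℕ) : ℤ) - 1).toNat : ℂ) =
      (((h + h : ℕ) : ℂ) - 1) := by
    have e1 : (h + h) / 2 = h := by omega
    rw [e1, show ((h : ℤ) - -(h : ℤ) - 1).toNat = h + h - 1 by omega, Nat.cast_sub (by omega)]
    simp
  rw [e, one_div, inv_mul_cancel₀]
  rw [sub_ne_zero]
  norm_cast
  omega

theorem norm_cast_sub_one {b : ℕ} (hb0 : 2 ≤ b) : ‖(b : ℂ) - 1‖ = (b : ℝ) - 1 := by
  have : ((b : ℂ) - 1) = (((b : ℝ) - 1 : ℝ) : ℂ) := by push_cast; rfl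
  rw [this, Complex.norm_real, Real.norm_of_nonneg]
  have : (2 : ℝ) ≤ b := by exact_mod_cast hb0
  linarith

theorem norm_boxKernel_le_one {b : ℕ} (hb : Even b) (hb0 : 2 ≤ b) (j : ZMod (2 ^ l)) :
    ‖boxKernel b j‖ ≤ 1 := by
  obtain ⟨h, rfl⟩ := hb
  have h2 : (2 : ℝ) ≤ (h + h : ℕ) := by exact_mod_cast hb0
  have hs : ‖∑ m ∈ Finset.Ioo (-(((h + h) / 2 : ℕ) : ℤ)) (((h + h) / 2 : ℕ) : ℤ),
      om ((m : ZMod (2 ^ l)) * j)‖ ≤ ((h + h : ℕ) : ℝ) - 1 := by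
    refine (norm_sum_le _ _).trans ?_
    simp only [norm_om, Finset.sum_const, Int.card_Ioo, nsmul_eq_mul, mul_one]
    have e1 : (h + h) / 2 = h := by omega
    rw [e1, show ((h : ℤ) - -(h : ℤ) - 1).toNat = h + h - 1 by omega, Nat.cast_sub (by omega)]
    simp
  rw [boxKernel, norm_mul, norm_div, norm_one, norm_cast_sub_one hb0, one_div,
    inv_mul_le_iff₀ (by linarith)]
  linarith

/-- Chord length: for `0 < r < n'` the root of unity `exp (2 π i r / n')` is at distance at least
`4 min(r, n' - r) / n'` from `1`. -/
theorem chord_lower_bound {n' r : ℕ} (hr : 0 < r) (hrn : r < n') :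
    4 * (min r (n' - r) : ℕ) / (n' : ℝ) ≤
      ‖Complex.exp (2 * Real.pi * Complex.I * r / n') - 1‖ := by
  have hn : (0 : ℝ) < n' := by exact_mod_cast (by omega : 0 < n')
  have e : (2 * Real.pi * Complex.I * r / n' : ℂ) =
      Complex.I * ((2 * Real.pi * r / n' : ℝ) : ℂ) := by push_cast; ring
  rw [e, Complex.norm_exp_I_mul_ofReal_sub_one]
  have hx : 2 * Real.pi * r / n' / 2 = Real.pi * r / n' := by ring
  rw [hx]
  refine le_trans ?_ (le_abs_self _)
  have hr' : (r : ℝ) ≤ n' := by exact_mod_cast hrn.le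
  rcases le_total (2 * r) n' with hc | hc
  · have hc' : (2 : ℝ) * r ≤ n' := by exact_mod_cast hc
    have hb := Real.mul_le_sin (x := Real.pi * r / n') (by positivity)
      (by rw [div_le_iff₀ hn]; nlinarith [Real.pi_pos])
    rw [min_eq_left (by omega)]
    have : 2 / Real.pi * (Real.pi * r / n') = 2 * r / n' := by
      field_simp
    rw [this] at hb
    calc (4 * (r : ℝ) / n') = 2 * (2 * r / n') := by ring
      _ ≤ _ := by linarith
  · have hc' : (n' : ℝ) ≤ 2 * r := by exact_mod_cast hc
    rw [← Real.sin_pi_sub, show Real.pi - Real.pi * r / n' = Real.pi * (n' - r) / n' by field_simp]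
    have hb := Real.mul_le_sin (x := Real.pi * (n' - r) / n')
      (by apply div_nonneg (mul_nonneg Real.pi_pos.le (by linarith)) hn.le)
      (by rw [div_le_iff₀ hn]; nlinarith [Real.pi_pos])
    rw [min_eq_right (by omega), Nat.cast_sub hrn.le]
    have : 2 / Real.pi * (Real.pi * (n' - r) / n') = 2 * ((n' : ℝ) - r) / n' := by
      field_simp
    rw [this] at hb
    calc (4 * ((n' : ℝ) - r) / n') = 2 * (2 * (n' - r) / n') := by ring
      _ ≤ _ := by linarith

theorem norm_boxKernel_le_of_chord {b : ℕ} (hb0 : 2 ≤ b) (j : ZMod (2 ^ l)) {c : ℝ}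
    (hc : 0 < c) (hj : 4 * c ≤ ‖om j - 1‖) : ‖boxKernel b j‖ ≤ 1 / (b * c) := by
  have hb' : (2 : ℝ) ≤ b := by exact_mod_cast hb0
  have hs := congrArg norm (sum_om_mul_sub_one (l := l) (b / 2) (by omega) j)
  rw [norm_mul] at hs
  have h2 := norm_sub_le (om (((b / 2 : ℕ) : ZMod (2 ^ l)) * j))
    (om ((1 - ((b / 2 : ℕ) : ZMod (2 ^ l))) * j))
  rw [norm_om, norm_om, ← hs] at h2
  rw [boxKernel, norm_mul, norm_div, norm_one, norm_cast_sub_one hb0]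
  set S := ‖∑ m ∈ Finset.Ioo (-((b / 2 : ℕ) : ℤ)) ((b / 2 : ℕ) : ℤ), om ((m : ZMod (2 ^ l)) * j)‖
  have hS : 0 ≤ S := norm_nonneg _
  have h3 : S * (4 * c) ≤ 2 := (mul_le_mul_of_nonneg_left hj hS).trans (by linarith)
  rw [one_div_mul_eq_div, div_le_div_iff₀ (by linarith) (by positivity)]
  nlinarith [mul_nonneg hS hc.le]

/-- The decay of the box kernel along the multiples of `2 ^ v`, in terms of the distance of
`r = z mod n'` to `0` modulo `n' = n / 2 ^ v`. -/
theorem norm_boxKernel_two_pow_mul_le {b v : ℕ} (hb0 : 2 ≤ b) (hv : v < l)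
    (z : ZMod (2 ^ l)) (hr : 0 < z.val % 2 ^ (l - v)) :
    ‖boxKernel b ((2 : ZMod (2 ^ l)) ^ v * z)‖ ≤
      ((2 : ℝ) ^ (l - v) / b) /
        (min (z.val % 2 ^ (l - v)) (2 ^ (l - v) - z.val % 2 ^ (l - v)) : ℕ) := by
  set r := z.val % 2 ^ (l - v) with hrdef
  have hrn : r < 2 ^ (l - v) := Nat.mod_lt _ (by positivity)
  have e1 : om ((2 : ZMod (2 ^ l)) ^ v * z) =
      Complex.exp (2 * Real.pi * Complex.I * r / (2 ^ (l - v) : ℕ)) := by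
    have hz : (2 : ZMod (2 ^ l)) ^ v * z = (((2 ^ v * r : ℕ) : ℤ) : ZMod (2 ^ l)) := by
      have h0 : ((z.val : ℕ) : ZMod (2 ^ l)) = z := ZMod.natCast_zmod_val z
      have h1 : z.val = 2 ^ (l - v) * (z.val / 2 ^ (l - v)) + r := (Nat.div_add_mod _ _).symm
      rw [← h0, h1]
      push_cast
      have h2 : (2 : ZMod (2 ^ l)) ^ v * 2 ^ (l - v) = 0 := by
        rw [← pow_add, Nat.add_sub_cancel' hv.le]
        have := ZMod.natCast_self (2 ^ l)
        push_cast at this; exact this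
      linear_combination ((z.val / 2 ^ (l - v) : ℕ) : ZMod (2 ^ l)) * h2
    rw [hz, om_intCast]
    congr 1
    have : (2 : ℂ) ^ l = 2 ^ v * 2 ^ (l - v) := by rw [← pow_add, Nat.add_sub_cancel' hv.le]
    push_cast
    rw [this]
    field_simp
  have hc := chord_lower_bound (n' := 2 ^ (l - v)) hr hrn
  rw [← e1] at hc
  have hmin : 0 < min r (2 ^ (l - v) - r) := by
    apply lt_min hr; omega
  have hmin' : (0 : ℝ) < (min r (2 ^ (l - v) - r) : ℕ) := by exact_mod_cast hmin
  have hn' : (0 : ℝ) < (2 ^ (l - v) : ℕ) := by positivity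
  refine (norm_boxKernel_le_of_chord hb0 _ (c := (min r (2 ^ (l - v) - r) : ℕ) /
    ((2 ^ (l - v) : ℕ) : ℝ)) (div_pos hmin' hn') (by rw [← mul_div_assoc]; exact hc)).trans ?_
  apply le_of_eq
  have hb' : (0 : ℝ) < b := by exact_mod_cast (by omega : 0 < b)
  push_cast at *
  field_simp

theorem filterG_zero {b F : ℕ} (hb : Even b) (hb0 : 2 ≤ b) :
    filterG b F (0 : Grid l d) = 1 := by
  simp [filterG, filterH_eq, boxKernel_zero hb hb0]

theorem norm_filterG_le_one {b F : ℕ} (hb : Even b) (hb0 : 2 ≤ b) (i : Grid l d) :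
    ‖filterG b F i‖ ≤ 1 := by
  rw [filterG, norm_prod]
  refine Finset.prod_le_one (fun _ _ => norm_nonneg _) fun s _ => ?_
  rw [filterH_eq, norm_pow]
  exact pow_le_one₀ (norm_nonneg _) (norm_boxKernel_le_one hb hb0 _)

/-- A summable majorant of the squared box kernel at distance `u + 1`, by telescoping. -/
theorem sum_min_sq_le {w : ℝ} (hw : 0 < w) (m : ℕ) :
    ∑ u ∈ Finset.range m, (min 1 (w / ((u : ℝ) + 1))) ^ 2 ≤ 4 * w := by
  have h : ∀ m : ℕ, ∑ u ∈ Finset.range m, (min 1 (w / ((u : ℝ) + 1))) ^ 2 ≤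
      4 * w - 4 * w ^ 2 / (m + w) := by
    intro m
    induction m with
    | zero => simp; rw [mul_div_assoc, sq, mul_div_assoc, div_self hw.ne', mul_one]
    | succ m ih =>
      rw [Finset.sum_range_succ]
      have hm : (0 : ℝ) ≤ m := Nat.cast_nonneg _
      have h1 : min 1 (w / ((m : ℝ) + 1)) ≤ 2 * w / (m + 1 + w) := by
        rcases le_total w (m + 1) with h | h
        · refine (min_le_right _ _).trans ?_
          rw [div_le_div_iff₀ (by positivity) (by positivity)]; nlinarith
        · refine (min_le_left _ _).trans ?_
          rw [le_div_iff₀ (by positivity)]; linarith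
      have h0 : 0 ≤ min 1 (w / ((m : ℝ) + 1)) := le_min zero_le_one (by positivity)
      have h2 : (min 1 (w / ((m : ℝ) + 1))) ^ 2 ≤ (2 * w / (m + 1 + w)) ^ 2 :=
        pow_le_pow_left₀ h0 h1 2
      have h3 : (2 * w / (m + 1 + w)) ^ 2 ≤ 4 * w ^ 2 / (m + w) - 4 * w ^ 2 / (m + 1 + w) := by
        rw [div_sub_div _ _ (by positivity) (by positivity), div_pow,
          div_le_div_iff₀ (by positivity) (by positivity)]
        have : 0 ≤ w ^ 2 * (m + 1 + w) := by positivity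
        nlinarith
      push_cast
      linarith
  refine (h m).trans ?_
  have : 0 ≤ 4 * w ^ 2 / (m + w) := by positivity
  linarith

/-- The majorant of the box kernel at residue `r` modulo `n'`; `w = n' / b`. At `r = 0` it is
`min 1 w` and not `1`: this is allowed as soon as another coordinate is nonzero. -/
def kernelMajorant (w : ℝ) (n' r : ℕ) : ℝ := min 1 (w / (max 1 (min r (n' - r)) : ℕ))

theorem sum_kernelMajorant_sq_le {w : ℝ} (hw : 0 < w) (n' : ℕ) :
    ∑ r ∈ Finset.range n', kernelMajorant w n' r ^ 2 ≤ 9 * w := by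
  rcases Nat.eq_zero_or_pos n' with rfl | hn
  · simp; exact hw.le
  obtain ⟨m, rfl⟩ : ∃ m, n' = m + 1 := ⟨n' - 1, by omega⟩
  rw [Finset.sum_range_succ']
  have h0 : kernelMajorant w (m + 1) 0 ^ 2 ≤ w := by
    have e : kernelMajorant w (m + 1) 0 = min 1 w := by simp [kernelMajorant]
    rw [e]
    have h1 := min_le_left 1 w
    have h2 := min_le_right 1 w
    have h3 : 0 ≤ min 1 w := le_min zero_le_one hw.le
    nlinarith
  have h1 : ∀ r ∈ Finset.range m, kernelMajorant w (m + 1) (r + 1) ^ 2 ≤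
      (min 1 (w / ((r : ℝ) + 1))) ^ 2 + (min 1 (w / (((m - 1 - r : ℕ) : ℝ) + 1))) ^ 2 := by
    intro r hr
    rw [Finset.mem_range] at hr
    have hmm : kernelMajorant w (m + 1) (r + 1) = min 1 (w / ((r : ℝ) + 1)) ∨
        kernelMajorant w (m + 1) (r + 1) = min 1 (w / (((m - 1 - r : ℕ) : ℝ) + 1)) := by
      unfold kernelMajorant
      rcases le_total (r + 1) (m + 1 - (r + 1)) with h | h
      · left; rw [min_eq_left h, max_eq_right (by omega)]; push_cast; rfl
      · right
        rw [min_eq_right h, max_eq_right (by omega), show m + 1 - (r + 1) = m - 1 - r + 1 by omega]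
        push_cast; rfl
    rcases hmm with h | h <;> rw [h]
    · have : 0 ≤ (min 1 (w / (((m - 1 - r : ℕ) : ℝ) + 1))) ^ 2 := sq_nonneg _
      linarith
    · have : 0 ≤ (min 1 (w / ((r : ℝ) + 1))) ^ 2 := sq_nonneg _
      linarith
  have h2 := Finset.sum_le_sum h1
  rw [Finset.sum_add_distrib,
    Finset.sum_range_reflect (fun j : ℕ => (min 1 (w / ((j : ℝ) + 1))) ^ 2) m] at h2
  have h3 := sum_min_sq_le hw m
  linarith

/-- Pointwise bound of the filter at `2 ^ v z` by a product over the coordinates, if some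
coordinate of `z` is odd. The exponent `2 d` of the filter pays for the coordinates at which the
box kernel does not decay: the factor at the largest coordinate is shared among all. -/
theorem norm_filterG_two_pow_smul_le {b v : ℕ} (hb : Even b) (hb0 : 2 ≤ b) (hv : v < l)
    (z : Grid l d) (hz : ∃ s, 0 < (z s).val % 2 ^ (l - v)) :
    ‖filterG b (2 * d) ((2 : ZMod (2 ^ l)) ^ v • z)‖ ≤
      ∏ s, kernelMajorant ((2 : ℝ) ^ (l - v) / b) (2 ^ (l - v)) ((z s).val % 2 ^ (l - v)) ^ 2 := by
  obtain ⟨s0, hs0⟩ := hz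
  set n' := 2 ^ (l - v) with hn'
  set w : ℝ := (2 : ℝ) ^ (l - v) / b with hw
  have hb' : (0 : ℝ) < b := by exact_mod_cast (by omega : 0 < b)
  have hwpos : 0 < w := by positivity
  let μ : Fin d → ℕ := fun s => min ((z s).val % n') (n' - (z s).val % n')
  obtain ⟨t, -, ht⟩ := Finset.exists_max_image Finset.univ μ ⟨s0, Finset.mem_univ _⟩
  have hlt : ∀ s, (z s).val % n' < n' := fun s => Nat.mod_lt _ (by positivity)
  have hμ1 : 1 ≤ μ t := by
    refine le_trans ?_ (ht s0 (Finset.mem_univ _))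
    have := hlt s0
    exact le_min hs0 (by omega)
  have hμt : 0 < (z t).val % n' := by
    have : μ t ≤ (z t).val % n' := min_le_left _ _
    omega
  have hD1 := norm_boxKernel_two_pow_mul_le hb0 hv (z t) hμt
  have hD2 := norm_boxKernel_le_one hb hb0 ((2 : ZMod (2 ^ l)) ^ v * z t)
  set D := ‖boxKernel b ((2 : ZMod (2 ^ l)) ^ v * z t)‖ with hD
  have hDn : 0 ≤ D := norm_nonneg _
  have hstep : ∀ s, D ≤ kernelMajorant w n' ((z s).val % n') := by
    intro s
    refine le_min hD2 (hD1.trans ?_)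
    have hle : max 1 (μ s) ≤ μ t := max_le hμ1 (ht s (Finset.mem_univ _))
    apply div_le_div_of_nonneg_left hwpos.le
    · exact_mod_cast lt_of_lt_of_le one_pos (le_max_left _ _)
    · exact_mod_cast hle
  calc ‖filterG b (2 * d) ((2 : ZMod (2 ^ l)) ^ v • z)‖
      ≤ D ^ (2 * d) := by
        rw [filterG, norm_prod, ← Finset.mul_prod_erase _ _ (Finset.mem_univ t), filterH_eq,
          norm_pow, Pi.smul_apply, smul_eq_mul]
        refine mul_le_of_le_one_right (by positivity) ?_
        refine Finset.prod_le_one (fun _ _ => norm_nonneg _) fun s _ => ?_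
        rw [filterH_eq, norm_pow]
        exact pow_le_one₀ (norm_nonneg _) (norm_boxKernel_le_one hb hb0 _)
    _ = ∏ _s : Fin d, D ^ 2 := by simp [pow_mul]
    _ ≤ _ := by
        refine Finset.prod_le_prod (fun _ _ => by positivity) fun s _ => ?_
        exact pow_le_pow_left₀ hDn (hstep s) 2

theorem sum_range_mul_mod (f : ℕ → ℝ) (n' c : ℕ) :
    ∑ x ∈ Finset.range (n' * c), f (x % n') = c * ∑ r ∈ Finset.range n', f r := by
  induction c with
  | zero => simp
  | succ c ih =>
    rw [Nat.mul_succ, Finset.sum_range_add, ih]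
    have : ∀ x ∈ Finset.range n', f ((n' * c + x) % n') = f x := fun x hx => by
      rw [Nat.mul_add_mod, Nat.mod_eq_of_lt (Finset.mem_range.mp hx)]
    rw [Finset.sum_congr rfl this]; push_cast; ring

theorem sum_zmod_eq_sum_range (f : ℕ → ℝ) :
    ∑ z : ZMod (2 ^ l), f z.val = ∑ x ∈ Finset.range (2 ^ l), f x := by
  refine Finset.sum_bij (fun z _ => z.val) (fun z _ => Finset.mem_range.mpr (ZMod.val_lt z))
    (fun a _ b _ h => ZMod.val_injective _ h) (fun x hx => ?_) (fun _ _ => rfl)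
  exact ⟨(x : ZMod (2 ^ l)), Finset.mem_univ _, ZMod.val_cast_of_lt (Finset.mem_range.mp hx)⟩

/-- The filter sums to `N (9 / b) ^ d` over the points `2 ^ v z` with `z` nonzero modulo `2`. -/
theorem sum_norm_filterG_le {b v : ℕ} (hb : Even b) (hb0 : 2 ≤ b) (hv : v < l)
    (Z : Finset (Grid l d)) (hZ : ∀ z ∈ Z, ∃ s, Odd (z s).val) :
    ∑ z ∈ Z, ‖filterG b (2 * d) ((2 : ZMod (2 ^ l)) ^ v • z)‖ ≤ sigLen l d * (9 / b) ^ d := by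
  have hb' : (0 : ℝ) < b := by exact_mod_cast (by omega : 0 < b)
  set w : ℝ := (2 : ℝ) ^ (l - v) / b with hw
  have hwpos : 0 < w := by positivity
  have hev : 2 ∣ 2 ^ (l - v) := dvd_pow_self 2 (by omega)
  calc _ ≤ ∑ z ∈ Z, ∏ s, kernelMajorant w (2 ^ (l - v)) ((z s).val % 2 ^ (l - v)) ^ 2 := by
        refine Finset.sum_le_sum fun z hz => norm_filterG_two_pow_smul_le hb hb0 hv z ?_
        obtain ⟨s, hs⟩ := hZ z hz
        refine ⟨s, Nat.pos_of_ne_zero fun h0 => ?_⟩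
        have := (Nat.dvd_of_mod_eq_zero h0)
        have h2 := hev.trans this
        rw [Nat.odd_iff] at hs; omega
    _ ≤ ∑ z : Grid l d, ∏ s, kernelMajorant w (2 ^ (l - v)) ((z s).val % 2 ^ (l - v)) ^ 2 := by
        refine Finset.sum_le_sum_of_subset_of_nonneg (Finset.subset_univ _) fun z _ _ => ?_
        exact Finset.prod_nonneg fun _ _ => sq_nonneg _
    _ = (∑ z : ZMod (2 ^ l), kernelMajorant w (2 ^ (l - v)) (z.val % 2 ^ (l - v)) ^ 2) ^ d := by
        rw [← Fintype.piFinset_univ, ← Finset.prod_univ_sum (fun _ => Finset.univ)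
          (fun _ z => kernelMajorant w (2 ^ (l - v)) (ZMod.val z % 2 ^ (l - v)) ^ 2)]
        simp
    _ ≤ ((2 : ℝ) ^ l * (9 / b)) ^ d := by
        refine pow_le_pow_left₀ (Finset.sum_nonneg fun _ _ => sq_nonneg _) ?_ d
        rw [sum_zmod_eq_sum_range (fun x => kernelMajorant w (2 ^ (l - v)) (x % 2 ^ (l - v)) ^ 2)]
        have e : 2 ^ l = 2 ^ (l - v) * 2 ^ v := by rw [← pow_add]; congr 1; omega
        rw [e, sum_range_mul_mod (fun r => kernelMajorant w (2 ^ (l - v)) r ^ 2)]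
        have h := sum_kernelMajorant_sq_le hwpos (2 ^ (l - v))
        have e' : (2 : ℝ) ^ l = 2 ^ (l - v) * 2 ^ v := by exact_mod_cast e
        calc _ ≤ ((2 ^ v : ℕ) : ℝ) * (9 * w) := by gcongr
          _ = _ := by rw [e', hw]; push_cast; ring
    _ = _ := by rw [mul_pow, sigLen]

end filter

/-! ### Averages over the random matrix and the random shift -/

section averages

variable {l d : ℕ}

theorem isUnit_iff_odd_val (hl : 1 ≤ l) (z : ZMod (2 ^ l)) : IsUnit z ↔ Odd z.val := by
  conv_lhs => rw [← ZMod.natCast_zmod_val z]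
  rw [ZMod.isUnit_iff_coprime, Nat.coprime_pow_right_iff (by omega), Nat.coprime_two_right]

theorem odd_val_add_one_iff (hl : 1 ≤ l) (z : ZMod (2 ^ l)) : ¬ Odd z.val → Odd (z + 1).val := by
  intro h
  have h2 : 2 ∣ 2 ^ l := dvd_pow_self 2 (by omega)
  have h1 : (1 : ZMod (2 ^ l)).val = 1 := by
    rw [ZMod.val_one_eq_one_mod, Nat.mod_eq_of_lt]
    exact Nat.one_lt_two_pow (by omega)
  rw [Nat.odd_iff, ZMod.val_add, Nat.mod_mod_of_dvd _ h2, h1]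
  rw [Nat.odd_iff] at h
  omega

/-- Invertible matrices preserve the vectors with an odd coordinate. -/
theorem exists_odd_mulVec (hl : 1 ≤ l) (M : OddMatrix l d) (z : Grid l d)
    (hz : ∃ s, Odd (z s).val) : ∃ s, Odd ((M.1.mulVec z) s).val := by
  by_contra hcon
  push Not at hcon
  have hu : IsUnit M.1.det := (isUnit_iff_odd_val hl _).mpr M.2
  let red := ZMod.castHom (dvd_pow_self 2 (by omega : l ≠ 0)) (ZMod 2)
  have hred : ∀ y : ZMod (2 ^ l), red y = 0 ↔ ¬ Odd y.val := by
    intro y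
    have : red y = ((y.val : ℕ) : ZMod 2) := by
      conv_lhs => rw [← ZMod.natCast_zmod_val y]
      exact map_natCast red y.val
    rw [this, ZMod.natCast_eq_zero_iff, Nat.not_odd_iff_even, even_iff_two_dvd]
  obtain ⟨s, hs⟩ := hz
  have e : z = M.1⁻¹.mulVec (M.1.mulVec z) := by
    rw [Matrix.mulVec_mulVec, Matrix.nonsing_inv_mul _ hu, Matrix.one_mulVec]
  apply (not_not.mpr hs)
  rw [← hred, e, Matrix.mulVec, dotProduct, map_sum]
  refine Finset.sum_eq_zero fun t _ => ?_
  rw [map_mul, (hred _).mpr (hcon t), mul_zero]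

theorem mulVec_injective (hl : 1 ≤ l) (M : OddMatrix l d) : Function.Injective M.1.mulVec :=
  Matrix.mulVec_injective_of_isUnit ((Matrix.isUnit_iff_isUnit_det _).mpr
    ((isUnit_iff_odd_val hl _).mpr M.2))

/-- Half of the grid has an odd coordinate at a given place. -/
theorem sigLen_le_two_mul_card_odd (hl : 1 ≤ l) (s : Fin d) :
    sigLen l d ≤ 2 * ((Finset.univ.filter fun z : Grid l d => Odd (z s).val).card : ℝ) := by
  classical
  have h1 : (Finset.univ.filter fun z : Grid l d => ¬ Odd (z s).val).card ≤
      (Finset.univ.filter fun z : Grid l d => Odd (z s).val).card := by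
    refine Finset.card_le_card_of_injOn (fun z => z + Pi.single s 1) (fun z hz => ?_)
      (fun a _ b _ h => add_right_cancel h)
    simp only [Finset.coe_filter, Finset.mem_univ, true_and, Set.mem_ofPred_eq] at hz ⊢
    rw [Pi.add_apply, Pi.single_eq_same]
    exact odd_val_add_one_iff hl _ hz
  have h2 := Finset.card_filter_add_card_filter_not (s := (Finset.univ : Finset (Grid l d)))
    (fun z : Grid l d => Odd (z s).val)
  rw [Finset.card_univ, Fintype.card_pi] at h2
  simp only [ZMod.card, Finset.prod_const, Finset.card_univ, Fintype.card_fin] at h2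
  have h3 : ((2 ^ l) ^ d : ℕ) ≤ 2 * (Finset.univ.filter fun z : Grid l d => Odd (z s).val).card := by
    omega
  rw [sigLen]
  exact_mod_cast h3

/-- A matrix of odd determinant that moves `m` to `z`, if both are odd at the place `s`. -/
theorem exists_oddMatrix_mulVec_eq (hl : 1 ≤ l) (s : Fin d) (m z : Grid l d) (hm : Odd (m s).val)
    (hz : Odd (z s).val) : ∃ U : OddMatrix l d, U.1.mulVec m = z := by
  obtain ⟨u, hu⟩ := (isUnit_iff_odd_val hl _).mpr hm
  obtain ⟨u', hu'⟩ := (isUnit_iff_odd_val hl _).mpr hz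
  let c : Grid l d := fun t => (z t - m t + if t = s then m s else 0) * ((u⁻¹ : (ZMod (2 ^ l))ˣ) : ZMod (2 ^ l))
  -- The identity with column `s` replaced by `c`: its determinant is the unit `c s = z s / m s`.
  refine ⟨⟨(1 : Matrix (Fin d) (Fin d) (ZMod (2 ^ l))).updateCol s c, ?_⟩, ?_⟩
  · rw [← isUnit_iff_odd_val hl]
    have : ((1 : Matrix (Fin d) (Fin d) (ZMod (2 ^ l))).updateCol s c).det = c s := by
      rw [← Matrix.cramer_apply, Matrix.cramer_one]; simp
    rw [this]
    simp only [c, if_true, sub_add_cancel]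
    rw [← hu']
    exact (u' * u⁻¹).isUnit
  · change ((1 : Matrix (Fin d) (Fin d) (ZMod (2 ^ l))).updateCol s c).mulVec m = z
    funext t
    have hone : ∀ y, y ∈ Finset.univ.erase s →
        (1 : Matrix (Fin d) (Fin d) (ZMod (2 ^ l))).updateCol s c t y * m y =
        if t = y then m y else 0 := by
      intro y hy
      rw [Matrix.updateCol_ne (Finset.ne_of_mem_erase hy), Matrix.one_apply]
      split_ifs <;> simp
    rw [Matrix.mulVec, dotProduct, ← Finset.add_sum_erase _ _ (Finset.mem_univ s),
      Finset.sum_congr rfl hone, Finset.sum_ite_eq, Matrix.updateCol_self]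
    have hum : ((u⁻¹ : (ZMod (2 ^ l))ˣ) : ZMod (2 ^ l)) * m s = 1 := by rw [← hu]; simp
    have e : c t * m s = z t - m t + if t = s then m s else 0 := by
      simp only [c]; rw [mul_assoc, hum, mul_one]
    rw [e]
    by_cases hts : t = s
    · subst hts; simp
    · simp [hts]

theorem sum_oddMatrix_mul (hl : 1 ≤ l) (U : OddMatrix l d) (φ : Grid l d → ℝ) (m : Grid l d) :
    ∑ M : OddMatrix l d, φ (M.1.mulVec (U.1.mulVec m)) = ∑ M : OddMatrix l d, φ (M.1.mulVec m) := by
  have hU := (isUnit_iff_odd_val hl _).mpr U.2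
  let g : OddMatrix l d → OddMatrix l d := fun M => ⟨M.1 * U.1, by
    rw [← isUnit_iff_odd_val hl, Matrix.det_mul]
    exact ((isUnit_iff_odd_val hl _).mpr M.2).mul hU⟩
  have hg : Function.Injective g := by
    intro M M' h
    have h' : M.1 * U.1 = M'.1 * U.1 := congrArg Subtype.val h
    apply Subtype.ext
    calc M.1 = M.1 * U.1 * U.1⁻¹ := by rw [mul_assoc, Matrix.mul_nonsing_inv _ hU, mul_one]
      _ = M'.1 := by rw [h', mul_assoc, Matrix.mul_nonsing_inv _ hU, mul_one]
  rw [← (Finite.injective_iff_bijective.mp hg).sum_comp (fun M => φ (M.1.mulVec m))]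
  simp only [g, Matrix.mulVec_mulVec]

/-- The image of a vector with an odd coordinate under the random matrix is, up to a factor `2`,
dominated by the uniform distribution on the vectors with an odd coordinate. The random matrix is
multiplied on the right by matrices which carry `m` to all vectors that are odd at the place `s`. -/
theorem sum_oddMatrix_le (hl : 1 ≤ l) (φ : Grid l d → ℝ) (hφ : ∀ y, 0 ≤ φ y) (m : Grid l d)
    (s : Fin d) (hm : Odd (m s).val) :
    sigLen l d * ∑ M : OddMatrix l d, φ (M.1.mulVec m) ≤
      2 * (Fintype.card (OddMatrix l d) *
        ∑ y ∈ Finset.univ.filter (fun z : Grid l d => ∃ s, Odd (z s).val), φ y) := by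
  classical
  set Z := Finset.univ.filter fun z : Grid l d => Odd (z s).val with hZ
  set Y := Finset.univ.filter fun z : Grid l d => ∃ s, Odd (z s).val with hY
  have h0 : 0 ≤ ∑ M : OddMatrix l d, φ (M.1.mulVec m) := Finset.sum_nonneg fun _ _ => hφ _
  have h1 : ∀ z ∈ Z, ∑ M : OddMatrix l d, φ (M.1.mulVec m) =
      ∑ M : OddMatrix l d, φ (M.1.mulVec z) := by
    intro z hz
    obtain ⟨U, rfl⟩ := exists_oddMatrix_mulVec_eq hl s m z hm (Finset.mem_filter.mp hz).2
    exact (sum_oddMatrix_mul hl U φ m).symm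
  have h2 : (Z.card : ℝ) * ∑ M : OddMatrix l d, φ (M.1.mulVec m) =
      ∑ M : OddMatrix l d, ∑ z ∈ Z, φ (M.1.mulVec z) := by
    rw [Finset.sum_comm, ← Finset.sum_congr rfl h1, Finset.sum_const, nsmul_eq_mul]
  have h3 : ∀ M : OddMatrix l d, ∑ z ∈ Z, φ (M.1.mulVec z) ≤ ∑ y ∈ Y, φ y := by
    intro M
    rw [← Finset.sum_image (f := φ) (s := Z) (g := M.1.mulVec)
      fun a _ b _ h => mulVec_injective hl M h]
    refine Finset.sum_le_sum_of_subset_of_nonneg (fun y hy => ?_) fun _ _ _ => hφ _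
    obtain ⟨z, hz, rfl⟩ := Finset.mem_image.mp hy
    exact Finset.mem_filter.mpr ⟨Finset.mem_univ _,
      exists_odd_mulVec hl M z ⟨s, (Finset.mem_filter.mp hz).2⟩⟩
  have h4 : ∑ M : OddMatrix l d, ∑ z ∈ Z, φ (M.1.mulVec z) ≤
      Fintype.card (OddMatrix l d) * ∑ y ∈ Y, φ y := by
    refine (Finset.sum_le_sum fun M _ => h3 M).trans ?_
    rw [Finset.sum_const, nsmul_eq_mul, Finset.card_univ]
  calc _ ≤ 2 * (Z.card : ℝ) * ∑ M : OddMatrix l d, φ (M.1.mulVec m) :=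
        mul_le_mul_of_nonneg_right (sigLen_le_two_mul_card_odd hl s) h0
    _ = 2 * ((Z.card : ℝ) * ∑ M : OddMatrix l d, φ (M.1.mulVec m)) := by ring
    _ ≤ _ := by rw [h2]; linarith

/-- A nonzero grid point is a power of two times a point with an odd coordinate. -/
theorem exists_eq_two_pow_smul (m : Grid l d) (hm : m ≠ 0) :
    ∃ v < l, ∃ z : Grid l d, (∃ s, Odd (z s).val) ∧ m = (2 : ZMod (2 ^ l)) ^ v • z := by
  classical
  let P : ℕ → Prop := fun v => ∀ s, 2 ^ v ∣ (m s).val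
  have hP0 : P 0 := fun s => by simp
  have hPl : ¬ P l := by
    intro h
    apply hm
    funext s
    exact (ZMod.val_eq_zero _).mp (Nat.eq_zero_of_dvd_of_lt (h s) (ZMod.val_lt _))
  obtain ⟨v, hvl, hv, hv'⟩ : ∃ v < l, P v ∧ ¬ P (v + 1) := by
    by_contra hcon
    push Not at hcon
    have : ∀ v ≤ l, P v := by
      intro v
      induction v with
      | zero => exact fun _ => hP0
      | succ v ih => exact fun hv => hcon v (by omega) (ih (by omega))
    exact hPl (this l le_rfl)
  have hval : ∀ s, (((m s).val / 2 ^ v : ℕ) : ZMod (2 ^ l)).val = (m s).val / 2 ^ v := fun s =>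
    ZMod.val_cast_of_lt (lt_of_le_of_lt (Nat.div_le_self _ _) (ZMod.val_lt _))
  refine ⟨v, hvl, fun s => (((m s).val / 2 ^ v : ℕ) : ZMod (2 ^ l)), ?_, ?_⟩
  · simp only [P, not_forall] at hv'
    obtain ⟨s, hs⟩ := hv'
    refine ⟨s, ?_⟩
    rw [hval, ← Nat.not_even_iff_odd, even_iff_two_dvd]
    intro h
    apply hs
    rw [pow_succ]
    exact (Nat.dvd_div_iff_mul_dvd (hv s)).mp h
  · funext s
    rw [Pi.smul_apply, smul_eq_mul]
    have : ((2 ^ v * ((m s).val / 2 ^ v) : ℕ) : ZMod (2 ^ l)) = m s := by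
      rw [Nat.mul_div_cancel' (hv s), ZMod.natCast_zmod_val]
    push_cast at this
    exact this.symm

/-- The mean of the filter at the image of a nonzero point under the random matrix. -/
theorem sum_oddMatrix_filterG_le (hl : 1 ≤ l) {b : ℕ} (hb : Even b) (hb0 : 2 ≤ b) (m : Grid l d)
    (hm : m ≠ 0) :
    ∑ M : OddMatrix l d, ‖filterG b (2 * d) (M.1.mulVec m)‖ ≤
      Fintype.card (OddMatrix l d) * (2 * (9 / b) ^ d) := by
  -- The power of two commutes with the random matrix, and the cofactor moves to a nearly uniform
  -- point among those with an odd coordinate.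
  obtain ⟨v, hv, z, ⟨s, hs⟩, rfl⟩ := exists_eq_two_pow_smul m hm
  have h1 := sum_oddMatrix_le hl
    (fun y : Grid l d => ‖filterG b (2 * d) ((2 : ZMod (2 ^ l)) ^ v • y)‖)
    (fun _ => norm_nonneg _) z s hs
  have h2 := sum_norm_filterG_le hb hb0 hv
    (Finset.univ.filter fun z : Grid l d => ∃ s, Odd (z s).val)
    fun z hz => (Finset.mem_filter.mp hz).2
  simp only [Matrix.mulVec_smul]
  have hN := sigLen_pos (l := l) (d := d)
  have hc : (0 : ℝ) ≤ Fintype.card (OddMatrix l d) := Nat.cast_nonneg _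
  have h3 := mul_le_mul_of_nonneg_left h2 hc
  refine le_of_mul_le_mul_left ?_ hN
  calc _ ≤ _ := h1
    _ ≤ 2 * (Fintype.card (OddMatrix l d) * (sigLen l d * (9 / b) ^ d)) := by linarith
    _ = _ := by ring

/-- Averaging over `a` makes distinct terms orthogonal. -/
theorem sum_norm_sq_sum_om (T : Finset (Grid l d)) (c : Grid l d → ℂ) (ψ : Grid l d → Grid l d)
    (hψ : Function.Injective ψ) :
    ∑ a : Grid l d, ‖∑ m ∈ T, c m * om (a ⬝ᵥ ψ m)‖ ^ 2 = sigLen l d * ∑ m ∈ T, ‖c m‖ ^ 2 := by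
  have key : ∑ a : Grid l d, (∑ m ∈ T, c m * om (a ⬝ᵥ ψ m)) *
      (starRingEnd ℂ) (∑ m ∈ T, c m * om (a ⬝ᵥ ψ m)) =
      (sigLen l d : ℂ) * ∑ m ∈ T, c m * (starRingEnd ℂ) (c m) := by
    have e : ∀ a : Grid l d, (∑ m ∈ T, c m * om (a ⬝ᵥ ψ m)) *
        (starRingEnd ℂ) (∑ m ∈ T, c m * om (a ⬝ᵥ ψ m)) =
        ∑ m ∈ T, ∑ m' ∈ T, c m * (starRingEnd ℂ) (c m') * om (a ⬝ᵥ (ψ m - ψ m')) := by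
      intro a
      rw [map_sum, Finset.sum_mul_sum]
      refine Finset.sum_congr rfl fun m _ => Finset.sum_congr rfl fun m' _ => ?_
      rw [map_mul, star_om, dotProduct_sub, sub_eq_add_neg, om_add]; ring
    simp only [e]
    rw [Finset.sum_comm, Finset.mul_sum]
    refine Finset.sum_congr rfl fun m hm => ?_
    rw [Finset.sum_comm]
    have e2 : ∀ m' ∈ T, ∑ a : Grid l d, c m * (starRingEnd ℂ) (c m') * om (a ⬝ᵥ (ψ m - ψ m')) =
        if m = m' then c m * (starRingEnd ℂ) (c m') * (sigLen l d : ℂ) else 0 := by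
      intro m' _
      rw [← Finset.mul_sum, sum_om_dotProduct]
      by_cases h : m = m'
      · rw [if_pos h, if_pos (by rw [h, sub_self])]
      · rw [if_neg h, if_neg (fun h0 => h (hψ (sub_eq_zero.mp h0))), mul_zero]
    rw [Finset.sum_congr rfl e2, Finset.sum_ite_eq, if_pos hm]; ring
  simp only [Complex.mul_conj, Complex.normSq_eq_norm_sq] at key
  exact_mod_cast key

end averages

/-! ### The probability that one hash is bad for a given coordinate -/

section badDraw

variable {l d : ℕ}

/-- The total weight with which the other coordinates of the head `S` enter the estimate at `f`. -/
def Draw.headWeight (h : Draw l d) (b F : ℕ) (S : Finset (Grid l d)) (f : Grid l d) : ℝ :=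
  ∑ m ∈ S.erase f, ‖filterG b F (h.mat.mulVec (f - m))‖

/-- The contribution of the tail, that is of the coordinates of `x` outside `S`, to the estimate
at `f`. -/
def Draw.tailNoise (h : Draw l d) (b F : ℕ) (S : Finset (Grid l d)) (x : Signal l d)
    (f : Grid l d) : ℂ :=
  ∑ m ∈ Sᶜ.erase f, x m * filterG b F (h.mat.mulVec (f - m)) * om (h.a ⬝ᵥ h.mat.mulVec (m - f))

theorem sum_draw (φ : OddMatrix l d → Grid l d → ℝ) :
    ∑ h : Draw l d, φ h.1 h.a =
      ∑ M : OddMatrix l d, ∑ a : Grid l d, Fintype.card (Grid l d) * φ M a := by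
  simp only [Draw.a]
  rw [Fintype.sum_prod_type]
  refine Finset.sum_congr rfl fun M _ => ?_
  rw [Fintype.sum_prod_type]
  refine Finset.sum_congr rfl fun a _ => ?_
  simp

theorem card_grid : (Fintype.card (Grid l d) : ℝ) = sigLen l d := by
  rw [Fintype.card_pi]
  simp [sigLen]

theorem card_draw : (Fintype.card (Draw l d) : ℝ) =
    Fintype.card (OddMatrix l d) * (sigLen l d * sigLen l d) := by
  simp only [Fintype.card_prod, Nat.cast_mul, card_grid]

theorem sum_headWeight_le (hl : 1 ≤ l) {b : ℕ} (hb : Even b) (hb0 : 2 ≤ b)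
    (S : Finset (Grid l d)) (f : Grid l d) :
    ∑ h : Draw l d, h.headWeight b (2 * d) S f ≤
      Fintype.card (Draw l d) * (2 * (9 / b) ^ d * S.card) := by
  have e := sum_draw (l := l) (d := d)
    (fun M _ => ∑ m ∈ S.erase f, ‖filterG b (2 * d) (M.1.mulVec (f - m))‖)
  have e' : ∑ h : Draw l d, h.headWeight b (2 * d) S f =
      ∑ h : Draw l d, ∑ m ∈ S.erase f, ‖filterG b (2 * d) (h.1.1.mulVec (f - m))‖ := rfl
  rw [e', e]
  simp only [Finset.sum_const, Finset.card_univ, nsmul_eq_mul, card_grid]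
  rw [← Finset.mul_sum, ← Finset.mul_sum, Finset.sum_comm, card_draw]
  have h1 : ∀ m ∈ S.erase f, ∑ M : OddMatrix l d, ‖filterG b (2 * d) (M.1.mulVec (f - m))‖ ≤
      Fintype.card (OddMatrix l d) * (2 * (9 / b) ^ d) := fun m hm =>
    sum_oddMatrix_filterG_le hl hb hb0 _ (sub_ne_zero.mpr (Finset.ne_of_mem_erase hm).symm)
  have h2 := Finset.sum_le_sum h1
  rw [Finset.sum_const, nsmul_eq_mul] at h2
  have h3 : ((S.erase f).card : ℝ) ≤ S.card := by exact_mod_cast Finset.card_erase_le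
  have hN := (sigLen_pos (l := l) (d := d)).le
  calc _ ≤ sigLen l d * (sigLen l d *
        ((S.erase f).card * (Fintype.card (OddMatrix l d) * (2 * (9 / b) ^ d)))) := by gcongr
    _ ≤ sigLen l d * (sigLen l d *
        (S.card * (Fintype.card (OddMatrix l d) * (2 * (9 / b) ^ d)))) := by gcongr
    _ = _ := by ring

/-- The phases in `a` are orthogonal, so the mean square of the tail noise is diagonal; as `‖G‖ ≤ 1`,
the mean of `‖G‖ ^ 2` is at most that of `‖G‖`. -/
theorem sum_tailNoise_sq_le (hl : 1 ≤ l) {b : ℕ} (hb : Even b) (hb0 : 2 ≤ b)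
    (S : Finset (Grid l d)) (x : Signal l d) (f : Grid l d) :
    ∑ h : Draw l d, ‖h.tailNoise b (2 * d) S x f‖ ^ 2 ≤
      Fintype.card (Draw l d) * (2 * (9 / b) ^ d * ∑ m ∈ Sᶜ, ‖x m‖ ^ 2) := by
  have e := sum_draw (l := l) (d := d)
    (fun M a => ‖∑ m ∈ Sᶜ.erase f, x m * filterG b (2 * d) (M.1.mulVec (f - m)) *
      om (a ⬝ᵥ M.1.mulVec (m - f))‖ ^ 2)
  have e' : ∑ h : Draw l d, ‖h.tailNoise b (2 * d) S x f‖ ^ 2 =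
      ∑ h : Draw l d, ‖∑ m ∈ Sᶜ.erase f, x m * filterG b (2 * d) (h.1.1.mulVec (f - m)) *
      om (h.a ⬝ᵥ h.1.1.mulVec (m - f))‖ ^ 2 := rfl
  rw [e', e]
  have hin : ∀ M : OddMatrix l d, Function.Injective fun m : Grid l d => M.1.mulVec (m - f) :=
    fun M a b h => sub_left_injective (mulVec_injective hl M h)
  have e2 : ∀ M : OddMatrix l d, ∑ a : Grid l d, ‖∑ m ∈ Sᶜ.erase f,
      x m * filterG b (2 * d) (M.1.mulVec (f - m)) * om (a ⬝ᵥ M.1.mulVec (m - f))‖ ^ 2 =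
      sigLen l d * ∑ m ∈ Sᶜ.erase f, ‖x m * filterG b (2 * d) (M.1.mulVec (f - m))‖ ^ 2 := fun M =>
    sum_norm_sq_sum_om _ _ (fun m => M.1.mulVec (m - f)) (hin M)
  simp only [← Finset.mul_sum, e2, card_grid]
  rw [Finset.sum_comm, card_draw]
  have h1 : ∀ m ∈ Sᶜ.erase f,
      ∑ M : OddMatrix l d, ‖x m * filterG b (2 * d) (M.1.mulVec (f - m))‖ ^ 2 ≤
      ‖x m‖ ^ 2 * (Fintype.card (OddMatrix l d) * (2 * (9 / b) ^ d)) := by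
    intro m hm
    have h2 := sum_oddMatrix_filterG_le hl hb hb0 (f - m)
      (sub_ne_zero.mpr (Finset.ne_of_mem_erase hm).symm)
    refine le_trans ?_ (mul_le_mul_of_nonneg_left h2 (sq_nonneg _))
    rw [Finset.mul_sum]
    refine Finset.sum_le_sum fun M _ => ?_
    rw [norm_mul, mul_pow]
    refine mul_le_mul_of_nonneg_left ?_ (sq_nonneg _)
    have h3 := norm_filterG_le_one (F := 2 * d) hb hb0 (M.1.mulVec (f - m))
    have h4 := norm_nonneg (filterG b (2 * d) (M.1.mulVec (f - m)))
    nlinarith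
  have h2 := Finset.sum_le_sum h1
  rw [← Finset.sum_mul] at h2
  have h3 : ∑ m ∈ Sᶜ.erase f, ‖x m‖ ^ 2 ≤ ∑ m ∈ Sᶜ, ‖x m‖ ^ 2 :=
    Finset.sum_le_sum_of_subset_of_nonneg (Finset.erase_subset _ _) fun _ _ _ => sq_nonneg _
  have hN := (sigLen_pos (l := l) (d := d)).le
  calc _ ≤ sigLen l d * (sigLen l d * ((∑ m ∈ Sᶜ.erase f, ‖x m‖ ^ 2) *
        (Fintype.card (OddMatrix l d) * (2 * (9 / b) ^ d)))) := by gcongr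
    _ ≤ sigLen l d * (sigLen l d * ((∑ m ∈ Sᶜ, ‖x m‖ ^ 2) *
        (Fintype.card (OddMatrix l d) * (2 * (9 / b) ^ d)))) := by gcongr
    _ = _ := by ring

/-- The draw is bad for `f`: the head weight exceeds `1 / 32`, or the tail noise `ρ / 32`. -/
def Draw.Bad (h : Draw l d) (b F : ℕ) (S : Finset (Grid l d)) (x : Signal l d) (ρ : ℝ)
    (f : Grid l d) : Prop :=
  1 / 32 < h.headWeight b F S f ∨ ρ / 32 < ‖h.tailNoise b F S x f‖

/-- Markov's inequality for the head weight and Chebyshev's for the tail noise. -/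
theorem card_bad_le (hl : 1 ≤ l) {b : ℕ} (hb : Even b) (hb0 : 2 ≤ b)
    (S : Finset (Grid l d)) (x : Signal l d) {ρ : ℝ} (hρ : 0 < ρ) (f : Grid l d)
    [DecidablePred fun h : Draw l d => h.Bad b (2 * d) S x ρ f] :
    ((Finset.univ.filter fun h : Draw l d => h.Bad b (2 * d) S x ρ f).card : ℝ) ≤
      Fintype.card (Draw l d) *
        (2 * (9 / b) ^ d * (32 * S.card + 1024 / ρ ^ 2 * ∑ m ∈ Sᶜ, ‖x m‖ ^ 2)) := by
  have h1 := sum_headWeight_le hl hb hb0 S f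
  have h2 := sum_tailNoise_sq_le hl hb hb0 S x f
  have h3 : ∀ h : Draw l d, (if h.Bad b (2 * d) S x ρ f then (1 : ℝ) else 0) ≤
      32 * h.headWeight b (2 * d) S f + 1024 / ρ ^ 2 * ‖h.tailNoise b (2 * d) S x f‖ ^ 2 := by
    intro h
    have p1 : 0 ≤ h.headWeight b (2 * d) S f := Finset.sum_nonneg fun _ _ => norm_nonneg _
    have p2 : 0 ≤ 1024 / ρ ^ 2 * ‖h.tailNoise b (2 * d) S x f‖ ^ 2 := by positivity
    split_ifs with hbad
    · rcases hbad with hh | hh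
      · linarith
      · have : (ρ / 32) ^ 2 ≤ ‖h.tailNoise b (2 * d) S x f‖ ^ 2 :=
          pow_le_pow_left₀ (by positivity) hh.le 2
        have h4 : 1024 / ρ ^ 2 * (ρ / 32) ^ 2 ≤
            1024 / ρ ^ 2 * ‖h.tailNoise b (2 * d) S x f‖ ^ 2 := by gcongr
        have h5 : 1024 / ρ ^ 2 * (ρ / 32) ^ 2 = 1 := by field_simp; norm_num
        linarith
    · linarith
  have h4 := Finset.sum_le_sum fun h (_ : h ∈ (Finset.univ : Finset (Draw l d))) => h3 h
  rw [Finset.sum_boole, Finset.sum_add_distrib, ← Finset.mul_sum, ← Finset.mul_sum] at h4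
  have h5 : 0 ≤ 1024 / ρ ^ 2 := by positivity
  have h6 := mul_le_mul_of_nonneg_left h2 h5
  refine h4.trans ?_
  calc _ ≤ 32 * (Fintype.card (Draw l d) * (2 * (9 / b) ^ d * S.card)) + 1024 / ρ ^ 2 *
        (Fintype.card (Draw l d) * (2 * (9 / b) ^ d * ∑ m ∈ Sᶜ, ‖x m‖ ^ 2)) := by linarith
    _ = _ := by ring

end badDraw

/-! ### Medians -/

section median

theorem getElem_le_of_lt_countP {L : List ℝ} (hL : L.Pairwise (· ≤ ·)) {p : ℕ} (hp : p < L.length)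
    {v : ℝ} (h : p < L.countP (fun a => decide (a ≤ v))) : L[p] ≤ v := by
  by_contra hcon
  push Not at hcon
  have h1 : (L.drop p).countP (fun a => decide (a ≤ v)) = 0 := by
    rw [List.countP_eq_zero]
    intro a ha
    obtain ⟨i, hi, rfl⟩ := List.mem_iff_getElem.mp ha
    rw [List.getElem_drop]
    simp only [decide_eq_true_eq, not_le]
    refine lt_of_lt_of_le hcon ?_
    rcases Nat.eq_zero_or_pos i with rfl | hi0
    · exact le_of_eq (by simp)
    · exact List.pairwise_iff_getElem.mp hL p (p + i) hp (by simp at hi; omega) (by omega)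
  have h2 : L.countP (fun a => decide (a ≤ v)) ≤ p := by
    conv_lhs => rw [← List.take_append_drop p L]
    rw [List.countP_append, h1, add_zero]
    exact (List.countP_le_length).trans (by simp)
  omega

theorem le_getElem_of_countP_le {L : List ℝ} (hL : L.Pairwise (· ≤ ·)) {p : ℕ} (hp : p < L.length)
    {v : ℝ} (h : L.countP (fun a => decide (a < v)) ≤ p) : v ≤ L[p] := by
  by_contra hcon
  push Not at hcon
  have h1 : (L.take (p + 1)).countP (fun a => decide (a < v)) = (L.take (p + 1)).length := by
    rw [List.countP_eq_length]
    intro a ha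
    obtain ⟨i, hi, rfl⟩ := List.mem_iff_getElem.mp ha
    rw [List.getElem_take]
    simp only [decide_eq_true_eq]
    refine lt_of_le_of_lt ?_ hcon
    have hip : i ≤ p := by simp at hi; omega
    rcases Nat.eq_or_lt_of_le hip with rfl | hi0
    · exact le_rfl
    · exact List.pairwise_iff_getElem.mp hL i p (by omega) hp hi0
  have h2 : p + 1 ≤ L.countP (fun a => decide (a < v)) := by
    conv_rhs => rw [← List.take_append_drop (p + 1) L]
    rw [List.countP_append, h1]
    simp; omega
  omega

variable {r : ℕ}

theorem countP_sort_map (s : Fin r → ℝ) (P : ℝ → Prop) [DecidablePred P] :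
    ((Finset.univ.val.map s).sort (· ≤ ·)).countP (fun a => decide (P a)) =
      (Finset.univ.filter fun i => P (s i)).card := by
  rw [← Multiset.coe_countP, Multiset.sort_eq, Multiset.countP_map]
  rfl

theorem median_le {s : Fin r → ℝ} {v : ℝ}
    (h : r / 2 < (Finset.univ.filter fun i => s i ≤ v).card) : median s ≤ v := by
  have hr : 0 < r := by
    rcases Nat.eq_zero_or_pos r with rfl | h0
    · simp at h
    · exact h0
  have hlen : ((Finset.univ.val.map s).sort (· ≤ ·)).length = r := by simp
  rw [median, List.getD_eq_getElem _ _ (by rw [hlen]; omega)]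
  apply getElem_le_of_lt_countP (Multiset.pairwise_sort _ _)
  rw [countP_sort_map]; exact h

theorem le_median (hr : 0 < r) {s : Fin r → ℝ} {v : ℝ}
    (h : (Finset.univ.filter fun i => s i < v).card ≤ r / 2) : v ≤ median s := by
  have hlen : ((Finset.univ.val.map s).sort (· ≤ ·)).length = r := by simp
  rw [median, List.getD_eq_getElem _ _ (by rw [hlen]; omega)]
  apply le_getElem_of_countP_le (Multiset.pairwise_sort _ _)
  rw [countP_sort_map]; exact h

/-- Rank characterization of the median, in the form in which the machine searches for it. -/
theorem median_eq_iff (hr : 0 < r) {s : Fin r → ℝ} {v : ℝ} :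
    median s = v ↔ (Finset.univ.filter fun i => s i < v).card ≤ r / 2 ∧
      r / 2 < (Finset.univ.filter fun i => s i ≤ v).card := by
  constructor
  · rintro rfl
    constructor
    · by_contra hcon
      push Not at hcon
      -- the largest entry below the median would bound the median
      have hne : (Finset.univ.filter fun i => s i < median s).Nonempty :=
        Finset.card_pos.mp (by omega)
      obtain ⟨j, hj, hmax⟩ := Finset.exists_max_image _ s hne
      have h1 : median s ≤ s j := by
        apply median_le
        refine lt_of_lt_of_le hcon (Finset.card_le_card fun i hi => ?_)
        exact Finset.mem_filter.mpr ⟨Finset.mem_univ _, hmax i hi⟩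
      exact absurd (Finset.mem_filter.mp hj).2 (not_lt.mpr h1)
    · by_contra hcon
      push Not at hcon
      have hne : (Finset.univ.filter fun i => ¬ s i ≤ median s).Nonempty := by
        rw [← Finset.card_pos]
        have := Finset.card_filter_add_card_filter_not (s := (Finset.univ : Finset (Fin r)))
          (fun i => s i ≤ median s)
        rw [Finset.card_univ, Fintype.card_fin] at this
        omega
      obtain ⟨j, hj, hmin⟩ := Finset.exists_min_image _ s hne
      have h1 : s j ≤ median s := by
        apply le_median hr
        refine le_trans (Finset.card_le_card fun i hi => ?_) hcon
        refine Finset.mem_filter.mpr ⟨Finset.mem_univ _, ?_⟩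
        by_contra hi'
        exact absurd (Finset.mem_filter.mp hi).2
          (not_lt.mpr (hmin i (Finset.mem_filter.mpr ⟨Finset.mem_univ _, hi'⟩)))
      exact (Finset.mem_filter.mp hj).2 h1
  · rintro ⟨h1, h2⟩
    exact le_antisymm (median_le h2) (le_median hr h1)

theorem median_mem (hr : 0 < r) (s : Fin r → ℝ) : ∃ i, s i = median s := by
  by_contra hcon
  push Not at hcon
  obtain ⟨h1, h2⟩ := (median_eq_iff hr (s := s)).mp rfl
  have : (Finset.univ.filter fun i => s i ≤ median s) =
      Finset.univ.filter fun i => s i < median s :=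
    Finset.filter_congr fun i _ => ⟨fun h => lt_of_le_of_ne h (hcon i), le_of_lt⟩
  rw [this] at h2
  omega

/-- If more than half of the entries are within `δ` of `c`, so is the median. -/
theorem abs_median_sub_le {s : Fin r → ℝ} {c δ : ℝ} {bad : Finset (Fin r)}
    (hbad : 2 * bad.card < r) (h : ∀ i ∉ bad, |s i - c| ≤ δ) : |median s - c| ≤ δ := by
  have hr : 0 < r := by omega
  have hc : bad.card + badᶜ.card = r := by rw [Finset.card_add_card_compl, Fintype.card_fin]
  rw [abs_le]
  constructor
  · have : c - δ ≤ median s := by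
      apply le_median hr
      have : (Finset.univ.filter fun i => s i < c - δ).card ≤ bad.card := by
        refine Finset.card_le_card fun i hi => ?_
        by_contra hib
        have h1 := (abs_le.mp (h i hib)).1
        have h2 := (Finset.mem_filter.mp hi).2
        linarith
      omega
    linarith
  · have : median s ≤ c + δ := by
      apply median_le
      have : badᶜ.card ≤ (Finset.univ.filter fun i => s i ≤ c + δ).card := by
        refine Finset.card_le_card fun i hi => ?_
        have h1 := (abs_le.mp (h i (Finset.mem_compl.mp hi))).2
        exact Finset.mem_filter.mpr ⟨Finset.mem_univ _, by linarith⟩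
      omega
    linarith

/-- The medians of the real and of the imaginary parts are each within `δ`, hence the factor `2`. -/
theorem norm_medianC_sub_le {s : Fin r → ℂ} {c : ℂ} {δ : ℝ} {bad : Finset (Fin r)}
    (hbad : 2 * bad.card < r) (h : ∀ i ∉ bad, ‖s i - c‖ ≤ δ) : ‖medianC s - c‖ ≤ 2 * δ := by
  have h1 : |(medianC s - c).re| ≤ δ := by
    rw [Complex.sub_re]
    refine abs_median_sub_le hbad fun i hi => ?_
    rw [← Complex.sub_re]
    exact (Complex.abs_re_le_norm _).trans (h i hi)
  have h2 : |(medianC s - c).im| ≤ δ := by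
    rw [Complex.sub_im]
    refine abs_median_sub_le hbad fun i hi => ?_
    rw [← Complex.sub_im]
    exact (Complex.abs_im_le_norm _).trans (h i hi)
  have := Complex.norm_le_abs_re_add_abs_im (medianC s - c)
  linarith

end median

/-! ### Many hashes: a Chernoff bound -/

section chernoff

/-- If one draw is bad with probability at most `1 / 64`, then at least half of `r` draws are bad with
probability at most `4 ^ (-r)`. Give each bad draw the weight `64`: the mean weight of a draw is at
most `2`, and half of the draws bad means a total weight of at least `8 ^ r`. -/
theorem card_half_bad_le {Ω : Type} [Fintype Ω] (B : Ω → Prop) [DecidablePred B]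
    (hB : 64 * ((Finset.univ.filter B).card : ℝ) ≤ Fintype.card Ω) (r : ℕ) :
    ((Finset.univ.filter fun ρ : Fin r → Ω =>
      r ≤ 2 * (Finset.univ.filter fun i => B (ρ i)).card).card : ℝ) * 4 ^ r ≤
      (Fintype.card Ω : ℝ) ^ r := by
  have hpt : ∀ ρ : Fin r → Ω,
      (if r ≤ 2 * (Finset.univ.filter fun i => B (ρ i)).card then (8 : ℝ) ^ r else 0) ≤
      ∏ i, (if B (ρ i) then (64 : ℝ) else 1) := by
    intro ρ
    have e : ∏ i, (if B (ρ i) then (64 : ℝ) else 1) =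
        8 ^ (2 * (Finset.univ.filter fun i => B (ρ i)).card) := by
      rw [Finset.prod_ite, Finset.prod_const, Finset.prod_const_one, mul_one, pow_mul]; norm_num
    rw [e]
    split_ifs with h
    · exact pow_le_pow_right₀ (by norm_num) h
    · positivity
  have hsum := Finset.sum_le_sum fun ρ (_ : ρ ∈ (Finset.univ : Finset (Fin r → Ω))) => hpt ρ
  have e2 : ∑ ρ : Fin r → Ω, ∏ i, (if B (ρ i) then (64 : ℝ) else 1) =
      (∑ ω : Ω, (if B ω then (64 : ℝ) else 1)) ^ r := by
    rw [← Fintype.piFinset_univ, ← Finset.prod_univ_sum (fun _ => Finset.univ)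
      (fun _ ω => if B ω then (64 : ℝ) else 1)]
    simp
  have e3 : ∑ ω : Ω, (if B ω then (64 : ℝ) else 1) ≤ 2 * Fintype.card Ω := by
    have : ∀ ω : Ω, (if B ω then (64 : ℝ) else 1) = 1 + 63 * (if B ω then (1 : ℝ) else 0) := by
      intro ω; split_ifs <;> norm_num
    simp only [this]
    rw [Finset.sum_add_distrib, ← Finset.mul_sum, Finset.sum_boole]
    simp only [Finset.sum_const, Finset.card_univ, nsmul_eq_mul, mul_one]
    have : (0 : ℝ) ≤ ((Finset.univ.filter B).card : ℝ) := Nat.cast_nonneg _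
    linarith
  have e4 : 0 ≤ ∑ ω : Ω, (if B ω then (64 : ℝ) else 1) :=
    Finset.sum_nonneg fun ω _ => by split_ifs <;> norm_num
  rw [e2, ← Finset.sum_filter, Finset.sum_const, nsmul_eq_mul] at hsum
  have h5 := hsum.trans (pow_le_pow_left₀ e4 e3 r)
  rw [mul_pow] at h5
  have e8 : (8 : ℝ) ^ r = 4 ^ r * 2 ^ r := by rw [← mul_pow]; norm_num
  rw [e8, ← mul_assoc, mul_comm ((2 : ℝ) ^ r)] at h5
  exact le_of_mul_le_mul_right h5 (by positivity)

end chernoff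

/-! ### Sparse approximation and norms -/

section norms

variable {l d : ℕ}

theorem l2norm_sq (x : Signal l d) : l2norm x ^ 2 = ∑ i, ‖x i‖ ^ 2 := by
  rw [l2norm, EuclideanSpace.norm_sq_eq]

theorem l2norm_nonneg (x : Signal l d) : 0 ≤ l2norm x := norm_nonneg _

theorem sparse_zero (k : ℕ) : (Function.support (0 : Signal l d)).ncard ≤ k := by
  rw [Function.support_zero, Set.ncard_empty]; exact Nat.zero_le _

theorem bddBelow_errK (k : ℕ) (x : Signal l d) : BddBelow (Set.range
    fun y : {y : Signal l d // (Function.support y).ncard ≤ k} => l2norm (x - y.1)) :=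
  ⟨0, by rintro _ ⟨y, rfl⟩; exact norm_nonneg _⟩

theorem errK_nonneg (k : ℕ) (x : Signal l d) : 0 ≤ errK k x :=
  Real.iInf_nonneg fun _ => norm_nonneg _

theorem errK_le_l2norm (k : ℕ) (x : Signal l d) : errK k x ≤ l2norm x := by
  have := ciInf_le (bddBelow_errK k x) ⟨0, sparse_zero k⟩
  simpa [errK] using this

theorem lt_sigLen_of_errK_pos {k : ℕ} {x : Signal l d} (h : 0 < errK k x) :
    (k : ℝ) < sigLen l d := by
  by_contra hcon
  push Not at hcon
  have hk : (Function.support x).ncard ≤ k := by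
    refine (Set.ncard_le_card _).trans ?_
    have h2 := card_grid (l := l) (d := d)
    rw [← h2, ← Nat.card_eq_fintype_card] at hcon
    exact_mod_cast hcon
  have := ciInf_le (bddBelow_errK k x) ⟨x, hk⟩
  rw [sub_self] at this
  have h0 : l2norm (0 : Signal l d) = 0 := by simp [l2norm]
  rw [h0] at this
  exact absurd h (not_lt.mpr this)

/-- A set of `k` coordinates that carries all but `Err_k(x)` of `x`. -/
theorem exists_head (k : ℕ) (x : Signal l d) : ∃ A : Finset (Grid l d), A.card ≤ k ∧
    ∑ i ∈ Aᶜ, ‖x i‖ ^ 2 ≤ errK k x ^ 2 := by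
  classical
  obtain ⟨A, hA, hmin⟩ := Finset.exists_min_image
    (Finset.univ.filter fun A : Finset (Grid l d) => A.card ≤ k)
    (fun A => ∑ i ∈ Aᶜ, ‖x i‖ ^ 2) ⟨∅, by simp⟩
  refine ⟨A, (Finset.mem_filter.mp hA).2, ?_⟩
  have h0 : 0 ≤ ∑ i ∈ Aᶜ, ‖x i‖ ^ 2 := Finset.sum_nonneg fun _ _ => sq_nonneg _
  rw [← Real.sqrt_le_left (errK_nonneg k x)]
  have : Nonempty {y : Signal l d // (Function.support y).ncard ≤ k} := ⟨⟨0, sparse_zero k⟩⟩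
  refine le_ciInf fun y => ?_
  refine Real.sqrt_le_iff.mpr ⟨norm_nonneg _, ?_⟩
  rw [l2norm_sq]
  let Y : Finset (Grid l d) := Finset.univ.filter fun i => y.1 i ≠ 0
  have hY : Y.card ≤ k := by
    have e : (Function.support y.1) = (Y : Set (Grid l d)) := by
      ext i; simp [Y]
    have := y.2
    rwa [e, Set.ncard_coe_finset] at this
  refine (hmin Y (Finset.mem_filter.mpr ⟨Finset.mem_univ _, hY⟩)).trans ?_
  calc ∑ i ∈ Yᶜ, ‖x i‖ ^ 2 = ∑ i ∈ Yᶜ, ‖(x - y.1) i‖ ^ 2 := by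
        refine Finset.sum_congr rfl fun i hi => ?_
        have : y.1 i = 0 := by
          by_contra hne
          exact (Finset.mem_compl.mp hi) (Finset.mem_filter.mpr ⟨Finset.mem_univ _, hne⟩)
        rw [Pi.sub_apply, this, sub_zero]
    _ ≤ _ := Finset.sum_le_sum_of_subset_of_nonneg (Finset.subset_univ _) fun _ _ _ => sq_nonneg _

theorem l2norm_le_sigLen_mul (x : Signal l d) : l2norm x ≤ sigLen l d * ‖x‖ := by
  have h1 : (1 : ℝ) ≤ sigLen l d := by
    unfold sigLen; exact one_le_pow₀ (one_le_pow₀ (by norm_num))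
  refine (sq_le_sq₀ (l2norm_nonneg x) (by positivity)).mp ?_
  rw [l2norm_sq]
  calc ∑ i, ‖x i‖ ^ 2 ≤ ∑ _i : Grid l d, ‖x‖ ^ 2 :=
        Finset.sum_le_sum fun i _ => pow_le_pow_left₀ (norm_nonneg _) (norm_le_pi_norm x i) 2
    _ = sigLen l d * ‖x‖ ^ 2 := by
        rw [Finset.sum_const, nsmul_eq_mul, Finset.card_univ, card_grid]
    _ ≤ (sigLen l d * ‖x‖) ^ 2 := by
        rw [mul_pow]
        refine mul_le_mul_of_nonneg_right ?_ (sq_nonneg _)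
        nlinarith

end norms

/-! ### The rounds of the algorithm under good hashing -/

section rounds

variable {l d r : ℕ}

/-- A draw that is not bad for `f` estimates the residual `x - χ` at `f` well, for every `χ`
supported on `S`. This is what allows all rounds to use the same draws. -/
theorem norm_estimate_sub_le {b F : ℕ} (hb : Even b) (hb0 : 2 ≤ b) {S : Finset (Grid l d)}
    {x χ : Signal l d} {ρ B : ℝ} {f : Grid l d} {h : Draw l d} (hbad : ¬ h.Bad b F S x ρ f)
    (hχ : ∀ g ∉ S, χ g = 0) (hB0 : 0 ≤ B) (hB : ∀ g ∈ S, ‖x g - χ g‖ ≤ B) (e : ℂ)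
    (he : ‖e‖ ≤ ρ / 32) :
    ‖(h.hash b F (dft x) (h.perm f) - h.hash b F (dft χ) (h.perm f) + e) *
        om (-(h.a ⬝ᵥ h.mat.mulVec f)) - (x f - χ f)‖ ≤ B / 32 + ρ / 16 := by
  classical
  simp only [Draw.Bad, not_or, not_lt] at hbad
  obtain ⟨hh, ht⟩ := hbad
  set y := x - χ with hy
  have hyf : ∀ g, y g = x g - χ g := fun g => rfl
  let c : Grid l d → ℂ := fun m =>
    y m * om (h.a ⬝ᵥ h.mat.mulVec (m - f)) * filterG b F (h.mat.mulVec (f - m))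
  -- The estimate is `x f - χ f` plus a head term and a tail term; on the tail `χ` vanishes, so that
  -- the tail term is the noise of `x` alone.
  have e1 : (h.hash b F (dft x) (h.perm f) - h.hash b F (dft χ) (h.perm f)) *
      om (-(h.a ⬝ᵥ h.mat.mulVec f)) = ∑ m, c m := by
    rw [← Draw.hash_sub, ← dft_sub, ← hy, Draw.estimate_eq]
  have e2 : ∑ m, c m = (x f - χ f) + (∑ m ∈ S.erase f, c m + ∑ m ∈ Sᶜ.erase f, c m) := by
    rw [← Finset.add_sum_erase _ _ (Finset.mem_univ f)]
    congr 1
    · simp only [c, sub_self, Matrix.mulVec_zero, dotProduct_zero, om_zero, mul_one]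
      rw [filterG_zero hb hb0, mul_one, hyf]
    · rw [← Finset.sum_union]
      · congr 1
        ext m
        by_cases hm : m ∈ S <;> simp [hm]
      · rw [Finset.disjoint_left]
        intro m hm hm'
        exact (Finset.mem_compl.mp (Finset.mem_of_mem_erase hm')) (Finset.mem_of_mem_erase hm)
  have e3 : ∑ m ∈ Sᶜ.erase f, c m = h.tailNoise b F S x f := by
    refine Finset.sum_congr rfl fun m hm => ?_
    have := hχ m (Finset.mem_compl.mp (Finset.mem_of_mem_erase hm))
    simp only [c, hyf, this, sub_zero]; ring
  have e4 : ‖∑ m ∈ S.erase f, c m‖ ≤ B * h.headWeight b F S f := by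
    rw [Draw.headWeight, Finset.mul_sum]
    refine (norm_sum_le _ _).trans (Finset.sum_le_sum fun m hm => ?_)
    simp only [c]
    rw [norm_mul, norm_mul, norm_om, mul_one]
    exact mul_le_mul_of_nonneg_right (hB m (Finset.mem_of_mem_erase hm)) (norm_nonneg _)
  rw [add_mul, e1, e2, e3]
  have e5 : (x f - χ f) + (∑ m ∈ S.erase f, c m + h.tailNoise b F S x f) +
      e * om (-(h.a ⬝ᵥ h.mat.mulVec f)) - (x f - χ f) =
      ∑ m ∈ S.erase f, c m + h.tailNoise b F S x f + e * om (-(h.a ⬝ᵥ h.mat.mulVec f)) := by ring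
  rw [e5]
  have h6 := norm_add₃_le (a := ∑ m ∈ S.erase f, c m) (b := h.tailNoise b F S x f)
    (c := e * om (-(h.a ⬝ᵥ h.mat.mulVec f)))
  rw [norm_mul e, norm_om, mul_one] at h6
  have h7 : B * h.headWeight b F S f ≤ B * (1 / 32) := mul_le_mul_of_nonneg_left hh hB0
  linarith

/-- The invariant of the rounds: the approximation is supported on the head, no coordinate of the
residual exceeds that of the signal, and the residual halves on the head in every round. -/
theorem sparseFFTRound_invariant {α : ℝ} {F k : ℕ} {ε R μ : ℝ} {x : Signal l d}
    {ρ : Fin r → Draw l d} {e : ℕ → Fin r → Signal l d} {S : Finset (Grid l d)} {b : ℕ}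
    (hbdef : bucketSide α d k ε = b) (hb : Even b) (hb0 : 2 ≤ b)
    (hμ : 0 < Real.sqrt ε * μ)
    (hS : ∀ f, f ∉ S → ‖x f‖ < Real.sqrt ε * μ)
    (hx : ∀ f, ‖x f‖ ≤ 3 * (Real.sqrt ε * μ) * 2 ^ numRounds R)
    (he : ∀ t i j, ‖e t i j‖ ≤ Real.sqrt ε * μ / 32)
    (bad : Grid l d → Finset (Fin r)) (hcard : ∀ f, 2 * (bad f).card < r)
    (hgood : ∀ f, ∀ i ∉ bad f, ¬ (ρ i).Bad b F S x (Real.sqrt ε * μ) f) (t : ℕ)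
    (ht : t ≤ numRounds R) :
    (∀ f ∉ S, sparseFFTRound α F k ε R μ (dft x) ρ e t f = 0) ∧
    (∀ f, ‖x f - sparseFFTRound α F k ε R μ (dft x) ρ e t f‖ ≤ ‖x f‖) ∧
    ∀ f ∈ S, ‖x f - sparseFFTRound α F k ε R μ (dft x) ρ e t f‖ ≤
      3 * (Real.sqrt ε * μ) * 2 ^ (numRounds R - t) := by
  set σ := Real.sqrt ε * μ with hσ
  induction t with
  | zero => exact ⟨fun _ _ => rfl, fun f => by simp [sparseFFTRound],
      fun f _ => by simpa [sparseFFTRound] using hx f⟩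
  | succ t ih =>
    obtain ⟨i1, i2, i3⟩ := ih (by omega)
    obtain ⟨q, hq⟩ : ∃ q, numRounds R - t = q + 1 := ⟨numRounds R - t - 1, by omega⟩
    have hq' : numRounds R - (t + 1) = q := by omega
    set χ := sparseFFTRound α F k ε R μ (dft x) ρ e t with hχ
    set Mq : ℝ := 2 ^ q with hMq
    have hM1 : 1 ≤ Mq := one_le_pow₀ (by norm_num)
    rw [hq, pow_succ, ← hMq] at i3
    rw [hq', ← hMq]
    have hσM : σ ≤ σ * Mq := by nlinarith
    -- The estimate of the residual. With `M = 2 ^ q` its error is at most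
    -- `2 * (6 σ M / 32 + σ / 16) ≤ σ M / 2`, while the threshold is `2 σ M`.
    let η : Grid l d → ℂ := fun f => medianC fun i =>
      ((ρ i).hash b F (dft x) ((ρ i).perm f) - (ρ i).hash b F (dft χ) ((ρ i).perm f) +
        e t i ((ρ i).perm f)) * om (-((ρ i).a ⬝ᵥ (ρ i).mat.mulVec f))
    have hη : ∀ f, ‖η f - (x f - χ f)‖ ≤ σ * Mq / 2 := by
      intro f
      have := norm_medianC_sub_le (s := fun i =>
        ((ρ i).hash b F (dft x) ((ρ i).perm f) - (ρ i).hash b F (dft χ) ((ρ i).perm f) +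
        e t i ((ρ i).perm f)) * om (-((ρ i).a ⬝ᵥ (ρ i).mat.mulVec f)))
        (hcard f) (c := x f - χ f) fun i hi =>
        norm_estimate_sub_le hb hb0 (hgood f i hi) i1 (by positivity) i3 _ (he t i _)
      refine this.trans ?_
      linarith
    have hstep : ∀ f, sparseFFTRound α F k ε R μ (dft x) ρ e (t + 1) f =
        χ f + if ‖η f‖ ≤ 2 * (σ * Mq) then 0 else η f := by
      intro f
      simp only [sparseFFTRound, ← hχ, hbdef, Pi.add_apply, locateAndEstimate, η, hq', ← hMq]
      rw [show 4 * Real.sqrt ε * μ * Mq / 2 = 2 * (σ * Mq) by rw [hσ]; ring]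
    -- An entry below the threshold has residual at most `3 σ M`; an updated entry had residual at
    -- least `σ M`, and its new residual `σ M / 2` is smaller.
    have hcase : ∀ f, (sparseFFTRound α F k ε R μ (dft x) ρ e (t + 1) f = χ f ∧
        ‖x f - χ f‖ ≤ 3 * σ * Mq) ∨
        (sparseFFTRound α F k ε R μ (dft x) ρ e (t + 1) f = χ f + η f ∧
          ‖x f - (χ f + η f)‖ ≤ σ * Mq / 2 ∧ σ * Mq ≤ ‖x f - χ f‖) := by
      intro f
      have h1 := hη f
      rw [hstep]
      have htri := abs_norm_sub_norm_le (η f) (x f - χ f)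
      rw [abs_le] at htri
      by_cases hc : ‖η f‖ ≤ 2 * (σ * Mq)
      · left
        rw [if_pos hc, add_zero]
        exact ⟨rfl, by linarith⟩
      · right
        rw [if_neg hc]
        push Not at hc
        refine ⟨rfl, ?_, by linarith⟩
        rw [← norm_neg]
        rwa [show -(x f - (χ f + η f)) = η f - (x f - χ f) by ring]
    refine ⟨fun f hf => ?_, fun f => ?_, fun f hf => ?_⟩
    · -- Outside the head the estimate stays below the threshold: `σ + σ M / 2 ≤ 2 σ M`.
      rw [hstep, i1 f hf, zero_add, if_pos]
      have h1 := hη f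
      rw [i1 f hf, sub_zero] at h1
      have htri := norm_le_norm_add_norm_sub' (η f) (x f)
      have := hS f hf
      linarith
    · rcases hcase f with ⟨h1, -⟩ | ⟨h1, h2, h3⟩
      · rw [h1]; exact i2 f
      · rw [h1]
        have := i2 f
        linarith
    · rcases hcase f with ⟨h1, h2⟩ | ⟨h1, h2, -⟩
      · rw [h1]; exact h2
      · rw [h1]
        have : 0 < σ * Mq := by positivity
        linarith

theorem two_pow_numRounds_ge {R : ℝ} (hR : 0 < R) : R ≤ 2 ^ numRounds R := by
  have h := Nat.le_ceil (Real.logb 2 R)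
  rw [← Real.rpow_natCast, ← Real.logb_le_iff_le_rpow (by norm_num) hR]
  exact h

end rounds

/-! ### The bucket side -/

section bucketSide

/-- The exponent of the bucket side. -/
def bucketExp (α : ℝ) (d k : ℕ) (ε : ℝ) : ℕ :=
  sInf {β : ℕ | (k : ℝ) / (ε * α ^ d) ≤ ((2 : ℝ) ^ β) ^ d}

theorem bucketSide_eq (α : ℝ) (d k : ℕ) (ε : ℝ) : bucketSide α d k ε = 2 ^ bucketExp α d k ε := rfl

theorem le_bucketSide_pow {α : ℝ} {d : ℕ} (hd : 1 ≤ d) (k : ℕ) (ε : ℝ) :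
    (k : ℝ) / (ε * α ^ d) ≤ ((2 : ℝ) ^ bucketExp α d k ε) ^ d := by
  refine Nat.sInf_mem (s := {β : ℕ | (k : ℝ) / (ε * α ^ d) ≤ ((2 : ℝ) ^ β) ^ d}) ?_
  obtain ⟨β, hβ⟩ := pow_unbounded_of_one_lt ((k : ℝ) / (ε * α ^ d)) (one_lt_two (α := ℝ))
  refine ⟨β, hβ.le.trans ?_⟩
  exact le_self_pow₀ (one_le_pow₀ (by norm_num)) (by omega)

theorem lt_of_lt_bucketExp {α : ℝ} {d k : ℕ} {ε : ℝ} {β : ℕ} (h : β < bucketExp α d k ε) :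
    ((2 : ℝ) ^ β) ^ d < (k : ℝ) / (ε * α ^ d) := by
  have := Nat.notMem_of_lt_sInf h
  simpa using this

theorem bucketExp_pos {α ε : ℝ} (hα : 0 < α) (hα1 : α < 1) {d k : ℕ} (hd : 1 ≤ d) (hk : 1 ≤ k)
    (hε : 0 < ε) (hε1 : ε ≤ 1) : 0 < bucketExp α d k ε := by
  by_contra hcon
  have h0 : bucketExp α d k ε = 0 := by omega
  have h := le_bucketSide_pow (α := α) hd k ε
  rw [h0, pow_zero, one_pow, div_le_one (by positivity)] at h
  have h1 : ε * α ^ d < 1 := by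
    have : α ^ d < 1 := pow_lt_one₀ hα.le hα1 (by omega)
    have : 0 < α ^ d := by positivity
    nlinarith
  have h2 : (1 : ℝ) ≤ k := by exact_mod_cast hk
  linarith

theorem even_bucketSide {α ε : ℝ} {d k : ℕ} (h : 0 < bucketExp α d k ε) :
    Even (bucketSide α d k ε) := by
  rw [bucketSide_eq]
  exact (even_two).pow_of_ne_zero (by omega)

theorem two_le_bucketSide {α ε : ℝ} {d k : ℕ} (h : 0 < bucketExp α d k ε) :
    2 ≤ bucketSide α d k ε := by
  rw [bucketSide_eq]
  exact Nat.le_self_pow (by omega) 2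

end bucketSide

/-! ### The recovery guarantee -/

section recovery

variable {l d : ℕ}

/-- The constant `α` of the algorithm, small enough for `4224 * 9 * α ≤ 1 / 64`. -/
def alphaConst : ℝ := 1 / 2 ^ 22

theorem sigLen_eq_two_pow : sigLen l d = 2 ^ (l * d) := by rw [sigLen, pow_mul]

/-- Number of head coordinates and energy of the tail, at the threshold `√ε μ`. -/
theorem head_bounds {k : ℕ} {ε μ : ℝ} {x : Signal l d} (hk : 1 ≤ k) (hε : 0 < ε) (hε1 : ε ≤ 1)
    (hμ : 0 < μ) (hμk : noiseLevel k x ≤ μ) {S : Finset (Grid l d)}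
    (hS : ∀ f, f ∈ S ↔ Real.sqrt ε * μ ≤ ‖x f‖) :
    (S.card : ℝ) ≤ 2 * k / ε ∧
      ∑ f ∈ Sᶜ, ‖x f‖ ^ 2 ≤ (Real.sqrt ε * μ) ^ 2 * (2 * k / ε) := by
  -- `A` carries a best `k`-sparse approximation; compare `S` with it.
  obtain ⟨A, hA, hAx⟩ := exists_head k x
  have hk' : (1 : ℝ) ≤ k := by exact_mod_cast hk
  have hA' : (A.card : ℝ) ≤ k := by exact_mod_cast hA
  have hE : errK k x ^ 2 ≤ k * μ ^ 2 := by
    have h1 : errK k x ≤ μ * Real.sqrt k := by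
      rw [noiseLevel, div_le_iff₀ (Real.sqrt_pos.mpr (by linarith))] at hμk
      exact hμk
    have h2 := pow_le_pow_left₀ (errK_nonneg k x) h1 2
    rw [mul_pow, Real.sq_sqrt (by linarith)] at h2
    linarith
  have hσ2 : (Real.sqrt ε * μ) ^ 2 = ε * μ ^ 2 := by rw [mul_pow, Real.sq_sqrt hε.le]
  have hσ : 0 < Real.sqrt ε * μ := mul_pos (Real.sqrt_pos.mpr hε) hμ
  have hkε : (k : ℝ) ≤ k / ε := by rw [le_div_iff₀ hε]; nlinarith
  constructor
  · have h1 : ((S \ A).card : ℝ) * (ε * μ ^ 2) ≤ k * μ ^ 2 := by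
      rw [← hσ2]
      refine le_trans ?_ (hAx.trans hE)
      calc _ = ∑ f ∈ S \ A, (Real.sqrt ε * μ) ^ 2 := by rw [Finset.sum_const, nsmul_eq_mul]
        _ ≤ ∑ f ∈ S \ A, ‖x f‖ ^ 2 := Finset.sum_le_sum fun f hf =>
            pow_le_pow_left₀ hσ.le ((hS f).mp (Finset.mem_sdiff.mp hf).1) 2
        _ ≤ _ := Finset.sum_le_sum_of_subset_of_nonneg
            (fun f hf => Finset.mem_compl.mpr (Finset.mem_sdiff.mp hf).2) fun _ _ _ => sq_nonneg _
    have h2 : ((S \ A).card : ℝ) ≤ k / ε := by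
      rw [le_div_iff₀ hε]
      have : 0 < μ ^ 2 := by positivity
      nlinarith
    have h3 : (S.card : ℝ) ≤ (S \ A).card + A.card := by
      have := Finset.card_sdiff_add_card S A
      have h4 := Finset.card_le_card (Finset.subset_union_left (s₁ := S) (s₂ := A))
      exact_mod_cast by omega
    rw [mul_div_assoc]; linarith
  · have h1 : ∑ f ∈ Sᶜ, ‖x f‖ ^ 2 ≤ ∑ f ∈ Aᶜ, ‖x f‖ ^ 2 + ∑ f ∈ A, (Real.sqrt ε * μ) ^ 2 := by
      rw [← Finset.sum_filter_add_sum_filter_not Sᶜ (fun f => f ∈ A), add_comm]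
      refine add_le_add ?_ ?_
      · refine Finset.sum_le_sum_of_subset_of_nonneg (fun f hf => ?_) fun _ _ _ => sq_nonneg _
        exact Finset.mem_compl.mpr (Finset.mem_filter.mp hf).2
      · calc _ ≤ ∑ f ∈ Sᶜ.filter (fun f => f ∈ A), (Real.sqrt ε * μ) ^ 2 := by
              refine Finset.sum_le_sum fun f hf => pow_le_pow_left₀ (norm_nonneg _) ?_ 2
              have := Finset.mem_compl.mp (Finset.mem_filter.mp hf).1
              rw [hS, not_le] at this
              exact this.le
          _ ≤ _ := Finset.sum_le_sum_of_subset_of_nonneg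
              (fun f hf => (Finset.mem_filter.mp hf).2) fun _ _ _ => sq_nonneg _
    rw [Finset.sum_const, nsmul_eq_mul, hσ2] at h1
    rw [hσ2]
    have h2 : (A.card : ℝ) * (ε * μ ^ 2) ≤ k * (1 * μ ^ 2) := by gcongr
    have h3 : ε * μ ^ 2 * (2 * k / ε) = 2 * (k * μ ^ 2) := by field_simp
    rw [h3]; linarith

/-- A draw is bad for a given coordinate with probability at most `1 / 64`. -/
theorem card_bad_le_div {k : ℕ} {ε μ : ℝ} {x : Signal l d} (hl : 1 ≤ l) (hd : 1 ≤ d) (hk : 1 ≤ k)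
    (hε : 0 < ε) (hε1 : ε ≤ 1) (hμ : 0 < μ) (hμk : noiseLevel k x ≤ μ) {S : Finset (Grid l d)}
    (hS : ∀ f, f ∈ S ↔ Real.sqrt ε * μ ≤ ‖x f‖) (f : Grid l d)
    [DecidablePred fun h : Draw l d =>
      h.Bad (bucketSide alphaConst d k ε) (2 * d) S x (Real.sqrt ε * μ) f] :
    64 * ((Finset.univ.filter fun h : Draw l d =>
      h.Bad (bucketSide alphaConst d k ε) (2 * d) S x (Real.sqrt ε * μ) f).card : ℝ) ≤
      Fintype.card (Draw l d) := by
  have hα : 0 < alphaConst := by unfold alphaConst; positivity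
  have hα1 : alphaConst < 1 := by unfold alphaConst; norm_num
  have hβ := bucketExp_pos hα hα1 hd hk hε hε1
  have hσ : 0 < Real.sqrt ε * μ := mul_pos (Real.sqrt_pos.mpr hε) hμ
  have h1 := card_bad_le hl (even_bucketSide hβ) (two_le_bucketSide hβ) S x hσ f
  obtain ⟨h2, h3⟩ := head_bounds hk hε hε1 hμ hμk hS
  have hk' : (1 : ℝ) ≤ k := by exact_mod_cast hk
  have hb := le_bucketSide_pow (α := alphaConst) hd k ε
  set b := bucketSide alphaConst d k ε with hbdef
  have hbc : ((2 : ℝ) ^ bucketExp alphaConst d k ε) = (b : ℝ) := by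
    rw [hbdef, bucketSide_eq]; push_cast; rfl
  rw [hbc] at hb
  have hb2 : (2 : ℝ) ≤ b := by exact_mod_cast two_le_bucketSide hβ
  have hq : 32 * (S.card : ℝ) + 1024 / (Real.sqrt ε * μ) ^ 2 * ∑ m ∈ Sᶜ, ‖x m‖ ^ 2 ≤
      1056 * (2 * k / ε) := by
    have h4 : 1024 / (Real.sqrt ε * μ) ^ 2 * ∑ m ∈ Sᶜ, ‖x m‖ ^ 2 ≤
        1024 / (Real.sqrt ε * μ) ^ 2 * ((Real.sqrt ε * μ) ^ 2 * (2 * k / ε)) := by gcongr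
    have h5 : 1024 / (Real.sqrt ε * μ) ^ 2 * ((Real.sqrt ε * μ) ^ 2 * (2 * k / ε)) =
        1024 * (2 * k / ε) := by
      have := hσ.ne'
      field_simp
    linarith
  have hfin : 2 * (9 / (b : ℝ)) ^ d *
      (32 * S.card + 1024 / (Real.sqrt ε * μ) ^ 2 * ∑ m ∈ Sᶜ, ‖x m‖ ^ 2) ≤ 1 / 64 := by
    have hbd : 0 < (b : ℝ) ^ d := by positivity
    calc _ ≤ 2 * (9 / (b : ℝ)) ^ d * (1056 * (2 * k / ε)) := by gcongr
      _ = 4224 * 9 ^ d * ((k / ε) / (b : ℝ) ^ d) := by rw [div_pow]; ring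
      _ ≤ 4224 * 9 ^ d * alphaConst ^ d := by
          gcongr
          rw [div_le_iff₀ hbd]
          rw [div_le_iff₀ (by positivity)] at hb
          rw [div_le_iff₀ hε]
          nlinarith
      _ = 4224 * (9 * alphaConst) ^ d := by rw [mul_pow]; ring
      _ ≤ 4224 * (9 * alphaConst) := by
          gcongr
          refine pow_le_of_le_one (by positivity) ?_ (by omega)
          unfold alphaConst; norm_num
      _ ≤ 1 / 64 := by unfold alphaConst; norm_num
  have hD : (0 : ℝ) ≤ Fintype.card (Draw l d) := Nat.cast_nonneg _
  have h6 := mul_le_mul_of_nonneg_left hfin hD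
  linarith

/-- If fewer than half of the draws are bad for each coordinate, the output is accurate. -/
theorem l2norm_sub_sparseFFT_le {r k : ℕ} {ε R μ Λ : ℝ} {A : ℕ} {x : Signal l d} {K : ℕ}
    (hK : 9 ≤ K) (hl : 1 ≤ l) (hd : 1 ≤ d) (hk : 1 ≤ k) (hε : 0 < ε) (hε1 : ε ≤ 1)
    (hμ : 0 < μ) (hμΛ : μ ≤ Λ * noiseLevel k x)
    (hxR : ‖x‖ ≤ R * (Real.sqrt ε * μ)) (hR : R ≤ sigLen l d ^ A) {S : Finset (Grid l d)}
    (hS : ∀ f, f ∈ S ↔ Real.sqrt ε * μ ≤ ‖x f‖) (ρ : Fin r → Draw l d)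
    (bad : Grid l d → Finset (Fin r)) (hcard : ∀ f, 2 * (bad f).card < r)
    (hgood : ∀ f, ∀ i ∉ bad f,
      ¬ (ρ i).Bad (bucketSide alphaConst d k ε) (2 * d) S x (Real.sqrt ε * μ) f)
    (e : ℕ → Fin r → Signal l d) (he : ∀ t i j, ‖e t i j‖ ≤ l2norm x / sigLen l d ^ (A + 6)) :
    l2norm (x - sparseFFT alphaConst (2 * d) k ε R μ (dft x) ρ e) ≤
      (1 + K * Λ ^ 2 * ε) * errK k x := by
  have hα : 0 < alphaConst := by unfold alphaConst; positivity
  have hα1 : alphaConst < 1 := by unfold alphaConst; norm_num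
  have hβ := bucketExp_pos hα hα1 hd hk hε hε1
  have hk' : (1 : ℝ) ≤ k := by exact_mod_cast hk
  have hsk : 0 < Real.sqrt k := Real.sqrt_pos.mpr (by linarith)
  set σ := Real.sqrt ε * μ with hσdef
  have hσ : 0 < σ := mul_pos (Real.sqrt_pos.mpr hε) hμ
  have hσ2 : σ ^ 2 = ε * μ ^ 2 := by rw [hσdef, mul_pow, Real.sq_sqrt hε.le]
  have hEpos : errK k x ≠ 0 := by
    intro h0
    rw [noiseLevel, h0, zero_div, mul_zero] at hμΛ
    linarith
  have hR0 : 0 < R := by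
    by_contra hcon
    push Not at hcon
    have h1 : ‖x‖ ≤ 0 := hxR.trans (mul_nonpos_of_nonpos_of_nonneg hcon hσ.le)
    have h2 := l2norm_le_sigLen_mul x
    have h3 := errK_le_l2norm k x
    have h4 : sigLen l d * ‖x‖ ≤ 0 := mul_nonpos_of_nonneg_of_nonpos sigLen_pos.le h1
    exact hEpos (le_antisymm (by linarith) (errK_nonneg k x))
  have hN2 : 2 ≤ sigLen l d := by
    rw [sigLen_eq_two_pow]
    exact le_self_pow₀ (by norm_num) (by have := Nat.mul_pos hl hd; omega)
  -- The numerical errors are below `σ / 32`: the factor `N ^ 6` in the bound absorbs `‖x‖₂ ≤ N ‖x‖∞`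
  -- and `32 ≤ N ^ 5`.
  have hsmall : l2norm x / sigLen l d ^ (A + 6) ≤ σ / 32 := by
    have h2 := l2norm_le_sigLen_mul x
    have hNA : 0 < sigLen l d ^ A := pow_pos (by linarith) A
    have h5 : (2 : ℝ) ^ 5 ≤ sigLen l d ^ 5 := pow_le_pow_left₀ (by norm_num) hN2 5
    rw [div_le_div_iff₀ (by positivity) (by norm_num)]
    calc l2norm x * 32 ≤ sigLen l d * (sigLen l d ^ A * σ) * 2 ^ 5 := by
          have : ‖x‖ ≤ sigLen l d ^ A * σ := hxR.trans (by gcongr)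
          have h6 : sigLen l d * ‖x‖ ≤ sigLen l d * (sigLen l d ^ A * σ) := by gcongr
          linarith
      _ ≤ sigLen l d * (sigLen l d ^ A * σ) * sigLen l d ^ 5 := by gcongr
      _ = _ := by ring
  have hT := two_pow_numRounds_ge hR0
  have hx : ∀ f, ‖x f‖ ≤ 3 * σ * 2 ^ numRounds R := by
    intro f
    refine (norm_le_pi_norm x f).trans (hxR.trans ?_)
    have : R * σ ≤ 2 ^ numRounds R * σ := by gcongr
    have : 0 ≤ 2 ^ numRounds R * σ := by positivity
    linarith
  obtain ⟨i1, i2, i3⟩ := sparseFFTRound_invariant (F := 2 * d) (e := e) rfl (even_bucketSide hβ)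
    (two_le_bucketSide hβ) hσ (fun f hf => not_le.mp fun h => hf ((hS f).mpr h)) hx
    (fun t i j => (he t i j).trans hsmall) bad hcard hgood (numRounds R) le_rfl
  obtain ⟨A', hA', hAx⟩ := exists_head k x
  rw [Nat.sub_self, pow_zero, mul_one] at i3
  have hA'' : (A'.card : ℝ) ≤ k := by exact_mod_cast hA'
  have hEΛ : k * μ ^ 2 ≤ Λ ^ 2 * errK k x ^ 2 := by
    have h1 : μ * Real.sqrt k ≤ Λ * errK k x := by
      rw [noiseLevel, ← mul_div_assoc, le_div_iff₀ hsk] at hμΛ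
      exact hμΛ
    have h2 := pow_le_pow_left₀ (by positivity) h1 2
    rw [mul_pow, mul_pow, Real.sq_sqrt (by linarith)] at h2
    linarith
  set χ := sparseFFTRound alphaConst (2 * d) k ε R μ (dft x) ρ e (numRounds R) with hχ
  -- On `A'` the residual is at most `3 σ` by the last invariant, and elsewhere at most `‖x f‖`.
  have hsq : l2norm (x - χ) ^ 2 ≤ errK k x ^ 2 + 9 * (ε * (k * μ ^ 2)) := by
    rw [l2norm_sq, ← Finset.sum_compl_add_sum A']
    refine add_le_add ?_ ?_
    · exact (Finset.sum_le_sum fun f _ => pow_le_pow_left₀ (norm_nonneg _) (i2 f) 2).trans hAx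
    · have h1 : ∀ f ∈ A', ‖(x - χ) f‖ ^ 2 ≤ 9 * (ε * μ ^ 2) := by
        intro f _
        have h2 : ‖x f - χ f‖ ≤ 3 * σ := by
          by_cases hf : f ∈ S
          · exact i3 f hf
          · have h3 := i2 f
            have h4 : ‖x f‖ < σ := not_le.mp fun h => hf ((hS f).mpr h)
            linarith
        have h5 := pow_le_pow_left₀ (norm_nonneg _) h2 2
        rw [mul_pow, hσ2] at h5
        rw [Pi.sub_apply]; linarith
      refine (Finset.sum_le_sum h1).trans ?_
      rw [Finset.sum_const, nsmul_eq_mul]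
      have : (A'.card : ℝ) * (9 * (ε * μ ^ 2)) ≤ k * (9 * (ε * μ ^ 2)) := by gcongr
      linarith
  have hE0 := errK_nonneg k x
  have hK' : (9 : ℝ) ≤ K := by exact_mod_cast hK
  refine (sq_le_sq₀ (l2norm_nonneg _) (by positivity)).mp ?_
  have hfin : ε * (k * μ ^ 2) ≤ ε * (Λ ^ 2 * errK k x ^ 2) := by gcongr
  have h8 : sparseFFT alphaConst (2 * d) k ε R μ (dft x) ρ e = χ := rfl
  rw [h8]
  refine hsq.trans ?_
  have hY : 0 ≤ ε * (Λ ^ 2 * errK k x ^ 2) := by positivity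
  have hexp : ((1 + K * Λ ^ 2 * ε) * errK k x) ^ 2 = errK k x ^ 2 +
      2 * K * (ε * (Λ ^ 2 * errK k x ^ 2)) + (K * Λ ^ 2 * ε * errK k x) ^ 2 := by ring
  rw [hexp]
  have : 0 ≤ (K * Λ ^ 2 * ε * errK k x) ^ 2 := sq_nonneg _
  nlinarith

theorem card_draw_pos (hl : 1 ≤ l) : 0 < Fintype.card (Draw l d) := by
  have h1 : Odd (1 : Matrix (Fin d) (Fin d) (ZMod (2 ^ l))).det.val := by
    rw [← isUnit_iff_odd_val hl, Matrix.det_one]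
    exact isUnit_one
  exact Fintype.card_pos_iff.mpr ⟨(⟨1, h1⟩, 0, 0)⟩

/-- The recovery guarantee: a Chernoff bound for each coordinate and a union bound over the `N`
coordinates. -/
theorem recovery_probability {k C : ℕ} {ε R μ Λ : ℝ} {A : ℕ} {x : Signal l d} {K : ℕ}
    (hC : 1 ≤ C) (hK : 9 ≤ K) (hl : 1 ≤ l) (hd : 1 ≤ d) (hk : 1 ≤ k) (hε : 0 < ε) (hε1 : ε ≤ 1)
    (hμ : 0 < μ) (hμk : noiseLevel k x ≤ μ) (hμΛ : μ ≤ Λ * noiseLevel k x)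
    (hxR : ‖x‖ ≤ R * (Real.sqrt ε * μ)) (hR : R ≤ sigLen l d ^ A) :
    1 - sigLen l d ^ (-((1 : ℝ) * C)) ≤
      uniformProb {ρ : Fin (numHashes C l d) → Draw l d |
        ∀ e : ℕ → Fin (numHashes C l d) → Signal l d,
          (∀ t i j, ‖e t i j‖ ≤ l2norm x / sigLen l d ^ (A + 6)) →
          l2norm (x - sparseFFT alphaConst (2 * d) k ε R μ (dft x) ρ e) ≤
            (1 + K * Λ ^ 2 * ε) * errK k x} := by
  classical
  set r := numHashes C l d with hr
  let S : Finset (Grid l d) := Finset.univ.filter fun f => Real.sqrt ε * μ ≤ ‖x f‖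
  have hS : ∀ f, f ∈ S ↔ Real.sqrt ε * μ ≤ ‖x f‖ := fun f => by simp [S]
  let B : Grid l d → Draw l d → Prop := fun f h =>
    h.Bad (bucketSide alphaConst d k ε) (2 * d) S x (Real.sqrt ε * μ) f
  let Fail : Grid l d → Finset (Fin r → Draw l d) := fun f =>
    Finset.univ.filter fun ρ => r ≤ 2 * (Finset.univ.filter fun i => B f (ρ i)).card
  set E := {ρ : Fin r → Draw l d |
        ∀ e : ℕ → Fin r → Signal l d,
          (∀ t i j, ‖e t i j‖ ≤ l2norm x / sigLen l d ^ (A + 6)) →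
          l2norm (x - sparseFFT alphaConst (2 * d) k ε R μ (dft x) ρ e) ≤
            (1 + K * Λ ^ 2 * ε) * errK k x} with hE
  have hsub : ∀ ρ, ρ ∉ Finset.univ.biUnion Fail → ρ ∈ E := by
    intro ρ hρ e he
    simp only [Fail, Finset.mem_biUnion, Finset.mem_univ, true_and, Finset.mem_filter,
      not_exists, not_le] at hρ
    exact l2norm_sub_sparseFFT_le hK hl hd hk hε hε1 hμ hμΛ hxR hR hS ρ
      (fun f => Finset.univ.filter fun i => B f (ρ i)) hρ
      (fun f i hi hb => hi (Finset.mem_filter.mpr ⟨Finset.mem_univ _, hb⟩)) e he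
  have hD : (0 : ℝ) < Fintype.card (Draw l d) := by exact_mod_cast card_draw_pos hl
  have hΩ : (Fintype.card (Fin r → Draw l d) : ℝ) = (Fintype.card (Draw l d) : ℝ) ^ r := by
    rw [Fintype.card_fun, Fintype.card_fin]; push_cast; rfl
  have hN := sigLen_pos (l := l) (d := d)
  have hF : ((Finset.univ.biUnion Fail).card : ℝ) ≤
      sigLen l d * ((Fintype.card (Draw l d) : ℝ) ^ r / 4 ^ r) := by
    have h1 : ((Finset.univ.biUnion Fail).card : ℝ) ≤ ∑ f, ((Fail f).card : ℝ) := by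
      exact_mod_cast Finset.card_biUnion_le
    refine h1.trans ?_
    have h2 : ∀ f ∈ Finset.univ, ((Fail f).card : ℝ) ≤ (Fintype.card (Draw l d) : ℝ) ^ r / 4 ^ r := by
      intro f _
      rw [le_div_iff₀ (by positivity)]
      exact card_half_bad_le (B f) (card_bad_le_div hl hd hk hε hε1 hμ hμk hS f) r
    refine (Finset.sum_le_sum h2).trans ?_
    rw [Finset.sum_const, nsmul_eq_mul, Finset.card_univ, card_grid]
  have hEc : (Fintype.card (Fin r → Draw l d) : ℝ) ≤
      E.ncard + (Finset.univ.biUnion Fail).card := by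
    have h1 : (Finset.univ : Finset (Fin r → Draw l d)) ⊆
        (Set.toFinite E).toFinset ∪ Finset.univ.biUnion Fail := by
      intro ρ _
      rw [Finset.mem_union]
      by_cases h : ρ ∈ Finset.univ.biUnion Fail
      · exact Or.inr h
      · exact Or.inl ((Set.Finite.mem_toFinset _).mpr (hsub ρ h))
    have h2 := (Finset.card_le_card h1).trans (Finset.card_union_le _ _)
    rw [← Set.ncard_eq_toFinset_card E] at h2
    exact_mod_cast h2
  -- As `r = C log₂ N`, the union bound leaves `N / 4 ^ r = N ^ (1 - 2 C) ≤ N ^ (-C)`.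
  have h4 : sigLen l d / 4 ^ r ≤ sigLen l d ^ (-((1 : ℝ) * C)) := by
    have h5 : (4 : ℝ) ^ r = sigLen l d ^ (2 * C) := by
      rw [sigLen_eq_two_pow, hr, numHashes, ← pow_mul, show (4 : ℝ) = 2 ^ 2 by norm_num, ← pow_mul]
      congr 1; ring
    rw [one_mul, Real.rpow_neg hN.le, Real.rpow_natCast, h5, div_eq_mul_inv]
    have h1N : 1 ≤ sigLen l d := by rw [sigLen_eq_two_pow]; exact one_le_pow₀ (by norm_num)
    have h6 : sigLen l d * sigLen l d ^ C ≤ sigLen l d ^ (2 * C) := by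
      rw [← pow_succ']
      exact pow_le_pow_right₀ h1N (by omega)
    rw [← div_eq_mul_inv, ← one_div, div_le_div_iff₀ (by positivity) (by positivity)]
    linarith
  rw [uniformProb, Nat.card_eq_fintype_card, hΩ, le_div_iff₀ (by positivity)]
  rw [hΩ] at hEc
  have h7 : sigLen l d * ((Fintype.card (Draw l d) : ℝ) ^ r / 4 ^ r) =
      sigLen l d / 4 ^ r * (Fintype.card (Draw l d) : ℝ) ^ r := by ring
  rw [h7] at hF
  have h8 : sigLen l d / 4 ^ r * (Fintype.card (Draw l d) : ℝ) ^ r ≤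
      sigLen l d ^ (-((1 : ℝ) * C)) * (Fintype.card (Draw l d) : ℝ) ^ r := by gcongr
  linarith

end recovery

/-! ### Named arrays in the memory of the machine -/

section arrays

/-- Entry `i` of the integer array number `t`. The memory is read as `32` interleaved arrays; a
scalar variable is an array of which only the entry `0` is used. -/
def Store.I (s : Store) (t : Fin 32) (i : ℤ) : ℤ := s.int (32 * i + (t : ℕ))

/-- Entry `i` of the complex array number `t`. -/
def Store.C (s : Store) (t : Fin 32) (i : ℤ) : ℂ := s.cpx (32 * i + (t : ℕ))

/-- The store after writing `v` to entry `i` of the integer array `t`. -/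
def Store.updI (s : Store) (t : Fin 32) (i v : ℤ) : Store :=
  { s with int := Function.update s.int (32 * i + (t : ℕ)) v }

/-- The store after writing `v` to entry `i` of the complex array `t`. -/
def Store.updC (s : Store) (t : Fin 32) (i : ℤ) (v : ℂ) : Store :=
  { s with cpx := Function.update s.cpx (32 * i + (t : ℕ)) v }

theorem loc_eq_iff {t t' : Fin 32} {i i' : ℤ} :
    32 * i' + ((t' : ℕ) : ℤ) = 32 * i + ((t : ℕ) : ℤ) ↔ t' = t ∧ i' = i := by
  have h1 := t.2
  have h2 := t'.2
  rw [Fin.ext_iff]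
  omega

theorem Store.updI_I (s : Store) (t t' : Fin 32) (i i' v : ℤ) :
    (s.updI t i v).I t' i' = if t' = t ∧ i' = i then v else s.I t' i' := by
  simp only [Store.updI, Store.I, Function.update_apply, loc_eq_iff]

theorem Store.updC_C (s : Store) (t t' : Fin 32) (i i' : ℤ) (v : ℂ) :
    (s.updC t i v).C t' i' = if t' = t ∧ i' = i then v else s.C t' i' := by
  simp only [Store.updC, Store.C, Function.update_apply, loc_eq_iff]

theorem Store.updI_self (s : Store) (t : Fin 32) (i v : ℤ) : (s.updI t i v).I t i = v := by
  rw [Store.updI_I, if_pos ⟨rfl, rfl⟩]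

theorem Store.updC_self (s : Store) (t : Fin 32) (i : ℤ) (v : ℂ) : (s.updC t i v).C t i = v := by
  rw [Store.updC_C, if_pos ⟨rfl, rfl⟩]

theorem Store.updI_ne (s : Store) {t t' : Fin 32} (h : t' ≠ t) (i v : ℤ) :
    (s.updI t i v).I t' = s.I t' := by
  funext i'
  rw [Store.updI_I, if_neg fun h' => h h'.1]

theorem Store.updC_ne (s : Store) {t t' : Fin 32} (h : t' ≠ t) (i : ℤ) (v : ℂ) :
    (s.updC t i v).C t' = s.C t' := by
  funext i'
  rw [Store.updC_C, if_neg fun h' => h h'.1]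

theorem Store.updI_C (s : Store) (t t' : Fin 32) (i v : ℤ) : (s.updI t i v).C t' = s.C t' := rfl

theorem Store.updC_I (s : Store) (t t' : Fin 32) (i : ℤ) (v : ℂ) : (s.updC t i v).I t' = s.I t' :=
  rfl

/-- The address of entry `e` of array `t`. -/
def loc (t : Fin 32) (e : IExp) : IExp := .add (.mul (.const 32) e) (.const (t : ℕ))

/-- Read an integer array. -/
def rI (t : Fin 32) (e : IExp) : IExp := .mem (loc t e)

/-- Read a complex array. -/
def rC (t : Fin 32) (e : IExp) : CExp := .mem (loc t e)

/-- Read an integer variable. -/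
def vI (t : Fin 32) : IExp := rI t (.const 0)

/-- Read a complex variable. -/
def vC (t : Fin 32) : CExp := rC t (.const 0)

/-- Write to an integer array. -/
def wI (t : Fin 32) (e v : IExp) : Prog := .setI (loc t e) v

/-- Write to a complex array. -/
def wC (t : Fin 32) (e : IExp) (v : CExp) : Prog := .setC (loc t e) v

/-- Query a sample into a complex array. -/
def qC (t : Fin 32) (e pos : IExp) : Prog := .query (loc t e) pos

variable {tp : ℤ → ℤ} {s : Store}

theorem eval_loc (t : Fin 32) (e : IExp) : (loc t e).eval tp s = 32 * e.eval tp s + (t : ℕ) := rfl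

theorem eval_rI (t : Fin 32) (e : IExp) : (rI t e).eval tp s = s.I t (e.eval tp s) := rfl

theorem eval_rC (t : Fin 32) (e : IExp) : (rC t e).eval tp s = s.C t (e.eval tp s) := rfl

theorem eval_vI (t : Fin 32) : (vI t).eval tp s = s.I t 0 := rfl

theorem eval_vC (t : Fin 32) : (vC t).eval tp s = s.C t 0 := rfl

theorem cost_rI (t : Fin 32) (e : IExp) : (rI t e).cost = e.cost + 5 := by
  simp only [rI, loc, IExp.cost]; ring

theorem cost_rC (t : Fin 32) (e : IExp) : (rC t e).cost = e.cost + 5 := by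
  simp only [rC, CExp.cost, loc, IExp.cost]; ring

theorem cost_vI (t : Fin 32) : (vI t).cost = 6 := rfl

theorem cost_vC (t : Fin 32) : (vC t).cost = 6 := rfl

end arrays

/-! ### A program logic with time and query bounds -/

section logic

/-- The two stores agree on all arrays outside the lists `LI` (integer) and `LC` (complex). -/
structure Frame (LI LC : List (Fin 32)) (s s' : Store) : Prop where
  I : ∀ t ∉ LI, s'.I t = s.I t
  C : ∀ t ∉ LC, s'.C t = s.C t

theorem Frame.refl (LI LC : List (Fin 32)) (s : Store) : Frame LI LC s s :=
  ⟨fun _ _ => rfl, fun _ _ => rfl⟩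

theorem Frame.trans {LI LC : List (Fin 32)} {s s' s'' : Store} (h : Frame LI LC s s')
    (h' : Frame LI LC s' s'') : Frame LI LC s s'' :=
  ⟨fun t ht => (h'.I t ht).trans (h.I t ht), fun t ht => (h'.C t ht).trans (h.C t ht)⟩

theorem Frame.mono {LI LC LI' LC' : List (Fin 32)} {s s' : Store} (h : Frame LI LC s s')
    (hI : LI ⊆ LI') (hC : LC ⊆ LC') : Frame LI' LC' s s' :=
  ⟨fun t ht => h.I t fun h' => ht (hI h'), fun t ht => h.C t fun h' => ht (hC h')⟩

theorem Frame.updI {LI LC : List (Fin 32)} {s s' : Store} (h : Frame LI LC s s') {t : Fin 32}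
    (ht : t ∈ LI) (i v : ℤ) : Frame LI LC s (s'.updI t i v) :=
  ⟨fun t' ht' => by rw [Store.updI_ne _ (fun h' => ht' (by rw [h']; exact ht))]; exact h.I t' ht',
    fun t' ht' => h.C t' ht'⟩

theorem Frame.updC {LI LC : List (Fin 32)} {s s' : Store} (h : Frame LI LC s s') {t : Fin 32}
    (ht : t ∈ LC) (i : ℤ) (v : ℂ) : Frame LI LC s (s'.updC t i v) :=
  ⟨fun t' ht' => h.I t' ht',
    fun t' ht' => by rw [Store.updC_ne _ (fun h' => ht' (by rw [h']; exact ht))]; exact h.C t' ht'⟩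

/-- The program writes only to the arrays in the lists `LI` and `LC`. -/
def WritesIn (LI LC : List (Fin 32)) : Prog → Prop
  | .skip => True
  | .setI a _ => ∃ t ∈ LI, ∃ e, a = loc t e
  | .setC a _ => ∃ t ∈ LC, ∃ e, a = loc t e
  | .query a _ => ∃ t ∈ LC, ∃ e, a = loc t e
  | .seq p q => WritesIn LI LC p ∧ WritesIn LI LC q
  | .ite _ p q => WritesIn LI LC p ∧ WritesIn LI LC q
  | .while _ p => WritesIn LI LC p

theorem writesIn_wI {LI LC : List (Fin 32)} {t : Fin 32} (e v : IExp) (h : t ∈ LI) :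
    WritesIn LI LC (wI t e v) := ⟨t, h, e, rfl⟩

theorem writesIn_wC {LI LC : List (Fin 32)} {t : Fin 32} (e : IExp) (v : CExp) (h : t ∈ LC) :
    WritesIn LI LC (wC t e v) := ⟨t, h, e, rfl⟩

theorem writesIn_qC {LI LC : List (Fin 32)} {t : Fin 32} (e v : IExp) (h : t ∈ LC) :
    WritesIn LI LC (qC t e v) := ⟨t, h, e, rfl⟩

theorem WritesIn.mono {LI LC LI' LC' : List (Fin 32)} {p : Prog} (h : WritesIn LI LC p)
    (hI : LI ⊆ LI') (hC : LC ⊆ LC') : WritesIn LI' LC' p := by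
  induction p with
  | skip => trivial
  | setI a v => obtain ⟨t, ht, e, he⟩ := h; exact ⟨t, hI ht, e, he⟩
  | setC a v => obtain ⟨t, ht, e, he⟩ := h; exact ⟨t, hC ht, e, he⟩
  | query a v => obtain ⟨t, ht, e, he⟩ := h; exact ⟨t, hC ht, e, he⟩
  | seq p q ihp ihq => exact ⟨ihp h.1, ihq h.2⟩
  | ite c p q ihp ihq => exact ⟨ihp h.1, ihq h.2⟩
  | _ c p ih => exact ih h

variable {W : ℝ} {smp : ℤ → ℂ} {tp : ℤ → ℤ}

theorem Exec.frame {LI LC : List (Fin 32)} {p : Prog} {s s' : Store} {t m : ℕ}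
    (h : Exec W smp tp p s s' t m) (hp : WritesIn LI LC p) : Frame LI LC s s' := by
  induction h with
  | skip s => exact Frame.refl _ _ _
  | setI a e s ha he =>
    obtain ⟨t, ht, e', rfl⟩ := hp
    exact (Frame.refl LI LC s).updI ht _ _
  | setC a z s ha =>
    obtain ⟨t, ht, e', rfl⟩ := hp
    exact (Frame.refl LI LC s).updC ht _ _
  | query a e s ha =>
    obtain ⟨t, ht, e', rfl⟩ := hp
    exact (Frame.refl LI LC s).updC ht _ _
  | seq _ _ ih1 ih2 => exact (ih1 hp.1).trans (ih2 hp.2)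
  | iteTrue _ _ ih => exact ih hp.1
  | iteFalse _ _ ih => exact ih hp.2
  | whileFalse _ => exact Frame.refl _ _ _
  | whileTrue _ _ _ ih1 ih2 => exact (ih1 hp).trans (ih2 hp)

variable (W smp tp) in
/-- Started in `s`, the program `p` halts in a store with the property `Q` after at most `τ` steps
and at most `κ` queries. -/
def Good (p : Prog) (s : Store) (Q : Store → Prop) (τ κ : ℕ) : Prop :=
  ∃ s' t m, Exec W smp tp p s s' t m ∧ Q s' ∧ t ≤ τ ∧ m ≤ κ

theorem Good.mono {p : Prog} {s : Store} {Q Q' : Store → Prop} {τ τ' κ κ' : ℕ}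
    (h : Good W smp tp p s Q τ κ) (hQ : ∀ s', Q s' → Q' s') (hτ : τ ≤ τ') (hκ : κ ≤ κ') :
    Good W smp tp p s Q' τ' κ' := by
  obtain ⟨s', t, m, h1, h2, h3, h4⟩ := h
  exact ⟨s', t, m, h1, hQ _ h2, h3.trans hτ, h4.trans hκ⟩

theorem Good.frame {p : Prog} {s : Store} {Q : Store → Prop} {τ κ : ℕ} {LI LC : List (Fin 32)}
    (h : Good W smp tp p s Q τ κ) (hp : WritesIn LI LC p) :
    Good W smp tp p s (fun s' => Q s' ∧ Frame LI LC s s') τ κ := by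
  obtain ⟨s', t, m, h1, h2, h3, h4⟩ := h
  exact ⟨s', t, m, h1, ⟨h2, h1.frame hp⟩, h3, h4⟩

theorem Good.frame_and {p : Prog} {s : Store} {Q Q' : Store → Prop} {τ κ : ℕ}
    {LI LC : List (Fin 32)} (hp : WritesIn LI LC p)
    (h : Good W smp tp p s (fun s' => Q s' ∧ Q' s') τ κ) :
    Good W smp tp p s (fun s' => Q s' ∧ Q' s' ∧ Frame LI LC s s') τ κ :=
  (h.frame hp).mono (fun _ h => ⟨h.1.1, h.1.2, h.2⟩) le_rfl le_rfl

theorem Good.skip {s : Store} {Q : Store → Prop} {τ κ : ℕ} (hQ : Q s) (hτ : 1 ≤ τ) :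
    Good W smp tp .skip s Q τ κ := ⟨s, 1, 0, .skip s, hQ, hτ, Nat.zero_le _⟩

theorem Good.seq {p q : Prog} {s : Store} {Q : Store → Prop} {τ τ' κ κ' : ℕ}
    (h : Good W smp tp p s (fun s' => Good W smp tp q s' Q τ' κ') τ κ) :
    Good W smp tp (.seq p q) s Q (τ + τ') (κ + κ') := by
  obtain ⟨s', t, m, h1, ⟨s'', t', m', h2, h3, h4, h5⟩, h6, h7⟩ := h
  exact ⟨s'', t + t', m + m', .seq h1 h2, h3, by omega, by omega⟩

theorem Good.ite {c : BExp} {p q : Prog} {s : Store} {Q : Store → Prop} {τ κ : ℕ}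
    (h1 : c.holds tp s → Good W smp tp p s Q τ κ) (h2 : ¬ c.holds tp s → Good W smp tp q s Q τ κ) :
    Good W smp tp (.ite c p q) s Q (c.cost + τ + 1) κ := by
  by_cases hc : c.holds tp s
  · obtain ⟨s', t, m, h3, h4, h5, h6⟩ := h1 hc
    exact ⟨s', _, m, .iteTrue hc h3, h4, by omega, h6⟩
  · obtain ⟨s', t, m, h3, h4, h5, h6⟩ := h2 hc
    exact ⟨s', _, m, .iteFalse hc h3, h4, by omega, h6⟩

theorem Good.while {c : BExp} {p : Prog} {Inv : ℕ → Store → Prop} {m τ : ℕ} {κ : ℕ → ℕ}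
    (hstep : ∀ j < m, ∀ s, Inv j s → c.holds tp s ∧ Good W smp tp p s (Inv (j + 1)) τ (κ j))
    (hend : ∀ s, Inv m s → ¬ c.holds tp s) {s : Store} (h0 : Inv 0 s) :
    Good W smp tp (.while c p) s (Inv m) (m * (c.cost + τ + 1) + (c.cost + 1))
      (∑ j ∈ Finset.range m, κ j) := by
  have key : ∀ i j, i + j = m → ∀ s, Inv j s → Good W smp tp (.while c p) s (Inv m)
      (i * (c.cost + τ + 1) + (c.cost + 1)) (∑ u ∈ Finset.Ico j m, κ u) := by
    intro i
    induction i with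
    | zero =>
      intro j hj s hs
      obtain rfl : j = m := by omega
      exact ⟨s, _, 0, .whileFalse (hend s hs), hs, by omega, Nat.zero_le _⟩
    | succ i ih =>
      intro j hj s hs
      obtain ⟨hc, s', t, q, h1, h2, h3, h4⟩ := hstep j (by omega) s hs
      obtain ⟨s'', t', q', h5, h6, h7, h8⟩ := ih (j + 1) (by omega) s' h2
      refine ⟨s'', _, _, .whileTrue hc h1 h5, h6, ?_, ?_⟩
      · rw [Nat.succ_mul]; omega
      · rw [← Finset.add_sum_Ioo_eq_sum_Ico (by omega : j < m),
          show Finset.Ioo j m = Finset.Ico (j + 1) m from by ext; simp]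
        omega
  have := key m 0 (by omega) s h0
  rwa [← Finset.range_eq_Ico] at this

/-- Write to an integer array: `Z` is an integral bound for the words. -/
theorem Good.writeI {Z : ℤ} (hZ : (Z : ℝ) ≤ W) {t : Fin 32} {e v : IExp} {s : Store}
    {Q : Store → Prop} {τ κ : ℕ} {i z : ℤ} (hi : e.eval tp s = i) (hz : v.eval tp s = z)
    (ha : 32 * |i| + 32 ≤ Z) (hv : |z| ≤ Z) (hQ : Q (s.updI t i z))
    (hτ : e.cost + v.cost + 5 ≤ τ) : Good W smp tp (wI t e v) s Q τ κ := by
  subst hi hz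
  have ht := t.2
  have cast : ∀ y : ℤ, |y| ≤ Z → |((y : ℤ) : ℝ)| ≤ W := fun y hy => by
    rw [← Int.cast_abs]; exact (Int.cast_le.mpr hy).trans hZ
  refine ⟨_, _, _, .setI _ _ _ (cast _ ?_) (cast _ hv), hQ, ?_, Nat.zero_le _⟩
  · rw [eval_loc]
    rw [abs_le]
    have := neg_abs_le (e.eval tp s)
    have := le_abs_self (e.eval tp s)
    constructor <;> omega
  · simp only [loc, IExp.cost]; omega

theorem Good.writeC {Z : ℤ} (hZ : (Z : ℝ) ≤ W) {t : Fin 32} {e : IExp} {v : CExp} {s : Store}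
    {Q : Store → Prop} {τ κ : ℕ} {i : ℤ} {z : ℂ} (hi : e.eval tp s = i) (hz : v.eval tp s = z)
    (ha : 32 * |i| + 32 ≤ Z) (hQ : Q (s.updC t i z))
    (hτ : e.cost + v.cost + 5 ≤ τ) : Good W smp tp (wC t e v) s Q τ κ := by
  subst hi hz
  have ht := t.2
  have cast : ∀ y : ℤ, |y| ≤ Z → |((y : ℤ) : ℝ)| ≤ W := fun y hy => by
    rw [← Int.cast_abs]; exact (Int.cast_le.mpr hy).trans hZ
  refine ⟨_, _, _, .setC _ _ _ (cast _ ?_), hQ, ?_, Nat.zero_le _⟩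
  · rw [eval_loc]
    rw [abs_le]
    have := neg_abs_le (e.eval tp s)
    have := le_abs_self (e.eval tp s)
    constructor <;> omega
  · simp only [loc, IExp.cost]; omega

theorem Good.queryC {Z : ℤ} (hZ : (Z : ℝ) ≤ W) {t : Fin 32} {e v : IExp} {s : Store}
    {Q : Store → Prop} {τ κ : ℕ} {i z : ℤ} (hi : e.eval tp s = i) (hz : v.eval tp s = z)
    (ha : 32 * |i| + 32 ≤ Z) (hQ : Q (s.updC t i (smp z)))
    (hτ : e.cost + v.cost + 5 ≤ τ) (hκ : 1 ≤ κ) : Good W smp tp (qC t e v) s Q τ κ := by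
  subst hi hz
  have ht := t.2
  have cast : ∀ y : ℤ, |y| ≤ Z → |((y : ℤ) : ℝ)| ≤ W := fun y hy => by
    rw [← Int.cast_abs]; exact (Int.cast_le.mpr hy).trans hZ
  refine ⟨_, _, _, .query _ _ _ (cast _ ?_), hQ, ?_, hκ⟩
  · rw [eval_loc]
    rw [abs_le]
    have := neg_abs_le (e.eval tp s)
    have := le_abs_self (e.eval tp s)
    constructor <;> omega
  · simp only [loc, IExp.cost]; omega

/-- `for i = 0, …, bound - 1 do body`. -/
def forProg (i : Fin 32) (bound : IExp) (body : Prog) : Prog :=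
  .seq (wI i (.const 0) (.const 0)) (.while (.ilt (vI i) bound)
    (.seq body (wI i (.const 0) (.add (vI i) (.const 1)))))

theorem writesIn_forProg {LI LC : List (Fin 32)} {i : Fin 32} {bound : IExp} {body : Prog}
    (hi : i ∈ LI) (h : WritesIn LI LC body) : WritesIn LI LC (forProg i bound body) :=
  ⟨writesIn_wI _ _ hi, h, writesIn_wI _ _ hi⟩

/-- The rule for loops with a counter. The frame condition is supplied by the syntax of the
body. -/
theorem Good.for {Z : ℤ} (hZ : (Z : ℝ) ≤ W) {i : Fin 32} {bound : IExp} {body : Prog}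
    {LI LC : List (Fin 32)} (hbody : WritesIn LI LC body) (hi : i ∉ LI) {s₀ : Store} {m : ℕ}
    (hbound : ∀ s, Frame (i :: LI) LC s₀ s → bound.eval tp s = m)
    (Inv : ℕ → Store → Prop) {τ τ' : ℕ} {κ : ℕ → ℕ}
    (hInv : ∀ j s v, Inv j s → Inv j (s.updI i 0 v))
    (h0 : Inv 0 s₀)
    (hstep : ∀ j < m, ∀ s, Frame (i :: LI) LC s₀ s → s.I i 0 = j → Inv j s →
      Good W smp tp body s (Inv (j + 1)) τ (κ j))
    (hm : (m : ℤ) ≤ Z) (hZ32 : 32 ≤ Z)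
    (hτ : m * (τ + bound.cost + 24) + bound.cost + 24 ≤ τ') :
    Good W smp tp (forProg i bound body) s₀
      (fun s => Inv m s ∧ Frame (i :: LI) LC s₀ s) τ' (∑ j ∈ Finset.range m, κ j) := by
  let J : ℕ → Store → Prop := fun j s => Frame (i :: LI) LC s₀ s ∧ s.I i 0 = j ∧ Inv j s
  have hw : ∀ s, J 0 s → Good W smp tp (.while (.ilt (vI i) bound)
    (.seq body (wI i (.const 0) (.add (vI i) (.const 1))))) s (J m)
      (m * ((BExp.ilt (vI i) bound).cost + (τ + 14) + 1) + ((BExp.ilt (vI i) bound).cost + 1))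
      (∑ j ∈ Finset.range m, (κ j + 0)) := by
    intro s hs
    refine Good.while ?_ ?_ hs
    · rintro j hj s ⟨hF, hij, hinv⟩
      refine ⟨?_, ?_⟩
      · simp only [BExp.holds, hbound s hF, eval_vI, hij]
        exact_mod_cast hj
      · refine Good.seq (((hstep j hj s hF hij hinv).frame hbody).mono ?_ le_rfl le_rfl)
        rintro s' ⟨h1, h2⟩
        have h3 : s'.I i 0 = j := by rw [h2.I i hi, hij]
        refine Good.writeI hZ (i := 0) (z := j + 1) rfl
          (by simp only [IExp.eval, eval_vI, h3]) (by simpa using hZ32)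
          (by rw [abs_of_nonneg (by positivity)]; omega) ⟨?_, ?_, ?_⟩ (by simp [IExp.cost, cost_vI])
        · exact (hF.trans (h2.mono (List.subset_cons_self _ _) fun _ h => h)).updI
            List.mem_cons_self _ _
        · rw [Store.updI_self]; push_cast; rfl
        · exact hInv _ _ _ h1
    · rintro s ⟨hF, hij, -⟩
      simp only [BExp.holds, hbound s hF, eval_vI, hij, lt_self_iff_false, not_false_iff]
  refine (Good.seq (τ := 8) (κ := 0) (Good.writeI hZ (i := 0) (z := 0) rfl rfl (by simpa using hZ32)
    (by simp; omega) (hw _ ⟨?_, ?_, ?_⟩) (by simp [IExp.cost]))).mono ?_ ?_ ?_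
  · exact (Frame.refl _ _ _).updI List.mem_cons_self _ _
  · rw [Store.updI_self]; rfl
  · exact hInv _ _ _ h0
  · rintro s ⟨h1, -, h2⟩
    exact ⟨h2, h1⟩
  · refine le_trans ?_ hτ
    simp only [BExp.cost, cost_vI]
    have : m * (6 + bound.cost + 1 + (τ + 14) + 1) ≤ m * (τ + bound.cost + 24) :=
      Nat.mul_le_mul_left m (by omega)
    omega
  · simp

/-- A loop that fills the entries `g x`, `x < m`, of a complex array `out`, which the expression
does not read. -/
theorem Good.tabulate {Z : ℤ} (hZ : (Z : ℝ) ≤ W) {i out : Fin 32} {bound idx : IExp} {e : CExp}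
    {s₀ : Store} {m : ℕ} (g : ℕ → ℤ) (val : ℕ → ℂ)
    (hbound : ∀ s, Frame [i] [out] s₀ s → bound.eval tp s = m)
    (hg : ∀ x < m, ∀ y < m, g x = g y → x = y)
    (hidx : ∀ x < m, ∀ s, Frame [i] [out] s₀ s → s.I i 0 = x → idx.eval tp s = g x)
    (hval : ∀ x < m, ∀ s, Frame [i] [out] s₀ s → s.I i 0 = x → e.eval tp s = val x)
    (hgZ : ∀ x < m, 32 * |g x| + 32 ≤ Z) (hm : (m : ℤ) ≤ Z) (hZ32 : 32 ≤ Z) {τ : ℕ}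
    (hτ : m * (idx.cost + e.cost + bound.cost + 29) + bound.cost + 24 ≤ τ) :
    Good W smp tp (forProg i bound (wC out idx e)) s₀
      (fun s => (∀ x < m, s.C out (g x) = val x) ∧
        (∀ z, (∀ x < m, z ≠ g x) → s.C out z = s₀.C out z) ∧ Frame [i] [out] s₀ s) τ 0 := by
  refine (Good.for hZ (LI := []) (LC := [out]) (τ := idx.cost + e.cost + 5) (κ := fun _ => 0)
    (writesIn_wC _ _ List.mem_cons_self) List.not_mem_nil hbound
    (fun j s => (∀ x < j, s.C out (g x) = val x) ∧
        (∀ z, (∀ x < m, z ≠ g x) → s.C out z = s₀.C out z)) ?_ ?_ ?_ hm hZ32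
    (by refine le_trans (le_of_eq ?_) hτ; ring)).mono ?_ le_rfl (by simp)
  · rintro j s v h; exact h
  · exact ⟨fun x hx => absurd hx (Nat.not_lt_zero _), fun _ _ => rfl⟩
  · rintro j hj s hF hij ⟨h1, h2⟩
    refine Good.writeC hZ (hidx j hj s hF hij) (hval j hj s hF hij) (hgZ j hj) ⟨?_, ?_⟩ le_rfl
    · intro x hx
      rw [Store.updC_C]
      rcases Nat.lt_succ_iff_lt_or_eq.mp hx with hx | rfl
      · rw [if_neg fun h => (by have := hg x (by omega) j hj h.2; omega)]
        exact h1 x hx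
      · rw [if_pos ⟨rfl, rfl⟩]
    · intro z hz
      rw [Store.updC_C, if_neg fun h => hz j hj h.2]
      exact h2 z hz
  · rintro s ⟨⟨h1, h2⟩, h3⟩; exact ⟨h1, h2, h3⟩

end logic

/-! ### The fast Fourier transform on flat arrays -/

section fftMath

/-- `exp (2 π i p / q)`, the value of the machine operation `root`. -/
def rootVal (p q : ℤ) : ℂ := Complex.exp (2 * Real.pi * Complex.I * (p : ℂ) / (q : ℂ))

theorem rootVal_add (p p' q : ℤ) : rootVal (p + p') q = rootVal p q * rootVal p' q := by
  rw [rootVal, rootVal, rootVal, ← Complex.exp_add]; push_cast; ring_nf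

theorem rootVal_mul_left (c p q : ℤ) (hc : c ≠ 0) : rootVal (c * p) (c * q) = rootVal p q := by
  have : (c : ℂ) ≠ 0 := by exact_mod_cast hc
  rw [rootVal, rootVal]; congr 1; push_cast
  rw [show 2 * (Real.pi : ℂ) * Complex.I * (c * p) = c * (2 * Real.pi * Complex.I * p) by ring,
    mul_div_mul_left _ _ this]

theorem rootVal_mul_self (p q : ℤ) : rootVal (q * p) q = 1 := by
  rcases eq_or_ne q 0 with rfl | hq
  · simp [rootVal]
  · have : (q : ℂ) ≠ 0 := by exact_mod_cast hq
    rw [rootVal, Complex.exp_eq_one_iff]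
    exact ⟨p, by push_cast; field_simp⟩

theorem rootVal_eq_om {l : ℕ} (p : ℤ) : rootVal p (2 ^ l : ℕ) = om (p : ZMod (2 ^ l)) := by
  rw [om_intCast, rootVal]; push_cast; rfl

/-- One stage of the transform: the radix-two butterfly in constant geometry. The `log₂ n` stages of
a round transform the most significant digit in base `n` and move it to the least significant
place, so that after `d` rounds all digits are transformed and in place. -/
def fftStep (sg : ℤ) (N q : ℕ) (a : ℕ → ℂ) (x : ℕ) : ℂ :=
  a (x % q + q * (x / (2 * q))) +
    rootVal (sg * (x % (2 * q) : ℕ)) (2 * q : ℕ) * a (x % q + q * (x / (2 * q)) + N / 2)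

theorem sum_range_mul (P n : ℕ) (f : ℕ → ℂ) :
    ∑ h ∈ Finset.range (P * n), f h =
      ∑ hi ∈ Finset.range P, ∑ i ∈ Finset.range n, f (hi * n + i) := by
  induction P with
  | zero => simp
  | succ P ih => rw [Nat.succ_mul, Finset.sum_range_add, ih, Finset.sum_range_succ]

/-- If `Z` holds, for each residue modulo `2 u` of the transformed digit, the transform over the `q`
values of that digit in this class, with the frequency at the least significant place, then one
stage halves the number of classes and doubles the length of the transforms. -/
theorem fftStep_spec (sg : ℤ) {q u M : ℕ} (hq : 0 < q) {Z A : ℕ → ℂ}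
    (hZ : ∀ j < q, ∀ rest < M, ∀ i < 2 * u, Z (j + q * (rest + M * i)) =
      ∑ h ∈ Finset.range q, A ((i + 2 * u * h) * M + rest) * rootVal (sg * (j * h)) q)
    (j : ℕ) (hj : j < 2 * q) (rest : ℕ) (hrest : rest < M) (i : ℕ) (hi : i < u) :
    fftStep sg (2 * q * u * M) q Z (j + 2 * q * (rest + M * i)) =
      ∑ h ∈ Finset.range (2 * q), A ((i + u * h) * M + rest) *
        rootVal (sg * (j * h)) (2 * q : ℕ) := by
  have e1 : (j + 2 * q * (rest + M * i)) % (2 * q) = j := by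
    rw [Nat.add_mul_mod_self_left, Nat.mod_eq_of_lt hj]
  have e2 : (j + 2 * q * (rest + M * i)) / (2 * q) = rest + M * i := by
    rw [Nat.add_mul_div_left _ _ (by omega), Nat.div_eq_of_lt hj, zero_add]
  have e3 : (j + 2 * q * (rest + M * i)) % q = j % q := by
    rw [show 2 * q * (rest + M * i) = q * (2 * (rest + M * i)) by ring, Nat.add_mul_mod_self_left]
  have e4 : 2 * q * u * M / 2 = q * (M * u) := by
    rw [show 2 * q * u * M = 2 * (q * (M * u)) by ring, Nat.mul_div_cancel_left _ (by norm_num)]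
  have hjq : j % q < q := Nat.mod_lt _ hq
  have hroot : ∀ h : ℕ, rootVal (sg * ((j % q : ℕ) * h)) q = rootVal (sg * (j * h)) q := by
    intro h
    have : (sg * (j * h) : ℤ) = sg * ((j % q : ℕ) * h) + q * (sg * ((j / q : ℕ) * h)) := by
      have h1 : (j : ℤ) = q * (j / q : ℕ) + (j % q : ℕ) := by exact_mod_cast (Nat.div_add_mod j q).symm
      conv_lhs => rw [h1]
      ring
    rw [this, rootVal_add, rootVal_mul_self, mul_one]
  have hq2 : ∀ p : ℤ, rootVal (2 * p) (2 * q : ℕ) = rootVal p q := fun p => by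
    push_cast; exact rootVal_mul_left 2 p q (by norm_num)
  rw [fftStep, e1, e2, e3, e4, show j % q + q * (rest + M * i) + q * (M * u) =
    j % q + q * (rest + M * (i + u)) by ring, hZ _ hjq _ hrest i (by omega),
    hZ _ hjq _ hrest (i + u) (by omega), mul_comm 2 q, sum_range_mul, Finset.mul_sum,
    ← Finset.sum_add_distrib]
  refine Finset.sum_congr rfl fun h _ => ?_
  rw [Finset.sum_range_succ, Finset.sum_range_one, hroot, mul_comm q 2]
  have r1 : rootVal (sg * (j * (h * 2 + 0 : ℕ))) (2 * q : ℕ) = rootVal (sg * (j * h)) q := by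
    rw [← hq2]; congr 1; push_cast; ring
  have r2 : rootVal (sg * (j * (h * 2 + 1 : ℕ))) (2 * q : ℕ) =
      rootVal (sg * j) (2 * q : ℕ) * rootVal (sg * (j * h)) q := by
    rw [← hq2, ← rootVal_add]; congr 1; push_cast; ring
  rw [r1, r2, show i + u * (h * 2 + 0) = i + 2 * u * h by ring,
    show i + u * (h * 2 + 1) = i + u + 2 * u * h by ring]
  ring

/-- The character of the first `s` digits in base `n`. -/
def digitChar (sg : ℤ) (n : ℕ) : ℕ → ℕ → ℕ → ℂ
  | 0, _, _ => 1
  | s + 1, a, b => rootVal (sg * ((a % n : ℕ) * (b % n : ℕ))) n * digitChar sg n s (a / n) (b / n)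

/-- One round: if the top digits of `X` have been transformed against the kernel `E` and moved to
the low places, then transforming the next digit in the same way extends the kernel by the
character of that digit. -/
theorem fft_round_spec (sg : ℤ) {n P Q : ℕ} (hn : 0 < n) {X A A' : ℕ → ℂ} {E : ℕ → ℕ → ℂ}
    (hA : ∀ lo < n * Q, ∀ jh < P, A (lo * P + jh) =
      ∑ hi ∈ Finset.range P, X (hi * (n * Q) + lo) * E hi jh)
    (hA' : ∀ j < n, ∀ rest < P * Q, A' (j + n * rest) =
      ∑ i ∈ Finset.range n, A (i * (P * Q) + rest) * rootVal (sg * (j * i)) n)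
    (lo : ℕ) (hlo : lo < Q) (y : ℕ) (hy : y < P * n) :
    A' (lo * (P * n) + y) = ∑ h ∈ Finset.range (P * n), X (h * Q + lo) *
      (rootVal (sg * ((h % n : ℕ) * (y % n : ℕ))) n * E (h / n) (y / n)) := by
  have hyP : y / n < P := Nat.div_lt_of_lt_mul (by rwa [mul_comm])
  have hrest : lo * P + y / n < P * Q := by
    calc lo * P + y / n < lo * P + P := by omega
      _ = (lo + 1) * P := by ring
      _ ≤ Q * P := Nat.mul_le_mul_right _ hlo
      _ = P * Q := mul_comm _ _
  have e1 : lo * (P * n) + y = y % n + n * (lo * P + y / n) := by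
    have := Nat.div_add_mod y n
    conv_lhs => rw [← this]
    ring
  rw [e1, hA' _ (Nat.mod_lt _ hn) _ hrest, sum_range_mul, Finset.sum_comm]
  refine Finset.sum_congr rfl fun i hi => ?_
  rw [Finset.mem_range] at hi
  have hlo' : i * Q + lo < n * Q := by
    calc i * Q + lo < i * Q + Q := by omega
      _ = (i + 1) * Q := by ring
      _ ≤ n * Q := Nat.mul_le_mul_right _ hi
  rw [show i * (P * Q) + (lo * P + y / n) = (i * Q + lo) * P + y / n by ring, hA _ hlo' _ hyP,
    Finset.sum_mul]
  refine Finset.sum_congr rfl fun h _ => ?_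
  have e2 : (h * n + i) % n = i := by
    rw [mul_comm, Nat.mul_add_mod, Nat.mod_eq_of_lt hi]
  have e3 : (h * n + i) / n = h := by
    rw [mul_comm, Nat.mul_add_div hn, Nat.div_eq_of_lt hi, add_zero]
  rw [e2, e3, show (h * n + i) * Q + lo = h * (n * Q) + (i * Q + lo) by ring,
    mul_comm ((y % n : ℕ) : ℤ) (i : ℤ)]
  ring

end fftMath

/-! ### Grid points as array positions -/

section flat

variable {l d : ℕ}

/-- The grid point at position `x` of a flat array. -/
def unflat (l d : ℕ) (x : ℕ) : Grid l d := fun s => ((x / (2 ^ l) ^ (s : ℕ) : ℕ) : ZMod (2 ^ l))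

theorem val_unflat (x : ℕ) (s : Fin d) :
    (unflat l d x s).val = x / (2 ^ l) ^ (s : ℕ) % 2 ^ l := by
  rw [unflat, ZMod.val_natCast]

theorem sum_digits_lt (n : ℕ) (g : ℕ → ℕ) (hg : ∀ s, g s < n) (d : ℕ) :
    ∑ s ∈ Finset.range d, g s * n ^ s < n ^ d := by
  induction d with
  | zero => simp
  | succ d ih =>
    rw [Finset.sum_range_succ, pow_succ]
    have h1 : g d * n ^ d + n ^ d ≤ n * n ^ d := by
      rw [← Nat.succ_mul]; exact Nat.mul_le_mul_right _ (hg d)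
    rw [mul_comm (n ^ d) n]
    omega

theorem sum_digits_eq_mod (n x d : ℕ) :
    ∑ s ∈ Finset.range d, (x / n ^ s % n) * n ^ s = x % n ^ d := by
  induction d with
  | zero => simp [Nat.mod_one]
  | succ d ih => rw [Finset.sum_range_succ, ih, pow_succ, Nat.mod_mul]; ring

/-- The position of a grid point as a natural number. -/
def flatNat (i : Grid l d) : ℕ := ∑ s : Fin d, (i s).val * (2 ^ l) ^ (s : ℕ)

theorem flatIndex_eq (i : Grid l d) : flatIndex i = (flatNat i : ℤ) := by
  rw [flatIndex, flatNat]; push_cast; rfl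

theorem flatNat_lt (i : Grid l d) : flatNat i < (2 ^ l) ^ d := by
  have h := sum_digits_lt (2 ^ l) (fun s => if h : s < d then (i ⟨s, h⟩).val else 0)
    (fun s => by split_ifs; exacts [ZMod.val_lt _, by positivity]) d
  rw [← Fin.sum_univ_eq_sum_range
    (fun s => (if h : s < d then (i ⟨s, h⟩).val else 0) * (2 ^ l) ^ s)] at h
  simpa [flatNat] using h

theorem flatNat_unflat {x : ℕ} (hx : x < (2 ^ l) ^ d) : flatNat (unflat l d x) = x := by
  simp only [flatNat, val_unflat]
  rw [Fin.sum_univ_eq_sum_range (fun s => x / (2 ^ l) ^ s % 2 ^ l * (2 ^ l) ^ s),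
    sum_digits_eq_mod, Nat.mod_eq_of_lt hx]

theorem unflat_bijective : Function.Bijective
    (fun x : Fin ((2 ^ l) ^ d) => unflat l d x) := by
  rw [Fintype.bijective_iff_injective_and_card]
  refine ⟨fun a b h => ?_, ?_⟩
  · have h1 := flatNat_unflat a.2
    have h2 := flatNat_unflat b.2
    simp only at h
    rw [h, h2] at h1
    exact Fin.ext h1.symm
  · rw [Fintype.card_fin, Fintype.card_pi]; simp

theorem unflat_flatNat (i : Grid l d) : unflat l d (flatNat i) = i := by
  obtain ⟨x, rfl⟩ := unflat_bijective.2 i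
  simp only [flatNat_unflat x.2]

theorem sum_grid_eq_sum_range (f : Grid l d → ℂ) :
    ∑ i : Grid l d, f i = ∑ x ∈ Finset.range ((2 ^ l) ^ d), f (unflat l d x) := by
  rw [← Fin.sum_univ_eq_sum_range (fun x => f (unflat l d x))]
  exact (unflat_bijective.sum_comp f).symm

theorem digitChar_eq_prod (sg : ℤ) (n s a b : ℕ) : digitChar sg n s a b =
    ∏ i ∈ Finset.range s, rootVal (sg * ((a / n ^ i % n : ℕ) * (b / n ^ i % n : ℕ))) n := by
  induction s generalizing a b with
  | zero => simp [digitChar]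
  | succ s ih =>
    rw [digitChar, Finset.prod_range_succ', ih, mul_comm]
    simp only [pow_zero, Nat.div_one, Nat.div_div_eq_div_mul, pow_succ']

theorem digitChar_eq_om (sg : ℤ) (a b : ℕ) :
    digitChar sg (2 ^ l) d a b = om ((sg : ZMod (2 ^ l)) * (unflat l d a ⬝ᵥ unflat l d b)) := by
  rw [digitChar_eq_prod, dotProduct, Finset.mul_sum, om_sum,
    ← Fin.prod_univ_eq_prod_range
      (fun i => rootVal (sg * ((a / (2 ^ l) ^ i % 2 ^ l : ℕ) * (b / (2 ^ l) ^ i % 2 ^ l : ℕ))) (2 ^ l : ℕ))]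
  refine Finset.prod_congr rfl fun s _ => ?_
  rw [rootVal_eq_om]
  congr 1
  have h : ∀ x : ℕ, ((x / (2 ^ l) ^ (s : ℕ) % 2 ^ l : ℕ) : ZMod (2 ^ l)) = unflat l d x s := fun x => by
    rw [← val_unflat, ZMod.natCast_zmod_val]
  rw [← h a, ← h b]
  simp only [Int.cast_mul, Int.cast_natCast]

end flat

/-! ### The arrays of the program -/

namespace IV

/-- The side `n` of the grid. -/
abbrev n : Fin 32 := 0
/-- The dimension `d`. -/
abbrev d : Fin 32 := 1
/-- The sparsity `k`. -/
abbrev k : Fin 32 := 2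
/-- The logarithm `l` of `n`. -/
abbrev l : Fin 32 := 3
/-- The length `N = n ^ d`. -/
abbrev N : Fin 32 := 4
/-- The logarithm of `N`. -/
abbrev logN : Fin 32 := 5
/-- The number of hashes. -/
abbrev r : Fin 32 := 6
/-- The bucket side `b`. -/
abbrev b : Fin 32 := 7
/-- The number of rounds. -/
abbrev T : Fin 32 := 8
/-- The powers of `n`. -/
abbrev pw : Fin 32 := 9
/-- A power of two. -/
abbrev q : Fin 32 := 10
/-- Counter of rounds over the dimensions. -/
abbrev fs : Fin 32 := 11
/-- Counter of stages. -/
abbrev fp : Fin 32 := 12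
/-- Counter of positions inside the transform. -/
abbrev fx : Fin 32 := 13
/-- Counter of hashes. -/
abbrev i : Fin 32 := 14
/-- Counter of positions. -/
abbrev x : Fin 32 := 15
/-- Counter of coordinates. -/
abbrev s : Fin 32 := 16
/-- Counter of coordinates. -/
abbrev t : Fin 32 := 17
/-- Inner accumulator. -/
abbrev acc : Fin 32 := 18
/-- Outer accumulator. -/
abbrev out : Fin 32 := 19
/-- Table of the positions from which a hash reads. -/
abbrev src : Fin 32 := 20
/-- Table of the buckets. -/
abbrev bucket : Fin 32 := 21
/-- Number of smaller entries. -/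
abbrev lt : Fin 32 := 22
/-- Number of smaller or equal entries. -/
abbrev le : Fin 32 := 23
/-- Counter of rounds of the algorithm. -/
abbrev round : Fin 32 := 24
/-- Counter of pairs of a hash and a position. -/
abbrev z : Fin 32 := 25
/-- Counter of hashes inside the search for the median. -/
abbrev j : Fin 32 := 26

end IV

namespace CV

/-- The accuracy `ε`. -/
abbrev eps : Fin 32 := 0
/-- The bound `R`. -/
abbrev R : Fin 32 := 1
/-- The noise bound `μ`. -/
abbrev mu : Fin 32 := 2
/-- The number `1 / √N`. -/
abbrev isq : Fin 32 := 3
/-- Table of the box kernel. -/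
abbrev box : Fin 32 := 4
/-- Table of the transformed filter. -/
abbrev filt : Fin 32 := 5
/-- The array that is transformed. -/
abbrev buf : Fin 32 := 6
/-- Auxiliary array of the transform. -/
abbrev buf2 : Fin 32 := 7
/-- The current approximation. -/
abbrev chi : Fin 32 := 8
/-- Table of the samples. -/
abbrev smp : Fin 32 := 9
/-- Table of the weights of the samples. -/
abbrev wt : Fin 32 := 10
/-- Table of the phases of the estimates. -/
abbrev ph : Fin 32 := 11
/-- Table of the estimates. -/
abbrev est : Fin 32 := 12
/-- The transform of the current approximation. -/
abbrev chihat : Fin 32 := 13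
/-- The squared threshold. -/
abbrev thr : Fin 32 := 14
/-- Accumulator. -/
abbrev acc : Fin 32 := 15
/-- Accumulator. -/
abbrev acc2 : Fin 32 := 16
/-- Real part of the median. -/
abbrev re : Fin 32 := 17
/-- Imaginary part of the median. -/
abbrev im : Fin 32 := 18

end CV

/-! ### The program for the fast Fourier transform -/

section fftProg

/-- The first position from which a stage reads. -/
def fftIdx : IExp :=
  .add (.mod (vI IV.fx) (vI IV.q)) (.mul (vI IV.q) (.div (vI IV.fx) (.mul (.const 2) (vI IV.q))))

/-- The value computed by a stage. -/
def fftVal (sg : ℤ) : CExp :=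
  .add (rC CV.buf fftIdx)
    (.mul (.root (.mul (.const sg) (.mod (vI IV.fx) (.mul (.const 2) (vI IV.q))))
        (.mul (.const 2) (vI IV.q)))
      (rC CV.buf (.add fftIdx (.div (vI IV.N) (.const 2)))))

/-- One stage of the transform, into the auxiliary array. -/
def fftStage (sg : ℤ) : Prog := forProg IV.fx (vI IV.N) (wC CV.buf2 (vI IV.fx) (fftVal sg))

/-- Copy the auxiliary array back. -/
def fftCopy : Prog := forProg IV.fx (vI IV.N) (wC CV.buf (vI IV.fx) (rC CV.buf2 (vI IV.fx)))

/-- The unnormalized transform of the array `buf` in place, with the sign `sg` in the exponent. -/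
def fftProg (sg : ℤ) : Prog :=
  forProg IV.fs (vI IV.d) (.seq (wI IV.q (.const 0) (.const 1))
    (forProg IV.fp (vI IV.l) (.seq (fftStage sg) (.seq fftCopy
      (wI IV.q (.const 0) (.mul (.const 2) (vI IV.q)))))))

theorem writesIn_fftBody (sg : ℤ) : WritesIn [IV.fx, IV.q] [CV.buf, CV.buf2]
    (.seq (fftStage sg) (.seq fftCopy (wI IV.q (.const 0) (.mul (.const 2) (vI IV.q))))) :=
  ⟨writesIn_forProg (by decide) (writesIn_wC _ _ (by decide)),
    writesIn_forProg (by decide) (writesIn_wC _ _ (by decide)), writesIn_wI _ _ (by decide)⟩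

theorem writesIn_fftRound (sg : ℤ) : WritesIn [IV.fp, IV.fx, IV.q] [CV.buf, CV.buf2]
    (.seq (wI IV.q (.const 0) (.const 1))
    (forProg IV.fp (vI IV.l) (.seq (fftStage sg) (.seq fftCopy
      (wI IV.q (.const 0) (.mul (.const 2) (vI IV.q))))))) :=
  ⟨writesIn_wI _ _ (by decide), writesIn_forProg (by decide)
    ((writesIn_fftBody sg).mono (by decide) (by decide))⟩

theorem writesIn_fftProg (sg : ℤ) :
    WritesIn [IV.fs, IV.fp, IV.fx, IV.q] [CV.buf, CV.buf2] (fftProg sg) :=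
  writesIn_forProg (by decide) ((writesIn_fftRound sg).mono (by decide) (by decide))

variable {W : ℝ} {smp : ℤ → ℂ} {tp : ℤ → ℤ} {Z : ℤ}

theorem fftStage_good (hZ : (Z : ℝ) ≤ W) (sg : ℤ) {N q : ℕ} (hN : 0 < N)
    (hNZ : 32 * (N : ℤ) + 32 ≤ Z) {s : Store} (hsN : s.I IV.N 0 = N) (hsq : s.I IV.q 0 = q) :
    Good W smp tp (fftStage sg) s (fun s' =>
      ∀ x < N, s'.C CV.buf2 x = fftStep sg N q (fun y => s.C CV.buf y) x) (300 * N) 0 := by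
  refine (Good.tabulate hZ (m := N) (fun x => (x : ℤ))
    (fun x => fftStep sg N q (fun y => s.C CV.buf y) x) ?_ ?_ ?_ ?_ ?_ ?_ ?_
    (τ := 300 * N) ?_).mono ?_ le_rfl le_rfl
  · intro s' hF
    rw [eval_vI, hF.I _ (by decide), hsN]
  · intro x _ y _ h; exact_mod_cast h
  · intro x _ s' _ hx
    rw [eval_vI, hx]
  · intro x _ s' hF hx
    have h1 := hF.I IV.q (by decide)
    have h2 := hF.I IV.N (by decide)
    have h3 := hF.C CV.buf (by decide)
    simp only [fftVal, fftIdx, CExp.eval, eval_rC, IExp.eval, eval_vI, hx, h1, h2, h3,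
      hsN, hsq, fftStep, rootVal]
    push_cast
    rfl
  · intro x hx
    rw [abs_of_nonneg (by positivity)]; omega
  · omega
  · omega
  · have : (fftVal sg).cost ≤ 200 := Nat.le_of_ble_eq_true rfl
    simp only [cost_vI]
    nlinarith
  · rintro s' ⟨h, -, -⟩; exact h

theorem fftCopy_good (hZ : (Z : ℝ) ≤ W) {N : ℕ} (hN : 0 < N)
    (hNZ : 32 * (N : ℤ) + 32 ≤ Z) {s : Store} (hsN : s.I IV.N 0 = N) :
    Good W smp tp fftCopy s (fun s' =>
      ∀ x < N, s'.C CV.buf x = s.C CV.buf2 x) (100 * N) 0 := by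
  refine (Good.tabulate hZ (m := N) (fun x => (x : ℤ))
    (fun x => s.C CV.buf2 x) ?_ ?_ ?_ ?_ ?_ ?_ ?_
    (τ := 100 * N) ?_).mono ?_ le_rfl le_rfl
  · intro s' hF
    rw [eval_vI, hF.I _ (by decide), hsN]
  · intro x _ y _ h; exact_mod_cast h
  · intro x _ s' _ hx
    rw [eval_vI, hx]
  · intro x _ s' hF hx
    rw [eval_rC, eval_vI, hx, hF.C _ (by decide)]
  · intro x hx
    rw [abs_of_nonneg (by positivity)]; omega
  · omega
  · omega
  · simp only [cost_vI, cost_rC]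
    omega
  · rintro s' ⟨h, -, -⟩; exact h

/-- The program computes the unnormalized transform, in `O(N log N)` steps. -/
theorem fftProg_good (hZ : (Z : ℝ) ≤ W) (sg : ℤ) {l d : ℕ} (hl : 1 ≤ l) (hd : 1 ≤ d)
    (hNZ : 32 * (((2 ^ l) ^ d : ℕ) : ℤ) + 32 ≤ Z) {s₀ : Store}
    (hsd : s₀.I IV.d 0 = d) (hsl : s₀.I IV.l 0 = l) (hsN : s₀.I IV.N 0 = ((2 ^ l) ^ d : ℕ))
    {y : Signal l d} (hy : ∀ x : ℕ, x < (2 ^ l) ^ d → s₀.C CV.buf x = y (unflat l d x)) :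
    Good W smp tp (fftProg sg) s₀ (fun s' =>
      (∀ x : ℕ, x < (2 ^ l) ^ d → s'.C CV.buf x =
        ∑ i : Grid l d, om ((sg : ZMod (2 ^ l)) * (i ⬝ᵥ unflat l d x)) * y i) ∧
      Frame [IV.fs, IV.fp, IV.fx, IV.q] [CV.buf, CV.buf2] s₀ s')
      (600 * (l * d) * (2 ^ l) ^ d) 0 := by
  set n := 2 ^ l with hn
  set N := n ^ d with hN
  have hnpos : 0 < n := by positivity
  have hNpos : 0 < N := by positivity
  have hnN : n ≤ N := Nat.le_self_pow (by omega) n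
  have hdN : d ≤ N := (Nat.lt_pow_self (Nat.one_lt_two_pow (by omega))).le
  have hlN : l ≤ N := (Nat.lt_two_pow_self).le.trans hnN
  let X : ℕ → ℂ := fun x => s₀.C CV.buf x
  refine (Good.for hZ (writesIn_fftRound sg) (by decide) (m := d) (s₀ := s₀) (i := IV.fs)
    (fun s hF => by rw [eval_vI, hF.I _ (by decide), hsd])
    (fun j s => ∀ lo < n ^ (d - j), ∀ jh < n ^ j, s.C CV.buf ((lo * n ^ j + jh : ℕ) : ℤ) =
      ∑ hi ∈ Finset.range (n ^ j), X (hi * n ^ (d - j) + lo) * digitChar sg n j hi jh)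
    (τ := 520 * l * N) (τ' := 600 * (l * d) * N) (κ := fun _ => 0)
    (fun j s v h => h) ?_ ?_ (by omega) (by omega) ?_).mono ?_ le_rfl (by simp)
  · intro lo hlo jh hjh
    obtain rfl : jh = 0 := by simpa using hjh
    simp [X, digitChar]
  · -- One round: transform the digit at the top of the position and move it to the bottom.
    intro j hj s hF _ hinv
    set P := n ^ j with hP
    set Q := n ^ (d - (j + 1)) with hQ
    have hPpos : 0 < P := by positivity
    have hnQ : n ^ (d - j) = n * Q := by
      rw [hQ, ← pow_succ']; congr 1; omega
    have hNPQ : N = n * (P * Q) := by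
      rw [hN, hP, hQ, ← pow_add, ← pow_succ']; congr 1; omega
    have hsN' : s.I IV.N 0 = N := by rw [hF.I _ (by decide), hsN]
    have hsl' : s.I IV.l 0 = l := by rw [hF.I _ (by decide), hsl]
    let A : ℕ → ℂ := fun x => s.C CV.buf x
    refine (Good.seq (τ := 20) (τ' := 490 * l * N) (κ := 0) (κ' := 0)
      (Good.writeI hZ (i := 0) (z := 1) rfl rfl (by simp; omega) (by simp; omega) ?_
        (by simp [IExp.cost]))).mono (fun _ h => h) ?_ le_rfl
    swap
    · have : 1 ≤ l * N := Nat.mul_pos hl hNpos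
      nlinarith
    refine (Good.for hZ (writesIn_fftBody sg) (by decide) (m := l) (i := IV.fp)
      (fun s' hF' => by
        rw [eval_vI, hF'.I _ (by decide), Store.updI_ne _ (by decide), hsl'])
      (fun p s' => s'.I IV.q 0 = (2 ^ p : ℕ) ∧
        ∀ j < 2 ^ p, ∀ rest < P * Q, ∀ i < 2 ^ (l - p),
          s'.C CV.buf ((j + 2 ^ p * (rest + P * Q * i) : ℕ) : ℤ) =
            ∑ h ∈ Finset.range (2 ^ p), A ((i + 2 ^ (l - p) * h) * (P * Q) + rest) *
              rootVal (sg * (j * h)) (2 ^ p : ℕ))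
      (τ := 430 * N) (τ' := 490 * l * N) (κ := fun _ => 0) ?_ ?_ ?_
      (by omega) (by omega) ?_).mono ?_ le_rfl (by simp)
    · rintro p s' v ⟨h1, h2⟩
      exact ⟨by rw [Store.updI_ne _ (by decide), h1], h2⟩
    · refine ⟨by rw [Store.updI_self]; norm_num, ?_⟩
      intro j' hj' rest hrest i hi
      obtain rfl : j' = 0 := by simpa using hj'
      simp only [pow_zero, Finset.range_one, Finset.sum_singleton, mul_zero, add_zero, A,
        Store.updI_C]
      rw [show (0 : ℕ) + 1 * (rest + P * Q * i) = i * (P * Q) + rest by ring]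
      simp [rootVal]
    · -- One stage: double the length of the transforms inside the round.
      rintro p hp s' hF' - ⟨hq', hinv'⟩
      set u := 2 ^ (l - (p + 1)) with hu
      have hu2 : 2 ^ (l - p) = 2 * u := by rw [hu, ← pow_succ']; congr 1; omega
      have hNu : N = 2 * 2 ^ p * u * (P * Q) := by
        have hnu : n = 2 * 2 ^ p * u := by
          rw [hn, hu, ← pow_succ', ← pow_add]
          congr 1; omega
        rw [hNPQ, hnu]
      have hsN'' : s'.I IV.N 0 = N := by
        rw [hF'.I _ (by decide), Store.updI_ne _ (by decide), hsN']
      refine (Good.seq (τ := 300 * N) (τ' := 130 * N) (κ := 0) (κ' := 0)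
        (((fftStage_good hZ sg hNpos hNZ hsN'' hq').frame (LI := [IV.fx]) (LC := [CV.buf2])
          (writesIn_forProg (by decide) (writesIn_wC _ _ (by decide)))).mono ?_
          le_rfl le_rfl)).mono (fun _ h => h) (by omega) le_rfl
      rintro s1 ⟨h1, hF1⟩
      have hsN1 : s1.I IV.N 0 = N := by rw [hF1.I _ (by decide), hsN'']
      refine (Good.seq (τ := 100 * N) (τ' := 30) (κ := 0) (κ' := 0)
        (((fftCopy_good hZ hNpos hNZ hsN1).frame (LI := [IV.fx]) (LC := [CV.buf])
          (writesIn_forProg (by decide) (writesIn_wC _ _ (by decide)))).mono ?_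
          le_rfl le_rfl)).mono (fun _ h => h) (by omega) le_rfl
      rintro s2 ⟨h2, hF2⟩
      have hq2 : s2.I IV.q 0 = (2 ^ p : ℕ) := by
        rw [hF2.I _ (by decide), hF1.I _ (by decide), hq']
      have h2pn : 2 ^ (p + 1) ≤ n := Nat.pow_le_pow_right (by norm_num) hp
      refine Good.writeI hZ (i := 0) (z := (2 ^ (p + 1) : ℕ)) rfl ?_ (by simp; omega) ?_ ⟨?_, ?_⟩
        (by simp [IExp.cost, cost_vI])
      · simp only [IExp.eval, eval_vI, hq2]; push_cast; ring
      · rw [abs_of_nonneg (by positivity)]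
        exact (Int.ofNat_le.mpr h2pn).trans (by omega)
      · rw [Store.updI_self]
      · intro j' hj' rest hrest i hi
        rw [Store.updI_C]
        have hj'' : j' < 2 * 2 ^ p := by rw [← pow_succ']; exact hj'
        have hlt : j' + 2 ^ (p + 1) * (rest + P * Q * i) < N := by
          have hb1 : rest + P * Q * i < u * (P * Q) := by
            calc rest + P * Q * i < P * Q + P * Q * i := by omega
              _ = (i + 1) * (P * Q) := by ring
              _ ≤ _ := Nat.mul_le_mul_right _ hi
          calc _ < 2 ^ (p + 1) + 2 ^ (p + 1) * (rest + P * Q * i) := by omega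
            _ = 2 ^ (p + 1) * (rest + P * Q * i + 1) := by ring
            _ ≤ 2 ^ (p + 1) * (u * (P * Q)) := Nat.mul_le_mul_left _ hb1
            _ = N := by rw [hNu]; ring
        rw [h2 _ hlt, h1 _ hlt, hNu, pow_succ' 2 p]
        exact fftStep_spec sg (by positivity) (fun j hj rest hrest i hi => by
          rw [hinv' j hj rest hrest i (by rw [hu2]; exact hi), hu2]) j' hj'' rest hrest i hi
    · simp only [cost_vI]
      have : 1 ≤ l * N := Nat.mul_pos hl hNpos
      nlinarith
    · rintro s' ⟨⟨-, h1⟩, -⟩ lo hlo jh hjh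
      rw [Nat.sub_self, pow_zero] at h1
      rw [pow_succ] at hjh ⊢
      have h2 := fft_round_spec sg hnpos (X := X) (A := A) (A' := fun x => s'.C CV.buf x)
        (E := digitChar sg n j) (P := P) (Q := Q)
        (fun lo hlo jh hjh => by rw [← hnQ]; exact hinv lo (by rw [hnQ]; exact hlo) jh hjh)
        (fun j' hj' rest hrest => by
          have := h1 j' hj' rest hrest 0 (by norm_num)
          simpa [hn] using this) lo hlo jh hjh
      exact h2
  · simp only [cost_vI]
    have : 1 ≤ l * N := Nat.mul_pos hl hNpos
    have : 1 ≤ d * (l * N) := Nat.mul_pos hd this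
    nlinarith
  · rintro s' ⟨h1, h2⟩
    refine ⟨fun x hx => ?_, h2⟩
    have h3 := h1 0 (by positivity) x hx
    rw [Nat.zero_mul, zero_add] at h3
    rw [h3, sum_grid_eq_sum_range]
    refine Finset.sum_congr rfl fun h hh => ?_
    rw [Nat.sub_self, pow_zero, mul_one, add_zero, digitChar_eq_om, mul_comm]
    simp only [X]
    rw [hy h (Finset.mem_range.mp hh)]

end fftProg

/-! ### Bilinear forms in the random data -/

section bilinear

variable {W : ℝ} {smp : ℤ → ℂ} {tp : ℤ → ℤ} {Z : ℤ} {l d C : ℕ}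

/-- The basic integer variables have their intended values. -/
structure Scalars (l d C : ℕ) (s : Store) : Prop where
  n_eq : s.I IV.n 0 = (2 ^ l : ℕ)
  d_eq : s.I IV.d 0 = d
  l_eq : s.I IV.l 0 = l
  N_eq : s.I IV.N 0 = ((2 ^ l) ^ d : ℕ)
  r_eq : s.I IV.r 0 = numHashes C l d
  pw_eq : ∀ j : ℕ, j ≤ d → s.I IV.pw j = ((2 ^ l) ^ j : ℕ)

theorem Scalars.frame {s s' : Store} {LI LC : List (Fin 32)} (h : Scalars l d C s)
    (hF : Frame LI LC s s')
    (hd : ∀ t ∈ [IV.n, IV.d, IV.l, IV.N, IV.r, IV.pw], t ∉ LI) : Scalars l d C s' := by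
  constructor
  · rw [hF.I _ (hd _ (by decide))]; exact h.n_eq
  · rw [hF.I _ (hd _ (by decide))]; exact h.d_eq
  · rw [hF.I _ (hd _ (by decide))]; exact h.l_eq
  · rw [hF.I _ (hd _ (by decide))]; exact h.N_eq
  · rw [hF.I _ (hd _ (by decide))]; exact h.r_eq
  · intro j hj; rw [hF.I _ (hd _ (by decide))]; exact h.pw_eq j hj

/-- The accumulation `out := upd (∑ t, M * v)` over the rows, with inner sums modulo `n`. -/
def bilProg (M v upd : IExp) : Prog :=
  .seq (wI IV.out (.const 0) (.const 0)) (forProg IV.s (vI IV.d)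
    (.seq (wI IV.acc (.const 0) (.const 0))
      (.seq (forProg IV.t (vI IV.d)
        (wI IV.acc (.const 0) (.mod (.add (vI IV.acc) (.mul M v)) (vI IV.n))))
        (wI IV.out (.const 0) upd))))

theorem writesIn_bilBody (M v upd : IExp) : WritesIn [IV.t, IV.acc, IV.out] []
    (.seq (wI IV.acc (.const 0) (.const 0))
      (.seq (forProg IV.t (vI IV.d)
        (wI IV.acc (.const 0) (.mod (.add (vI IV.acc) (.mul M v)) (vI IV.n))))
        (wI IV.out (.const 0) upd))) :=
  ⟨writesIn_wI _ _ (by decide), writesIn_forProg (by decide) (writesIn_wI _ _ (by decide)),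
    writesIn_wI _ _ (by decide)⟩

theorem writesIn_bilProg (M v upd : IExp) :
    WritesIn [IV.s, IV.t, IV.acc, IV.out] [] (bilProg M v upd) :=
  ⟨writesIn_wI _ _ (by decide), writesIn_forProg (by decide)
    ((writesIn_bilBody M v upd).mono (by decide) (by decide))⟩

/-- Extension by zero of a function on `Fin d`. -/
def extend {β : Type*} [Zero β] (f : Fin d → β) (j : ℕ) : β := if h : j < d then f ⟨j, h⟩ else 0

theorem sum_range_extend {β : Type*} [AddCommMonoid β] (f : Fin d → β) :
    ∑ j ∈ Finset.range d, extend f j = ∑ j, f j := by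
  rw [← Fin.sum_univ_eq_sum_range (extend f)]
  simp [extend]

theorem extend_of_lt {β : Type*} [Zero β] (f : Fin d → β) {j : ℕ} (h : j < d) :
    extend f j = f ⟨j, h⟩ := dif_pos h

/-- The accumulator holds the row sum `∑ b, m a b` when `upd` is evaluated, and `P` lists the values
of the outer accumulator after each row. The cost is `O(d²)`, with all integers bounded by `Z`. -/
theorem bilProg_good (hZ : (Z : ℝ) ≤ W) {M v upd : IExp} {s₀ : Store} (hs : Scalars l d C s₀)
    (hd : 1 ≤ d) (m : Fin d → Fin d → ZMod (2 ^ l)) (P : ℕ → ℤ)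
    (hM : ∀ a b : Fin d, ∀ s, Frame [IV.s, IV.t, IV.acc, IV.out] [] s₀ s →
      s.I IV.s 0 = (a : ℕ) → s.I IV.t 0 = (b : ℕ) →
      ((M.eval tp s * v.eval tp s : ℤ) : ZMod (2 ^ l)) = m a b)
    (hU : ∀ a : Fin d, ∀ s, Frame [IV.s, IV.t, IV.acc, IV.out] [] s₀ s →
      s.I IV.s 0 = (a : ℕ) → s.I IV.acc 0 = ((∑ b, m a b).val : ℕ) →
      s.I IV.out 0 = P a → upd.eval tp s = P (a + 1))
    (hP0 : P 0 = 0) (hPZ : ∀ a ≤ d, |P a| ≤ Z)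
    (hnZ : ((2 ^ l : ℕ) : ℤ) ≤ Z) (hdZ : (d : ℤ) ≤ Z) (hZ32 : 32 ≤ Z)
    (hc : M.cost + v.cost ≤ 200) (hcu : upd.cost ≤ 100) :
    Good W smp tp (bilProg M v upd) s₀ (fun s' => s'.I IV.out 0 = P d ∧
      Frame [IV.s, IV.t, IV.acc, IV.out] [] s₀ s') (600 * (d * d)) 0 := by
  have hn1 : (0 : ℤ) < (2 ^ l : ℕ) := by positivity
  have hdd : d ≤ d * d := Nat.le_mul_self d
  refine (Good.frame (Good.seq (τ := 10) (τ' := 590 * (d * d)) (κ := 0) (κ' := 0)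
    (Good.writeI hZ (i := 0) (z := 0) rfl rfl (by simpa using hZ32) (by simp; omega) ?_
      (by simp [IExp.cost]))) (writesIn_bilProg M v upd)).mono (fun _ h => h) (by nlinarith) le_rfl
  set s1 := s₀.updI IV.out 0 0 with hs1
  have hF1 : Frame [IV.s, IV.t, IV.acc, IV.out] [] s₀ s1 := (Frame.refl _ _ _).updI (by decide) _ _
  refine (Good.for hZ (writesIn_bilBody M v upd) (by decide) (m := d)
    (fun s hF => by rw [eval_vI, hF.I _ (by decide), hF1.I _ (by decide), hs.d_eq])
    (fun a s => s.I IV.out 0 = P a) (τ := 500 * d) (τ' := 590 * (d * d)) (κ := fun _ => 0)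
    ?_ ?_ ?_ hdZ hZ32 (by simp only [cost_vI]; nlinarith)).mono (fun s h => h.1) le_rfl (by simp)
  · intro j s v h
    rwa [Store.updI_ne _ (by decide)]
  · rw [hs1, Store.updI_self, hP0]
  · intro a ha s hF hsa hout
    have hF' : Frame [IV.s, IV.t, IV.acc, IV.out] [] s₀ s := hF1.trans hF
    refine (Good.seq (τ := 10) (τ' := 480 * d) (κ := 0) (κ' := 0)
      (Good.writeI hZ (i := 0) (z := 0) rfl rfl (by simpa using hZ32) (by simp; omega) ?_
      (by simp [IExp.cost]))).mono (fun _ h => h) (by omega) le_rfl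
    set s2 := s.updI IV.acc 0 0 with hs2
    have hF2 : Frame [IV.s, IV.t, IV.acc, IV.out] [] s₀ s2 := hF'.updI (by decide) _ _
    have hstep : ∀ (s' : Store), s'.I IV.out 0 = P a → s'.I IV.s 0 = a →
        s'.I IV.acc 0 = ((∑ b, m ⟨a, ha⟩ b).val : ℕ) →
        Frame [IV.s, IV.t, IV.acc, IV.out] [] s₀ s' →
        Good W smp tp (wI IV.out (.const 0) upd) s' (fun s => s.I IV.out 0 = P (a + 1)) 110 0 := by
      intro s' h1 h2 h3 h4
      exact Good.writeI hZ (i := 0) (z := P (a + 1)) rfl (hU ⟨a, ha⟩ s' h4 h2 h3 h1)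
        (by simpa using hZ32) (hPZ _ ha) (Store.updI_self _ _ _ _)
        (by simp only [IExp.cost]; omega)
    refine (Good.seq (τ := 300 * d + 30) (τ' := 110) (κ := 0) (κ' := 0)
      ((Good.for hZ (LI := [IV.acc]) (LC := []) (writesIn_wI _ _ (by decide)) (by decide) (m := d)
      (fun s hF => by rw [eval_vI, hF.I _ (by decide), hF2.I _ (by decide), hs.d_eq])
      (fun b s => s.I IV.acc 0 =
        ((∑ b ∈ Finset.range b, extend (m ⟨a, ha⟩) b : ZMod (2 ^ l)).val : ℕ))
      (τ := 230) (τ' := 300 * d + 30) (κ := fun _ => 0)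
      ?_ ?_ ?_ hdZ hZ32 (by simp only [cost_vI]; omega)).mono ?_ le_rfl (by simp))).mono
      (fun _ h => h) (by omega) le_rfl
    · intro j s v h
      rwa [Store.updI_ne _ (by decide)]
    · rw [hs2, Store.updI_self]; simp
    · intro b hb s3 hF3 hsb hacc
      have hF4 : Frame [IV.s, IV.t, IV.acc, IV.out] [] s₀ s3 :=
        hF2.trans (hF3.mono (by decide) (by decide))
      have hsa3 : s3.I IV.s 0 = a := by
        rw [hF3.I _ (by decide), hs2, Store.updI_ne _ (by decide), hsa]
      have hval := hM ⟨a, ha⟩ ⟨b, hb⟩ s3 hF4 hsa3 hsb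
      have hn3 : s3.I IV.n 0 = (2 ^ l : ℕ) := by rw [hF4.I _ (by decide), hs.n_eq]
      refine Good.writeI hZ (i := 0)
        (z := ((∑ b ∈ Finset.range (b + 1), extend (m ⟨a, ha⟩) b : ZMod (2 ^ l)).val : ℕ)) rfl ?_
        (by simpa using hZ32) ?_ (Store.updI_self _ _ _ _) ?_
      · simp only [IExp.eval, eval_vI, hacc, hn3]
        rw [Finset.sum_range_succ, extend_of_lt _ hb, ← hval, ← ZMod.val_intCast]
        push_cast
        rw [ZMod.natCast_zmod_val]
      · rw [abs_of_nonneg (by positivity)]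
        have := ZMod.val_lt (∑ b ∈ Finset.range (b + 1), extend (m ⟨a, ha⟩) b)
        omega
      · simp only [IExp.cost, cost_vI]; omega
    · rintro s' ⟨h1, h2⟩
      refine hstep s' ?_ ?_ ?_ (hF2.trans (h2.mono (by decide) (by decide)))
      · rw [h2.I _ (by decide), hs2, Store.updI_ne _ (by decide), hout]
      · rw [h2.I _ (by decide), hs2, Store.updI_ne _ (by decide), hsa]
      · rw [h1, sum_range_extend]

/-- The position of the grid point with the coordinates `∑ t, M * v`. -/
def bilFlat (M v : IExp) : Prog :=
  bilProg M v (.add (vI IV.out) (.mul (vI IV.acc) (rI IV.pw (vI IV.s))))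

theorem bilFlat_good (hZ : (Z : ℝ) ≤ W) {M v : IExp} {s₀ : Store} (hs : Scalars l d C s₀)
    (hd : 1 ≤ d) (m : Fin d → Fin d → ZMod (2 ^ l))
    (hM : ∀ a b : Fin d, ∀ s, Frame [IV.s, IV.t, IV.acc, IV.out] [] s₀ s →
      s.I IV.s 0 = (a : ℕ) → s.I IV.t 0 = (b : ℕ) →
      ((M.eval tp s * v.eval tp s : ℤ) : ZMod (2 ^ l)) = m a b)
    (hNZ : (((2 ^ l) ^ d : ℕ) : ℤ) ≤ Z) (hdZ : (d : ℤ) ≤ Z) (hZ32 : 32 ≤ Z)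
    (hc : M.cost + v.cost ≤ 200) :
    Good W smp tp (bilFlat M v) s₀ (fun s' =>
      s'.I IV.out 0 = flatIndex (fun a => ∑ b, m a b) ∧
      Frame [IV.s, IV.t, IV.acc, IV.out] [] s₀ s') (600 * (d * d)) 0 := by
  let w : Fin d → ℕ := fun a => (∑ b, m a b).val
  have hw : ∀ s, extend w s < 2 ^ l := fun s => by
    unfold extend
    split_ifs
    · exact ZMod.val_lt _
    · positivity
  have hnN : 2 ^ l ≤ (2 ^ l) ^ d := Nat.le_self_pow (by omega) _
  refine (bilProg_good hZ hs hd m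
    (fun a => ((∑ s ∈ Finset.range a, extend w s * (2 ^ l) ^ s : ℕ) : ℤ)) hM ?_ (by simp) ?_
    ?_ hdZ hZ32 hc (by simp [IExp.cost, cost_vI, cost_rI])).mono ?_ le_rfl le_rfl
  · intro a s hF hsa hacc hout
    have hp : s.I IV.pw (a : ℕ) = ((2 ^ l) ^ (a : ℕ) : ℕ) := by
      rw [hF.I _ (by decide), hs.pw_eq _ a.2.le]
    simp only [IExp.eval, eval_vI, eval_rI, hsa, hacc, hout, hp]
    rw [Finset.sum_range_succ, extend_of_lt _ a.2]
    push_cast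
    rfl
  · intro a ha
    rw [abs_of_nonneg (by positivity)]
    have h1 := sum_digits_lt (2 ^ l) (extend w) hw a
    have h2 : (2 ^ l) ^ a ≤ (2 ^ l) ^ d := Nat.pow_le_pow_right (by positivity) ha
    exact le_trans (Int.ofNat_le.mpr (h1.le.trans h2)) hNZ
  · exact le_trans (Int.ofNat_le.mpr hnN) hNZ
  · rintro s ⟨h1, h2⟩
    refine ⟨?_, h2⟩
    rw [h1, flatIndex_eq, flatNat, ← Fin.sum_univ_eq_sum_range (fun s => extend w s * (2 ^ l) ^ s)]
    congr 1
    refine Finset.sum_congr rfl fun a _ => ?_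
    rw [extend_of_lt _ a.2]

/-- The residue `∑ s, c * ∑ t, M * v` modulo `n`. -/
def bilDot (M v c : IExp) : Prog :=
  bilProg M v (.mod (.add (vI IV.out) (.mul c (vI IV.acc))) (vI IV.n))

theorem bilDot_good (hZ : (Z : ℝ) ≤ W) {M v c : IExp} {s₀ : Store} (hs : Scalars l d C s₀)
    (hd : 1 ≤ d) (m : Fin d → Fin d → ZMod (2 ^ l)) (γ : Fin d → ZMod (2 ^ l))
    (hM : ∀ a b : Fin d, ∀ s, Frame [IV.s, IV.t, IV.acc, IV.out] [] s₀ s →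
      s.I IV.s 0 = (a : ℕ) → s.I IV.t 0 = (b : ℕ) →
      ((M.eval tp s * v.eval tp s : ℤ) : ZMod (2 ^ l)) = m a b)
    (hγ : ∀ a : Fin d, ∀ s, Frame [IV.s, IV.t, IV.acc, IV.out] [] s₀ s →
      s.I IV.s 0 = (a : ℕ) → ((c.eval tp s : ℤ) : ZMod (2 ^ l)) = γ a)
    (hnZ : ((2 ^ l : ℕ) : ℤ) ≤ Z) (hdZ : (d : ℤ) ≤ Z) (hZ32 : 32 ≤ Z)
    (hc : M.cost + v.cost ≤ 200) (hcc : c.cost ≤ 70) :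
    Good W smp tp (bilDot M v c) s₀ (fun s' =>
      s'.I IV.out 0 = ((γ ⬝ᵥ fun a => ∑ b, m a b).val : ℕ) ∧
      Frame [IV.s, IV.t, IV.acc, IV.out] [] s₀ s') (600 * (d * d)) 0 := by
  refine (bilProg_good hZ hs hd m
    (fun a => ((∑ s ∈ Finset.range a, extend (fun a => γ a * ∑ b, m a b) s : ZMod (2 ^ l)).val : ℤ))
    hM ?_ (by simp) ?_ hnZ hdZ hZ32 hc (by simp only [IExp.cost, cost_vI]; omega)).mono
    ?_ le_rfl le_rfl
  · intro a s hF hsa hacc hout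
    have hn : s.I IV.n 0 = (2 ^ l : ℕ) := by rw [hF.I _ (by decide), hs.n_eq]
    simp only [IExp.eval, eval_vI, hacc, hout, hn]
    rw [Finset.sum_range_succ, extend_of_lt _ a.2, ← hγ a s hF hsa, ← ZMod.val_intCast]
    push_cast
    rw [ZMod.natCast_zmod_val, ZMod.natCast_zmod_val]
  · intro a ha
    rw [abs_of_nonneg (by positivity)]
    have := ZMod.val_lt (∑ s ∈ Finset.range a, extend (fun a => γ a * ∑ b, m a b) s)
    omega
  · rintro s ⟨h1, h2⟩
    refine ⟨?_, h2⟩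
    rw [h1, sum_range_extend]
    rfl

end bilinear

/-! ### The tables of the hashes, and the queries -/

section tables

variable {W : ℝ} {smp : ℤ → ℂ} {tp : ℤ → ℤ} {Z : ℤ} {l d C : ℕ}

/-- Digit number `t` of the position `x`. -/
def digitE (t : Fin 32) : IExp := .mod (.div (vI IV.x) (rI IV.pw (vI t))) (vI IV.n)

/-- Start of the block of the current hash on the random tape. -/
def baseE : IExp := .mul (vI IV.i) (.add (.mul (vI IV.d) (vI IV.d)) (.mul (.const 2) (vI IV.d)))

/-- Entry of the random matrix. -/
def tapeM (s t : Fin 32) : IExp := .tape (.add (.add baseE (.mul (vI s) (vI IV.d))) (vI t))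

/-- Entry of the random shift `a`. -/
def tapeA (s : Fin 32) : IExp := .tape (.add (.add baseE (.mul (vI IV.d) (vI IV.d))) (vI s))

/-- Entry of the random shift `q`. -/
def tapeQ (s : Fin 32) : IExp :=
  .tape (.add (.add (.add baseE (.mul (vI IV.d) (vI IV.d))) (vI IV.d)) (vI s))

/-- Fill in the entries of the tables for one hash and one position. A sample is queried only if the
transformed filter does not vanish there. -/
def tableBody : Prog :=
  .seq (wI IV.i (.const 0) (.div (vI IV.z) (vI IV.N)))
  (.seq (wI IV.x (.const 0) (.mod (vI IV.z) (vI IV.N)))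
  (.seq (bilFlat (tapeM IV.t IV.s) (.sub (digitE IV.t) (tapeA IV.t)))
  (.seq (wI IV.src (vI IV.z) (vI IV.out))
  (.seq (.ite (.clt (.ofInt (.const 0))
      (.add (.mul (.re (rC CV.filt (vI IV.x))) (.re (rC CV.filt (vI IV.x))))
        (.mul (.im (rC CV.filt (vI IV.x))) (.im (rC CV.filt (vI IV.x))))))
    (qC CV.smp (vI IV.z) (vI IV.out)) .skip)
  (.seq (bilDot (tapeM IV.s IV.t) (tapeQ IV.t) (digitE IV.s))
  (.seq (wC CV.wt (vI IV.z) (.mul (.root (vI IV.out) (vI IV.n)) (rC CV.filt (vI IV.x))))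
  (.seq (bilFlat (tapeM IV.s IV.t) (.sub (digitE IV.t) (tapeQ IV.t)))
  (.seq (wI IV.bucket (vI IV.z) (vI IV.out))
  (.seq (bilDot (tapeM IV.s IV.t) (digitE IV.t) (tapeA IV.s))
    (wC CV.ph (vI IV.z) (.root (.sub (.const 0) (vI IV.out)) (vI IV.n))))))))))))

/-- The tables for all hashes. -/
def tableProg : Prog := forProg IV.z (.mul (vI IV.r) (vI IV.N)) tableBody

theorem writesIn_tableBody : WritesIn
    [IV.i, IV.x, IV.s, IV.t, IV.acc, IV.out, IV.src, IV.bucket] [CV.smp, CV.wt, CV.ph]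
    tableBody :=
  ⟨writesIn_wI _ _ (by decide), writesIn_wI _ _ (by decide),
    (writesIn_bilProg _ _ _).mono (by decide) (by decide), writesIn_wI _ _ (by decide),
    ⟨writesIn_qC _ _ (by decide), trivial⟩,
    (writesIn_bilProg _ _ _).mono (by decide) (by decide), writesIn_wC _ _ (by decide),
    (writesIn_bilProg _ _ _).mono (by decide) (by decide), writesIn_wI _ _ (by decide),
    (writesIn_bilProg _ _ _).mono (by decide) (by decide), writesIn_wC _ _ (by decide)⟩

/-- The entries of the tables for the hash `h` and the position `x` at place `z`. The sample is only
required where it has nonzero weight. -/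
structure TableAt (s : Store) (h : Draw l d) (Ghat xhat : Signal l d) (z x : ℕ) : Prop where
  src : s.I IV.src z = flatIndex (h.mat.transpose.mulVec (unflat l d x - h.a))
  bucket : s.I IV.bucket z = flatIndex (h.perm (unflat l d x))
  wt : s.C CV.wt z = om (unflat l d x ⬝ᵥ h.mat.mulVec h.q) * Ghat (unflat l d x)
  ph : s.C CV.ph z = om (-(h.a ⬝ᵥ h.mat.mulVec (unflat l d x)))
  smp : Ghat (unflat l d x) ≠ 0 →
    s.C CV.smp z = xhat (h.mat.transpose.mulVec (unflat l d x - h.a))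

theorem digitE_eval {s : Store} (hs : Scalars l d C s) {x : ℕ} (hx : s.I IV.x 0 = x) {t : Fin 32}
    {b : Fin d} (ht : s.I t 0 = (b : ℕ)) :
    (digitE t).eval tp s = ((unflat l d x b).val : ℕ) := by
  simp only [digitE, IExp.eval, eval_vI, eval_rI, hx, ht, hs.pw_eq _ b.2.le, hs.n_eq]
  rw [val_unflat]
  push_cast
  rfl

theorem tapeM_eval {s : Store} (hs : Scalars l d C s) {r : ℕ} {ρ : Fin r → Draw l d}
    (hT : IsRandomTape tp ρ) {i : Fin r} (hi : s.I IV.i 0 = (i : ℕ)) {t u : Fin 32} {a b : Fin d}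
    (ht : s.I t 0 = (a : ℕ)) (hu : s.I u 0 = (b : ℕ)) :
    (tapeM t u).eval tp s = (((ρ i).mat a b).val : ℕ) := by
  rw [← (hT i a).1 b]
  simp only [tapeM, baseE, IExp.eval, eval_vI, hs.d_eq, hi, ht, hu]
  push_cast
  rfl

theorem tapeA_eval {s : Store} (hs : Scalars l d C s) {r : ℕ} {ρ : Fin r → Draw l d}
    (hT : IsRandomTape tp ρ) {i : Fin r} (hi : s.I IV.i 0 = (i : ℕ)) {t : Fin 32} {a : Fin d}
    (ht : s.I t 0 = (a : ℕ)) : (tapeA t).eval tp s = (((ρ i).a a).val : ℕ) := by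
  rw [← (hT i a).2.1]
  simp only [tapeA, baseE, IExp.eval, eval_vI, hs.d_eq, hi, ht]
  push_cast
  rfl

theorem tapeQ_eval {s : Store} (hs : Scalars l d C s) {r : ℕ} {ρ : Fin r → Draw l d}
    (hT : IsRandomTape tp ρ) {i : Fin r} (hi : s.I IV.i 0 = (i : ℕ)) {t : Fin 32} {a : Fin d}
    (ht : s.I t 0 = (a : ℕ)) : (tapeQ t).eval tp s = (((ρ i).q a).val : ℕ) := by
  rw [← (hT i a).2.2]
  simp only [tapeQ, baseE, IExp.eval, eval_vI, hs.d_eq, hi, ht]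
  push_cast
  rfl

/-- The entries of the tables for one hash and one position are computed in `O(d²)` steps, and the
other entries are kept. -/
theorem tableBody_good (hZ : (Z : ℝ) ≤ W) {r : ℕ} {ρ : Fin r → Draw l d}
    (hT : IsRandomTape tp ρ) {xhat Ghat : Signal l d} (hsmp : IsSampleAccess smp xhat)
    {s₀ : Store} (hs : Scalars l d C s₀) (hd : 1 ≤ d) (hl : 1 ≤ l) {z : ℕ}
    (i : Fin r) (hzi : z / (2 ^ l) ^ d = i)
    (hz : s₀.I IV.z 0 = z) (hrZ : 32 * (z : ℤ) + 32 ≤ Z) (hrZ' : (r : ℤ) ≤ Z)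
    (hNZ : (((2 ^ l) ^ d : ℕ) : ℤ) ≤ Z)
    [DecidablePred fun j => Ghat j ≠ 0]
    (hG : ∀ x : ℕ, x < (2 ^ l) ^ d → s₀.C CV.filt x = Ghat (unflat l d x)) :
    Good W smp tp tableBody s₀ (fun s' => TableAt s' (ρ i) Ghat xhat z (z % (2 ^ l) ^ d) ∧
      ∀ z' : ℤ, z' ≠ z → s'.I IV.src z' = s₀.I IV.src z' ∧ s'.I IV.bucket z' = s₀.I IV.bucket z' ∧
        s'.C CV.wt z' = s₀.C CV.wt z' ∧ s'.C CV.ph z' = s₀.C CV.ph z' ∧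
        s'.C CV.smp z' = s₀.C CV.smp z') (3000 * (d * d))
      (if Ghat (unflat l d (z % (2 ^ l) ^ d)) ≠ 0 then 1 else 0) := by
  have hNpos : 0 < (2 ^ l) ^ d := by positivity
  set N := (2 ^ l) ^ d with hN
  set x := z % N with hx
  have hxN : x < N := Nat.mod_lt _ hNpos
  have hnN : 2 ^ l ≤ N := Nat.le_self_pow (by omega) _
  have hnZ : ((2 ^ l : ℕ) : ℤ) ≤ Z := (Int.ofNat_le.mpr hnN).trans hNZ
  have hdN : d ≤ N := (Nat.lt_pow_self (Nat.one_lt_two_pow (by omega))).le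
  have hdZ : (d : ℤ) ≤ Z := (Int.ofNat_le.mpr hdN).trans hNZ
  have hZ32 : 32 ≤ Z := by omega
  have hzabs : 32 * |(z : ℤ)| + 32 ≤ Z := by rw [abs_of_nonneg (by positivity)]; exact hrZ
  have hvalN : ∀ g : Grid l d, |flatIndex g| ≤ Z := fun g => by
    rw [flatIndex_eq, abs_of_nonneg (by positivity)]
    exact (Int.ofNat_le.mpr (flatNat_lt g).le).trans hNZ
  have hdd : 1 ≤ d * d := Nat.mul_pos hd hd
  -- The part of the state that the single steps rely on.
  let L : List (Fin 32) := [IV.i, IV.x, IV.s, IV.t, IV.acc, IV.out, IV.src, IV.bucket]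
  let LC : List (Fin 32) := [CV.smp, CV.wt, CV.ph]
  let J : Store → Prop := fun s => Frame L LC s₀ s ∧ s.I IV.i 0 = (i : ℕ) ∧ s.I IV.x 0 = x
  have hJs : ∀ s, J s → Scalars l d C s := fun s h => hs.frame h.1 (by decide)
  have hJz : ∀ s, J s → s.I IV.z 0 = z := fun s h => by rw [h.1.I _ (by decide), hz]
  have hJb : ∀ s s', J s → Frame [IV.s, IV.t, IV.acc, IV.out] [] s s' → J s' := fun s s' h hF =>
    ⟨h.1.trans (hF.mono (by decide) (by decide)), by rw [hF.I _ (by decide)]; exact h.2.1,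
      by rw [hF.I _ (by decide)]; exact h.2.2⟩
  have hJC : ∀ s t v, J s → t ∈ LC → J (s.updC t z v) := fun s t v h ht =>
    ⟨h.1.updC ht _ _, h.2⟩
  have hJI : ∀ s t v, J s → t ∈ [IV.src, IV.bucket] → J (s.updI t z v) := fun s t v h ht => by
    refine ⟨h.1.updI (by revert ht; revert t; decide) _ _, ?_, ?_⟩
    · rw [Store.updI_ne _ (by revert ht; revert t; decide)]; exact h.2.1
    · rw [Store.updI_ne _ (by revert ht; revert t; decide)]; exact h.2.2
  have hJG : ∀ s, J s → s.C CV.filt x = Ghat (unflat l d x) := fun s h => by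
    rw [h.1.C _ (by decide), hG x hxN]
  -- The two index variables.
  refine (Good.seq (τ := 30) (τ' := 2900 * (d * d)) (κ := 0) (κ' := _)
    (Good.writeI hZ (i := 0) (z := (i : ℕ)) rfl
      (by simp only [IExp.eval, eval_vI, hz, hs.N_eq, ← hzi]; push_cast; rfl) (by simpa using hZ32)
      (by rw [abs_of_nonneg (by positivity)]; have := i.2; omega) ?_
      (by simp [IExp.cost, cost_vI]))).mono (fun _ h => h) (by omega) (by rw [zero_add])
  have hz1 : (s₀.updI IV.i 0 ((i : ℕ) : ℤ)).I IV.z 0 = z := by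
    rw [Store.updI_ne _ (by decide), hz]
  have hN1 : (s₀.updI IV.i 0 ((i : ℕ) : ℤ)).I IV.N 0 = (N : ℕ) := by
    rw [Store.updI_ne _ (by decide), hs.N_eq]
  refine (Good.seq (τ := 30) (τ' := 2800 * (d * d)) (κ := 0) (κ' := _)
    (Good.writeI hZ (i := 0) (z := (x : ℕ)) rfl
      (by simp only [IExp.eval, eval_vI, hz1, hN1, hx]; push_cast; rfl) (by simpa using hZ32)
      (by rw [abs_of_nonneg (by positivity)]; omega) ?_
      (by simp [IExp.cost, cost_vI]))).mono (fun _ h => h) (by omega) (by rw [zero_add])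
  have hJ2 : J ((s₀.updI IV.i 0 ((i : ℕ) : ℤ)).updI IV.x 0 (x : ℤ)) :=
    ⟨((Frame.refl _ _ _).updI (by decide) _ _).updI (by decide) _ _,
      by rw [Store.updI_ne _ (by decide), Store.updI_self], by rw [Store.updI_self]⟩
  have hK2 : ∀ z' : ℤ, z' ≠ z →
      ((s₀.updI IV.i 0 ((i : ℕ) : ℤ)).updI IV.x 0 (x : ℤ)).I IV.src z' = s₀.I IV.src z' ∧
      ((s₀.updI IV.i 0 ((i : ℕ) : ℤ)).updI IV.x 0 (x : ℤ)).I IV.bucket z' =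
        s₀.I IV.bucket z' := fun z' _ => by
    rw [Store.updI_ne _ (by decide), Store.updI_ne _ (by decide), Store.updI_ne _ (by decide),
      Store.updI_ne _ (by decide)]
    exact ⟨rfl, rfl⟩
  have hC2 : ((s₀.updI IV.i 0 ((i : ℕ) : ℤ)).updI IV.x 0 (x : ℤ)).C = s₀.C := rfl
  generalize (s₀.updI IV.i 0 ((i : ℕ) : ℤ)).updI IV.x 0 (x : ℤ) = s2 at hJ2 hK2 hC2 ⊢
  -- The position read by the hash.
  refine (Good.seq (τ := 600 * (d * d)) (τ' := 2200 * (d * d)) (κ := 0) (κ' := _)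
    ((bilFlat_good hZ (hJs s2 hJ2) hd
      (fun a b => (ρ i).mat b a * (unflat l d x b - (ρ i).a b)) ?_ hNZ hdZ hZ32
      (by decide)).mono ?_ le_rfl le_rfl)).mono (fun _ h => h) (by omega) (by rw [zero_add])
  · intro a b s hF ha hb
    have hJ := hJb s2 s hJ2 hF
    simp only [IExp.eval]
    rw [tapeM_eval (hJs s hJ) hT hJ.2.1 hb ha, digitE_eval (hJs s hJ) hJ.2.2 hb,
      tapeA_eval (hJs s hJ) hT hJ.2.1 hb]
    push_cast
    simp only [ZMod.natCast_zmod_val]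
  rintro s3 ⟨hout3, hF3⟩
  have hJ3 := hJb s2 s3 hJ2 hF3
  have hidx : (fun a => ∑ b, (ρ i).mat b a * (unflat l d x b - (ρ i).a b)) =
      (ρ i).mat.transpose.mulVec (unflat l d x - (ρ i).a) := rfl
  rw [hidx] at hout3
  set g := (ρ i).mat.transpose.mulVec (unflat l d x - (ρ i).a) with hg
  refine (Good.seq (τ := 30) (τ' := 2100 * (d * d)) (κ := 0) (κ' := _)
    (Good.writeI hZ (i := z) (z := flatIndex g) (by rw [eval_vI, hJz _ hJ3])
      (by rw [eval_vI, hout3]) hzabs (hvalN _) ?_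
      (by simp [cost_vI]))).mono (fun _ h => h) (by omega) (by rw [zero_add])
  have hJ4 := hJI s3 IV.src (flatIndex g) hJ3 (by decide)
  set s4 := s3.updI IV.src z (flatIndex g) with hs4
  have hout4 : s4.I IV.out 0 = flatIndex g := by rw [hs4, Store.updI_ne _ (by decide), hout3]
  -- The query.
  refine (Good.seq (τ := 120) (τ' := 1920 * (d * d))
    (κ := if Ghat (unflat l d x) ≠ 0 then 1 else 0) (κ' := 0)
    ((Good.ite (τ := 30) (Q := fun s => J s ∧ (∃ v, s = s4.updC CV.smp z v) ∧
        (Ghat (unflat l d x) ≠ 0 → s.C CV.smp z = xhat g)) ?_ ?_).mono ?_ ?_ le_rfl)).mono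
        (fun _ h => h) (by omega) le_rfl
  · intro hc
    have hne : Ghat (unflat l d x) ≠ 0 := by
      intro h0
      simp only [BExp.holds, CExp.eval, eval_rC, eval_vI, hJ4.2.2, hJG _ hJ4, h0] at hc
      simp [IExp.eval] at hc
    rw [if_pos hne]
    refine Good.queryC hZ (i := z) (z := flatIndex g) (by rw [eval_vI, hJz _ hJ4])
      (by rw [eval_vI, hout4]) hzabs ⟨hJC _ _ _ hJ4 (by decide), ⟨_, rfl⟩, fun _ => ?_⟩
      (by simp [cost_vI]) le_rfl
    rw [Store.updC_self, hsmp g]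
  · intro hc
    refine Good.skip ⟨hJ4, ⟨s4.C CV.smp z, ?_⟩, fun hne => ?_⟩ (by norm_num)
    · simp only [Store.updC, Store.C, Function.update_eq_self]
    · exfalso
      apply hc
      simp only [BExp.holds, CExp.eval, eval_rC, eval_vI, hJ4.2.2, hJG _ hJ4]
      simp only [IExp.eval, Int.cast_zero, Complex.zero_re, Complex.add_re, Complex.mul_re,
        Complex.ofReal_re, Complex.ofReal_im, mul_zero, sub_zero]
      have := Complex.normSq_pos.mpr hne
      rwa [Complex.normSq_apply] at this
  swap
  · simp [BExp.cost, CExp.cost, IExp.cost, cost_rC, cost_vI]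
  rintro s5 ⟨hJ5, ⟨v5, hv5⟩, hsmp5⟩
  have hsrc5 : s5.I IV.src z = flatIndex g := by
    rw [hv5, Store.updC_I, hs4, Store.updI_self]
  have hK5 : ∀ z' : ℤ, z' ≠ z → s5.I IV.src z' = s₀.I IV.src z' ∧
      s5.I IV.bucket z' = s₀.I IV.bucket z' ∧ s5.C CV.wt z' = s₀.C CV.wt z' ∧
      s5.C CV.ph z' = s₀.C CV.ph z' ∧ s5.C CV.smp z' = s₀.C CV.smp z' := fun z' hz' => by
    obtain ⟨k1, k2⟩ := hK2 z' hz'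
    refine ⟨?_, ?_, ?_, ?_, ?_⟩
    · rw [hv5, Store.updC_I, hs4, Store.updI_I, if_neg fun h => hz' h.2, hF3.I _ (by decide), k1]
    · rw [hv5, Store.updC_I, hs4, Store.updI_ne _ (by decide), hF3.I _ (by decide), k2]
    · rw [hv5, Store.updC_ne _ (by decide), hs4, Store.updI_C, hF3.C _ (by decide), hC2]
    · rw [hv5, Store.updC_ne _ (by decide), hs4, Store.updI_C, hF3.C _ (by decide), hC2]
    · rw [hv5, Store.updC_C, if_neg fun h => hz' h.2, hs4, Store.updI_C, hF3.C _ (by decide), hC2]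
  -- The weight.
  refine (Good.seq (τ := 600 * (d * d)) (τ' := 1320 * (d * d)) (κ := 0) (κ' := 0)
    ((bilDot_good hZ (hJs s5 hJ5) hd (fun a b => (ρ i).mat a b * (ρ i).q b) (unflat l d x) ?_ ?_
      hnZ hdZ hZ32 (by decide) (by decide)).mono ?_ le_rfl le_rfl)).mono (fun _ h => h)
      (by omega) le_rfl
  · intro a b s hF ha hb
    have hJ := hJb s5 s hJ5 hF
    rw [tapeM_eval (hJs s hJ) hT hJ.2.1 ha hb, tapeQ_eval (hJs s hJ) hT hJ.2.1 hb]
    push_cast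
    simp only [ZMod.natCast_zmod_val]
  · intro a s hF ha
    have hJ := hJb s5 s hJ5 hF
    rw [digitE_eval (hJs s hJ) hJ.2.2 ha]
    push_cast
    rw [ZMod.natCast_zmod_val]
  rintro s6 ⟨hout6, hF6⟩
  have hJ6 := hJb s5 s6 hJ5 hF6
  refine (Good.seq (τ := 60) (τ' := 1260 * (d * d)) (κ := 0) (κ' := 0)
    (Good.writeC hZ (i := z) (z := om (unflat l d x ⬝ᵥ (ρ i).mat.mulVec (ρ i).q) *
      Ghat (unflat l d x)) (by rw [eval_vI, hJz _ hJ6]) ?_ hzabs ?_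
      (by simp [CExp.cost, cost_rC, cost_vI]))).mono (fun _ h => h) (by omega) le_rfl
  · simp only [CExp.eval, eval_rC, eval_vI, hJ6.2.2, hJG _ hJ6, hout6, (hJs _ hJ6).n_eq]
    congr 1
    have := rootVal_eq_om (l := l) (((unflat l d x ⬝ᵥ (ρ i).mat.mulVec (ρ i).q).val : ℕ) : ℤ)
    rw [Int.cast_natCast, ZMod.natCast_zmod_val] at this
    rw [← this]; rfl
  have hJ7 := hJC s6 CV.wt (om (unflat l d x ⬝ᵥ (ρ i).mat.mulVec (ρ i).q) *
      Ghat (unflat l d x)) hJ6 (by decide)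
  set s7 := s6.updC CV.wt z (om (unflat l d x ⬝ᵥ (ρ i).mat.mulVec (ρ i).q) *
      Ghat (unflat l d x)) with hs7
  -- The bucket.
  refine (Good.seq (τ := 600 * (d * d)) (τ' := 660 * (d * d)) (κ := 0) (κ' := 0)
    ((bilFlat_good hZ (hJs s7 hJ7) hd
      (fun a b => (ρ i).mat a b * (unflat l d x b - (ρ i).q b)) ?_ hNZ hdZ hZ32
      (by decide)).mono ?_ le_rfl le_rfl)).mono (fun _ h => h) (by omega) le_rfl
  · intro a b s hF ha hb
    have hJ := hJb s7 s hJ7 hF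
    simp only [IExp.eval]
    rw [tapeM_eval (hJs s hJ) hT hJ.2.1 ha hb, digitE_eval (hJs s hJ) hJ.2.2 hb,
      tapeQ_eval (hJs s hJ) hT hJ.2.1 hb]
    push_cast
    simp only [ZMod.natCast_zmod_val]
  rintro s8 ⟨hout8, hF8⟩
  have hJ8 := hJb s7 s8 hJ7 hF8
  have hperm : (fun a => ∑ b, (ρ i).mat a b * (unflat l d x b - (ρ i).q b)) =
      (ρ i).perm (unflat l d x) := rfl
  rw [hperm] at hout8
  refine (Good.seq (τ := 20) (τ' := 640 * (d * d)) (κ := 0) (κ' := 0)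
    (Good.writeI hZ (i := z) (z := flatIndex ((ρ i).perm (unflat l d x)))
      (by rw [eval_vI, hJz _ hJ8]) (by rw [eval_vI, hout8]) hzabs (hvalN _) ?_
      (by simp [cost_vI]))).mono (fun _ h => h) (by omega) le_rfl
  have hJ9 := hJI s8 IV.bucket (flatIndex ((ρ i).perm (unflat l d x))) hJ8 (by decide)
  set s9 := s8.updI IV.bucket z (flatIndex ((ρ i).perm (unflat l d x))) with hs9
  -- The phase.
  refine (Good.seq (τ := 600 * (d * d)) (τ' := 40) (κ := 0) (κ' := 0)
    ((bilDot_good hZ (hJs s9 hJ9) hd (fun a b => (ρ i).mat a b * unflat l d x b) (ρ i).a ?_ ?_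
      hnZ hdZ hZ32 (by decide) (by decide)).mono ?_ le_rfl le_rfl)).mono (fun _ h => h)
      (by omega) le_rfl
  · intro a b s hF ha hb
    have hJ := hJb s9 s hJ9 hF
    rw [tapeM_eval (hJs s hJ) hT hJ.2.1 ha hb, digitE_eval (hJs s hJ) hJ.2.2 hb]
    push_cast
    simp only [ZMod.natCast_zmod_val]
  · intro a s hF ha
    have hJ := hJb s9 s hJ9 hF
    rw [tapeA_eval (hJs s hJ) hT hJ.2.1 ha]
    push_cast
    rw [ZMod.natCast_zmod_val]
  rintro s10 ⟨hout10, hF10⟩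
  have hJ10 := hJb s9 s10 hJ9 hF10
  have hmv : (fun a => ∑ b, (ρ i).mat a b * unflat l d x b) = (ρ i).mat.mulVec (unflat l d x) := rfl
  rw [hmv] at hout10
  refine Good.writeC hZ (i := z) (z := om (-((ρ i).a ⬝ᵥ (ρ i).mat.mulVec (unflat l d x))))
    (by rw [eval_vI, hJz _ hJ10]) ?_ hzabs ⟨⟨?_, ?_, ?_, ?_, ?_⟩, ?_⟩
      (by simp [CExp.cost, IExp.cost, cost_vI])
  · simp only [CExp.eval, IExp.eval, eval_vI, hout10, (hJs _ hJ10).n_eq]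
    have := rootVal_eq_om (l := l)
      (0 - (((ρ i).a ⬝ᵥ (ρ i).mat.mulVec (unflat l d x)).val : ℕ) : ℤ)
    rw [Int.cast_sub, Int.cast_natCast, ZMod.natCast_zmod_val, Int.cast_zero] at this
    rw [← zero_sub ((ρ i).a ⬝ᵥ _), ← this]; rfl
  · rw [Store.updC_I, hF10.I _ (by decide), hs9, Store.updI_ne _ (by decide), hF8.I _ (by decide),
      hs7, Store.updC_I, hF6.I _ (by decide), hsrc5]
  · rw [Store.updC_I, hF10.I _ (by decide), hs9, Store.updI_self]
  · rw [Store.updC_ne _ (by decide), hF10.C _ (by decide), hs9, Store.updI_C, hF8.C _ (by decide),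
      hs7, Store.updC_self]
  · rw [Store.updC_self]
  · intro hne
    rw [Store.updC_ne _ (by decide), hF10.C _ (by decide), hs9, Store.updI_C, hF8.C _ (by decide),
      hs7, Store.updC_ne _ (by decide), hF6.C _ (by decide), hsmp5 hne]
  · intro z' hz'
    obtain ⟨k1, k2, k3, k4, k5⟩ := hK5 z' hz'
    refine ⟨?_, ?_, ?_, ?_, ?_⟩
    · rw [Store.updC_I, hF10.I _ (by decide), hs9, Store.updI_ne _ (by decide),
        hF8.I _ (by decide), hs7, Store.updC_I, hF6.I _ (by decide), k1]
    · rw [Store.updC_I, hF10.I _ (by decide), hs9, Store.updI_I, if_neg fun h => hz' h.2,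
        hF8.I _ (by decide), hs7, Store.updC_I, hF6.I _ (by decide), k2]
    · rw [Store.updC_ne _ (by decide), hF10.C _ (by decide), hs9, Store.updI_C,
        hF8.C _ (by decide), hs7, Store.updC_C, if_neg fun h => hz' h.2, hF6.C _ (by decide), k3]
    · rw [Store.updC_C, if_neg fun h => hz' h.2, hF10.C _ (by decide), hs9, Store.updI_C,
        hF8.C _ (by decide), hs7, Store.updC_ne _ (by decide), hF6.C _ (by decide), k4]
    · rw [Store.updC_ne _ (by decide), hF10.C _ (by decide), hs9, Store.updI_C,
        hF8.C _ (by decide), hs7, Store.updC_ne _ (by decide), hF6.C _ (by decide), k5]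

theorem TableAt.congr {s s' : Store} {h : Draw l d} {Ghat xhat : Signal l d} {z x : ℕ}
    (ht : TableAt s h Ghat xhat z x)
    (he : s'.I IV.src z = s.I IV.src z ∧ s'.I IV.bucket z = s.I IV.bucket z ∧
      s'.C CV.wt z = s.C CV.wt z ∧ s'.C CV.ph z = s.C CV.ph z ∧ s'.C CV.smp z = s.C CV.smp z) :
    TableAt s' h Ghat xhat z x where
  src := he.1.trans ht.src
  bucket := he.2.1.trans ht.bucket
  wt := he.2.2.1.trans ht.wt
  ph := he.2.2.2.1.trans ht.ph
  smp := fun hne => he.2.2.2.2.trans (ht.smp hne)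

/-- The tables hold the data of all hashes. -/
def Tables {r : ℕ} (ρ : Fin r → Draw l d) (Ghat xhat : Signal l d) (s : Store) : Prop :=
  ∀ (i : Fin r) (x : ℕ), x < (2 ^ l) ^ d → TableAt s (ρ i) Ghat xhat (i * (2 ^ l) ^ d + x) x

/-- The tables take `O(r N d²)` steps, and `r` queries for each nonzero entry of the transformed
filter. -/
theorem tableProg_good (hZ : (Z : ℝ) ≤ W) {r : ℕ} (hr : r = numHashes C l d)
    {ρ : Fin r → Draw l d}
    (hT : IsRandomTape tp ρ) {xhat Ghat : Signal l d} (hsmp : IsSampleAccess smp xhat)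
    {s₀ : Store} (hs : Scalars l d C s₀) (hd : 1 ≤ d) (hl : 1 ≤ l) (hC : 1 ≤ C)
    (hrZ : 32 * ((r * (2 ^ l) ^ d : ℕ) : ℤ) + 32 ≤ Z)
    [DecidablePred fun j => Ghat j ≠ 0]
    (hG : ∀ x : ℕ, x < (2 ^ l) ^ d → s₀.C CV.filt x = Ghat (unflat l d x)) :
    Good W smp tp tableProg s₀ (fun s' => Tables ρ Ghat xhat s' ∧
      Frame [IV.z, IV.i, IV.x, IV.s, IV.t, IV.acc, IV.out, IV.src, IV.bucket]
        [CV.smp, CV.wt, CV.ph] s₀ s')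
      (3100 * (r * (2 ^ l) ^ d * (d * d)))
      (r * (Finset.univ.filter fun j => Ghat j ≠ 0).card) := by
  have hNpos : 0 < (2 ^ l) ^ d := by positivity
  have hrpos : 0 < r := by rw [hr]; unfold numHashes; positivity
  set N := (2 ^ l) ^ d with hN
  have hrN : r ≤ r * N := Nat.le_mul_of_pos_right _ hNpos
  have hNr : N ≤ r * N := Nat.le_mul_of_pos_left _ hrpos
  have hdd : 1 ≤ d * d := Nat.mul_pos hd hd
  have hlast : ∀ z, z < r * N → z / N < r := fun z hz => Nat.div_lt_of_lt_mul (by rwa [mul_comm])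
  refine (Good.for hZ (LI := [IV.i, IV.x, IV.s, IV.t, IV.acc, IV.out, IV.src, IV.bucket])
    (LC := [CV.smp, CV.wt, CV.ph]) (m := r * N) (s₀ := s₀) writesIn_tableBody (by decide)
    (fun s hF => by
      have h1 := hs.frame hF (by decide)
      simp only [IExp.eval, eval_vI, h1.r_eq, h1.N_eq, ← hr]; push_cast; rfl)
    (fun z s => ∀ z' < z, ∀ hz' : z' < r * N,
      TableAt s (ρ ⟨z' / N, hlast z' hz'⟩) Ghat xhat z' (z' % N))
    (τ := 3000 * (d * d)) (κ := fun z => if Ghat (unflat l d (z % N)) ≠ 0 then 1 else 0)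
    (τ' := 3100 * (r * N * (d * d)))
    ?_ ?_ ?_ (by omega) (by omega) ?_).mono ?_ le_rfl ?_
  · intro j s v h z' hz' hz''
    exact (h z' hz' hz'').congr ⟨by rw [Store.updI_ne _ (by decide)],
      by rw [Store.updI_ne _ (by decide)], rfl, rfl, rfl⟩
  · intro z' hz'; exact absurd hz' (Nat.not_lt_zero _)
  · intro z hz s hF hzs hinv
    refine (tableBody_good hZ hT hsmp (hs.frame hF (by decide)) hd hl ⟨z / N, hlast z hz⟩ rfl hzs
      (by omega) (by omega) (by omega) (fun x hx => by rw [hF.C _ (by decide)]; exact hG x hx)).mono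
      ?_ le_rfl le_rfl
    rintro s' ⟨h1, h2⟩ z' hz' hz''
    rcases Nat.lt_succ_iff_lt_or_eq.mp hz' with h | rfl
    · exact (hinv z' h hz'').congr (h2 z' (by exact_mod_cast h.ne))
    · exact h1
  · have h1 : 1 ≤ r * N := Nat.mul_pos hrpos hNpos
    simp only [IExp.cost, cost_vI]
    nlinarith
  · rintro s ⟨h1, h2⟩
    refine ⟨fun i x hx => ?_, h2⟩
    have hlt : (i : ℕ) * N + x < r * N := by
      calc (i : ℕ) * N + x < i * N + N := by omega
        _ = (i + 1) * N := by ring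
        _ ≤ r * N := Nat.mul_le_mul_right _ i.2
    have h3 := h1 (i * N + x) hlt hlt
    have e1 : ((i : ℕ) * N + x) / N = i := by
      rw [mul_comm, Nat.mul_add_div hNpos, Nat.div_eq_of_lt hx, add_zero]
    have e2 : ((i : ℕ) * N + x) % N = x := by
      rw [mul_comm, Nat.mul_add_mod, Nat.mod_eq_of_lt hx]
    simp only [e1, e2] at h3
    exact h3
  · have e : ∀ (r : ℕ), ∑ z ∈ Finset.range (r * N),
        (if Ghat (unflat l d (z % N)) ≠ 0 then 1 else 0) =
        r * (Finset.univ.filter fun j => Ghat j ≠ 0).card := by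
      intro r
      induction r with
      | zero => simp
      | succ r ih =>
        rw [Nat.succ_mul, Finset.sum_range_add, ih, Nat.succ_mul, Finset.card_filter]
        congr 1
        rw [← unflat_bijective.sum_comp (fun j : Grid l d => if Ghat j ≠ 0 then 1 else 0),
          ← Fin.sum_univ_eq_sum_range]
        refine Finset.sum_congr rfl fun x _ => ?_
        rw [mul_comm, Nat.mul_add_mod, Nat.mod_eq_of_lt x.2]
    exact (e r).le

end tables

/-! ### Medians by counting ranks -/

section medianProg

variable {W : ℝ} {smp : ℤ → ℂ} {tp : ℤ → ℤ} {Z : ℤ} {l d C : ℕ}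

/-- Place of the estimate from the hash number `t` for the current position. -/
def estE (t : Fin 32) : CExp := rC CV.est (.add (.mul (vI IV.x) (vI IV.r)) (vI t))

/-- Count the entries smaller than the candidate, and those not larger than it. -/
def rankBody (part : CExp → CExp) : Prog :=
  .seq (.ite (.clt (part (estE IV.i)) (part (estE IV.j)))
      (wI IV.lt (.const 0) (.add (vI IV.lt) (.const 1))) .skip)
    (.ite (.clt (part (estE IV.j)) (part (estE IV.i)))
      .skip (wI IV.le (.const 0) (.add (vI IV.le) (.const 1))))

/-- Try one candidate for the median. -/
def candBody (part : CExp → CExp) (dst : Fin 32) : Prog :=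
  .seq (wI IV.lt (.const 0) (.const 0)) (.seq (wI IV.le (.const 0) (.const 0))
    (.seq (forProg IV.i (vI IV.r) (rankBody part))
      (.ite (.ilt (.div (vI IV.r) (.const 2)) (vI IV.lt)) .skip
        (.ite (.ilt (.div (vI IV.r) (.const 2)) (vI IV.le))
          (wC dst (.const 0) (part (estE IV.j))) .skip))))

/-- The median of the real or imaginary parts of the estimates for the current position. -/
def medianProg (part : CExp → CExp) (dst : Fin 32) : Prog :=
  forProg IV.j (vI IV.r) (candBody part dst)

theorem writesIn_rankBody (part : CExp → CExp) : WritesIn [IV.lt, IV.le] [] (rankBody part) :=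
  ⟨⟨writesIn_wI _ _ (by decide), trivial⟩, trivial, writesIn_wI _ _ (by decide)⟩

theorem writesIn_candBody (part : CExp → CExp) (dst : Fin 32) :
    WritesIn [IV.i, IV.lt, IV.le] [dst] (candBody part dst) :=
  ⟨writesIn_wI _ _ (by decide), writesIn_wI _ _ (by decide),
    writesIn_forProg (by decide) ((writesIn_rankBody part).mono (by decide) (List.nil_subset _)),
    trivial, writesIn_wC _ _ List.mem_cons_self, trivial⟩

theorem card_filter_fin (r : ℕ) (p : ℕ → Prop) [DecidablePred p] :
    (Finset.univ.filter fun i : Fin r => p i).card = ∑ i ∈ Finset.range r, if p i then 1 else 0 := by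
  rw [Finset.card_filter, ← Fin.sum_univ_eq_sum_range (fun i => if p i then 1 else 0)]

/-- The median is the only value `v` with at most `r / 2` entries below it and more than `r / 2`
entries not above it, so trying every entry costs `O(r²)` steps and finds it. -/
theorem medianProg_good (hZ : (Z : ℝ) ≤ W) {part : CExp → CExp} {pr : ℂ → ℝ}
    (hpart : ∀ (s : Store) (z : CExp), (part z).eval tp s = (pr (z.eval tp s) : ℂ))
    (hcost : ∀ z : CExp, (part z).cost = z.cost + 1) {dst : Fin 32} (hdst : dst ≠ CV.est)
    {s₀ : Store} {r x : ℕ} (hr : 0 < r) (hrZ : (r : ℤ) ≤ Z) (hZ32 : 32 ≤ Z)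
    (hsr : s₀.I IV.r 0 = r) (hsx : s₀.I IV.x 0 = x) {η : Fin r → ℂ}
    (hη : ∀ i : Fin r, s₀.C CV.est (x * r + i : ℕ) = η i) :
    Good W smp tp (medianProg part dst) s₀ (fun s =>
      s.C dst 0 = (median (fun i => pr (η i)) : ℂ) ∧
      Frame [IV.j, IV.i, IV.lt, IV.le] [dst] s₀ s) (400 * (r * r)) 0 := by
  classical
  let f : ℕ → ℝ := fun i => pr (s₀.C CV.est (x * r + i : ℕ))
  have hf : (fun i => pr (η i)) = fun i : Fin r => f i := by
    funext i; simp only [f, hη]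
  rw [hf]
  have hest : ∀ s, Frame [IV.j, IV.i, IV.lt, IV.le] [dst] s₀ s → ∀ (t : Fin 32) (i : ℕ),
      s.I t 0 = i → (part (estE t)).eval tp s = (f i : ℂ) := by
    intro s hF t i ht
    have h1 : s.I IV.x 0 = x := by rw [hF.I _ (by decide), hsx]
    have h2 : s.I IV.r 0 = r := by rw [hF.I _ (by decide), hsr]
    have h3 : s.C CV.est = s₀.C CV.est :=
      hF.C _ (by rw [List.mem_singleton]; exact fun h => hdst h.symm)
    rw [hpart]
    simp only [estE, eval_rC, IExp.eval, eval_vI, h1, h2, ht, h3, f]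
    push_cast
    rfl
  have hce : ∀ t, (part (estE t)).cost = 26 := fun t => by
    rw [hcost, estE, cost_rC]; simp [IExp.cost, cost_vI]
  refine (Good.for hZ (writesIn_candBody part dst) (by decide) (m := r)
    (fun s hF => by rw [eval_vI, hF.I _ (by decide), hsr])
    (fun j s => ∀ j' < j, f j' = median (fun i : Fin r => f i) →
      s.C dst 0 = (median (fun i : Fin r => f i) : ℂ))
    (τ := 300 * r) (τ' := 400 * (r * r)) (κ := fun _ => 0) ?_ ?_ ?_ hrZ hZ32
    (by simp only [cost_vI]; nlinarith)).mono ?_ le_rfl (by simp)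
  · intro j s v h; exact h
  · intro j hj; exact absurd hj (Nat.not_lt_zero _)
  · intro j hj s hF hsj hinv
    refine (Good.seq (τ := 8) (τ' := 290 * r) (κ := 0) (κ' := 0)
      (Good.writeI hZ (i := 0) (z := 0) rfl rfl (by simpa using hZ32) (by simp; omega) ?_
      (by simp [IExp.cost]))).mono (fun _ h => h) (by omega) le_rfl
    refine (Good.seq (τ := 8) (τ' := 280 * r) (κ := 0) (κ' := 0)
      (Good.writeI hZ (i := 0) (z := 0) rfl rfl (by simpa using hZ32) (by simp; omega) ?_
      (by simp [IExp.cost]))).mono (fun _ h => h) (by omega) le_rfl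
    have hF2 : Frame [IV.j, IV.i, IV.lt, IV.le] [dst] s₀ ((s.updI IV.lt 0 0).updI IV.le 0 0) :=
      (hF.updI (by decide) _ _).updI (by decide) _ _
    have hj2 : ((s.updI IV.lt 0 0).updI IV.le 0 0).I IV.j 0 = j := by
      rw [Store.updI_ne _ (by decide), Store.updI_ne _ (by decide), hsj]
    have hlt2 : ((s.updI IV.lt 0 0).updI IV.le 0 0).I IV.lt 0 = 0 := by
      rw [Store.updI_ne _ (by decide), Store.updI_self]
    have hle2 : ((s.updI IV.lt 0 0).updI IV.le 0 0).I IV.le 0 = 0 := by rw [Store.updI_self]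
    have hC2 : ((s.updI IV.lt 0 0).updI IV.le 0 0).C = s.C := rfl
    generalize (s.updI IV.lt 0 0).updI IV.le 0 0 = s2 at hF2 hj2 hlt2 hle2 hC2 ⊢
    refine (Good.seq (τ := 210 * r) (τ' := 70) (κ := 0) (κ' := 0)
      ((Good.for hZ (writesIn_rankBody part) (by decide) (m := r)
      (fun s hF => by rw [eval_vI, hF.I _ (by decide), hF2.I _ (by decide), hsr])
      (fun i s => s.I IV.lt 0 = (∑ i ∈ Finset.range i, if f i < f j then 1 else 0 : ℕ) ∧
        s.I IV.le 0 = (∑ i ∈ Finset.range i, if f i ≤ f j then 1 else 0 : ℕ))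
      (τ := 150) (τ' := 210 * r) (κ := fun _ => 0) ?_ ?_ ?_ hrZ hZ32
      (by simp only [cost_vI]; omega)).mono ?_ le_rfl (by simp))).mono
      (fun _ h => h) (by omega) le_rfl
    · rintro i s' v ⟨h1, h2⟩
      exact ⟨by rw [Store.updI_ne _ (by decide), h1], by rw [Store.updI_ne _ (by decide), h2]⟩
    · exact ⟨by rw [hlt2]; simp, by rw [hle2]; simp⟩
    · rintro i hi s' hF' hsi ⟨h1, h2⟩
      have hF3 : Frame [IV.j, IV.i, IV.lt, IV.le] [dst] s₀ s' :=
        hF2.trans (hF'.mono (by decide) (List.nil_subset _))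
      have hj3 : s'.I IV.j 0 = j := by rw [hF'.I _ (by decide), hj2]
      have bound : ∀ (p : ℕ → Prop) [DecidablePred p],
          ((∑ i ∈ Finset.range i, if p i then 1 else 0 : ℕ) : ℤ) + 1 ≤ Z := by
        intro p _
        have : (∑ i ∈ Finset.range i, if p i then 1 else 0 : ℕ) ≤ i := by
          calc _ ≤ ∑ i ∈ Finset.range i, 1 := Finset.sum_le_sum fun i _ => by split_ifs <;> omega
            _ = i := by simp
        omega
      have e1 := hest s' hF3 IV.i i hsi
      have e2 := hest s' hF3 IV.j j hj3
      refine (Good.seq (τ := 53 + 14 + 1) (τ' := 53 + 14 + 1) (κ := 0) (κ' := 0)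
        ((Good.ite (τ := 14) (κ := 0) (Q := fun s'' =>
          s''.I IV.lt 0 = (∑ i ∈ Finset.range (i + 1), if f i < f j then 1 else 0 : ℕ) ∧
          Frame [IV.lt] [] s' s'') ?_ ?_).mono ?_ ?_ le_rfl)).mono
          (fun _ h => h) (by omega) le_rfl
      · intro hc
        simp only [BExp.holds, e1, e2, Complex.ofReal_re] at hc
        refine Good.writeI hZ (i := 0)
          (z := (∑ i ∈ Finset.range (i + 1), if f i < f j then 1 else 0 : ℕ)) rfl ?_
          (by simpa using hZ32) ?_ ⟨Store.updI_self _ _ _ _,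
            (Frame.refl _ _ _).updI (by decide) _ _⟩ (by simp [IExp.cost, cost_vI])
        · simp only [IExp.eval, eval_vI, h1]
          rw [Finset.sum_range_succ, if_pos hc]; push_cast; rfl
        · rw [abs_of_nonneg (by positivity), Finset.sum_range_succ, if_pos hc]
          exact_mod_cast bound (fun i => f i < f j)
      · intro hc
        simp only [BExp.holds, e1, e2, Complex.ofReal_re] at hc
        refine Good.skip ⟨?_, Frame.refl _ _ _⟩ (by norm_num)
        rw [Finset.sum_range_succ, if_neg hc, h1]; rfl
      swap
      · simp only [BExp.cost, hce]; norm_num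
      rintro s4 ⟨h3, hF4⟩
      have hF5 : Frame [IV.j, IV.i, IV.lt, IV.le] [dst] s₀ s4 :=
        hF3.trans (hF4.mono (by decide) (List.nil_subset _))
      have e3 := hest s4 hF5 IV.i i (by rw [hF4.I _ (by decide), hsi])
      have e4 := hest s4 hF5 IV.j j (by rw [hF4.I _ (by decide), hj3])
      have h5 : s4.I IV.le 0 = (∑ i ∈ Finset.range i, if f i ≤ f j then 1 else 0 : ℕ) := by
        rw [hF4.I _ (by decide), h2]
      refine (Good.ite (τ := 14) (κ := 0) ?_ ?_).mono (fun _ h => h)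
        (by simp only [BExp.cost, hce]; norm_num) le_rfl
      · intro hc
        simp only [BExp.holds, e3, e4, Complex.ofReal_re] at hc
        refine Good.skip ⟨h3, ?_⟩ (by norm_num)
        rw [Finset.sum_range_succ, if_neg (not_le.mpr hc), h5]; rfl
      · intro hc
        simp only [BExp.holds, e3, e4, Complex.ofReal_re, not_lt] at hc
        refine Good.writeI hZ (i := 0)
          (z := (∑ i ∈ Finset.range (i + 1), if f i ≤ f j then 1 else 0 : ℕ)) rfl ?_
          (by simpa using hZ32) ?_ ⟨by rw [Store.updI_ne _ (by decide), h3],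
            Store.updI_self _ _ _ _⟩ (by simp [IExp.cost, cost_vI])
        · simp only [IExp.eval, eval_vI, h5]
          rw [Finset.sum_range_succ, if_pos hc]; push_cast; rfl
        · rw [abs_of_nonneg (by positivity), Finset.sum_range_succ, if_pos hc]
          exact_mod_cast bound (fun i => f i ≤ f j)
    rintro s5 ⟨⟨h1, h2⟩, hF5⟩
    rw [← card_filter_fin r (fun i => f i < f j)] at h1
    rw [← card_filter_fin r (fun i => f i ≤ f j)] at h2
    have hr5 : s5.I IV.r 0 = r := by rw [hF5.I _ (by decide), hF2.I _ (by decide), hsr]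
    have hmed := median_eq_iff hr (s := fun i : Fin r => f i) (v := f j)
    have hold : ∀ j' < j, f j' = median (fun i : Fin r => f i) →
        s5.C dst 0 = (median (fun i : Fin r => f i) : ℂ) := fun j' hj' he => by
      rw [hF5.C _ List.not_mem_nil, hC2]; exact hinv j' hj' he
    have hskip : ¬ median (fun i : Fin r => f i) = f j →
        ∀ j' < j + 1, f j' = median (fun i : Fin r => f i) →
        s5.C dst 0 = (median (fun i : Fin r => f i) : ℂ) := by
      intro hne j' hj' he
      rcases Nat.lt_succ_iff_lt_or_eq.mp hj' with h | rfl
      · exact hold j' h he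
      · exact absurd he.symm hne
    refine (Good.ite (τ := 50) (κ := 0) ?_ ?_).mono (fun _ h => h)
      (by simp [BExp.cost, IExp.cost, cost_vI]) le_rfl
    · intro hc
      simp only [BExp.holds, IExp.eval, eval_vI, hr5, h1] at hc
      refine Good.skip (hskip fun h => ?_) (by norm_num)
      have := (hmed.mp h).1
      omega
    · intro hc
      simp only [BExp.holds, IExp.eval, eval_vI, hr5, h1, not_lt] at hc
      refine (Good.ite (τ := 32) (κ := 0) ?_ ?_).mono (fun _ h => h)
        (by simp [BExp.cost, IExp.cost, cost_vI]) le_rfl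
      · intro hc'
        simp only [BExp.holds, IExp.eval, eval_vI, hr5, h2] at hc'
        have hm : median (fun i : Fin r => f i) = f j := hmed.mpr ⟨by omega, by omega⟩
        have hF6 : Frame [IV.j, IV.i, IV.lt, IV.le] [dst] s₀ s5 :=
          hF2.trans (hF5.mono (by decide) (List.nil_subset _))
        refine Good.writeC hZ (i := 0) (z := (f j : ℂ)) rfl
          (hest s5 hF6 IV.j j (by rw [hF5.I _ (by decide), hj2])) (by simpa using hZ32)
          (fun j' _ _ => by rw [Store.updC_self, hm]) (by simp [IExp.cost, hce])
      · intro hc'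
        simp only [BExp.holds, IExp.eval, eval_vI, hr5, h2, not_lt] at hc'
        refine Good.skip (hskip fun h => ?_) (by norm_num)
        have := (hmed.mp h).2
        omega
  · rintro s ⟨h1, h2⟩
    obtain ⟨j, hj⟩ := median_mem hr (fun i : Fin r => f i)
    exact ⟨h1 j j.2 hj, h2⟩

end medianProg

/-! ### The rounds of the algorithm as a program -/

section roundProg

variable {W : ℝ} {smp : ℤ → ℂ} {tp : ℤ → ℤ} {Z : ℤ} {l d C : ℕ}

/-- Everything that the rounds only read: the integer variables, the tables and `1 / √N`. -/
structure Prepared {r : ℕ} (C : ℕ) (ρ : Fin r → Draw l d) (Ghat xhat : Signal l d) (s : Store) :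
    Prop where
  scalars : Scalars l d C s
  tables : Tables ρ Ghat xhat s
  isq_eq : s.C CV.isq 0 = 1 / (Real.sqrt (sigLen l d) : ℂ)

theorem Prepared.frame {r : ℕ} {ρ : Fin r → Draw l d} {Ghat xhat : Signal l d} {s s' : Store}
    {LI LC : List (Fin 32)} (h : Prepared C ρ Ghat xhat s) (hF : Frame LI LC s s')
    (hI : ∀ t ∈ [IV.n, IV.d, IV.l, IV.N, IV.r, IV.pw, IV.src, IV.bucket], t ∉ LI)
    (hC : ∀ t ∈ [CV.smp, CV.wt, CV.ph, CV.isq], t ∉ LC) : Prepared C ρ Ghat xhat s' where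
  scalars := h.scalars.frame hF fun t ht => hI t (by revert ht; revert t; decide)
  tables := fun i x hx => (h.tables i x hx).congr ⟨by rw [hF.I _ (hI _ (by decide))],
    by rw [hF.I _ (hI _ (by decide))], by rw [hF.C _ (hC _ (by decide))],
    by rw [hF.C _ (hC _ (by decide))], by rw [hF.C _ (hC _ (by decide))]⟩
  isq_eq := by rw [hF.C _ (hC _ (by decide))]; exact h.isq_eq

/-- The array `arr` holds the signal `y`. -/
def Holds (s : Store) (arr : Fin 32) (y : Signal l d) : Prop :=
  ∀ x : ℕ, x < (2 ^ l) ^ d → s.C arr x = y (unflat l d x)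

theorem Holds.frame {s s' : Store} {arr : Fin 32} {y : Signal l d} {LI LC : List (Fin 32)}
    (h : Holds s arr y) (hF : Frame LI LC s s') (ha : arr ∉ LC) : Holds s' arr y :=
  fun x hx => by rw [hF.C _ ha]; exact h x hx

/-- Fill an array of length `N`. -/
def fillProg (out : Fin 32) (e : CExp) : Prog := forProg IV.x (vI IV.N) (wC out (vI IV.x) e)

theorem writesIn_fillProg (out : Fin 32) (e : CExp) : WritesIn [IV.x] [out] (fillProg out e) :=
  writesIn_forProg (by decide) (writesIn_wC _ _ List.mem_cons_self)

theorem fillProg_good (hZ : (Z : ℝ) ≤ W) {out : Fin 32} {e : CExp} {s₀ : Store}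
    (hNZ : 32 * (((2 ^ l) ^ d : ℕ) : ℤ) + 32 ≤ Z) (hN : s₀.I IV.N 0 = ((2 ^ l) ^ d : ℕ))
    {y : Signal l d} (hval : ∀ x : ℕ, x < (2 ^ l) ^ d → ∀ s, Frame [IV.x] [out] s₀ s → s.I IV.x 0 = x →
      e.eval tp s = y (unflat l d x)) {c : ℕ} (hc : e.cost + 80 ≤ c) :
    Good W smp tp (fillProg out e) s₀ (fun s => Holds s out y ∧ Frame [IV.x] [out] s₀ s)
      (c * (2 ^ l) ^ d) 0 := by
  have hNpos : 0 < (2 ^ l) ^ d := by positivity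
  refine (Good.tabulate hZ (m := (2 ^ l) ^ d) (fun x => (x : ℤ)) (fun x => y (unflat l d x))
    (fun s hF => by rw [eval_vI, hF.I _ (by decide), hN]) (fun x _ y _ h => by exact_mod_cast h)
    (fun x _ s _ hx => by rw [eval_vI, hx]) hval
    (fun x hx => by rw [abs_of_nonneg (by positivity)]; omega) (by omega) (by omega)
    (τ := c * (2 ^ l) ^ d) (by simp only [cost_vI]; nlinarith)).mono ?_ le_rfl le_rfl
  rintro s ⟨h1, -, h2⟩
  exact ⟨h1, h2⟩

/-- Place of the current hash and position in the tables. -/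
def idxE : IExp := .add (.mul (vI IV.i) (vI IV.N)) (vI IV.x)

/-- The weighted difference of a sample and the transform of the current approximation. -/
def diffE : CExp :=
  .mul (.sub (rC CV.smp idxE) (rC CV.chihat (rI IV.src idxE))) (rC CV.wt idxE)

/-- Evaluate one hash at all positions. -/
def hashBody : Prog :=
  .seq (fillProg CV.buf diffE) (.seq (fftProg 1)
    (forProg IV.x (vI IV.N) (wC CV.est (.add (.mul (vI IV.x) (vI IV.r)) (vI IV.i))
      (.mul (rC CV.buf (rI IV.bucket idxE)) (rC CV.ph idxE)))))

/-- The estimates from all hashes for all positions. -/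
def estimateProg : Prog :=
  .seq (fillProg CV.buf (rC CV.chi (vI IV.x))) (.seq (fftProg (-1))
    (.seq (fillProg CV.chihat (.mul (rC CV.buf (vI IV.x)) (vC CV.isq)))
      (forProg IV.i (vI IV.r) hashBody)))

theorem writesIn_hashBody : WritesIn [IV.x, IV.fs, IV.fp, IV.fx, IV.q] [CV.buf, CV.buf2, CV.est]
    hashBody :=
  ⟨(writesIn_fillProg _ _).mono (by decide) (by decide),
    (writesIn_fftProg _).mono (by decide) (by decide),
    writesIn_forProg (by decide) (writesIn_wC _ _ (by decide))⟩

theorem writesIn_estimateProg : WritesIn [IV.i, IV.x, IV.fs, IV.fp, IV.fx, IV.q]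
    [CV.buf, CV.buf2, CV.est, CV.chihat] estimateProg :=
  ⟨(writesIn_fillProg _ _).mono (by decide) (by decide),
    (writesIn_fftProg _).mono (by decide) (by decide),
    (writesIn_fillProg _ _).mono (by decide) (by decide),
    writesIn_forProg (by decide) (writesIn_hashBody.mono (by decide) (by decide))⟩

/-- One hash costs one fast Fourier transform. Where the sample was not queried the weight is zero,
so the unknown content of the table does not matter. -/
theorem hashBody_good (hZ : (Z : ℝ) ≤ W) {r : ℕ} (hr : r = numHashes C l d)
    {ρ : Fin r → Draw l d} {xhat yhat : Signal l d} {b F : ℕ}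
    (hd : 1 ≤ d) (hl : 1 ≤ l) (hrZ : 32 * ((r * (2 ^ l) ^ d : ℕ) : ℤ) + 32 ≤ Z) {s₀ : Store}
    (hp : Prepared C ρ (dft (filterG b F)) xhat s₀) (hy : Holds s₀ CV.chihat yhat)
    (i : Fin r) (hi : s₀.I IV.i 0 = (i : ℕ)) :
    Good W smp tp hashBody s₀ (fun s =>
      (∀ x < (2 ^ l) ^ d, s.C CV.est (x * r + i : ℕ) =
        (ρ i).hash b F (xhat - yhat) ((ρ i).perm (unflat l d x)) *
          om (-((ρ i).a ⬝ᵥ (ρ i).mat.mulVec (unflat l d x)))) ∧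
      (∀ x < (2 ^ l) ^ d, ∀ i' : Fin r, i' ≠ i →
        s.C CV.est (x * r + i' : ℕ) = s₀.C CV.est (x * r + i' : ℕ)))
      (1200 * ((l * d) * (2 ^ l) ^ d)) 0 := by
  have hNpos : 0 < (2 ^ l) ^ d := by positivity
  have hld : 1 ≤ l * d := Nat.mul_pos hl hd
  have hrpos : 0 < r := i.pos
  set N := (2 ^ l) ^ d with hN
  have hNr : N ≤ r * N := Nat.le_mul_of_pos_left _ hrpos
  have hNZ : 32 * (N : ℤ) + 32 ≤ Z := by omega
  have hNl : N ≤ l * d * N := Nat.le_mul_of_pos_left _ hld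
  refine (Good.seq (τ := 300 * N) (τ' := 600 * (l * d) * N + 250 * N) (κ := 0) (κ' := 0)
    ((fillProg_good hZ hNZ hp.scalars.N_eq (y := fun j =>
      (ρ i).permute (xhat - yhat) j * dft (filterG b F) j) ?_ (by decide)).mono ?_ le_rfl le_rfl)).mono
    (fun _ h => h) ?_ le_rfl
  · intro x hx s hF hsx
    have hp' := hp.frame hF (by decide) (by decide)
    have ht : TableAt s (ρ i) _ xhat (i * N + x) x := hp'.tables i x hx
    have hi' : s.I IV.i 0 = (i : ℕ) := by rw [hF.I _ (by decide), hi]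
    have hidx : (idxE).eval tp s = ((i * N + x : ℕ) : ℤ) := by
      simp only [idxE, IExp.eval, eval_vI, hi', hp'.scalars.N_eq, hsx]; push_cast; rfl
    simp only [diffE, CExp.eval, eval_rC, eval_rI, hidx, ht.src, ht.wt]
    rw [flatIndex_eq, hF.C CV.chihat (by decide), hy _ (flatNat_lt _), unflat_flatNat]
    by_cases h0 : dft (filterG b F) (unflat l d x) = 0
    · rw [h0]; ring
    · rw [ht.smp h0]
      simp only [Draw.permute, Pi.sub_apply]
      ring
  · rintro s1 ⟨h1, hF1⟩
    have hp1 := hp.frame hF1 (by decide) (by decide)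
    refine Good.seq (κ := 0) (κ' := 0)
      ((fftProg_good hZ 1 hl hd hNZ hp1.scalars.d_eq hp1.scalars.l_eq hp1.scalars.N_eq
        (y := fun j => (ρ i).permute (xhat - yhat) j * dft (filterG b F) j) h1).mono ?_
        le_rfl le_rfl)
    rintro s2 ⟨h2, hF2⟩
    have hp2 := hp1.frame hF2 (by decide) (by decide)
    have h2' : Holds s2 CV.buf ((ρ i).hash b F (xhat - yhat)) := by
      intro x hx
      rw [h2 x hx, Draw.hash_eq_sum]
      simp only [Int.cast_one, one_mul]
    have hi2 : s2.I IV.i 0 = (i : ℕ) := by rw [hF2.I _ (by decide), hF1.I _ (by decide), hi]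
    have hinj : ∀ x i' y j' : ℕ, i' < r → j' < r → x * r + i' = y * r + j' → x = y ∧ i' = j' := by
      intro x i' y j' hi' hj' h
      have h1 := congrArg (· / r) h
      have h2 := congrArg (· % r) h
      simp only [mul_comm _ r, Nat.mul_add_div hrpos, Nat.mul_add_mod, Nat.div_eq_of_lt hi',
        Nat.div_eq_of_lt hj', Nat.mod_eq_of_lt hi', Nat.mod_eq_of_lt hj'] at h1 h2
      exact ⟨by omega, h2⟩
    refine (Good.tabulate hZ (m := N) (fun x => ((x * r + i : ℕ) : ℤ))
      (fun x => (ρ i).hash b F (xhat - yhat) ((ρ i).perm (unflat l d x)) *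
          om (-((ρ i).a ⬝ᵥ (ρ i).mat.mulVec (unflat l d x))))
      (fun s hF => by rw [eval_vI, hF.I _ (by decide), hp2.scalars.N_eq]) ?_ ?_ ?_ ?_ (by omega)
      (by omega) (τ := 250 * N) ?_).mono ?_ le_rfl le_rfl
    · intro x _ y _ h
      exact (hinj x i y i i.2 i.2 (by exact_mod_cast h)).1
    · intro x hx s hF hsx
      have hp3 := hp2.frame hF (by decide) (by decide)
      simp only [IExp.eval, eval_vI, hsx, hp3.scalars.r_eq, ← hr, hF.I IV.i (by decide), hi2]
      push_cast; rfl
    · intro x hx s hF hsx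
      have hp3 := hp2.frame hF (by decide) (by decide)
      have ht : TableAt s (ρ i) _ xhat (i * N + x) x := hp3.tables i x hx
      have hidx : (idxE).eval tp s = ((i * N + x : ℕ) : ℤ) := by
        simp only [idxE, IExp.eval, eval_vI, hF.I IV.i (by decide), hi2, hp3.scalars.N_eq, hsx]
        push_cast; rfl
      simp only [CExp.eval, eval_rC, eval_rI, hidx, ht.bucket, ht.ph]
      rw [flatIndex_eq, hF.C CV.buf (by decide), h2' _ (flatNat_lt _), unflat_flatNat]
    · intro x hx
      have : x * r + i < r * N := by
        calc x * r + i < x * r + r := by have := i.2; omega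
          _ = (x + 1) * r := by ring
          _ ≤ N * r := Nat.mul_le_mul_right _ hx
          _ = r * N := mul_comm _ _
      rw [abs_of_nonneg (by positivity)]; omega
    · have h1 : (CExp.mul (rC CV.buf (rI IV.bucket idxE)) (rC CV.ph idxE)).cost ≤ 80 := by decide
      have h2 : (IExp.add (.mul (vI IV.x) (vI IV.r)) (vI IV.i)).cost ≤ 20 := by decide
      simp only [cost_vI]
      nlinarith
    · rintro s3 ⟨h3, h4, -⟩
      refine ⟨h3, fun x hx i' hne => ?_⟩
      rw [h4 _ fun y _ h => hne (Fin.ext (hinj x i' y i i'.2 i.2 (by exact_mod_cast h)).2),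
        hF2.C _ (by decide), hF1.C _ (by decide)]
  · have : 600 * (l * d) * N = 600 * (l * d * N) := by ring
    omega

/-- All estimates cost `O(r N log N)` steps. By linearity of the hash it is applied to the difference
of the samples and the transform of the current approximation, and no further query is needed. -/
theorem estimateProg_good (hZ : (Z : ℝ) ≤ W) {r : ℕ} (hr : r = numHashes C l d) (hC : 1 ≤ C)
    {ρ : Fin r → Draw l d} {xhat χ : Signal l d} {b F : ℕ}
    (hd : 1 ≤ d) (hl : 1 ≤ l) (hrZ : 32 * ((r * (2 ^ l) ^ d : ℕ) : ℤ) + 32 ≤ Z) {s₀ : Store}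
    (hp : Prepared C ρ (dft (filterG b F)) xhat s₀) (hχ : Holds s₀ CV.chi χ) :
    Good W smp tp estimateProg s₀ (fun s =>
      (∀ x < (2 ^ l) ^ d, ∀ i : Fin r, s.C CV.est (x * r + i : ℕ) =
        (ρ i).hash b F (xhat - dft χ) ((ρ i).perm (unflat l d x)) *
          om (-((ρ i).a ⬝ᵥ (ρ i).mat.mulVec (unflat l d x)))) ∧
      Frame [IV.i, IV.x, IV.fs, IV.fp, IV.fx, IV.q] [CV.buf, CV.buf2, CV.est, CV.chihat] s₀ s)
      (2200 * (r * (l * d) * (2 ^ l) ^ d)) 0 := by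
  have hNpos : 0 < (2 ^ l) ^ d := by positivity
  have hld : 1 ≤ l * d := Nat.mul_pos hl hd
  have hrpos : 0 < r := by rw [hr]; unfold numHashes; positivity
  set N := (2 ^ l) ^ d with hN
  have hNr : N ≤ r * N := Nat.le_mul_of_pos_left _ hrpos
  have hrN : r ≤ r * N := Nat.le_mul_of_pos_right _ hNpos
  have hNZ : 32 * (N : ℤ) + 32 ≤ Z := by omega
  have hNl : N ≤ l * d * N := Nat.le_mul_of_pos_left _ hld
  have hlr : l * d * N ≤ r * (l * d) * N := by
    rw [mul_assoc r]; exact Nat.le_mul_of_pos_left _ hrpos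
  have hrl : r ≤ r * (l * d) * N := by
    rw [mul_assoc]; exact Nat.le_mul_of_pos_right _ (by positivity)
  refine (Good.frame (Good.seq (τ := 100 * N) (τ' := 2000 * (r * (l * d) * N)) (κ := 0) (κ' := 0)
    ((fillProg_good hZ hNZ hp.scalars.N_eq (y := χ) (fun x hx s hF hsx => by
      rw [eval_rC, eval_vI, hsx, hF.C _ (by decide), hχ x hx]) (by decide)).mono ?_ le_rfl le_rfl))
      writesIn_estimateProg).mono (fun _ h => h) (by omega) le_rfl
  rintro s1 ⟨h1, hF1⟩
  have hp1 := hp.frame hF1 (by decide) (by decide)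
  refine (Good.seq (κ := 0) (κ' := 0) (τ := 600 * (l * d) * N) (τ' := 1400 * (r * (l * d) * N))
    ((fftProg_good hZ (-1) hl hd hNZ hp1.scalars.d_eq hp1.scalars.l_eq hp1.scalars.N_eq h1).mono ?_
      le_rfl le_rfl)).mono (fun _ h => h) (by rw [mul_assoc 600]; omega) le_rfl
  rintro s2 ⟨h2, hF2⟩
  have hp2 := hp1.frame hF2 (by decide) (by decide)
  refine (Good.seq (κ := 0) (κ' := 0) (τ := 100 * N) (τ' := 1300 * (r * (l * d) * N))
    ((fillProg_good hZ hNZ hp2.scalars.N_eq (y := dft χ) (fun x hx s hF hsx => by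
      have hp3 := hp2.frame hF (by decide) (by decide)
      simp only [CExp.eval, eval_rC, eval_vI, eval_vC, hsx, hF.C CV.buf (by decide), h2 x hx,
        hp3.isq_eq]
      rw [mul_comm, dft]
      congr 1
      refine Finset.sum_congr rfl fun i _ => ?_
      push_cast
      rw [neg_one_mul]) (by decide)).mono ?_ le_rfl le_rfl)).mono
    (fun _ h => h) (by omega) le_rfl
  rintro s3 ⟨h3, hF3⟩
  have hp3 := hp2.frame hF3 (by decide) (by decide)
  refine (Good.for hZ writesIn_hashBody (by decide) (m := r)
    (fun s hF => by rw [eval_vI, hF.I _ (by decide), hp3.scalars.r_eq, hr])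
    (fun i s => ∀ x < N, ∀ i' : Fin r, (i' : ℕ) < i → s.C CV.est (x * r + i' : ℕ) =
        (ρ i').hash b F (xhat - dft χ) ((ρ i').perm (unflat l d x)) *
          om (-((ρ i').a ⬝ᵥ (ρ i').mat.mulVec (unflat l d x))))
    (τ := 1200 * (l * d * N)) (κ := fun _ => 0) (τ' := 1300 * (r * (l * d) * N)) (fun i s v h => h)
    ?_ ?_ (by omega) (by omega) ?_).mono ?_ le_rfl (by simp)
  · intro x _ i hi; exact absurd hi (Nat.not_lt_zero _)
  · intro i hi s hF hsi hinv
    refine (hashBody_good hZ hr hd hl hrZ (hp3.frame hF (by decide) (by decide))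
      (h3.frame hF (by decide)) ⟨i, hi⟩ hsi).mono ?_ le_rfl le_rfl
    rintro s' ⟨h4, h5⟩ x hx i' hi'
    rcases Nat.lt_succ_iff_lt_or_eq.mp hi' with h | h
    · rw [h5 x hx i' (fun h' => by rw [h'] at h; exact lt_irrefl _ h)]
      exact hinv x hx i' h
    · obtain rfl : i' = ⟨i, hi⟩ := Fin.ext h
      exact h4 x hx
  · simp only [cost_vI]
    have e : r * (l * d) * N = r * (l * d * N) := by ring
    have : 1 ≤ l * d * N := by omega
    rw [e]
    nlinarith
  · rintro s ⟨h4, -⟩ x hx i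
    exact h4 x hx i i.2

/-- Update one entry of the approximation. -/
def updateBody : Prog :=
  .seq (medianProg .re CV.re) (.seq (medianProg .im CV.im)
    (.ite (.clt (vC CV.thr) (.add (.mul (vC CV.re) (vC CV.re)) (.mul (vC CV.im) (vC CV.im))))
      (wC CV.chi (vI IV.x) (.add (rC CV.chi (vI IV.x))
        (.add (vC CV.re) (.mul (vC CV.im) (.root (.const 1) (.const 4)))))) .skip))

/-- One round of the algorithm. -/
def roundProg : Prog :=
  .seq estimateProg (.seq (forProg IV.x (vI IV.N) updateBody)
    (wC CV.thr (.const 0) (.div (vC CV.thr) (.ofInt (.const 4)))))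

theorem writesIn_updateBody : WritesIn [IV.j, IV.i, IV.lt, IV.le] [CV.re, CV.im, CV.chi]
    updateBody :=
  ⟨writesIn_forProg (by decide) ((writesIn_candBody _ _).mono (by decide) (by decide)),
    writesIn_forProg (by decide) ((writesIn_candBody _ _).mono (by decide) (by decide)),
    writesIn_wC _ _ (by decide), trivial⟩

theorem writesIn_roundProg : WritesIn
    [IV.i, IV.x, IV.fs, IV.fp, IV.fx, IV.q, IV.j, IV.lt, IV.le]
    [CV.buf, CV.buf2, CV.est, CV.chihat, CV.re, CV.im, CV.chi, CV.thr] roundProg :=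
  ⟨writesIn_estimateProg.mono (by decide) (by decide),
    writesIn_forProg (by decide) (writesIn_updateBody.mono (by decide) (by decide)),
    writesIn_wC _ _ (by decide)⟩

theorem rootVal_one_four : rootVal 1 4 = Complex.I := by
  rw [rootVal, show 2 * (Real.pi : ℂ) * Complex.I * ((1 : ℤ) : ℂ) / ((4 : ℤ) : ℂ) =
    (Real.pi : ℂ) / 2 * Complex.I by push_cast; ring, Complex.exp_pi_div_two_mul_I]

theorem updateBody_good (hZ : (Z : ℝ) ≤ W) {r x : ℕ} (hr : 0 < r) (hrZ : (r : ℤ) ≤ Z)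
    (hxZ : 32 * (x : ℤ) + 32 ≤ Z) {s₀ : Store}
    (hsr : s₀.I IV.r 0 = r) (hsx : s₀.I IV.x 0 = x) {η : Fin r → ℂ}
    (hη : ∀ i : Fin r, s₀.C CV.est (x * r + i : ℕ) = η i) {ν : ℝ} (hν : 0 ≤ ν)
    (hthr : s₀.C CV.thr 0 = ((ν / 2) ^ 2 : ℝ)) :
    Good W smp tp updateBody s₀ (fun s =>
      s.C CV.chi x = s₀.C CV.chi x + (if ‖medianC η‖ ≤ ν / 2 then 0 else medianC η) ∧
      (∀ z : ℤ, z ≠ x → s.C CV.chi z = s₀.C CV.chi z)) (900 * (r * r)) 0 := by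
  have hZ32 : 32 ≤ Z := by omega
  have hrr : 1 ≤ r * r := Nat.mul_pos hr hr
  refine (Good.seq (κ := 0) (κ' := 0) (τ' := 500 * (r * r))
    ((medianProg_good hZ (part := .re) (pr := Complex.re) (fun _ _ => rfl) (fun _ => rfl)
      (by decide) hr hrZ hZ32 hsr hsx hη).mono ?_ le_rfl le_rfl)).mono
    (fun _ h => h) (by omega) le_rfl
  rintro s1 ⟨h1, hF1⟩
  refine (Good.seq (κ := 0) (κ' := 0) (τ' := 100)
    ((medianProg_good hZ (part := .im) (pr := Complex.im) (fun _ _ => rfl) (fun _ => rfl)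
      (by decide) hr hrZ hZ32 (by rw [hF1.I _ (by decide), hsr]) (by rw [hF1.I _ (by decide), hsx])
      (η := η) (fun i => by rw [hF1.C _ (by decide), hη])).mono ?_ le_rfl le_rfl)).mono
    (fun _ h => h) (by omega) le_rfl
  rintro s2 ⟨h2, hF2⟩
  have hre : s2.C CV.re 0 = ((medianC η).re : ℂ) := by rw [hF2.C _ (by decide), h1]; rfl
  have him : s2.C CV.im 0 = ((medianC η).im : ℂ) := h2
  have hthr2 : s2.C CV.thr 0 = ((ν / 2) ^ 2 : ℝ) := by
    rw [hF2.C _ (by decide), hF1.C _ (by decide), hthr]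
  have hx2 : s2.I IV.x 0 = x := by rw [hF2.I _ (by decide), hF1.I _ (by decide), hsx]
  have hchi : s2.C CV.chi = s₀.C CV.chi := by rw [hF2.C _ (by decide), hF1.C _ (by decide)]
  have hiff : (BExp.clt (vC CV.thr) (.add (.mul (vC CV.re) (vC CV.re))
      (.mul (vC CV.im) (vC CV.im)))).holds tp s2 ↔ ¬ ‖medianC η‖ ≤ ν / 2 := by
    simp only [BExp.holds, CExp.eval, eval_vC, hre, him, hthr2]
    rw [Complex.ofReal_re, ← Complex.ofReal_mul, ← Complex.ofReal_mul, ← Complex.ofReal_add,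
      Complex.ofReal_re, ← Complex.normSq_apply, Complex.normSq_eq_norm_sq, not_le,
      sq_lt_sq₀ (by positivity) (norm_nonneg _)]
  refine (Good.ite (τ := 60) (κ := 0) ?_ ?_).mono (fun _ h => h)
    (by decide) le_rfl
  · intro hc
    rw [hiff] at hc
    refine Good.writeC hZ (i := x) (z := s₀.C CV.chi x + medianC η) (by rw [eval_vI, hx2]) ?_
      (by rw [abs_of_nonneg (by positivity)]; exact hxZ) ⟨?_, ?_⟩ (by decide)
    · simp only [CExp.eval, eval_rC, eval_vI, eval_vC, hx2, hchi, hre, him]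
      congr 1
      conv_rhs => rw [← Complex.re_add_im (medianC η), ← rootVal_one_four]
      rfl
    · rw [Store.updC_self, if_neg hc]
    · intro z hz
      rw [Store.updC_C, if_neg fun h => hz h.2, hchi]
  · intro hc
    rw [hiff, not_not] at hc
    exact Good.skip ⟨by rw [if_pos hc, hchi, add_zero], fun z _ => by rw [hchi]⟩ (by norm_num)

/-- A round of the program performs a round of the algorithm. The variable `thr` holds the square of
the threshold. -/
theorem roundProg_good (hZ : (Z : ℝ) ≤ W) {r : ℕ} (hr : r = numHashes C l d) (hC : 1 ≤ C)
    {ρ : Fin r → Draw l d} {xhat χ : Signal l d} {b F : ℕ}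
    (hd : 1 ≤ d) (hl : 1 ≤ l) (hrZ : 32 * ((r * (2 ^ l) ^ d : ℕ) : ℤ) + 32 ≤ Z) {s₀ : Store}
    (hp : Prepared C ρ (dft (filterG b F)) xhat s₀) (hχ : Holds s₀ CV.chi χ) {ν : ℝ} (hν : 0 ≤ ν)
    (hthr : s₀.C CV.thr 0 = ((ν / 2) ^ 2 : ℝ)) :
    Good W smp tp roundProg s₀ (fun s =>
      Holds s CV.chi (χ + locateAndEstimate b F ρ (fun i => (ρ i).hash b F xhat) 0 χ ν) ∧
      s.C CV.thr 0 = ((ν / 2 / 2) ^ 2 : ℝ))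
      (3500 * ((2 ^ l) ^ d * (r * r))) 0 := by
  have hNpos : 0 < (2 ^ l) ^ d := by positivity
  have hld : 1 ≤ l * d := Nat.mul_pos hl hd
  have hrld : l * d ≤ r := by rw [hr]; unfold numHashes; exact Nat.le_mul_of_pos_left _ hC
  have hrpos : 0 < r := by omega
  set N := (2 ^ l) ^ d with hN
  have hNr : N ≤ r * N := Nat.le_mul_of_pos_left _ hrpos
  have hrN : r ≤ r * N := Nat.le_mul_of_pos_right _ hNpos
  have hNZ : 32 * (N : ℤ) + 32 ≤ Z := by omega
  have hrr : 1 ≤ r * r := Nat.mul_pos hrpos hrpos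
  have hNrr : 1 ≤ N * (r * r) := Nat.mul_pos hNpos hrr
  have hcost : r * (l * d) * N ≤ N * (r * r) := by
    rw [mul_comm]; exact Nat.mul_le_mul_left _ (Nat.mul_le_mul_left _ hrld)
  refine (Good.seq (κ := 0) (κ' := 0) (τ := 2200 * (r * (l * d) * N)) (τ' := 1100 * (N * (r * r)))
    ((estimateProg_good hZ hr hC hd hl hrZ hp hχ).mono ?_ le_rfl le_rfl)).mono
    (fun _ h => h) (by omega) le_rfl
  rintro s1 ⟨h1, hF1⟩
  have hp1 := hp.frame hF1 (by decide) (by decide)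
  have hχ1 := hχ.frame hF1 (by decide)
  have hthr1 : s1.C CV.thr 0 = ((ν / 2) ^ 2 : ℝ) := by rw [hF1.C _ (by decide), hthr]
  set χ' := χ + locateAndEstimate b F ρ (fun i => (ρ i).hash b F xhat) 0 χ ν with hχ'
  let η : ℕ → Fin r → ℂ := fun x i => (ρ i).hash b F (xhat - dft χ) ((ρ i).perm (unflat l d x)) *
          om (-((ρ i).a ⬝ᵥ (ρ i).mat.mulVec (unflat l d x)))
  have hval : ∀ x, χ' (unflat l d x) = χ (unflat l d x) +
      (if ‖medianC (η x)‖ ≤ ν / 2 then 0 else medianC (η x)) := by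
    intro x
    rw [hχ', Pi.add_apply]
    congr 1
    simp only [locateAndEstimate, η, Draw.hash_sub, Pi.zero_apply, add_zero]
  refine (Good.seq (κ := 0) (κ' := 0) (τ := 1000 * (N * (r * r))) (τ' := 50)
    ((Good.for hZ writesIn_updateBody (by decide) (m := N)
      (fun s hF => by rw [eval_vI, hF.I _ (by decide), hp1.scalars.N_eq])
      (fun j s => (∀ x < j, s.C CV.chi (x : ℕ) = χ' (unflat l d x)) ∧
        (∀ x : ℕ, j ≤ x → s.C CV.chi x = s1.C CV.chi x)) (τ := 900 * (r * r)) (κ := fun _ => 0)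
      (τ' := 1000 * (N * (r * r))) (fun j s v h => h) ?_ ?_ (by omega) (by omega) ?_).mono ?_ le_rfl
      (by simp))).mono (fun _ h => h) (by omega) le_rfl
  · exact ⟨fun x hx => absurd hx (Nat.not_lt_zero _), fun _ _ => rfl⟩
  · rintro x hx s hF hsx ⟨hi1, hi2⟩
    have hp2 := hp1.frame hF (by decide) (by decide)
    refine (updateBody_good hZ hrpos (by omega) (x := x) (by omega)
      (by rw [hp2.scalars.r_eq, hr]) hsx (η := η x)
      (fun i => by rw [hF.C _ (by decide)]; exact h1 x hx i) hν
      (by rw [hF.C _ (by decide), hthr1])).mono ?_ le_rfl le_rfl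
    rintro s' ⟨h2, h3⟩
    refine ⟨fun y hy => ?_, fun y hy => ?_⟩
    · rcases Nat.lt_succ_iff_lt_or_eq.mp hy with h | rfl
      · rw [h3 _ (by exact_mod_cast h.ne)]; exact hi1 y h
      · rw [h2, hi2 y le_rfl, hχ1 y hx, hval]
    · rw [h3 _ (by exact_mod_cast (by omega : y ≠ x)), hi2 y (by omega)]
  · simp only [cost_vI]
    nlinarith
  · rintro s2 ⟨⟨h2, -⟩, hF2⟩
    refine Good.writeC hZ (i := 0) (z := ((ν / 2 / 2) ^ 2 : ℝ)) rfl ?_ (by simp; omega)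
      ⟨fun x hx => by rw [Store.updC_ne _ (by decide)]; exact h2 x hx,
        Store.updC_self _ _ _ _⟩ (by decide)
    simp only [CExp.eval, eval_vC, IExp.eval, hF2.C CV.thr (by decide), hthr1]
    push_cast
    ring

end roundProg

/-! ### The integer parameters as a program -/

section scalarProg

variable {W : ℝ} {smp : ℤ → ℂ} {tp : ℤ → ℤ} {Z : ℤ} {l d C : ℕ}

/-- The logarithm of the side of the grid. -/
def logProg : Prog :=
  .seq (wI IV.q (.const 0) (.const 1)) (.seq (wI IV.l (.const 0) (.const 0))
    (.while (.ilt (vI IV.q) (vI IV.n))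
      (.seq (wI IV.q (.const 0) (.mul (.const 2) (vI IV.q)))
        (wI IV.l (.const 0) (.add (vI IV.l) (.const 1))))))

theorem writesIn_logProg : WritesIn [IV.q, IV.l] [] logProg :=
  ⟨writesIn_wI _ _ (by decide), writesIn_wI _ _ (by decide), writesIn_wI _ _ (by decide),
    writesIn_wI _ _ (by decide)⟩

theorem logProg_good (hZ : (Z : ℝ) ≤ W) (hl : 1 ≤ l) (hnZ : 32 * ((2 ^ l : ℕ) : ℤ) + 32 ≤ Z)
    {s₀ : Store} (hn : s₀.I IV.n 0 = (2 ^ l : ℕ)) :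
    Good W smp tp logProg s₀ (fun s => s.I IV.l 0 = l ∧ Frame [IV.q, IV.l] [] s₀ s) (100 * l) 0 := by
  have hln : l < 2 ^ l := Nat.lt_two_pow_self
  refine (Good.frame (Good.seq (τ := 8) (τ' := 90 * l) (κ := 0) (κ' := 0)
    (Good.writeI hZ (i := 0) (z := 1) rfl rfl (by simp; omega) (by simp; omega) ?_
      (by decide))) writesIn_logProg).mono (fun _ h => h) (by omega) le_rfl
  refine (Good.seq (τ := 8) (τ' := 80 * l) (κ := 0) (κ' := 0)
    (Good.writeI hZ (i := 0) (z := 0) rfl rfl (by simp; omega) (by simp; omega) ?_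
      (by decide))).mono (fun _ h => h) (by omega) le_rfl
  refine (Good.while (m := l) (τ := 40) (κ := fun _ => 0)
    (Inv := fun j s => s.I IV.n 0 = (2 ^ l : ℕ) ∧ s.I IV.q 0 = (2 ^ j : ℕ) ∧ s.I IV.l 0 = j)
    ?_ ?_ ?_).mono (fun s h => h.2.2) ?_ (by simp)
  · rintro j hj s ⟨h1, h2, h3⟩
    have hle : 2 ^ (j + 1) ≤ 2 ^ l := Nat.pow_le_pow_right (by norm_num) hj
    refine ⟨?_, ?_⟩
    · simp only [BExp.holds, eval_vI, h1, h2]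
      exact_mod_cast Nat.pow_lt_pow_right (by norm_num) hj
    · refine Good.seq (τ := 20) (τ' := 20) (κ := 0) (κ' := 0)
        (Good.writeI hZ (i := 0) (z := (2 ^ (j + 1) : ℕ)) rfl ?_ (by simp; omega) ?_ ?_ (by decide))
      · simp only [IExp.eval, eval_vI, h2]; push_cast; ring
      · rw [abs_of_nonneg (by positivity)]; omega
      · refine Good.writeI hZ (i := 0) (z := (j + 1 : ℕ)) rfl ?_ (by simp; omega) ?_ ⟨?_, ?_, ?_⟩
          (by decide)
        · simp only [IExp.eval, eval_vI, Store.updI_ne _ (by decide : IV.l ≠ IV.q), h3]; push_cast; rfl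
        · rw [abs_of_nonneg (by positivity)]; omega
        · rw [Store.updI_ne _ (by decide), Store.updI_ne _ (by decide), h1]
        · rw [Store.updI_ne _ (by decide), Store.updI_self]
        · rw [Store.updI_self]
  · rintro s ⟨h1, h2, -⟩
    simp only [BExp.holds, eval_vI, h1, h2, lt_self_iff_false, not_false_iff]
  · refine ⟨?_, ?_, ?_⟩
    · rw [Store.updI_ne _ (by decide), Store.updI_ne _ (by decide), hn]
    · rw [Store.updI_ne _ (by decide), Store.updI_self]; rfl
    · rw [Store.updI_self]; rfl
  · simp only [BExp.cost, cost_vI]; omega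

/-- All basic integer variables. -/
def scalarProg (C : ℕ) : Prog :=
  .seq logProg (.seq (wI IV.pw (.const 0) (.const 1))
    (.seq (forProg IV.s (vI IV.d) (wI IV.pw (.add (vI IV.s) (.const 1))
        (.mul (rI IV.pw (vI IV.s)) (vI IV.n))))
      (.seq (wI IV.N (.const 0) (rI IV.pw (vI IV.d)))
        (.seq (wI IV.logN (.const 0) (.mul (vI IV.l) (vI IV.d)))
          (wI IV.r (.const 0) (.mul (.const C) (vI IV.logN)))))))

theorem writesIn_scalarProg : WritesIn [IV.q, IV.l, IV.pw, IV.s, IV.N, IV.logN, IV.r] []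
    (scalarProg C) :=
  ⟨writesIn_logProg.mono (by decide) (by decide), writesIn_wI _ _ (by decide),
    writesIn_forProg (by decide) (writesIn_wI _ _ (by decide)), writesIn_wI _ _ (by decide),
    writesIn_wI _ _ (by decide), writesIn_wI _ _ (by decide)⟩

theorem scalarProg_good (hZ : (Z : ℝ) ≤ W) (hl : 1 ≤ l) (hd : 1 ≤ d)
    (hNZ : 32 * (((2 ^ l) ^ d : ℕ) : ℤ) + 32 ≤ Z) (hrZ : (numHashes C l d : ℤ) ≤ Z)
    {s₀ : Store} (hn : s₀.I IV.n 0 = (2 ^ l : ℕ)) (hsd : s₀.I IV.d 0 = d) :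
    Good W smp tp (scalarProg C) s₀ (fun s => Scalars l d C s ∧ s.I IV.logN 0 = (l * d : ℕ) ∧
      Frame [IV.q, IV.l, IV.pw, IV.s, IV.N, IV.logN, IV.r] [] s₀ s) (1000 * (l * d)) 0 := by
  have hnN : 2 ^ l ≤ (2 ^ l) ^ d := Nat.le_self_pow (by omega) _
  have hdN : d < (2 ^ l) ^ d := Nat.lt_pow_self (Nat.one_lt_two_pow (by omega))
  have hldN : l * d < (2 ^ l) ^ d := by rw [← pow_mul]; exact Nat.lt_two_pow_self
  have hld : 1 ≤ l * d := Nat.mul_pos hl hd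
  have hl' : l ≤ l * d := Nat.le_mul_of_pos_right _ hd
  have hd' : d ≤ l * d := Nat.le_mul_of_pos_left _ hl
  refine Good.frame_and writesIn_scalarProg ((Good.seq (τ := 100 * l) (τ' := 900 * (l * d)) (κ := 0) (κ' := 0)
    ((logProg_good hZ hl (by omega) hn).mono ?_ le_rfl le_rfl)).mono (fun _ h => h)
    (by omega) le_rfl)
  rintro s1 ⟨hl1, hF1⟩
  have hn1 : s1.I IV.n 0 = (2 ^ l : ℕ) := by rw [hF1.I _ (by decide), hn]
  have hd1 : s1.I IV.d 0 = d := by rw [hF1.I _ (by decide), hsd]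
  refine (Good.seq (τ := 8) (τ' := 800 * (l * d)) (κ := 0) (κ' := 0)
    (Good.writeI hZ (i := 0) (z := 1) rfl rfl (by simp; omega) (by simp; omega) ?_
      (by decide))).mono (fun _ h => h) (by omega) le_rfl
  refine (Good.seq (τ := 200 * (l * d)) (τ' := 100) (κ := 0) (κ' := 0)
    ((Good.for hZ (LI := [IV.pw]) (LC := []) (writesIn_wI _ _ (by decide)) (by decide) (m := d)
      (fun s hF => by rw [eval_vI, hF.I _ (by decide), Store.updI_ne _ (by decide), hd1])
      (fun j s => ∀ i : ℕ, i ≤ j → s.I IV.pw i = ((2 ^ l) ^ i : ℕ)) (τ := 50) (κ := fun _ => 0)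
      (τ' := 200 * (l * d)) ?_ ?_ ?_ (by omega) (by omega)
      (by simp only [cost_vI]; omega)).mono ?_ le_rfl (by simp))).mono
      (fun _ h => h) (by omega) le_rfl
  · intro j s v h i hi
    rw [Store.updI_ne _ (by decide), h i hi]
  · intro i hi
    obtain rfl : i = 0 := by omega
    exact Store.updI_self _ _ _ _
  · intro j hj s hF hsj hinv
    have hle : (2 ^ l) ^ (j + 1) ≤ (2 ^ l) ^ d := Nat.pow_le_pow_right (by positivity) hj
    refine Good.writeI hZ (i := (j + 1 : ℕ)) (z := ((2 ^ l) ^ (j + 1) : ℕ)) ?_ ?_ ?_ ?_ ?_ (by decide)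
    · simp only [IExp.eval, eval_vI, hsj]; push_cast; rfl
    · have hn2 : s.I IV.n 0 = (2 ^ l : ℕ) := by
        rw [hF.I _ (by decide), Store.updI_ne _ (by decide), hn1]
      simp only [IExp.eval, eval_vI, eval_rI, hsj, hinv j le_rfl, hn2]; push_cast; ring
    · rw [abs_of_nonneg (by positivity)]; omega
    · rw [abs_of_nonneg (by positivity)]; omega
    · intro i hi
      rw [Store.updI_I]
      split_ifs with h
      · have : i = j + 1 := by exact_mod_cast h.2
        rw [this]
      · exact hinv i (by
          rcases Nat.lt_succ_iff_lt_or_eq.mp (Nat.lt_succ_of_le hi) with h' | h'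
          · omega
          · exact absurd ⟨rfl, by rw [h']⟩ h)
  · rintro s2 ⟨hpw, hF2⟩
    have hn2 : s2.I IV.n 0 = (2 ^ l : ℕ) := by
      rw [hF2.I _ (by decide), Store.updI_ne _ (by decide), hn1]
    have hd2 : s2.I IV.d 0 = d := by
      rw [hF2.I _ (by decide), Store.updI_ne _ (by decide), hd1]
    have hl2 : s2.I IV.l 0 = l := by
      rw [hF2.I _ (by decide), Store.updI_ne _ (by decide), hl1]
    refine (Good.seq (τ := 20) (τ' := 60) (κ := 0) (κ' := 0)
      (Good.writeI hZ (i := 0) (z := ((2 ^ l) ^ d : ℕ)) rfl ?_ (by simp; omega) ?_ ?_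
      (by decide))).mono (fun _ h => h) (by omega) le_rfl
    · simp only [eval_rI, eval_vI, hd2, hpw d le_rfl]
    · rw [abs_of_nonneg (by positivity)]; omega
    refine (Good.seq (τ := 20) (τ' := 40) (κ := 0) (κ' := 0)
      (Good.writeI hZ (i := 0) (z := (l * d : ℕ)) rfl ?_ (by simp; omega) ?_ ?_
      (by decide))).mono (fun _ h => h) (by omega) le_rfl
    · simp only [IExp.eval, eval_vI, Store.updI_ne _ (by decide : IV.l ≠ IV.N),
        Store.updI_ne _ (by decide : IV.d ≠ IV.N), hl2, hd2]
      push_cast; rfl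
    · rw [abs_of_nonneg (by positivity)]; omega
    have e : ∀ {t : Fin 32} {i v : ℤ} {s : Store} {t' : Fin 32}, t' ≠ t →
        (s.updI t i v).I t' = s.I t' := fun h => Store.updI_ne _ h _ _
    refine Good.writeI hZ (i := 0) (z := (numHashes C l d : ℕ)) rfl ?_ (by simp; omega) ?_
      ⟨⟨?_, ?_, ?_, ?_, ?_, ?_⟩, ?_⟩ (by simp [IExp.cost, cost_vI])
    · simp only [IExp.eval, eval_vI, Store.updI_self, numHashes]
      push_cast; rfl
    · rw [abs_of_nonneg (by positivity)]; omega
    · rw [e (by decide), e (by decide), e (by decide), hn2]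
    · rw [e (by decide), e (by decide), e (by decide), hd2]
    · rw [e (by decide), e (by decide), e (by decide), hl2]
    · rw [e (by decide), e (by decide), Store.updI_self]
    · rw [Store.updI_self]
    · intro j hj
      rw [e (by decide), e (by decide), e (by decide), hpw j hj]
    · rw [e (by decide), Store.updI_self]

end scalarProg

/-! ### The normalization, the bucket side and the threshold as a program -/

section paramProg

variable {W : ℝ} {smp : ℤ → ℂ} {tp : ℤ → ℤ} {Z : ℤ} {l d C : ℕ}

/-- The normalization `1 / √N`, as a power of `Re exp (2 π i / 8) = 1 / √2`. -/
def isqProg : Prog :=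
  .seq (wC CV.isq (.const 0) (.ofInt (.const 1))) (forProg IV.s (vI IV.logN)
    (wC CV.isq (.const 0) (.mul (vC CV.isq) (.re (.root (.const 1) (.const 8))))))

theorem writesIn_isqProg : WritesIn [IV.s] [CV.isq] isqProg :=
  ⟨writesIn_wC _ _ (by decide), writesIn_forProg (by decide) (writesIn_wC _ _ (by decide))⟩

theorem re_rootVal_one_eight : (rootVal 1 8).re = 1 / Real.sqrt 2 := by
  rw [rootVal, show 2 * (Real.pi : ℂ) * Complex.I * ((1 : ℤ) : ℂ) / ((8 : ℤ) : ℂ) =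
    ((Real.pi / 4 : ℝ) : ℂ) * Complex.I by push_cast; ring, Complex.exp_ofReal_mul_I_re,
    Real.cos_pi_div_four, div_eq_div_iff (by norm_num) (by positivity),
    Real.mul_self_sqrt (by norm_num)]
  norm_num

theorem isqProg_good (hZ : (Z : ℝ) ≤ W) (hld : 1 ≤ l * d) (hZ32 : 32 ≤ Z)
    (hldZ : ((l * d : ℕ) : ℤ) ≤ Z) {s₀ : Store} (hL : s₀.I IV.logN 0 = (l * d : ℕ)) :
    Good W smp tp isqProg s₀ (fun s => s.C CV.isq 0 = 1 / (Real.sqrt (sigLen l d) : ℂ) ∧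
      Frame [IV.s] [CV.isq] s₀ s) (100 * (l * d)) 0 := by
  refine (Good.frame (Good.seq (τ := 10) (τ' := 90 * (l * d)) (κ := 0) (κ' := 0)
    (Good.writeC hZ (i := 0) (z := 1) rfl (by simp [CExp.eval, IExp.eval]) (by simpa using hZ32) ?_
      (by decide))) writesIn_isqProg).mono (fun _ h => h) (by omega) le_rfl
  refine (Good.for hZ (LI := []) (LC := [CV.isq]) (writesIn_wC _ _ (by decide)) (by decide)
    (m := l * d) (fun s hF => by rw [eval_vI, hF.I _ (by decide), Store.updC_I, hL])
    (fun j s => s.C CV.isq 0 = ((1 / Real.sqrt 2 : ℝ) : ℂ) ^ j) (τ := 20) (κ := fun _ => 0)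
    (τ' := 90 * (l * d)) (fun j s v h => h) (by rw [Store.updC_self, pow_zero]) ?_ hldZ hZ32
    (by simp only [cost_vI]; omega)).mono ?_ le_rfl (by simp)
  · intro j hj s hF hsj hinv
    refine Good.writeC hZ (i := 0) (z := ((1 / Real.sqrt 2 : ℝ) : ℂ) ^ (j + 1)) rfl ?_
      (by simpa using hZ32) (Store.updC_self _ _ _ _) (by decide)
    rw [pow_succ, ← re_rootVal_one_eight]
    simp only [CExp.eval, eval_vC, hinv, re_rootVal_one_eight]
    congr 2
    exact re_rootVal_one_eight
  · rintro s ⟨h1, -⟩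
    have h2 : Real.sqrt 2 ^ (l * d) = Real.sqrt (sigLen l d) := by
      rw [eq_comm, Real.sqrt_eq_iff_eq_sq sigLen_pos.le (by positivity), ← pow_mul, mul_comm _ 2,
        pow_mul, Real.sq_sqrt (by norm_num), sigLen_eq_two_pow]
    rw [h1, ← Complex.ofReal_pow, one_div_pow, h2]
    push_cast
    rfl

/-- The quantity `ε α ^ d` in `acc` and `2 ^ d` in `acc2`. -/
def accProg : Prog :=
  .seq (wC CV.acc (.const 0) (vC CV.eps)) (.seq (wC CV.acc2 (.const 0) (.ofInt (.const 1)))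
    (forProg IV.s (vI IV.d)
      (.seq (wC CV.acc (.const 0) (.div (vC CV.acc) (.ofInt (.const 4194304))))
        (wC CV.acc2 (.const 0) (.mul (vC CV.acc2) (.ofInt (.const 2)))))))

theorem writesIn_accProg : WritesIn [IV.s] [CV.acc, CV.acc2] accProg :=
  ⟨writesIn_wC _ _ (by decide), writesIn_wC _ _ (by decide), writesIn_forProg (by decide)
    ⟨writesIn_wC _ _ (by decide), writesIn_wC _ _ (by decide)⟩⟩

theorem accProg_good (hZ : (Z : ℝ) ≤ W) (hd : 1 ≤ d) (hZ32 : 32 ≤ Z) (hdZ : (d : ℤ) ≤ Z)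
    {s₀ : Store} (hsd : s₀.I IV.d 0 = d) {ε : ℝ} (hε : s₀.C CV.eps 0 = ε) :
    Good W smp tp accProg s₀ (fun s => s.C CV.acc 0 = (ε * alphaConst ^ d : ℝ) ∧
      s.C CV.acc2 0 = (2 ^ d : ℝ) ∧ Frame [IV.s] [CV.acc, CV.acc2] s₀ s) (200 * d) 0 := by
  refine Good.frame_and writesIn_accProg (Good.mono (Good.seq (τ := 20) (τ' := 170 * d) (κ := 0)
    (κ' := 0) (Good.writeC hZ (i := 0) (z := ε) rfl hε (by simpa using hZ32) ?_
      (by decide))) (fun _ h => h) (by omega) le_rfl)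
  refine Good.mono (Good.seq (τ := 20) (τ' := 150 * d) (κ := 0) (κ' := 0)
    (Good.writeC hZ (i := 0) (z := 1) rfl (by simp [CExp.eval, IExp.eval]) (by simpa using hZ32) ?_
      (by decide))) (fun _ h => h) (by omega) le_rfl
  have hw : WritesIn [] [CV.acc, CV.acc2]
      (.seq (wC CV.acc (.const 0) (.div (vC CV.acc) (.ofInt (.const 4194304))))
        (wC CV.acc2 (.const 0) (.mul (vC CV.acc2) (.ofInt (.const 2))))) :=
    ⟨writesIn_wC _ _ (by decide), writesIn_wC _ _ (by decide)⟩
  refine Good.mono (Good.for hZ hw (by decide)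
    (m := d) (fun s hF => by rw [eval_vI, hF.I _ (by decide), Store.updC_I, Store.updC_I, hsd])
    (fun j s => s.C CV.acc 0 = (ε * alphaConst ^ j : ℝ) ∧ s.C CV.acc2 0 = (2 ^ j : ℝ)) (τ := 40)
    (κ := fun _ => 0) (τ' := 150 * d) (fun j s v h => h) ⟨?_, ?_⟩ ?_ hdZ hZ32
    (by simp only [cost_vI]; omega)) (fun s h => h.1) le_rfl (by simp)
  · rw [Store.updC_ne _ (by decide), Store.updC_self, pow_zero, mul_one]
  · rw [Store.updC_self, pow_zero, Complex.ofReal_one]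
  · rintro j hj s hF hsj ⟨h1, h2⟩
    refine Good.seq (τ := 20) (τ' := 20) (κ := 0) (κ' := 0)
      (Good.writeC hZ (i := 0) (z := (ε * alphaConst ^ (j + 1) : ℝ)) rfl ?_ (by simpa using hZ32) ?_
      (by decide))
    · simp only [CExp.eval, eval_vC, h1, IExp.eval, alphaConst]
      push_cast
      ring
    refine Good.writeC hZ (i := 0) (z := (2 ^ (j + 1) : ℝ)) rfl ?_ (by simpa using hZ32)
      ⟨?_, ?_⟩ (by decide)
    · simp only [CExp.eval, eval_vC, Store.updC_ne _ (by decide : CV.acc2 ≠ CV.acc), h2, IExp.eval]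
      push_cast
      ring
    · rw [Store.updC_ne _ (by decide), Store.updC_self]
    · rw [Store.updC_self]

/-- The bucket side. -/
def sideProg : Prog :=
  .seq (wI IV.b (.const 0) (.const 1)) (.while (.clt (vC CV.acc) (.ofInt (vI IV.k)))
    (.seq (wI IV.b (.const 0) (.mul (.const 2) (vI IV.b)))
      (wC CV.acc (.const 0) (.mul (vC CV.acc) (vC CV.acc2)))))

theorem writesIn_sideProg : WritesIn [IV.b] [CV.acc] sideProg :=
  ⟨writesIn_wI _ _ (by decide), writesIn_wI _ _ (by decide), writesIn_wC _ _ (by decide)⟩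

theorem sideProg_good (hZ : (Z : ℝ) ≤ W) (hd : 1 ≤ d) (hZ32 : 32 ≤ Z) {k : ℕ}
    {ε : ℝ} (hε : 0 < ε) (hbZ : (bucketSide alphaConst d k ε : ℤ) ≤ Z)
    {s₀ : Store} (hk : s₀.I IV.k 0 = k) (hacc : s₀.C CV.acc 0 = (ε * alphaConst ^ d : ℝ))
    (hacc2 : s₀.C CV.acc2 0 = (2 ^ d : ℝ)) :
    Good W smp tp sideProg s₀ (fun s => s.I IV.b 0 = bucketSide alphaConst d k ε ∧
      Frame [IV.b] [CV.acc] s₀ s) (100 * (bucketExp alphaConst d k ε + 1)) 0 := by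
  set β := bucketExp alphaConst d k ε with hβ
  have hbβ : bucketSide alphaConst d k ε = 2 ^ β := bucketSide_eq _ _ _ _
  have hα : 0 < alphaConst := by norm_num [alphaConst]
  have hpos : 0 < ε * alphaConst ^ d := by positivity
  refine Good.frame (Good.mono (Good.seq (τ := 10) (τ' := 90 * (β + 1)) (κ := 0) (κ' := 0)
    (Good.writeI hZ (i := 0) (z := 1) rfl rfl (by simpa using hZ32) (by simp; omega) ?_
      (by decide))) (fun _ h => h) (by omega) le_rfl) writesIn_sideProg
  refine (Good.while (m := β) (τ := 50) (κ := fun _ => 0)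
    (Inv := fun j s => s.I IV.k 0 = k ∧ s.C CV.acc2 0 = (2 ^ d : ℝ) ∧ s.I IV.b 0 = (2 ^ j : ℕ) ∧
      s.C CV.acc 0 = (ε * alphaConst ^ d * (2 ^ j) ^ d : ℝ)) ?_ ?_ ?_).mono ?_ ?_ (by simp)
  · rintro j hj s ⟨h1, h2, h3, h4⟩
    have hle : 2 ^ (j + 1) ≤ 2 ^ β := Nat.pow_le_pow_right (by norm_num) hj
    refine ⟨?_, ?_⟩
    · have := lt_of_lt_bucketExp hj
      rw [lt_div_iff₀ hpos] at this
      simp only [BExp.holds, CExp.eval, eval_vC, eval_vI, h1, h4]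
      rw [Complex.ofReal_re, Int.cast_natCast, Complex.natCast_re]
      linarith
    · refine Good.seq (τ := 20) (τ' := 30) (κ := 0) (κ' := 0)
        (Good.writeI hZ (i := 0) (z := (2 ^ (j + 1) : ℕ)) rfl ?_ (by simpa using hZ32) ?_ ?_ (by decide))
      · simp only [IExp.eval, eval_vI, h3]; push_cast; ring
      · rw [abs_of_nonneg (by positivity)]; rw [hbβ] at hbZ; omega
      refine Good.writeC hZ (i := 0) (z := (ε * alphaConst ^ d * (2 ^ (j + 1)) ^ d : ℝ)) rfl ?_
        (by simpa using hZ32) ⟨?_, ?_, ?_, ?_⟩ (by decide)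
      · simp only [CExp.eval, eval_vC, Store.updI_C, h2, h4]
        push_cast
        rw [pow_succ (2 : ℂ) j, mul_pow]
        ring
      · rw [Store.updC_I, Store.updI_ne _ (by decide), h1]
      · rw [Store.updC_ne _ (by decide)]; exact h2
      · rw [Store.updC_I, Store.updI_self]
      · rw [Store.updC_self]
  · rintro s ⟨h1, -, -, h4⟩
    have := le_bucketSide_pow (α := alphaConst) hd k ε
    rw [div_le_iff₀ hpos] at this
    simp only [BExp.holds, CExp.eval, eval_vC, eval_vI, h1, h4, not_lt]
    rw [Complex.ofReal_re, Int.cast_natCast, Complex.natCast_re]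
    linarith
  · refine ⟨?_, hacc2, ?_, ?_⟩
    · rw [Store.updI_ne _ (by decide), hk]
    · rw [Store.updI_self]; rfl
    · rw [Store.updI_C, hacc]; simp
  · rintro s ⟨-, -, h, -⟩
    rw [h, hbβ]
  · simp only [BExp.cost, CExp.cost, cost_vC, cost_vI]; omega

/-- The number of rounds in `T`, and the square of the initial threshold. -/
def thrProg : Prog :=
  .seq (wI IV.T (.const 0) (.const 0)) (.seq (wC CV.acc (.const 0) (.ofInt (.const 1)))
    (.seq (.while (.clt (vC CV.acc) (vC CV.R))
      (.seq (wI IV.T (.const 0) (.add (vI IV.T) (.const 1)))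
        (wC CV.acc (.const 0) (.mul (.ofInt (.const 2)) (vC CV.acc)))))
      (wC CV.thr (.const 0) (.mul (.mul (vC CV.eps) (.mul (vC CV.mu) (vC CV.mu)))
        (.mul (vC CV.acc) (vC CV.acc))))))

theorem writesIn_thrProg : WritesIn [IV.T] [CV.acc, CV.thr] thrProg :=
  ⟨writesIn_wI _ _ (by decide), writesIn_wC _ _ (by decide), ⟨writesIn_wI _ _ (by decide),
    writesIn_wC _ _ (by decide)⟩, writesIn_wC _ _ (by decide)⟩

theorem two_pow_lt_of_lt_numRounds {R : ℝ} (hR : 0 < R) {j : ℕ} (hj : j < numRounds R) :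
    2 ^ j < R := by
  rw [numRounds, Nat.lt_ceil, Real.lt_logb_iff_rpow_lt (by norm_num) hR, Real.rpow_natCast] at hj
  exact hj

theorem thrProg_good (hZ : (Z : ℝ) ≤ W) (hZ32 : 32 ≤ Z) {ε R μ : ℝ} (hε : 0 < ε) (hR : 0 < R)
    (hTZ : (numRounds R : ℤ) ≤ Z) {s₀ : Store} (hsε : s₀.C CV.eps 0 = ε) (hsR : s₀.C CV.R 0 = R)
    (hsμ : s₀.C CV.mu 0 = μ) :
    Good W smp tp thrProg s₀ (fun s => s.I IV.T 0 = numRounds R ∧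
      s.C CV.thr 0 = ((Real.sqrt ε * μ * 2 ^ numRounds R) ^ 2 : ℝ) ∧
      Frame [IV.T] [CV.acc, CV.thr] s₀ s) (150 * (numRounds R + 1)) 0 := by
  set T := numRounds R with hT
  refine Good.frame_and writesIn_thrProg ((Good.seq (τ := 10) (τ' := 90 * T + 110) (κ := 0) (κ' := 0)
    (Good.writeI hZ (i := 0) (z := 0) rfl rfl (by simpa using hZ32) (by simp; omega) ?_
      (by decide))).mono (fun _ h => h) (by omega) le_rfl)
  refine (Good.seq (τ := 10) (τ' := 90 * T + 100) (κ := 0) (κ' := 0)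
    (Good.writeC hZ (i := 0) (z := 1) rfl (by simp [CExp.eval, IExp.eval]) (by simpa using hZ32) ?_
      (by decide))).mono (fun _ h => h) (by omega) le_rfl
  refine (Good.seq (τ := 90 * T + 30) (τ' := 70) (κ := 0) (κ' := 0)
    ((Good.while (m := T) (τ := 50) (κ := fun _ => 0)
    (Inv := fun j s => s.C CV.R 0 = R ∧ s.C CV.eps 0 = ε ∧ s.C CV.mu 0 = μ ∧ s.I IV.T 0 = j ∧
      s.C CV.acc 0 = (2 ^ j : ℝ)) ?_ ?_ ?_).mono ?_ ?_ (by simp))).mono (fun _ h => h)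
      (by omega) le_rfl
  · rintro j hj s ⟨h1, h2, h3, h4, h5⟩
    refine ⟨?_, ?_⟩
    · simp only [BExp.holds, eval_vC, h1, h5, Complex.ofReal_re]
      exact two_pow_lt_of_lt_numRounds hR hj
    · refine Good.seq (τ := 20) (τ' := 30) (κ := 0) (κ' := 0)
        (Good.writeI hZ (i := 0) (z := (j + 1 : ℕ)) rfl ?_ (by simpa using hZ32) ?_ ?_ (by decide))
      · simp only [IExp.eval, eval_vI, h4]; push_cast; rfl
      · rw [abs_of_nonneg (by positivity)]; omega
      refine Good.writeC hZ (i := 0) (z := (2 ^ (j + 1) : ℝ)) rfl ?_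
        (by simpa using hZ32) ⟨?_, ?_, ?_, ?_, ?_⟩ (by decide)
      · simp only [CExp.eval, eval_vC, Store.updI_C, h5, IExp.eval]
        push_cast
        ring
      · rw [Store.updC_ne _ (by decide)]; exact h1
      · rw [Store.updC_ne _ (by decide)]; exact h2
      · rw [Store.updC_ne _ (by decide)]; exact h3
      · rw [Store.updC_I, Store.updI_self]
      · rw [Store.updC_self]
  · rintro s ⟨h1, -, -, -, h5⟩
    simp only [BExp.holds, eval_vC, h1, h5, Complex.ofReal_re, not_lt]
    exact two_pow_numRounds_ge hR
  · refine ⟨?_, ?_, ?_, ?_, ?_⟩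
    · rw [Store.updC_ne _ (by decide)]; exact hsR
    · rw [Store.updC_ne _ (by decide)]; exact hsε
    · rw [Store.updC_ne _ (by decide)]; exact hsμ
    · rw [Store.updC_I, Store.updI_self]; rfl
    · rw [Store.updC_self, pow_zero, Complex.ofReal_one]
  · rintro s ⟨h1, h2, h3, h4, h5⟩
    refine Good.writeC hZ (i := 0) (z := ((Real.sqrt ε * μ * 2 ^ T) ^ 2 : ℝ)) rfl ?_
      (by simpa using hZ32) ⟨h4, Store.updC_self _ _ _ _⟩ (by decide)
    simp only [CExp.eval, eval_vC, h2, h3, h5]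
    rw [mul_pow, mul_pow, Real.sq_sqrt hε.le]
    push_cast
    ring
  · simp only [BExp.cost, cost_vC]; omega

end paramProg

/-! ### The filter as a program -/

section filterProg

variable {W : ℝ} {smp : ℤ → ℂ} {tp : ℤ → ℤ} {Z : ℤ} {l d C : ℕ}

theorem om_ne_one {z : ZMod (2 ^ l)} (hz : z ≠ 0) : om z ≠ 1 := fun h =>
  hz (ZMod.injective_stdAddChar (by simpa [om] using h))

/-- The geometric sum in the box kernel, in closed form. -/
def boxE : CExp :=
  .mul (.div (.ofInt (.const 1)) (.sub (.ofInt (vI IV.b)) (.ofInt (.const 1))))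
    (.div (.sub (.root (.mul (.div (vI IV.b) (.const 2)) (vI IV.x)) (vI IV.n))
        (.root (.mul (.sub (.const 1) (.div (vI IV.b) (.const 2))) (vI IV.x)) (vI IV.n)))
      (.sub (.root (vI IV.x) (vI IV.n)) (.ofInt (.const 1))))

theorem boxE_eval {s : Store} {b j : ℕ} (hb0 : 2 ≤ b) (hsb : s.I IV.b 0 = b)
    (hsn : s.I IV.n 0 = (2 ^ l : ℕ)) (hsx : s.I IV.x 0 = j) (hj : (j : ZMod (2 ^ l)) ≠ 0) :
    boxE.eval tp s = boxKernel b (j : ZMod (2 ^ l)) := by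
  have h := sum_om_mul_sub_one (l := l) (b / 2) (by omega) j
  have hne : om (j : ZMod (2 ^ l)) - 1 ≠ 0 := sub_ne_zero.mpr (om_ne_one hj)
  rw [← eq_div_iff hne] at h
  have r1 := rootVal_eq_om (l := l) (((b : ℤ) / 2) * j)
  have r2 := rootVal_eq_om (l := l) ((1 - (b : ℤ) / 2) * j)
  have r3 := rootVal_eq_om (l := l) (j : ℤ)
  have e : (((b : ℤ) / 2 : ℤ) : ZMod (2 ^ l)) = ((b / 2 : ℕ) : ZMod (2 ^ l)) := by
    rw [← Int.cast_natCast (b / 2)]; norm_cast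
  rw [Int.cast_mul, e, Int.cast_natCast] at r1
  rw [Int.cast_mul, Int.cast_sub, e, Int.cast_natCast, Int.cast_one] at r2
  rw [Int.cast_natCast] at r3
  rw [boxKernel, h, ← r1, ← r2, ← r3]
  simp only [boxE, CExp.eval, IExp.eval, eval_vI, hsb, hsn, hsx, rootVal]
  push_cast
  rfl

/-- The table of the box kernel. -/
def boxProg : Prog :=
  forProg IV.x (vI IV.n) (.ite (.ilt (vI IV.x) (.const 1))
    (wC CV.box (vI IV.x) (.ofInt (.const 1))) (wC CV.box (vI IV.x) boxE))

theorem writesIn_boxProg : WritesIn [IV.x] [CV.box] boxProg :=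
  writesIn_forProg (by decide) ⟨writesIn_wC _ _ (by decide), writesIn_wC _ _ (by decide)⟩

theorem boxProg_good (hZ : (Z : ℝ) ≤ W) {b : ℕ} (hb : Even b) (hb0 : 2 ≤ b)
    (hnZ : 32 * ((2 ^ l : ℕ) : ℤ) + 32 ≤ Z) {s₀ : Store} (hsb : s₀.I IV.b 0 = b)
    (hsn : s₀.I IV.n 0 = (2 ^ l : ℕ)) :
    Good W smp tp boxProg s₀ (fun s => (∀ j : ℕ, j < 2 ^ l → s.C CV.box j =
      boxKernel b (j : ZMod (2 ^ l))) ∧ Frame [IV.x] [CV.box] s₀ s) (300 * 2 ^ l) 0 := by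
  have hn : 0 < 2 ^ l := by positivity
  have hw : WritesIn [] [CV.box] (.ite (.ilt (vI IV.x) (.const 1))
      (wC CV.box (vI IV.x) (.ofInt (.const 1))) (wC CV.box (vI IV.x) boxE)) :=
    ⟨writesIn_wC _ _ (by decide), writesIn_wC _ _ (by decide)⟩
  refine Good.mono (Good.for hZ hw (by decide) (m := 2 ^ l)
    (fun s hF => by rw [eval_vI, hF.I _ (by decide), hsn])
    (fun i s => ∀ j : ℕ, j < i → s.C CV.box j = boxKernel b (j : ZMod (2 ^ l))) (τ := 200)
    (κ := fun _ => 0) (τ' := 300 * 2 ^ l) (fun j s v h => h)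
    (fun j hj => absurd hj (Nat.not_lt_zero _)) ?_ (by omega) (by omega)
    (by simp only [cost_vI]; omega)) (fun s h => h) le_rfl (by simp)
  intro j hj s hF hsj hinv
  have hnext : ∀ v, v = boxKernel b (j : ZMod (2 ^ l)) → ∀ i : ℕ, i < j + 1 →
      (s.updC CV.box j v).C CV.box i = boxKernel b (i : ZMod (2 ^ l)) := by
    intro v hv i hi
    rw [Store.updC_C]
    split_ifs with h
    · rw [hv]; congr 2; exact_mod_cast h.2.symm
    · exact hinv i (lt_of_le_of_ne (Nat.le_of_lt_succ hi) fun h' => h ⟨rfl, by rw [h']⟩)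
  refine (Good.ite (τ := 180) (κ := 0) ?_ ?_).mono (fun _ h => h) (by decide) le_rfl
  · intro hc
    simp only [BExp.holds, eval_vI, hsj, IExp.eval] at hc
    obtain rfl : j = 0 := by omega
    exact Good.writeC hZ (i := (0 : ℕ)) (z := 1) (by rw [eval_vI, hsj])
      (by simp [CExp.eval, IExp.eval]) (by simp; omega)
      (hnext 1 (by rw [Nat.cast_zero, boxKernel_zero hb hb0])) (by decide)
  · intro hc
    simp only [BExp.holds, eval_vI, hsj, IExp.eval] at hc
    refine Good.writeC hZ (i := j) (by rw [eval_vI, hsj])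
      (boxE_eval hb0 (by rw [hF.I _ (by decide), hsb]) (by rw [hF.I _ (by decide), hsn]) hsj ?_)
      (by rw [abs_of_nonneg (by positivity)]; omega) (hnext _ rfl) (by decide)
    intro h0
    rw [ZMod.natCast_eq_zero_iff] at h0
    exact absurd (Nat.le_of_dvd (by omega) h0) (by omega)

/-- One value of the filter. -/
def gBody : Prog :=
  .seq (wC CV.acc (.const 0) (.ofInt (.const 1)))
    (.seq (forProg IV.s (vI IV.d) (wC CV.acc (.const 0) (.mul (vC CV.acc) (rC CV.box (digitE IV.s)))))
      (.seq (wC CV.acc2 (.const 0) (.ofInt (.const 1)))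
        (.seq (forProg IV.t (.mul (.const 2) (vI IV.d))
            (wC CV.acc2 (.const 0) (.mul (vC CV.acc2) (vC CV.acc))))
          (wC CV.buf (vI IV.x) (vC CV.acc2)))))

/-- The filter in `buf`. -/
def gProg : Prog := forProg IV.x (vI IV.N) gBody

theorem writesIn_gBody : WritesIn [IV.s, IV.t] [CV.acc, CV.acc2, CV.buf] gBody :=
  ⟨writesIn_wC _ _ (by decide), writesIn_forProg (by decide) (writesIn_wC _ _ (by decide)),
    writesIn_wC _ _ (by decide), writesIn_forProg (by decide) (writesIn_wC _ _ (by decide)),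
    writesIn_wC _ _ (by decide)⟩

theorem writesIn_gProg : WritesIn [IV.x, IV.s, IV.t] [CV.acc, CV.acc2, CV.buf] gProg :=
  writesIn_forProg (by decide) (writesIn_gBody.mono (by decide) (by decide))

theorem filterG_eq_pow (b F : ℕ) (j : Grid l d) :
    filterG b F j = (∏ s, boxKernel b (j s)) ^ F := by
  simp only [filterG, filterH_eq, Finset.prod_pow]

theorem gBody_good (hZ : (Z : ℝ) ≤ W) {b x : ℕ} (hd : 1 ≤ d) (hx : 32 * (x : ℤ) + 32 ≤ Z)
    (hdZ : 2 * (d : ℤ) ≤ Z) {s₀ : Store} (hs : Scalars l d C s₀) (hsx : s₀.I IV.x 0 = x)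
    (hbox : ∀ j : ℕ, j < 2 ^ l → s₀.C CV.box j = boxKernel b (j : ZMod (2 ^ l))) :
    Good W smp tp gBody s₀ (fun s => s.C CV.buf x = filterG b (2 * d) (unflat l d x) ∧
      ∀ z : ℤ, z ≠ x → s.C CV.buf z = s₀.C CV.buf z) (500 * d) 0 := by
  have hZ32 : 32 ≤ Z := by omega
  let g : ℂ := ∏ s, boxKernel b (unflat l d x s)
  let e : ℕ → ℂ := fun j => boxKernel b (((x / (2 ^ l) ^ j : ℕ) : ZMod (2 ^ l)))
  have hge : g = ∏ j ∈ Finset.range d, e j :=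
    Fin.prod_univ_eq_prod_range (fun j => e j) d
  refine Good.mono (Good.seq (τ := 10) (τ' := 450 * d) (κ := 0) (κ' := 0)
    (Good.writeC hZ (i := 0) (z := 1) rfl (by simp [CExp.eval, IExp.eval]) (by simpa using hZ32) ?_
      (by decide))) (fun _ h => h) (by omega) le_rfl
  have hw1 : WritesIn [] [CV.acc]
      (wC CV.acc (.const 0) (.mul (vC CV.acc) (rC CV.box (digitE IV.s)))) :=
    writesIn_wC _ _ (by decide)
  refine Good.mono (Good.seq (τ := 160 * d) (τ' := 280 * d) (κ := 0) (κ' := 0)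
    (Good.mono (Good.for hZ hw1 (by decide) (m := d)
    (fun s hF => by rw [eval_vI, hF.I _ (by decide), Store.updC_I, hs.d_eq])
    (fun j s => s.C CV.acc 0 = ∏ j ∈ Finset.range j, e j) (τ := 70)
    (κ := fun _ => 0) (τ' := 160 * d) (fun j s v h => h)
    (by rw [Store.updC_self]; simp) ?_ (by omega) hZ32
    (by simp only [cost_vI]; omega)) ?_ le_rfl (by simp))) (fun _ h => h) (by omega) le_rfl
  · intro j hj s hF hsj hinv
    refine Good.writeC hZ (i := 0) (z := ∏ j ∈ Finset.range (j + 1), e j) rfl ?_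
      (by simpa using hZ32) (Store.updC_self _ _ _ _) (by decide)
    have hs' : Scalars l d C s := (hs.frame (LI := [IV.s]) (LC := [CV.acc])
      ⟨fun t ht => by rw [hF.I t ht]; rfl,
        fun t ht => by rw [hF.C t ht]; exact Store.updC_ne _ (by simpa using ht) _ _⟩ (by decide))
    have hx' : s.I IV.x 0 = x := by rw [hF.I _ (by decide), Store.updC_I, hsx]
    have hb' : s.C CV.box = s₀.C CV.box := by
      rw [hF.C _ (by decide), Store.updC_ne _ (by decide)]
    have hdig := digitE_eval (tp := tp) hs' hx' (t := IV.s) (b := ⟨j, hj⟩) hsj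
    simp only [CExp.eval, eval_vC, eval_rC, hdig, hinv, hb']
    rw [hbox _ (ZMod.val_lt _), ZMod.natCast_zmod_val, Finset.prod_range_succ]
    rfl
  rintro s1 ⟨h1, hF1⟩
  rw [← hge] at h1
  refine Good.mono (Good.seq (τ := 10) (τ' := 250 * d) (κ := 0) (κ' := 0)
    (Good.writeC hZ (i := 0) (z := 1) rfl (by simp [CExp.eval, IExp.eval]) (by simpa using hZ32) ?_
      (by decide))) (fun _ h => h) (by omega) le_rfl
  have hw2 : WritesIn [] [CV.acc2]
      (wC CV.acc2 (.const 0) (.mul (vC CV.acc2) (vC CV.acc))) :=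
    writesIn_wC _ _ (by decide)
  have hd1 : (s1.updC CV.acc2 0 1).I IV.d 0 = d := by
    rw [Store.updC_I, hF1.I _ (by decide), Store.updC_I, hs.d_eq]
  have hg1 : (s1.updC CV.acc2 0 1).C CV.acc 0 = g := by
    rw [Store.updC_ne _ (by decide), h1]
  refine Good.mono (Good.seq (τ := 210 * d) (τ' := 20) (κ := 0) (κ' := 0)
    (Good.mono (Good.for hZ hw2 (by decide) (m := 2 * d)
    (fun s hF => by simp only [IExp.eval, eval_vI, hF.I IV.d (by decide), hd1]; push_cast; rfl)
    (fun j s => s.C CV.acc2 0 = g ^ j) (τ := 25)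
    (κ := fun _ => 0) (τ' := 210 * d) (fun j s v h => h)
    (by rw [Store.updC_self]; simp) ?_ (by push_cast; omega) hZ32
    (by simp only [cost_vI, IExp.cost]; omega)) ?_ le_rfl (by simp))) (fun _ h => h) (by omega) le_rfl
  · intro j hj s hF hsj hinv
    refine Good.writeC hZ (i := 0) (z := g ^ (j + 1)) rfl ?_
      (by simpa using hZ32) (Store.updC_self _ _ _ _) (by decide)
    simp only [CExp.eval, eval_vC, hinv, hF.C CV.acc (by decide), hg1]
    rw [pow_succ]
  rintro s2 ⟨h2, hF2⟩
  have hbuf2 : s2.C CV.buf = s₀.C CV.buf := by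
    rw [hF2.C _ (by decide), Store.updC_ne _ (by decide), hF1.C _ (by decide),
      Store.updC_ne _ (by decide)]
  refine Good.writeC hZ (i := x) (z := filterG b (2 * d) (unflat l d x)) ?_ ?_
    (by rw [abs_of_nonneg (by positivity)]; exact hx) ⟨Store.updC_self _ _ _ _, fun z hz => ?_⟩
    (by decide)
  · rw [eval_vI, hF2.I _ (by decide), Store.updC_I, hF1.I _ (by decide), Store.updC_I, hsx]
  · rw [eval_vC, h2, filterG_eq_pow]
  · rw [Store.updC_C, if_neg fun h => hz h.2, hbuf2]

theorem gProg_good (hZ : (Z : ℝ) ≤ W) {b : ℕ} (hl : 1 ≤ l) (hd : 1 ≤ d)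
    (hNZ : 32 * (((2 ^ l) ^ d : ℕ) : ℤ) + 32 ≤ Z) {s₀ : Store} (hs : Scalars l d C s₀)
    (hbox : ∀ j : ℕ, j < 2 ^ l → s₀.C CV.box j = boxKernel b (j : ZMod (2 ^ l))) :
    Good W smp tp gProg s₀ (fun s => Holds s CV.buf (filterG b (2 * d) : Signal l d) ∧
      Frame [IV.x, IV.s, IV.t] [CV.acc, CV.acc2, CV.buf] s₀ s) (600 * (d * (2 ^ l) ^ d)) 0 := by
  have hdN : d < (2 ^ l) ^ d := Nat.lt_pow_self (Nat.one_lt_two_pow (by omega))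
  set N := (2 ^ l) ^ d with hN
  refine Good.mono (Good.for hZ writesIn_gBody (by decide) (m := N)
    (fun s hF => by rw [eval_vI, hF.I _ (by decide), hs.N_eq])
    (fun i s => ∀ x : ℕ, x < i → s.C CV.buf x = filterG b (2 * d) (unflat l d x))
    (τ := 500 * d) (κ := fun _ => 0) (τ' := 600 * (d * N)) (fun j s v h => h)
    (fun j hj => absurd hj (Nat.not_lt_zero _)) ?_ (by omega) (by omega)
    (by simp only [cost_vI]; nlinarith)) (fun s h => ⟨fun x hx => h.1 x hx, h.2⟩) le_rfl (by simp)
  intro x hx s hF hsx hinv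
  refine (gBody_good hZ hd (by omega) (by omega) (hs.frame hF (by decide)) hsx
    (fun j hj => by rw [hF.C _ (by decide)]; exact hbox j hj)).mono ?_ le_rfl le_rfl
  rintro s' ⟨h1, h2⟩ y hy
  rcases Nat.lt_succ_iff_lt_or_eq.mp hy with h | rfl
  · rw [h2 _ (by exact_mod_cast h.ne)]; exact hinv y h
  · exact h1

/-- The table of the transformed filter. -/
def filterProg : Prog :=
  .seq boxProg (.seq gProg (.seq (fftProg (-1))
    (fillProg CV.filt (.mul (rC CV.buf (vI IV.x)) (vC CV.isq)))))

theorem writesIn_filterProg : WritesIn [IV.x, IV.s, IV.t, IV.fs, IV.fp, IV.fx, IV.q]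
    [CV.box, CV.acc, CV.acc2, CV.buf, CV.buf2, CV.filt] filterProg :=
  ⟨writesIn_boxProg.mono (by decide) (by decide), writesIn_gProg.mono (by decide) (by decide),
    (writesIn_fftProg _).mono (by decide) (by decide),
    (writesIn_fillProg _ _).mono (by decide) (by decide)⟩

theorem filterProg_good (hZ : (Z : ℝ) ≤ W) {b : ℕ} (hb : Even b) (hb0 : 2 ≤ b) (hl : 1 ≤ l)
    (hd : 1 ≤ d) (hNZ : 32 * (((2 ^ l) ^ d : ℕ) : ℤ) + 32 ≤ Z) {s₀ : Store}
    (hs : Scalars l d C s₀) (hsb : s₀.I IV.b 0 = b)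
    (hisq : s₀.C CV.isq 0 = 1 / (Real.sqrt (sigLen l d) : ℂ)) :
    Good W smp tp filterProg s₀ (fun s =>
      Holds s CV.filt (dft (filterG b (2 * d)) : Signal l d) ∧
      Frame [IV.x, IV.s, IV.t, IV.fs, IV.fp, IV.fx, IV.q]
        [CV.box, CV.acc, CV.acc2, CV.buf, CV.buf2, CV.filt] s₀ s)
      (1600 * (l * d * (2 ^ l) ^ d)) 0 := by
  have hnN : 2 ^ l ≤ (2 ^ l) ^ d := Nat.le_self_pow (by omega) _
  have hld : 1 ≤ l * d := Nat.mul_pos hl hd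
  set N := (2 ^ l) ^ d with hN
  have hNl : N ≤ l * d * N := Nat.le_mul_of_pos_left _ hld
  have hdN : d * N ≤ l * d * N := Nat.mul_le_mul_right _ (Nat.le_mul_of_pos_left _ hl)
  refine Good.frame (Good.mono (Good.seq (τ := 300 * 2 ^ l) (τ' := 1300 * (l * d * N)) (κ := 0)
    (κ' := 0) (Good.mono (boxProg_good hZ hb hb0 (by omega) hsb hs.n_eq) ?_ le_rfl le_rfl))
    (fun _ h => h) (by omega) le_rfl) writesIn_filterProg
  rintro s1 ⟨h1, hF1⟩
  have hs1 := hs.frame hF1 (by decide)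
  refine Good.mono (Good.seq (τ := 600 * (d * N)) (τ' := 700 * (l * d * N)) (κ := 0)
    (κ' := 0) (Good.mono (gProg_good hZ hl hd hNZ hs1 h1) ?_ le_rfl le_rfl))
    (fun _ h => h) (by omega) le_rfl
  rintro s2 ⟨h2, hF2⟩
  have hs2 := hs1.frame hF2 (by decide)
  refine Good.mono (Good.seq (τ := 600 * (l * d) * N) (τ' := 100 * N) (κ := 0)
    (κ' := 0) (Good.mono (fftProg_good hZ (-1) hl hd hNZ hs2.d_eq hs2.l_eq hs2.N_eq h2) ?_
    le_rfl le_rfl)) (fun _ h => h) (by rw [mul_assoc 600]; omega) le_rfl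
  rintro s3 ⟨h3, hF3⟩
  have hs3 := hs2.frame hF3 (by decide)
  have hisq3 : s3.C CV.isq 0 = 1 / (Real.sqrt (sigLen l d) : ℂ) := by
    rw [hF3.C _ (by decide), hF2.C _ (by decide), hF1.C _ (by decide), hisq]
  refine Good.mono (fillProg_good hZ hNZ hs3.N_eq (y := dft (filterG b (2 * d))) (c := 100) ?_
    (by decide)) (fun s h => h.1) le_rfl le_rfl
  intro x hx s hF hsx
  simp only [CExp.eval, eval_rC, eval_vI, eval_vC, hsx, hF.C CV.buf (by decide), h3 x hx,
    hF.C CV.isq (by decide), hisq3]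
  rw [mul_comm, dft]
  congr 1
  refine Finset.sum_congr rfl fun i _ => ?_
  push_cast
  rw [neg_one_mul]

end filterProg

/-! ### The whole program -/

section mainProg

variable {W : ℝ} {smp : ℤ → ℂ} {tp : ℤ → ℤ} {Z : ℤ} {l d C : ℕ}

/-- Copy the approximation to the first `N` complex cells. The cell `x` is overwritten only after
all entries of the array that lie below it have been read. -/
def outProg : Prog :=
  .seq (wI IV.x (.const 0) (.const 0)) (.while (.ilt (vI IV.x) (vI IV.N))
    (.seq (.setC (vI IV.x) (rC CV.chi (vI IV.x))) (wI IV.x (.const 0) (.add (vI IV.x) (.const 1)))))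

theorem outProg_good (hZ : (Z : ℝ) ≤ W) (hNZ : 32 * (((2 ^ l) ^ d : ℕ) : ℤ) + 32 ≤ Z) {s₀ : Store}
    (hN : s₀.I IV.N 0 = ((2 ^ l) ^ d : ℕ)) {χ : Signal l d} (hχ : Holds s₀ CV.chi χ) :
    Good W smp tp outProg s₀ (fun s => ∀ f, s.cpx (flatIndex f) = χ f) (100 * (2 ^ l) ^ d) 0 := by
  have hNpos : 0 < (2 ^ l) ^ d := by positivity
  set N := (2 ^ l) ^ d with hNdef
  refine Good.mono (Good.seq (τ := 10) (τ' := 90 * N) (κ := 0) (κ' := 0)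
    (Good.writeI hZ (i := 0) (z := 0) rfl rfl (by simp; omega) (by simp; omega) ?_
      (by decide))) (fun _ h => h) (by omega) le_rfl
  refine Good.mono (Good.while (m := N) (τ := 50) (κ := fun _ => 0)
    (Inv := fun j s => s.I IV.x 0 = j ∧ s.I IV.N 0 = (N : ℕ) ∧
      (∀ y : ℕ, y < j → s.cpx y = χ (unflat l d y)) ∧
      ∀ y : ℕ, j ≤ y → y < N → s.C CV.chi y = χ (unflat l d y)) ?_ ?_ ?_) ?_ ?_ (by simp)
  · rintro j hj s ⟨h1, h2, h3, h4⟩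
    refine ⟨?_, ?_⟩
    · simp only [BExp.holds, eval_vI, h1, h2]; exact_mod_cast hj
    refine Good.seq (τ := 20) (τ' := 30) (κ := 0) (κ' := 0)
      ⟨_, _, _, .setC _ _ _ ?_, ?_, by decide, le_rfl⟩
    · rw [eval_vI, h1, ← Int.cast_abs]
      refine le_trans (Int.cast_le.mpr ?_) hZ
      rw [abs_of_nonneg (by positivity)]; omega
    · simp only [eval_rC, eval_vI, h1]
      have hI : ∀ t, Store.I { s with cpx := Function.update s.cpx (j : ℤ) (s.C CV.chi j) } t = s.I t :=
        fun _ => rfl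
      refine Good.writeI hZ (i := 0) (z := (j + 1 : ℕ)) rfl ?_ (by simp; omega) ?_ ⟨?_, ?_, ?_, ?_⟩
        (by decide)
      · simp only [IExp.eval, eval_vI, hI, h1]; push_cast; rfl
      · rw [abs_of_nonneg (by positivity)]; omega
      · rw [Store.updI_self]
      · rw [Store.updI_ne _ (by decide), hI, h2]
      · intro y hy
        simp only [Store.updI, Function.update_apply]
        split_ifs with h
        · obtain rfl : y = j := by exact_mod_cast h
          exact h4 y le_rfl hj
        · exact h3 y (lt_of_le_of_ne (Nat.le_of_lt_succ hy) fun h' => h (by rw [h']))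
      · intro y hy hyN
        rw [← h4 y (by omega) hyN]
        simp only [Store.updI, Store.C, Function.update_apply]
        rw [if_neg]
        omega
  · rintro s ⟨h1, h2, -⟩
    simp only [BExp.holds, eval_vI, h1, h2, lt_self_iff_false, not_false_iff]
  · refine ⟨by rw [Store.updI_self]; rfl, by rw [Store.updI_ne _ (by decide), hN],
      fun y hy => absurd hy (Nat.not_lt_zero _), fun y _ hy => hχ y hy⟩
  · rintro s ⟨-, -, h, -⟩ f
    rw [flatIndex_eq, h _ (flatNat_lt f), unflat_flatNat]
  · simp only [BExp.cost, cost_vI]; omega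

/-- The program for SparseFFT with `C log₂ N` hashes. -/
def mainProg (C : ℕ) : Prog :=
  .seq (scalarProg C) (.seq isqProg (.seq accProg (.seq sideProg (.seq thrProg (.seq filterProg
    (.seq tableProg (.seq (forProg IV.round (vI IV.T) roundProg) outProg)))))))

theorem roundsProg_good (hZ : (Z : ℝ) ≤ W) {r : ℕ} (hr : r = numHashes C l d) (hC : 1 ≤ C)
    {ρ : Fin r → Draw l d} {xhat : Signal l d} {k : ℕ} {ε R μ : ℝ} (hμ : 0 ≤ μ)
    (hd : 1 ≤ d) (hl : 1 ≤ l) (hrZ : 32 * ((r * (2 ^ l) ^ d : ℕ) : ℤ) + 32 ≤ Z)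
    (hTZ : (numRounds R : ℤ) ≤ Z) {s₀ : Store}
    (hp : Prepared C ρ (dft (filterG (bucketSide alphaConst d k ε) (2 * d))) xhat s₀)
    (hχ : Holds s₀ CV.chi (0 : Signal l d)) (hT : s₀.I IV.T 0 = numRounds R)
    (hthr : s₀.C CV.thr 0 = ((Real.sqrt ε * μ * 2 ^ numRounds R) ^ 2 : ℝ)) :
    Good W smp tp (forProg IV.round (vI IV.T) roundProg) s₀ (fun s =>
      Holds s CV.chi (sparseFFT alphaConst (2 * d) k ε R μ xhat ρ 0) ∧ s.I IV.N 0 = s₀.I IV.N 0)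
      (4000 * ((2 ^ l) ^ d * (r * r)) * numRounds R + 30) 0 := by
  have hrpos : 0 < r := by rw [hr]; unfold numHashes; positivity
  have hNrr : 1 ≤ (2 ^ l) ^ d * (r * r) := Nat.mul_pos (by positivity) (Nat.mul_pos hrpos hrpos)
  have hrN : 1 ≤ r * (2 ^ l) ^ d := Nat.mul_pos hrpos (by positivity)
  set T := numRounds R with hTdef
  refine Good.mono (Good.for hZ writesIn_roundProg (by decide) (m := T)
    (fun s hF => by rw [eval_vI, hF.I _ (by decide), hT])
    (fun t s => Holds s CV.chi (sparseFFTRound alphaConst (2 * d) k ε R μ xhat ρ 0 t) ∧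
      s.C CV.thr 0 = ((Real.sqrt ε * μ * 2 ^ (T - t)) ^ 2 : ℝ))
    (τ := 3500 * ((2 ^ l) ^ d * (r * r))) (κ := fun _ => 0)
    (τ' := 4000 * ((2 ^ l) ^ d * (r * r)) * T + 30)
    (fun j s v h => h) ⟨hχ, hthr⟩ ?_ hTZ (by omega) (by simp only [cost_vI]; nlinarith)) ?_ le_rfl
    (by simp)
  · rintro t ht s hF - ⟨h1, h2⟩
    have e1 : (2 : ℝ) ^ (T - t) = 2 * 2 ^ (T - (t + 1)) := by
      rw [← pow_succ']; congr 1; omega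
    refine (roundProg_good hZ hr hC hd hl hrZ (hp.frame hF (by decide) (by decide)) h1
      (ν := 4 * Real.sqrt ε * μ * 2 ^ (T - (t + 1))) (by positivity)
      (by rw [h2, e1]; congr 2; ring)).mono ?_ le_rfl le_rfl
    rintro s' ⟨h3, h4⟩
    exact ⟨h3, by rw [h4]; congr 2; ring⟩
  · rintro s ⟨⟨h1, -⟩, hF⟩
    exact ⟨h1, by rw [hF.I _ (by decide)]⟩

/-- The program computes the output of the algorithm. -/
theorem mainProg_good (hZ : (Z : ℝ) ≤ W) {r : ℕ} (hr : r = numHashes C l d) (hC : 1 ≤ C)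
    {ρ : Fin r → Draw l d} (hTape : IsRandomTape tp ρ) {xhat : Signal l d}
    (hsmp : IsSampleAccess smp xhat) {k : ℕ} {ε R μ : ℝ} (hk : 1 ≤ k) (hε : 0 < ε) (hε1 : ε ≤ 1)
    (hR : 0 < R) (hμ : 0 ≤ μ)
    (hd : 1 ≤ d) (hl : 1 ≤ l) (hrZ : 32 * ((r * (2 ^ l) ^ d : ℕ) : ℤ) + 32 ≤ Z)
    (hTZ : (numRounds R : ℤ) ≤ Z) (hbZ : (bucketSide alphaConst d k ε : ℤ) ≤ Z)
    [DecidablePred fun j : Grid l d =>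
      dft (filterG (bucketSide alphaConst d k ε) (2 * d)) j ≠ 0] :
    Good W smp tp (mainProg C) (initStore l d k ε R μ) (fun s =>
      ∀ f, s.cpx (flatIndex f) = sparseFFT alphaConst (2 * d) k ε R μ xhat ρ 0 f)
      (8000 * ((2 ^ l) ^ d * (r * r * r)) + 4000 * ((2 ^ l) ^ d * (r * r)) * numRounds R +
        100 * bucketExp alphaConst d k ε + 150 * numRounds R)
      (r * (Finset.univ.filter fun j : Grid l d =>
        dft (filterG (bucketSide alphaConst d k ε) (2 * d)) j ≠ 0).card) := by
  have hNpos : 0 < (2 ^ l) ^ d := by positivity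
  have hld : 1 ≤ l * d := Nat.mul_pos hl hd
  have hrld : l * d ≤ r := by rw [hr]; unfold numHashes; exact Nat.le_mul_of_pos_left _ hC
  have hrpos : 0 < r := by omega
  have hdld : d ≤ l * d := Nat.le_mul_of_pos_left _ hl
  set N := (2 ^ l) ^ d with hN
  have hNr : N ≤ r * N := Nat.le_mul_of_pos_left _ hrpos
  have hrN : r ≤ r * N := Nat.le_mul_of_pos_right _ hNpos
  have hNZ : 32 * (N : ℤ) + 32 ≤ Z := by omega
  have hα : 0 < alphaConst := by norm_num [alphaConst]
  have hα1 : alphaConst < 1 := by norm_num [alphaConst]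
  have hβ := bucketExp_pos hα hα1 hd hk hε hε1
  set T := numRounds R with hT
  set β := bucketExp alphaConst d k ε with hβdef
  set b := bucketSide alphaConst d k ε with hbdef
  -- All costs in terms of `Q = N r³`.
  set Q := N * (r * r * r) with hQ
  have hrr : 1 ≤ r * r := Nat.mul_pos hrpos hrpos
  have hQr : r ≤ Q := by
    calc r = 1 * (1 * r) := by ring
      _ ≤ N * (r * r * r) := Nat.mul_le_mul hNpos (Nat.mul_le_mul_right _ hrr)
  have hQN : N ≤ Q := Nat.le_mul_of_pos_right _ (Nat.mul_pos hrr hrpos)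
  have hQl : l * d * N ≤ Q := by
    rw [mul_comm]
    exact Nat.mul_le_mul_left _ (hrld.trans (Nat.le_mul_of_pos_left _ hrr))
  have hQd : r * N * (d * d) ≤ Q := by
    calc r * N * (d * d) = N * (d * d * r) := by ring
      _ ≤ _ := Nat.mul_le_mul_left _ (Nat.mul_le_mul_right _
          (Nat.mul_le_mul (hdld.trans hrld) (hdld.trans hrld)))
  have i1 : (initStore l d k ε R μ).I IV.n 0 = (2 ^ l : ℕ) := by simp [Store.I, initStore]
  have i2 : (initStore l d k ε R μ).I IV.d 0 = d := by simp [Store.I, initStore]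
  have i3 : (initStore l d k ε R μ).I IV.k 0 = k := by simp [Store.I, initStore]
  have i4 : (initStore l d k ε R μ).C CV.eps 0 = ε := by simp [Store.C, initStore]
  have i5 : (initStore l d k ε R μ).C CV.R 0 = R := by simp [Store.C, initStore]
  have i6 : (initStore l d k ε R μ).C CV.mu 0 = μ := by simp [Store.C, initStore]
  have i7 : Holds (initStore l d k ε R μ) CV.chi (0 : Signal l d) := by
    intro x _
    have h8 : ((CV.chi : ℕ) : ℤ) = 8 := rfl
    simp only [Store.C, initStore, h8]
    rw [if_neg (by omega), if_neg (by omega), if_neg (by omega)]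
    rfl
  generalize initStore l d k ε R μ = s₀ at *
  refine Good.mono (Good.seq (τ := 1000 * (l * d)) (κ := 0)
    (τ' := 6900 * Q + 4000 * (N * (r * r)) * T + 100 * β + 150 * T)
    (Good.mono (scalarProg_good hZ hl hd hNZ (by rw [← hr]; omega) i1 i2) ?_ le_rfl le_rfl))
    (fun _ h => h) (by omega) (by rw [zero_add])
  rintro s1 ⟨hs1, hL1, hF1⟩
  have hldN : l * d < N := by rw [hN, ← pow_mul]; exact Nat.lt_two_pow_self
  refine Good.mono (Good.seq (τ := 100 * (l * d)) (κ := 0)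
    (τ' := 6800 * Q + 4000 * (N * (r * r)) * T + 100 * β + 150 * T)
    (Good.mono (isqProg_good hZ hld (by omega) (by omega) hL1) ?_ le_rfl le_rfl))
    (fun _ h => h) (by omega) (by rw [zero_add])
  rintro s2 ⟨hisq2, hF2⟩
  have hs2 := hs1.frame hF2 (by decide)
  refine Good.mono (Good.seq (τ := 200 * d) (κ := 0)
    (τ' := 6500 * Q + 4000 * (N * (r * r)) * T + 100 * β + 150 * T)
    (Good.mono (accProg_good hZ hd (by omega) (by omega) hs2.d_eq
      (by rw [hF2.C _ (by decide), hF1.C _ (by decide), i4])) ?_ le_rfl le_rfl))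
    (fun _ h => h) (by omega) (by rw [zero_add])
  rintro s3 ⟨hacc3, hacc3', hF3⟩
  have hs3 := hs2.frame hF3 (by decide)
  refine Good.mono (Good.seq (τ := 100 * (β + 1)) (κ := 0)
    (τ' := 6300 * Q + 4000 * (N * (r * r)) * T + 150 * T)
    (Good.mono (sideProg_good hZ hd (by omega) hε hbZ
      (by rw [hF3.I _ (by decide), hF2.I _ (by decide), hF1.I _ (by decide), i3]) hacc3 hacc3') ?_
      le_rfl le_rfl))
    (fun _ h => h) (by omega) (by rw [zero_add])
  rintro s4 ⟨hb4, hF4⟩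
  have hs4 := hs3.frame hF4 (by decide)
  refine Good.mono (Good.seq (τ := 150 * (T + 1)) (κ := 0)
    (τ' := 6000 * Q + 4000 * (N * (r * r)) * T)
    (Good.mono (thrProg_good hZ (by omega) hε hR hTZ (μ := μ)
      (by rw [hF4.C _ (by decide), hF3.C _ (by decide), hF2.C _ (by decide), hF1.C _ (by decide), i4])
      (by rw [hF4.C _ (by decide), hF3.C _ (by decide), hF2.C _ (by decide), hF1.C _ (by decide), i5])
      (by rw [hF4.C _ (by decide), hF3.C _ (by decide), hF2.C _ (by decide), hF1.C _ (by decide), i6]))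
      ?_ le_rfl le_rfl))
    (fun _ h => h) (by omega) (by rw [zero_add])
  rintro s5 ⟨hT5, hthr5, hF5⟩
  have hs5 := hs4.frame hF5 (by decide)
  have hisq5 : s5.C CV.isq 0 = 1 / (Real.sqrt (sigLen l d) : ℂ) := by
    rw [hF5.C _ (by decide), hF4.C _ (by decide), hF3.C _ (by decide), hisq2]
  refine Good.mono (Good.seq (τ := 1600 * (l * d * N)) (κ := 0)
    (τ' := 4000 * Q + 4000 * (N * (r * r)) * T)
    (Good.mono (filterProg_good hZ (even_bucketSide hβ) (two_le_bucketSide hβ) hl hd hNZ hs5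
      (by rw [hF5.I _ (by decide), hb4]) hisq5) ?_ le_rfl le_rfl))
    (fun _ h => h) (by omega) (by rw [zero_add])
  rintro s6 ⟨hfilt6, hF6⟩
  have hs6 := hs5.frame hF6 (by decide)
  refine Good.mono (Good.seq (τ := 3100 * (r * N * (d * d))) (κ' := 0)
    (τ' := 500 * Q + 4000 * (N * (r * r)) * T)
    (Good.mono (tableProg_good hZ hr hTape hsmp hs6 hd hl hC hrZ hfilt6) ?_ le_rfl le_rfl))
    (fun _ h => h) (by omega) (by rw [add_zero]; exact le_of_eq (by congr))
  rintro s7 ⟨htab7, hF7⟩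
  have hs7 := hs6.frame hF7 (by decide)
  have hp7 : Prepared C ρ (dft (filterG b (2 * d))) xhat s7 :=
    ⟨hs7, htab7, by rw [hF7.C _ (by decide), hF6.C _ (by decide), hisq5]⟩
  have hχ7 : Holds s7 CV.chi (0 : Signal l d) := (((((((i7.frame hF1 (by decide)).frame hF2
    (by decide)).frame hF3 (by decide)).frame hF4 (by decide)).frame hF5 (by decide)).frame hF6
    (by decide)).frame hF7 (by decide))
  refine Good.mono (Good.seq (τ := 4000 * (N * (r * r)) * T + 30) (κ := 0) (κ' := 0)
    (τ' := 100 * N)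
    (Good.mono (roundsProg_good hZ hr hC hμ hd hl hrZ hTZ hp7 hχ7
      (by rw [hF7.I _ (by decide), hF6.I _ (by decide), hT5])
      (by rw [hF7.C _ (by decide), hF6.C _ (by decide), hthr5])) ?_ le_rfl le_rfl))
    (fun _ h => h) (by omega) le_rfl
  rintro s8 ⟨hχ8, hN8⟩
  exact outProg_good hZ hNZ (by rw [hN8, hs7.N_eq]) hχ8

end mainProg

/-! ### The support of the transformed filter -/

section support

variable {l d : ℕ}

/-- The frequencies of the `F`-th power of the box kernel. -/
def freqs (l b F : ℕ) : Finset (ZMod (2 ^ l)) :=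
  (Finset.Icc (-((F * (b / 2 - 1) : ℕ) : ℤ)) ((F * (b / 2 - 1) : ℕ) : ℤ)).image
    (fun m : ℤ => (m : ZMod (2 ^ l)))

theorem card_freqs_le {b F : ℕ} (hb0 : 2 ≤ b) (hF : 1 ≤ F) : (freqs l b F).card ≤ F * b := by
  refine Finset.card_image_le.trans ?_
  rw [Int.card_Icc]
  have h1 : F * (b / 2 - 1) + F = F * (b / 2) := by
    rw [← Nat.mul_succ]; congr 1; omega
  have h2 : 2 * (F * (b / 2)) ≤ F * b := by
    rw [mul_left_comm]; exact Nat.mul_le_mul_left _ (by omega)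
  omega

/-- The power of the box kernel is a trigonometric polynomial of low degree. -/
theorem sum_om_mul_filterH {b F : ℕ} (hb0 : 2 ≤ b) {j : ZMod (2 ^ l)} (hj : j ∉ freqs l b F) :
    ∑ z : ZMod (2 ^ l), om (-(z * j)) * filterH b F z = 0 := by
  have hpow : ∀ z : ZMod (2 ^ l), filterH b F z = (1 / ((b : ℂ) - 1)) ^ F *
      (∑ m ∈ Finset.Ioo (-((b / 2 : ℕ) : ℤ)) ((b / 2 : ℕ) : ℤ), om ((m : ZMod (2 ^ l)) * z)) ^ F :=
    fun z => mul_pow _ _ _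
  simp only [hpow, Finset.sum_pow', Finset.mul_sum]
  rw [Finset.sum_comm]
  refine Finset.sum_eq_zero fun p hp => ?_
  have hz : ∀ z : ZMod (2 ^ l), om (-(z * j)) * ((1 / ((b : ℂ) - 1)) ^ F *
      ∏ i : Fin F, om ((p i : ZMod (2 ^ l)) * z)) =
      (1 / ((b : ℂ) - 1)) ^ F * om (z * (((∑ i, p i : ℤ) : ZMod (2 ^ l)) - j)) := by
    intro z
    rw [← om_sum, mul_left_comm, ← om_add]
    congr 2
    push_cast
    rw [← Finset.sum_mul]
    ring
  rw [Finset.sum_congr rfl fun z _ => hz z, ← Finset.mul_sum, sum_om_mul, if_neg, mul_zero]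
  rw [sub_eq_zero]
  intro h
  apply hj
  rw [← h]
  refine Finset.mem_image.mpr ⟨_, ?_, rfl⟩
  rw [Fintype.mem_piFinset] at hp
  have h1 : ∀ i, |p i| ≤ ((b / 2 - 1 : ℕ) : ℤ) := fun i => by
    have := Finset.mem_Ioo.mp (hp i)
    rw [abs_le]
    omega
  rw [Finset.mem_Icc, ← abs_le]
  calc |∑ i, p i| ≤ ∑ i, |p i| := Finset.abs_sum_le_sum_abs _ _
    _ ≤ ∑ i : Fin F, ((b / 2 - 1 : ℕ) : ℤ) := Finset.sum_le_sum fun i _ => h1 i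
    _ = _ := by simp

theorem dft_filterG (b F : ℕ) (j : Grid l d) : dft (filterG b F) j =
    (1 / (Real.sqrt (sigLen l d) : ℂ)) * ∏ s, ∑ z : ZMod (2 ^ l), om (-(z * j s)) * filterH b F z := by
  rw [dft, Finset.prod_univ_sum, Fintype.piFinset_univ]
  congr 1
  refine Finset.sum_congr rfl fun i _ => ?_
  rw [filterG, Finset.prod_mul_distrib, ← om_sum, dotProduct, Finset.sum_neg_distrib]

/-- The transformed filter is a product over the coordinates, each factor supported on the
frequencies of the power of the box kernel. This bounds the number of samples that a hash reads. -/
theorem card_support_dft_filterG_le {b F : ℕ} (hb0 : 2 ≤ b) (hF : 1 ≤ F)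
    [DecidablePred fun j : Grid l d => dft (filterG b F) j ≠ 0] :
    (Finset.univ.filter fun j : Grid l d => dft (filterG b F) j ≠ 0).card ≤ (F * b) ^ d := by
  calc _ ≤ (Fintype.piFinset fun _ : Fin d => freqs l b F).card := by
        refine Finset.card_le_card fun j hj => ?_
        rw [Fintype.mem_piFinset]
        intro s
        by_contra hs
        refine (Finset.mem_filter.mp hj).2 ?_
        rw [dft_filterG, Finset.prod_eq_zero (Finset.mem_univ s) (sum_om_mul_filterH hb0 hs),
          mul_zero]
    _ = (freqs l b F).card ^ d := by simp
    _ ≤ _ := Nat.pow_le_pow_left (card_freqs_le hb0 hF) d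

end support

/-! ### Sizes of the parameters -/

section sizes

variable {l d : ℕ}

/-- By minimality of `b` we have `(b / 2) ^ d < k / (ε α ^ d)`, and `2 / α = 2 ^ 23`. -/
theorem bucketSide_pow_lt {d k : ℕ} {ε : ℝ} (hd : 1 ≤ d) (hk : 1 ≤ k) (hε : 0 < ε) (hε1 : ε ≤ 1) :
    (bucketSide alphaConst d k ε : ℝ) ^ d < (2 ^ 23) ^ d * (k / ε) := by
  have hα : 0 < alphaConst := by norm_num [alphaConst]
  have hα1 : alphaConst < 1 := by norm_num [alphaConst]
  have hβ := bucketExp_pos hα hα1 hd hk hε hε1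
  have h := lt_of_lt_bucketExp (Nat.sub_lt hβ one_pos)
  have e : (bucketSide alphaConst d k ε : ℝ) = 2 * 2 ^ (bucketExp alphaConst d k ε - 1) := by
    rw [bucketSide_eq, ← pow_succ']
    push_cast
    congr 1
    omega
  rw [e, mul_pow]
  have h2 : (k : ℝ) / (ε * alphaConst ^ d) = (2 ^ 22) ^ d * (k / ε) := by
    rw [alphaConst, one_div, inv_pow]
    field_simp
  rw [h2] at h
  calc (2 : ℝ) ^ d * (2 ^ (bucketExp alphaConst d k ε - 1)) ^ d <
      2 ^ d * ((2 ^ 22) ^ d * (k / ε)) := by gcongr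
    _ = _ := by rw [← mul_assoc, ← mul_pow]; norm_num

/-- The exponential factor in `d` is absorbed by `d ^ (K d)` if `d ≥ 2`, and by the constant factor if
`d = 1`. -/
theorem two_pow_mul_pow_le {d : ℕ} (hd : 1 ≤ d) {K : ℕ} (hK : 25 ≤ K) :
    (2 ^ 24) ^ d * (d : ℝ) ^ d ≤ 2 ^ 24 * (d : ℝ) ^ (K * d) := by
  have hd' : (1 : ℝ) ≤ d := by exact_mod_cast hd
  have h1 : ((2 : ℝ) ^ 24) ^ d ≤ 2 ^ 24 * (d : ℝ) ^ (24 * d) := by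
    rcases eq_or_lt_of_le hd with h | h
    · rw [← h]; norm_num
    · have h2 : (2 : ℝ) ≤ d := by exact_mod_cast h
      rw [← pow_mul]
      calc (2 : ℝ) ^ (24 * d) ≤ (d : ℝ) ^ (24 * d) := by gcongr
        _ ≤ _ := le_mul_of_one_le_left (by positivity) (by norm_num)
  calc ((2 : ℝ) ^ 24) ^ d * (d : ℝ) ^ d ≤ 2 ^ 24 * (d : ℝ) ^ (24 * d) * (d : ℝ) ^ d := by gcongr
    _ = 2 ^ 24 * (d : ℝ) ^ (25 * d) := by rw [mul_assoc, ← pow_add]; congr 2; ring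
    _ ≤ _ := by gcongr

theorem log_sigLen : Real.log (sigLen l d) = (l * d : ℕ) * Real.log 2 := by
  rw [sigLen_eq_two_pow, Real.log_pow]

theorem half_le_log_two : (1 : ℝ) / 2 ≤ Real.log 2 := by
  have := Real.log_two_gt_d9; linarith

/-- Each of the `r` hashes reads at most `(F b) ^ d` samples, where `F = 2 d`. -/
theorem queries_le {C k : ℕ} {ε : ℝ} (hd : 1 ≤ d) (hk : 1 ≤ k) (hε : 0 < ε) (hε1 : ε ≤ 1)
    {K : ℕ} (hK : 2 ^ 25 ≤ K) :
    ((numHashes C l d * (2 * d * bucketSide alphaConst d k ε) ^ d : ℕ) : ℝ) ≤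
      C * (K * (d : ℝ) ^ (K * d) * (1 / ε) * k * Real.log (sigLen l d)) := by
  have h1 := (bucketSide_pow_lt hd hk hε hε1).le
  have h2 := two_pow_mul_pow_le hd (K := K) (le_trans (by norm_num) hK)
  have hK' : (2 : ℝ) ^ 25 ≤ K := by exact_mod_cast hK
  have hlog : ((l * d : ℕ) : ℝ) * (1 / 2) ≤ Real.log (sigLen l d) := by
    rw [log_sigLen]
    exact mul_le_mul_of_nonneg_left half_le_log_two (Nat.cast_nonneg _)
  have hk0 : 0 ≤ (k : ℝ) / ε := by positivity
  have hL : (0 : ℝ) ≤ (l * d : ℕ) := Nat.cast_nonneg _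
  have hlog0 : 0 ≤ Real.log (sigLen l d) := le_trans (by positivity) hlog
  have e : ((numHashes C l d * (2 * d * bucketSide alphaConst d k ε) ^ d : ℕ) : ℝ) =
      C * ((l * d : ℕ) * (2 ^ d * (d : ℝ) ^ d * (bucketSide alphaConst d k ε : ℝ) ^ d)) := by
    rw [numHashes]; push_cast; ring
  rw [e]
  have h3 : 2 ^ d * (d : ℝ) ^ d * (bucketSide alphaConst d k ε : ℝ) ^ d ≤
      2 ^ 24 * (d : ℝ) ^ (K * d) * (k / ε) := by
    calc _ ≤ 2 ^ d * (d : ℝ) ^ d * ((2 ^ 23) ^ d * (k / ε)) := by gcongr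
      _ = (2 ^ 24) ^ d * (d : ℝ) ^ d * (k / ε) := by
          rw [show (2 : ℝ) ^ 24 = 2 * 2 ^ 23 by norm_num, mul_pow 2 ((2 : ℝ) ^ 23) d]; ring
      _ ≤ _ := by gcongr
  have h4 : ((l * d : ℕ) : ℝ) * (2 ^ 24 * (d : ℝ) ^ (K * d) * (k / ε)) ≤
      K * (d : ℝ) ^ (K * d) * (1 / ε) * k * Real.log (sigLen l d) := by
    calc _ = 2 ^ 25 * (d : ℝ) ^ (K * d) * (1 / ε) * k * (((l * d : ℕ) : ℝ) * (1 / 2)) := by ring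
      _ ≤ _ := by gcongr
  refine mul_le_mul_of_nonneg_left (le_trans ?_ h4) (Nat.cast_nonneg _)
  exact mul_le_mul_of_nonneg_left h3 hL

theorem numRounds_le {A : ℕ} {R : ℝ} (hR : 0 < R) (hRA : R ≤ sigLen l d ^ A) :
    numRounds R ≤ A * (l * d) := by
  rw [numRounds, Nat.ceil_le, Real.logb_le_iff_le_rpow (by norm_num) hR, Real.rpow_natCast]
  rwa [sigLen_eq_two_pow, ← pow_mul, mul_comm] at hRA

/-- A polynomial lower bound for `ε`: the tail of the signal cannot be much larger than its largest
entry. -/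
theorem one_le_mul_sqrt {k : ℕ} {ε R μ Λ : ℝ} {A : ℕ} {x : Signal l d} (hk : 1 ≤ k) (hμ : 0 < μ)
    (hΛ : 1 ≤ Λ) (hμk : μ ≤ Λ * noiseLevel k x) (hx : ‖x‖ ≤ R * (Real.sqrt ε * μ))
    (hRA : R ≤ sigLen l d ^ A) : 1 ≤ Λ * sigLen l d ^ (A + 1) * Real.sqrt ε := by
  have hN := sigLen_pos (l := l) (d := d)
  have hk' : (1 : ℝ) ≤ Real.sqrt k := by
    rw [Real.one_le_sqrt]; exact_mod_cast hk
  have h1 : noiseLevel k x ≤ errK k x := by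
    rw [noiseLevel]; exact div_le_self (errK_nonneg k x) hk'
  have h2 : errK k x ≤ sigLen l d * ‖x‖ := (errK_le_l2norm k x).trans (l2norm_le_sigLen_mul x)
  have h3 : sigLen l d * ‖x‖ ≤ sigLen l d * (sigLen l d ^ A * (Real.sqrt ε * μ)) := by
    refine mul_le_mul_of_nonneg_left (hx.trans ?_) hN.le
    exact mul_le_mul_of_nonneg_right hRA (by positivity)
  have h4 : μ ≤ Λ * (sigLen l d * (sigLen l d ^ A * (Real.sqrt ε * μ))) :=
    hμk.trans (mul_le_mul_of_nonneg_left (h1.trans (h2.trans h3)) (by linarith))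
  have h5 : μ * 1 ≤ μ * (Λ * sigLen l d ^ (A + 1) * Real.sqrt ε) := by
    rw [mul_one]; refine h4.trans (le_of_eq ?_); rw [pow_succ]; ring
  exact le_of_mul_le_mul_left h5 hμ

/-- The bucket side is polynomial in `N`, by the lower bound for `ε`. -/
theorem bucketSide_le {k : ℕ} {ε R μ Λ : ℝ} {A M : ℕ} {x : Signal l d} (hl : 1 ≤ l) (hd : 1 ≤ d)
    (hk : 1 ≤ k) (hε : 0 < ε) (hε1 : ε ≤ 1) (hμ : 0 < μ) (hΛ : 1 ≤ Λ) (hM : Λ ≤ 2 ^ M)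
    (hμk : μ ≤ Λ * noiseLevel k x) (hx : ‖x‖ ≤ R * (Real.sqrt ε * μ))
    (hRA : R ≤ sigLen l d ^ A) (hkN : (k : ℝ) ≤ sigLen l d) :
    (bucketSide alphaConst d k ε : ℝ) ≤ sigLen l d ^ (2 * A + 2 * M + 26) := by
  have hld : 1 ≤ l * d := Nat.mul_pos hl hd
  have hN2 : (2 : ℝ) ≤ sigLen l d := by
    rw [sigLen_eq_two_pow]; exact le_self_pow₀ (by norm_num) (by omega)
  have hN2d : (2 : ℝ) ^ d ≤ sigLen l d := by
    rw [sigLen_eq_two_pow]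
    exact pow_le_pow_right₀ (by norm_num) (Nat.le_mul_of_pos_left _ hl)
  have h1 := one_le_mul_sqrt hk hμ hΛ hμk hx hRA
  have hΛN : Λ ≤ sigLen l d ^ M := hM.trans (by gcongr)
  have h2 : 1 / ε ≤ (sigLen l d ^ M * sigLen l d ^ (A + 1)) ^ 2 := by
    rw [div_le_iff₀ hε]
    calc (1 : ℝ) = 1 ^ 2 := by norm_num
      _ ≤ (Λ * sigLen l d ^ (A + 1) * Real.sqrt ε) ^ 2 := by gcongr
      _ = (Λ * sigLen l d ^ (A + 1)) ^ 2 * ε := by rw [mul_pow _ (Real.sqrt ε), Real.sq_sqrt hε.le]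
      _ ≤ _ := by gcongr
  have hb1 : (1 : ℝ) ≤ bucketSide alphaConst d k ε := by
    rw [bucketSide_eq]; push_cast; exact one_le_pow₀ (by norm_num)
  calc (bucketSide alphaConst d k ε : ℝ) ≤ (bucketSide alphaConst d k ε : ℝ) ^ d :=
        le_self_pow₀ hb1 (by omega)
    _ ≤ (2 ^ 23) ^ d * (k / ε) := (bucketSide_pow_lt hd hk hε hε1).le
    _ = (2 ^ d) ^ 23 * (k * (1 / ε)) := by rw [← pow_mul, ← pow_mul, mul_comm 23 d]; ring
    _ ≤ sigLen l d ^ 23 * (sigLen l d * (sigLen l d ^ M * sigLen l d ^ (A + 1)) ^ 2) := by gcongr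
    _ = _ := by ring

end sizes

/-! ### Time, queries and word size -/

section complexity

variable {l d : ℕ}

theorem nat_le_pow_of_two_le {N : ℕ} (hN : 2 ≤ N) (a : ℕ) : a ≤ N ^ a :=
  (Nat.lt_pow_self (by omega)).le

/-- The time, query and word bounds of the program. All of `r`, `b`, `T` and `N` are polynomial in `N`,
so one exponent `w` bounds the words. The time is dominated by `r` transforms and `N` medians of
`r` numbers, found in `O(r²)` steps, in each of at most `A log₂ N` rounds. -/
theorem mainProg_computes {C A : ℕ} {Λ : ℝ} (hC : 1 ≤ C) (hΛ : 1 ≤ Λ) {K : ℕ} (hK : 2 ^ 25 ≤ K) :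
    ∃ (K' : ℝ) (w : ℕ), ∀ (l d k : ℕ) (ε R μ : ℝ) (x : Signal l d),
      1 ≤ l → 1 ≤ d → 1 ≤ k → 0 < ε → ε ≤ 1 → 0 < μ → μ ≤ Λ * noiseLevel k x →
      ‖x‖ ≤ R * (Real.sqrt ε * μ) → R ≤ sigLen l d ^ A →
      ∀ (ρ : Fin (numHashes C l d) → Draw l d) (smp : ℤ → ℂ) (tp : ℤ → ℤ),
        IsSampleAccess smp (dft x) → IsRandomTape tp ρ →
        Computes (mainProg C) (sigLen l d ^ w) smp tp (initStore l d k ε R μ)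
          (sparseFFT alphaConst (2 * d) k ε R μ (dft x) ρ 0)
          (K' * sigLen l d * Real.log (sigLen l d) ^ 3)
          (C * (K * (d : ℝ) ^ (K * d) * (1 / ε) * k * Real.log (sigLen l d))) := by
  classical
  obtain ⟨M, hM⟩ := pow_unbounded_of_one_lt Λ (one_lt_two (α := ℝ))
  let w : ℕ := 2 * A + 2 * M + C + 30
  refine ⟨8 * (8000 * C ^ 3 + 4000 * C ^ 2 * A + 100 * w + 150 * A : ℕ), w, ?_⟩
  intro l d k ε R μ x hl hd hk hε hε1 hμ hμΛ hxR hRA ρ smp tp hsmp hT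
  have hld : 1 ≤ l * d := Nat.mul_pos hl hd
  -- As `μ > 0`, the noise level is positive. Hence the signal is nonzero and `k < N`.
  have herr : 0 < errK k x := by
    have h1 : 0 < noiseLevel k x := by
      by_contra hcon
      have : Λ * noiseLevel k x ≤ 0 :=
        mul_nonpos_of_nonneg_of_nonpos (by linarith) (not_lt.mp hcon)
      linarith
    by_contra hcon
    rw [noiseLevel] at h1
    have : errK k x / Real.sqrt k ≤ 0 := div_nonpos_of_nonpos_of_nonneg (not_lt.mp hcon) (Real.sqrt_nonneg _)
    linarith
  have hkN := (lt_sigLen_of_errK_pos herr).le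
  have hR : 0 < R := by
    by_contra hcon
    have h1 : R * (Real.sqrt ε * μ) ≤ 0 :=
      mul_nonpos_of_nonpos_of_nonneg (not_lt.mp hcon) (by positivity)
    have h2 := l2norm_le_sigLen_mul x
    have h3 : sigLen l d * ‖x‖ ≤ 0 :=
      mul_nonpos_of_nonneg_of_nonpos sigLen_pos.le (by linarith)
    have h4 := errK_le_l2norm k x
    linarith
  -- The sizes of the parameters, compared with the word size `N ^ w`.
  set N : ℕ := (2 ^ l) ^ d with hN
  have hNs : (N : ℝ) = sigLen l d := by rw [hN, sigLen]; push_cast; rfl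
  have hN2 : 2 ≤ N := by
    rw [hN, ← pow_mul]; exact Nat.le_self_pow (by omega) 2
  have hldN : l * d ≤ N := by rw [hN, ← pow_mul]; exact Nat.lt_two_pow_self.le
  have hTr := numRounds_le hR hRA
  have hTN : numRounds R ≤ N ^ w := by
    calc numRounds R ≤ A * (l * d) := hTr
      _ ≤ N ^ A * N := Nat.mul_le_mul (nat_le_pow_of_two_le hN2 A) hldN
      _ = N ^ (A + 1) := (pow_succ _ _).symm
      _ ≤ N ^ w := Nat.pow_le_pow_right (by omega) (by simp only [w]; omega)
  have hbN : bucketSide alphaConst d k ε ≤ N ^ w := by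
    have h1 := bucketSide_le hl hd hk hε hε1 hμ hΛ hM.le hμΛ hxR hRA hkN
    rw [← hNs] at h1
    have h2 : bucketSide alphaConst d k ε ≤ N ^ (2 * A + 2 * M + 26) := by exact_mod_cast h1
    exact h2.trans (Nat.pow_le_pow_right (by omega) (by simp only [w]; omega))
  have hβ : bucketExp alphaConst d k ε ≤ w * (l * d) := by
    rw [bucketSide_eq, hN, ← pow_mul, ← pow_mul, show l * (d * w) = w * (l * d) by ring] at hbN
    exact (Nat.pow_le_pow_iff_right (by norm_num : 1 < 2)).mp hbN
  have hrN : 32 * (numHashes C l d * N) + 32 ≤ N ^ w := by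
    have h1 : numHashes C l d * N ≤ N ^ (C + 2) := by
      calc C * (l * d) * N ≤ N ^ C * N * N :=
            Nat.mul_le_mul_right _ (Nat.mul_le_mul (nat_le_pow_of_two_le hN2 C) hldN)
        _ = N ^ (C + 2) := by ring
    have h2 : 64 ≤ N ^ 6 := le_trans (by norm_num) (Nat.pow_le_pow_left hN2 6)
    have h3 : 1 ≤ N ^ (C + 2) := Nat.one_le_pow _ _ (by omega)
    calc 32 * (numHashes C l d * N) + 32 ≤ 64 * N ^ (C + 2) := by omega
      _ ≤ N ^ 6 * N ^ (C + 2) := Nat.mul_le_mul_right _ h2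
      _ = N ^ (C + 8) := by rw [← pow_add]; congr 1; omega
      _ ≤ N ^ w := Nat.pow_le_pow_right (by omega) (by simp only [w]; omega)
  obtain ⟨s', t, m, hex, hout, ht, hm⟩ := mainProg_good (W := sigLen l d ^ w) (Z := ((N ^ w : ℕ) : ℤ))
    (by rw [Int.cast_natCast, Nat.cast_pow, hNs]) rfl hC hT hsmp hk hε hε1 hR hμ.le hd hl
    (by exact_mod_cast hrN) (by exact_mod_cast hTN) (by exact_mod_cast hbN)
  refine ⟨s', t, m, hex, ?_, ?_, hout⟩
  · -- The running time. Replacing `log₂ N` by the natural logarithm costs the factor `2 ^ 3`.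
    set L := l * d with hL
    have hL3 : 1 ≤ L ^ 2 := Nat.one_le_pow _ _ hld
    have hNL : L ≤ N * L ^ 3 := by
      calc L = 1 * (L * 1) := by ring
        _ ≤ N * (L * L ^ 2) := Nat.mul_le_mul (by omega) (Nat.mul_le_mul_left _ hL3)
        _ = N * L ^ 3 := by ring
    have h1 : t ≤ (8000 * C ^ 3 + 4000 * C ^ 2 * A + 100 * w + 150 * A) * (N * L ^ 3) := by
      refine ht.trans ?_
      calc _ ≤ 8000 * (N * ((C * L) * (C * L) * (C * L))) +
            4000 * (N * ((C * L) * (C * L))) * (A * L) + 100 * (w * L) + 150 * (A * L) := by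
              unfold numHashes; gcongr
        _ ≤ 8000 * (N * ((C * L) * (C * L) * (C * L))) +
            4000 * (N * ((C * L) * (C * L))) * (A * L) + 100 * (w * (N * L ^ 3)) +
              150 * (A * (N * L ^ 3)) := by gcongr
        _ = _ := by ring
    have h2 : (L : ℝ) * (1 / 2) ≤ Real.log (sigLen l d) := by
      rw [log_sigLen]
      exact mul_le_mul_of_nonneg_left half_le_log_two (Nat.cast_nonneg _)
    have h3 : ((L : ℝ) * (1 / 2)) ^ 3 ≤ Real.log (sigLen l d) ^ 3 :=
      pow_le_pow_left₀ (by positivity) h2 3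
    rw [← hNs]
    rw [← hNs] at h3
    calc (t : ℝ) ≤ (8000 * C ^ 3 + 4000 * C ^ 2 * A + 100 * w + 150 * A : ℕ) * (N * L ^ 3) := by
          exact_mod_cast h1
      _ = 8 * (8000 * C ^ 3 + 4000 * C ^ 2 * A + 100 * w + 150 * A : ℕ) * N *
            ((L : ℝ) * (1 / 2)) ^ 3 := by ring
      _ ≤ _ := by gcongr
  · -- The number of queries.
    have hα : 0 < alphaConst := by norm_num [alphaConst]
    have hα1 : alphaConst < 1 := by norm_num [alphaConst]
    have hβ := bucketExp_pos hα hα1 hd hk hε hε1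
    refine le_trans (Nat.cast_le.mpr ?_) (queries_le (C := C) hd hk hε hε1 hK)
    exact hm.trans (Nat.mul_le_mul_left _
      (card_support_dft_filterG_le (two_le_bucketSide hβ) (by omega)))

end complexity

end SparseFourier

end

theorem mainTheorem1 :
    -- absolute constants: `F = cF * d`, failure probability `N ^ (-c C)`
    ∃ (α : ℝ) (cF : ℕ) (c : ℝ) (C₀ K : ℕ), 0 < α ∧ α < 1 ∧ 2 ≤ cF ∧ 0 < c ∧
      -- the algorithm uses `r_max = C log₂ N` hash functions, for any large enough constant `C`
      ∀ C : ℕ, C₀ ≤ C →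
        ∃ p : Prog,
          -- `Λ`: quality of the known bound on the noise level; `R ≤ N ^ A`
          ∀ (Λ : ℝ) (A : ℕ), 1 ≤ Λ →
            ∃ (K' : ℝ) (w P : ℕ),
              ∀ (l d k : ℕ) (ε R μ : ℝ) (x : Signal l d),
                1 ≤ l → 1 ≤ d → 1 ≤ k → 0 < ε → ε ≤ 1 →
                0 < μ → noiseLevel k x ≤ μ → μ ≤ Λ * noiseLevel k x →
                ‖x‖ ≤ R * (Real.sqrt ε * μ) → R ≤ sigLen l d ^ A →
                -- recovery guarantee with high probability, stable under small numerical errors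
                1 - sigLen l d ^ (-(c * C)) ≤
                  uniformProb {ρ : Fin (numHashes C l d) → Draw l d |
                    ∀ e : ℕ → Fin (numHashes C l d) → Signal l d,
                      (∀ t i j, ‖e t i j‖ ≤ l2norm x / sigLen l d ^ P) →
                      l2norm (x - sparseFFT α (cF * d) k ε R μ (dft x) ρ e) ≤
                        (1 + K * Λ ^ 2 * ε) * errK k x} ∧
                -- running time and number of samples, for all random choices
                ∀ (ρ : Fin (numHashes C l d) → Draw l d) (smp : ℤ → ℂ) (tp : ℤ → ℤ),
                  IsSampleAccess smp (dft x) → IsRandomTape tp ρ →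
                  Computes p (sigLen l d ^ w) smp tp (initStore l d k ε R μ)
                    (sparseFFT α (cF * d) k ε R μ (dft x) ρ 0)
                    (K' * sigLen l d * Real.log (sigLen l d) ^ 3)
                    (C * (K * (d : ℝ) ^ (K * d) * (1 / ε) * k * Real.log (sigLen l d))) := by
  have hα1 : alphaConst < 1 := by norm_num [alphaConst]
  -- The size of `K` is forced by the number of queries; the recovery guarantee only needs `9 ≤ K`.
  refine ⟨alphaConst, 2, 1, 1, 2 ^ 25, by norm_num [alphaConst], hα1, le_rfl, one_pos,
    fun C hC => ⟨mainProg C, fun Λ A hΛ => ?_⟩⟩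
  obtain ⟨K', w, hcomp⟩ := mainProg_computes (C := C) (A := A) hC hΛ (K := 2 ^ 25) le_rfl
  refine ⟨K', w, A + 6, ?_⟩
  intro l d k ε R μ x hl hd hk hε hε1 hμ hμk hμΛ hxR hRA
  exact ⟨recovery_probability hC (by norm_num) hl hd hk hε hε1 hμ hμk hμΛ hxR hRA,
    hcomp l d k ε R μ x hl hd hk hε hε1 hμ hμΛ hxR hRA⟩
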